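/- Let $\gamma\in(0,\tfrac n2)\setminus\mathbb N$, write $\lfloor\gamma\rfloor$ and $[\gamma]=\gamma-\lfloor\gamma\rfloor$ for its integer and fractional parts, and put $k=\lfloor\gamma\rfloor+1$, $s=\tfrac n2+\gamma$. On $\mathbb R^{n+1}_+=\{(x,y):x\in\mathbb R^n,\ y>0\}$ let $$\Delta_{\mathbb H}=y^2(\Delta_x+\partial_{yy})+(1-n)y\,\partial_y,\qquad \tilde\Delta_{\mathbb H}=\Delta_{\mathbb H}+\tfrac{n^2}{4},\qquad D_s=-\Delta_{\mathbb H}-s(n-s),$$ $$L^{\mathbb H}_{2k}=y^{-\frac n2+\gamma-2k}\circ\prod_{j=0}^{k-1}D_{s-2j}\circ y^{\frac n2-\gamma}.$$ Let $C^\infty_{\rm even}$ be the space of real functions that are smooth on $\overline{\mathbb R^{n+1}_+}$ with only even powers of $y$ in their Taylor expansion at $y=0$, and let $\mathcal C^{2\gamma}=C^\infty_{\rm even}+y^{2[\gamma]}C^\infty_{\rm even}$. Boundary operators on $\mathcal C^{2\gamma}$. For a finite family $S$ of real numbers and $\alpha\in\mathbb R$ set $$\tilde B_{\alpha}[S]\,U=y^{-\frac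 n2+\gamma-\alpha}\prod_{\kappa\in S}(\tilde\Delta_{\mathbb H}-\kappa)\,\bigl(y^{\frac n2-\gamma}U\bigr)\Big|_{y=0},\qquad N_\alpha[S]\,U=\frac{\tilde B_\alpha[S]U}{\tilde B_\alpha[S](y^{\alpha})},$$ and let $\kappa_\ell=(\gamma-2\ell)^2$. * For $0\le j<\frac12(1+\lfloor\gamma\rfloor)$: $B_{2j}^{2\gamma,\mathbb H}=N_{2j}[S]$, where $S$ consists of $\kappa_\ell$ and $\kappa_{\lfloor\gamma\rfloor-\ell}$, $0\le\ell\le j-1$. * For $0\le j<\frac12\lfloor\gamma\rfloor$: $B_{2j+2[\gamma]}^{2\gamma,\mathbb H}=N_{2j+2[\gamma]}[S]$, where $S$ consists of $\kappa_\ell$, $0\le\ell\le j$, and $\kappa_{\lfloor\gamma\rfloor-\ell}$, $0\le\ell\le j-1$. * Jets: $J_+^{0}U=B_0^{2\gamma,\mathbb H}U$, $J_+^{2m}U=J_+^{2m-2}U+y^{2m}B_{2m}^{2\gamma,\mathbb H}(U-J_+^{2m-2}U)$, and $J_-^0U=y^{2[\gamma]}B_{2[\gamma]}^{2\gamma,\mathbb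 H}U$, $J_-^{2m}U=J_-^{2m-2}U+y^{2m+2[\gamma]}B_{2m+2[\gamma]}^{2\gamma,\mathbb H}(U-J_-^{2m-2}U)$. * For $\frac12(1+\lfloor\gamma\rfloor)\le j\le\lfloor\gamma\rfloor$: $B_{2j}^{2\gamma,\mathbb H}U=\lim_{\epsilon\to0}N_{2j}[S_\epsilon](U-J_-^{2\lfloor\gamma\rfloor-2j}U)$, where $S_\epsilon$ consists of $\kappa_j-\epsilon$, of $\kappa_\ell$ for $0\le\ell\le j-1$, and of $\kappa_\ell$ for $\ell\in\{\lfloor\gamma\rfloor-j+1,\dots,\lfloor\gamma\rfloor\}\setminus\{j\}$. * For $\frac12\lfloor\gamma\rfloor\le j\le\lfloor\gamma\rfloor$: $B_{2j+2[\gamma]}^{2\gamma,\mathbb H}U=\lim_{\epsilon\to0}N_{2j+2[\gamma]}[S_\epsilon](U-J_+^{2\lfloor\gamma\rfloor-2j}U)$, where $S_\epsilon$ consists of $\kappa_{\lfloor\gamma\rfloor-j}-\epsilon$, of $\kappa_\ell$ for $\ell\in\{0,\dots,j\}\setminus\{\lfloor\gamma\rfloor-j\}$, and of $\kappa_\ell$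 for $\ell\in\{\lfloor\gamma\rfloor-j+1,\dots,\lfloor\gamma\rfloor\}$. Note that $2\gamma-2j=2(\lfloor\gamma\rfloor-j)+2[\gamma]$. Energy space. For compactly supported $U,V\in\mathcal C^{2\gamma}$ let $$\mathcal Q_{2\gamma}(U,V)=\int_{\mathbb R^{n+1}_+}U\,L^{\mathbb H}_{2k}V\,y^{1-2[\gamma]}dx\,dy-\sum_{j=0}^{\lfloor\gamma/2\rfloor}\sigma_{j,\gamma}\int_{\mathbb R^n}B_{2j}^{2\gamma,\mathbb H}U\,B_{2\gamma-2j}^{2\gamma,\mathbb H}V\,dx-\sum_{j=\lfloor\gamma/2\rfloor+1}^{\lfloor\gamma\rfloor}\sigma_{j,\gamma}\int_{\mathbb R^n}B_{2\gamma-2j}^{2\gamma,\mathbb H}U\,B_{2j}^{2\gamma,\mathbb H}V\,dx,$$ $$\sigma_{j,\gamma}=2\cdot4^{\lfloor\gamma\rfloor}\,\frac{\Gamma(\gamma-j+1)\Gamma(j+1)\Gamma(j+\lfloor\gamma\rfloor-\gamma+1)\Gamma(\lfloor\gamma\rfloor-j+1)}{g_j},$$ where $g_j=\Gamma(\gamma-2j)\Gamma(2j-\gamma+1)$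 for $j\le\lfloor\gamma/2\rfloor$ and $g_j=\Gamma(\gamma-2j+1)\Gamma(2j-\gamma)$ for $j>\lfloor\gamma/2\rfloor$; and let $\mathcal E_{2\gamma}(U)=\mathcal Q_{2\gamma}(U,U)$. The space $\dot H^{k,\gamma}(\mathbb R^{n+1}_+)$ is the closure of the compactly supported elements of $\mathcal C^{2\gamma}$ with respect to $\mathcal E_{2\gamma}^{1/2}$, that is, the set of all $L^2_{\rm loc}(\mathbb R^{n+1}_+)$-limits of sequences of such elements that are Cauchy with respect to $\mathcal E_{2\gamma}^{1/2}$. Theorem. Let $U\in\mathcal C^{2\gamma}\cap\dot H^{k,\gamma}(\mathbb R^{n+1}_+)$ satisfy $L^{\mathbb H}_{2k}U=0$ in $\mathbb R^{n+1}_+$. Then $$B^{2\gamma,\mathbb H}_{2\gamma-2j}U=c_{\gamma,j}\,(-\Delta_x)^{\gamma-2j}B^{2\gamma,\mathbb H}_{2j}U,\qquad 0\le j\le\lfloor\gamma/2\rfloor,$$ $$B^{2\gamma,\mathbb H}_{2\lfloor\gamma\rfloor-2j}U=d_{\gamma,j}\,(-\Delta_x)^{\lfloor\gamma\rfloor-[\gamma]-2j}B^{2\gamma,\mathbb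 H}_{2j+2[\gamma]}U,\qquad 0\le j\le\lfloor\gamma\rfloor-\lfloor\gamma/2\rfloor-1,$$ with $$c_{\gamma,j}=2^{2(2j-\gamma)}\frac{\Gamma(2j-\gamma)}{\Gamma(\gamma-2j)},\qquad d_{\gamma,j}=2^{2(2j+[\gamma]-\lfloor\gamma\rfloor)}\frac{\Gamma(2j+[\gamma]-\lfloor\gamma\rfloor)}{\Gamma(\lfloor\gamma\rfloor-2j-[\gamma])}.$$ Here, for $0<\sigma<\tfrac n2$, $(-\Delta_x)^{\sigma}f$ is the distribution with Fourier transform $|\xi|^{2\sigma}\hat f(\xi)$ (with $\hat f(\xi)=\int e^{-i\langle x,\xi\rangle}f(x)\,dx$), for $f\in\dot H^{\sigma}(\mathbb R^n)$, i.e. $\hat f$ is a function with $|\xi|^{\sigma}\hat f\in L^2$; it is part of the assertion that $B^{2\gamma,\mathbb H}_{2j}U\in\dot H^{\gamma-2j}(\mathbb R^n)$ and $B^{2\gamma,\mathbb H}_{2j+2[\gamma]}U\in\dot H^{\lfloor\gamma\rfloor-[\gamma]-2j}(\mathbb R^n)$ for the indices $j$ above. -/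

import Mathlib

open Filter Topology MeasureTheory
open scoped ContDiff Laplacian FourierTransform

noncomputable section

namespace HalfSpace

/-- Points `(x, y)` of `ℝⁿ × ℝ`. The open half-space `ℝ^{n+1}_+` is the set where `0 < y`; a function
on the half-space is represented by a function on `ℝⁿ × ℝ` whose values at `y ≤ 0` never matter. -/
abbrev Pt (n : ℕ) := EuclideanSpace ℝ (Fin n) × ℝ

/-- The open upper half-space `{(x, y) : y > 0}`. -/
def upper (n : ℕ) : Set (Pt n) := {p | 0 < p.2}

/-- The space `C^∞_even` on the closed half-space: smooth up to `y = 0` with only even powers of `y`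
in the Taylor expansion at `y = 0`. Equivalently, the even reflection in `y` is smooth on `ℝ^{n+1}`,
which is how it is expressed here. -/
def IsEvenSmooth {n : ℕ} (f : Pt n → ℝ) : Prop :=
  ContDiff ℝ ∞ f ∧ ∀ x y, f (x, -y) = f (x, y)

/-- The space `𝒞^{2γ} = C^∞_even + y^{2[γ]} C^∞_even`, with `[γ]` the fractional part of `γ`. -/
def MemC {n : ℕ} (γ : ℝ) (U : Pt n → ℝ) : Prop :=
  ∃ f g : Pt n → ℝ, IsEvenSmooth f ∧ IsEvenSmooth g ∧
    ∀ p ∈ upper n, U p = f p + p.2 ^ (2 * Int.fract γ) * g p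

/-- Elements of `𝒞^{2γ}` with bounded support in the closed half-space. -/
def MemCc {n : ℕ} (γ : ℝ) (U : Pt n → ℝ) : Prop :=
  MemC γ U ∧ ∃ R : ℝ, ∀ p ∈ upper n, R < ‖p‖ → U p = 0

/-- Multiplication by the power `y ^ a`. -/
def mulPow {n : ℕ} (a : ℝ) (u : Pt n → ℝ) : Pt n → ℝ := fun p => p.2 ^ a * u p

/-- The Laplace-Beltrami operator of the hyperbolic metric `(|dx|² + dy²) / y²` on the half-space:
`Δ_H = y² (Δ_x + ∂_yy) + (1 - n) y ∂_y`. -/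
def hypLaplacian {n : ℕ} (u : Pt n → ℝ) : Pt n → ℝ := fun p =>
  p.2 ^ 2 * ((Δ fun x => u (x, p.2)) p.1 + iteratedDeriv 2 (fun t => u (p.1, t)) p.2)
    + (1 - (n : ℝ)) * p.2 * deriv (fun t => u (p.1, t)) p.2

/-- `D_s = -Δ_H - s (n - s)`. -/
def opD {n : ℕ} (s : ℝ) (u : Pt n → ℝ) : Pt n → ℝ := fun p =>
  -hypLaplacian u p - s * ((n : ℝ) - s) * u p

/-- `L_{2k}^+ = ∏_{j<k} D_{s-2j}` with `s = n/2 + γ` and `k = ⌊γ⌋ + 1`. -/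
def opLplus {n : ℕ} (γ : ℝ) (u : Pt n → ℝ) : Pt n → ℝ :=
  (List.range (⌊γ⌋₊ + 1)).foldr (fun j v => opD ((n : ℝ) / 2 + γ - 2 * j) v) u

/-- `L_{2k} = y^{-n/2+γ-2k} ∘ L_{2k}^+ ∘ y^{n/2-γ}` with `k = ⌊γ⌋ + 1`. -/
def opL {n : ℕ} (γ : ℝ) (U : Pt n → ℝ) : Pt n → ℝ :=
  mulPow (-(n : ℝ) / 2 + γ - 2 * ((⌊γ⌋₊ : ℝ) + 1)) (opLplus γ (mulPow ((n : ℝ) / 2 - γ) U))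

/-- The factor `Δ_H + n²/4 - κ`. -/
def factor {n : ℕ} (κ : ℝ) (u : Pt n → ℝ) : Pt n → ℝ := fun p =>
  hypLaplacian u p + ((n : ℝ) ^ 2 / 4 - κ) * u p

/-- The product of the (commuting) factors `Δ_H + n²/4 - κ` over a list of numbers `κ`. -/
def factorProd {n : ℕ} (l : List ℝ) (u : Pt n → ℝ) : Pt n → ℝ := l.foldr factor u

/-- Restriction to `y = 0`, as the limit `y → 0⁺`. -/
def restrict {n : ℕ} (u : Pt n → ℝ) : EuclideanSpace ℝ (Fin n) → ℝ := fun x =>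
  limUnder (𝓝[>] (0 : ℝ)) fun y => u (x, y)

/-- `y^{-n/2+γ-a} ∘ ∏_{κ ∈ l} (Δ_H + n²/4 - κ) ∘ y^{n/2-γ} |_{y=0}`, the common shape of all the
preliminary boundary operators. -/
def preB {n : ℕ} (γ a : ℝ) (l : List ℝ) (U : Pt n → ℝ) : EuclideanSpace ℝ (Fin n) → ℝ :=
  restrict (mulPow (-(n : ℝ) / 2 + γ - a) (factorProd l (mulPow ((n : ℝ) / 2 - γ) U)))

/-- Factors of `B̃_{2j}`: `(γ-2ℓ)²` and `(γ+2ℓ-2⌊γ⌋)²` for `0 ≤ ℓ ≤ j-1`. -/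
def evenFactors (γ : ℝ) (j : ℕ) : List ℝ :=
  ((List.range j).map fun ℓ => (γ - 2 * (ℓ : ℝ)) ^ 2) ++
    (List.range j).map fun ℓ => (γ + 2 * (ℓ : ℝ) - 2 * (⌊γ⌋₊ : ℝ)) ^ 2

/-- Factors of `B̃_{2j+2[γ]}`: `(γ-2ℓ)²` for `0 ≤ ℓ ≤ j`, and `(γ+2ℓ-2⌊γ⌋)²` for
`0 ≤ ℓ ≤ j-1`. -/
def fracFactors (γ : ℝ) (j : ℕ) : List ℝ :=
  ((List.range (j + 1)).map fun ℓ => (γ - 2 * (ℓ : ℝ)) ^ 2) ++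
    (List.range j).map fun ℓ => (γ + 2 * (ℓ : ℝ) - 2 * (⌊γ⌋₊ : ℝ)) ^ 2

/-- Factors of `B̃^ε_{2j}`: `(γ-2j)² - ε`, `(γ-2ℓ)²` for `0 ≤ ℓ ≤ j-1`, and `(γ-2ℓ)²` for
`ℓ ∈ {⌊γ⌋-j+1, …, ⌊γ⌋} \ {j}`. -/
def evenFactorsEps (γ ε : ℝ) (j : ℕ) : List ℝ :=
  ((γ - 2 * (j : ℝ)) ^ 2 - ε) ::
    (((List.range j).map fun ℓ => (γ - 2 * (ℓ : ℝ)) ^ 2) ++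
      ((List.range' (⌊γ⌋₊ - j + 1) j).filter fun ℓ => ℓ ≠ j).map
        fun ℓ => (γ - 2 * (ℓ : ℝ)) ^ 2)

/-- Factors of `B̃^ε_{2j+2[γ]}`: `(γ-2⌊γ⌋+2j)² - ε`, `(γ-2ℓ)²` for
`ℓ ∈ {0, …, j} \ {⌊γ⌋-j}`, and `(γ-2ℓ)²` for `ℓ ∈ {⌊γ⌋-j+1, …, ⌊γ⌋}`. -/
def fracFactorsEps (γ ε : ℝ) (j : ℕ) : List ℝ :=
  ((γ - 2 * (⌊γ⌋₊ : ℝ) + 2 * (j : ℝ)) ^ 2 - ε) ::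
    ((((List.range (j + 1)).filter fun ℓ => ℓ ≠ ⌊γ⌋₊ - j).map fun ℓ => (γ - 2 * (ℓ : ℝ)) ^ 2) ++
      (List.range' (⌊γ⌋₊ - j + 1) j).map fun ℓ => (γ - 2 * (ℓ : ℝ)) ^ 2)

/-- The monomial `y ^ a` as a function on the half-space. -/
def powY (n : ℕ) (a : ℝ) : Pt n → ℝ := fun p => p.2 ^ a

/-- `B̃(U) / B̃(y^a)` for the preliminary operator `B̃` with factors `l`; the boundary function
`B̃(y^a)` is a constant. -/
def normB {n : ℕ} (γ a : ℝ) (l : List ℝ) (U : Pt n → ℝ) : EuclideanSpace ℝ (Fin n) → ℝ := fun x =>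
  preB γ a l U x / preB γ a l (powY n a) x

/-- `B_{2j} = B̃_{2j} / b_{2j}`, `b_{2j} = B̃_{2j}(y^{2j})`; used for `0 ≤ j < (1 + ⌊γ⌋)/2`. -/
def bEvenLow {n : ℕ} (γ : ℝ) (j : ℕ) (U : Pt n → ℝ) : EuclideanSpace ℝ (Fin n) → ℝ :=
  normB γ (2 * (j : ℝ)) (evenFactors γ j) U

/-- `B_{2j+2[γ]} = B̃_{2j+2[γ]} / b_{2j+2[γ]}`, `b_{2j+2[γ]} = B̃_{2j+2[γ]}(y^{2j+2[γ]})`; used for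
`0 ≤ j < ⌊γ⌋/2`. -/
def bFracLow {n : ℕ} (γ : ℝ) (j : ℕ) (U : Pt n → ℝ) : EuclideanSpace ℝ (Fin n) → ℝ :=
  normB γ (2 * (j : ℝ) + 2 * Int.fract γ) (fracFactors γ j) U

/-- The auxiliary operator `lim_{ε → 0} B̃^ε_{2j} U / b̃^ε_{2j}`. -/
def bEvenBar {n : ℕ} (γ : ℝ) (j : ℕ) (U : Pt n → ℝ) : EuclideanSpace ℝ (Fin n) → ℝ := fun x =>
  limUnder (𝓝[≠] (0 : ℝ)) fun ε => normB γ (2 * (j : ℝ)) (evenFactorsEps γ ε j) U x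

/-- The auxiliary operator `lim_{ε → 0} B̃^ε_{2j+2[γ]} U / b̃^ε_{2j+2[γ]}`. -/
def bFracBar {n : ℕ} (γ : ℝ) (j : ℕ) (U : Pt n → ℝ) : EuclideanSpace ℝ (Fin n) → ℝ := fun x =>
  limUnder (𝓝[≠] (0 : ℝ)) fun ε =>
    normB γ (2 * (j : ℝ) + 2 * Int.fract γ) (fracFactorsEps γ ε j) U x

/-- The jets `J_+^{2m} U`. -/
def jetPlus {n : ℕ} (γ : ℝ) : ℕ → (Pt n → ℝ) → Pt n → ℝ
  | 0, U => fun p => bEvenLow γ 0 U p.1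
  | m + 1, U => fun p => jetPlus γ m U p +
      p.2 ^ (2 * ((m : ℝ) + 1)) * bEvenLow γ (m + 1) (U - jetPlus γ m U) p.1

/-- The jets `J_-^{2m} U`. -/
def jetMinus {n : ℕ} (γ : ℝ) : ℕ → (Pt n → ℝ) → Pt n → ℝ
  | 0, U => fun p => p.2 ^ (2 * Int.fract γ) * bFracLow γ 0 U p.1
  | m + 1, U => fun p => jetMinus γ m U p +
      p.2 ^ (2 * ((m : ℝ) + 1) + 2 * Int.fract γ) *
        bFracLow γ (m + 1) (U - jetMinus γ m U) p.1

/-- The boundary operators `B_{2j}`, `0 ≤ j ≤ ⌊γ⌋`. -/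
def bEven {n : ℕ} (γ : ℝ) (j : ℕ) (U : Pt n → ℝ) : EuclideanSpace ℝ (Fin n) → ℝ :=
  if 2 * j < 1 + ⌊γ⌋₊ then bEvenLow γ j U else bEvenBar γ j (U - jetMinus γ (⌊γ⌋₊ - j) U)

/-- The boundary operators `B_{2j+2[γ]}`, `0 ≤ j ≤ ⌊γ⌋`. -/
def bFrac {n : ℕ} (γ : ℝ) (j : ℕ) (U : Pt n → ℝ) : EuclideanSpace ℝ (Fin n) → ℝ :=
  if 2 * j < ⌊γ⌋₊ then bFracLow γ j U else bFracBar γ j (U - jetPlus γ (⌊γ⌋₊ - j) U)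

/-- The coefficients `σ_{j,γ}` of the boundary terms of the Dirichlet form. -/
def sigma (γ : ℝ) (j : ℕ) : ℝ :=
  2 * 4 ^ ⌊γ⌋₊ *
    (Real.Gamma (γ - j + 1) * Real.Gamma (j + 1) * Real.Gamma (j + (⌊γ⌋₊ : ℝ) - γ + 1) *
      Real.Gamma ((⌊γ⌋₊ : ℝ) - j + 1)) /
    (if j ≤ ⌊γ / 2⌋₊ then Real.Gamma (γ - 2 * j) * Real.Gamma (2 * j - γ + 1)
      else Real.Gamma (γ - 2 * j + 1) * Real.Gamma (2 * j - γ))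

/-- The Dirichlet form `Q_{2γ}(U, V)`. Note `2γ - 2j = 2(⌊γ⌋ - j) + 2[γ]`. -/
def dirichletForm {n : ℕ} (γ : ℝ) (U V : Pt n → ℝ) : ℝ :=
  (∫ p in upper n, U p * opL γ V p * p.2 ^ (1 - 2 * Int.fract γ))
    - (∑ j ∈ Finset.range (⌊γ / 2⌋₊ + 1),
        sigma γ j * ∫ x, bEven γ j U x * bFrac γ (⌊γ⌋₊ - j) V x)
    - ∑ j ∈ Finset.Icc (⌊γ / 2⌋₊ + 1) ⌊γ⌋₊,
        sigma γ j * ∫ x, bFrac γ (⌊γ⌋₊ - j) U x * bEven γ j V x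

/-- The Dirichlet energy `E_{2γ}(U) = Q_{2γ}(U, U)`. -/
def energy {n : ℕ} (γ : ℝ) (U : Pt n → ℝ) : ℝ := dirichletForm γ U U

/-- The homogeneous space `Ḣ^{k,γ}`, `k = ⌊γ⌋ + 1`: the closure of the compactly supported elements
of `𝒞^{2γ}` with respect to `E_{2γ}^{1/2}`. A function belongs to it if it is the `L²_loc` limit, on
the open half-space, of a sequence of such elements that is Cauchy with respect to `E_{2γ}^{1/2}`. -/
def MemH {n : ℕ} (γ : ℝ) (U : Pt n → ℝ) : Prop :=
  ∃ Φ : ℕ → Pt n → ℝ, (∀ i, MemCc γ (Φ i)) ∧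
    Tendsto (fun q : ℕ × ℕ => energy γ (Φ q.1 - Φ q.2)) atTop (𝓝 0) ∧
    ∀ K : Set (Pt n), IsCompact K → K ⊆ upper n →
      Tendsto (fun i => eLpNorm (Φ i - U) 2 (volume.restrict K)) atTop (𝓝 0)

end HalfSpace

/-- `f` belongs to the homogeneous Sobolev space `Ḣ^s(ℝⁿ)` (here `0 < s < n/2`) and `(-Δ)^s f = w`,
in the sense of the Fourier transform of distributions: the Fourier transform of `f` is a function
`g` with `|ξ|^s g ∈ L²`, and that of `w` is the multiple of `g` by the symbol of `(-Δ)^s`. With the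
normalization `∫ e^{-2πi⟨x,ξ⟩} f(x) dx` of the Fourier transform that symbol is `(2π|ξ|)^{2s}`. -/
def IsFracLaplacian {n : ℕ} (s : ℝ) (f w : EuclideanSpace ℝ (Fin n) → ℝ) : Prop :=
  LocallyIntegrable f ∧ LocallyIntegrable w ∧
  ∃ g : EuclideanSpace ℝ (Fin n) → ℂ,
    AEStronglyMeasurable g ∧
    MemLp (fun ξ => ((‖ξ‖ ^ s : ℝ) : ℂ) * g ξ) 2 ∧
    ∀ η : EuclideanSpace ℝ (Fin n) → ℂ, ContDiff ℝ ∞ η → HasCompactSupport η →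
      (∫ x, (f x : ℂ) * η x) = ∫ ξ, g ξ * 𝓕⁻ η ξ ∧
      (∫ x, (w x : ℂ) * η x) = ∫ ξ, (((2 * Real.pi * ‖ξ‖) ^ (2 * s) : ℝ) : ℂ) * g ξ * 𝓕⁻ η ξ

end

noncomputable section

namespace HalfSpace

/-- The exponent of the second branch. -/
local notation "δ[" g "]" => g - 2 * (⌊g⌋₊ : ℝ)

open Int (fract)
open Real (Gamma inv_rpow mul_rpow rpow_add rpow_add_one rpow_le_one_of_one_le_of_nonpos rpow_le_rpow
  rpow_mul rpow_natCast rpow_neg rpow_neg_one rpow_one rpow_pos_of_pos rpow_sub rpow_sub_one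
  rpow_two rpow_zero)
open Module.End (mul_apply)
open Polynomial (aeval)

theorem integral_ext {X E : Type*} [MeasurableSpace X] [NormedAddCommGroup E] [NormedSpace ℝ E] {μ : Measure X}
    {f g : X → E} (h : ∀ x, f x = g x) : ∫ x, f x ∂μ = ∫ x, g x ∂μ := congrArg _ (funext h)

theorem integral_Ioi_ext {E : Type*} [NormedAddCommGroup E] [NormedSpace ℝ E] {a : ℝ} {f g : ℝ → E}
    (h : ∀ y, a < y → f y = g y) : ∫ y in Set.Ioi a, f y = ∫ y in Set.Ioi a, g y :=
  setIntegral_congr_fun measurableSet_Ioi h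

section ParametricIntegral

theorem hasFDerivAt_setIntegral_param {P X G : Type} [NormedAddCommGroup P] [NormedSpace ℝ P]
    [FiniteDimensional ℝ P] [NormedAddCommGroup X] [NormedSpace ℝ X] [SecondCountableTopology X]
    [MeasurableSpace X] [BorelSpace X] [NormedAddCommGroup G] [NormedSpace ℝ G]
    (μ : Measure X) [IsFiniteMeasureOnCompacts μ] {K : Set X} (hK : IsCompact K)
    {F : P × X → G} (hF : ContDiff ℝ ∞ F) (p : P) :
    HasFDerivAt (fun p => ∫ x in K, F (p, x) ∂μ)
      (∫ x in K, (fderiv ℝ F (p, x)).comp (ContinuousLinearMap.inl ℝ P X) ∂μ) p := by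
  have hP : ProperSpace P := FiniteDimensional.proper ℝ P
  have hc : Continuous fun q : P × X => (fderiv ℝ F q).comp (ContinuousLinearMap.inl ℝ P X) :=
    (hF.continuous_fderiv (by simp)).clm_comp continuous_const
  obtain ⟨C, hC⟩ := ((isCompact_closedBall p 1 : IsCompact (Metric.closedBall p 1)).prod hK).exists_bound_of_continuousOn
    hc.continuousOn
  have hfin : IsFiniteMeasure (μ.restrict K) := ⟨by
    rw [Measure.restrict_apply_univ]; exact hK.measure_lt_top⟩
  refine hasFDerivAt_integral_of_dominated_of_fderiv_le (𝕜 := ℝ)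
    (F := fun p x => F (p, x)) (F' := fun p x => (fderiv ℝ F (p, x)).comp (ContinuousLinearMap.inl ℝ P X))
    (s := Metric.closedBall p 1) (bound := fun _ => C)
    (Metric.closedBall_mem_nhds p one_pos) ?_ ?_ ?_ ?_ ?_ ?_
  · exact Eventually.of_forall fun q =>
      (hF.continuous.comp (by fun_prop : Continuous fun x : X => (q, x))).aestronglyMeasurable
  · exact (hF.continuous.comp (by fun_prop : Continuous fun x : X => (p, x))).continuousOn.integrableOn_compact
      hK
  · exact (hc.comp (by fun_prop : Continuous fun x : X => (p, x))).aestronglyMeasurable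
  · filter_upwards [ae_restrict_mem hK.measurableSet] with x hx q hq
    exact hC (q, x) ⟨hq, hx⟩
  · exact integrable_const C
  · refine Eventually.of_forall fun x q _ => ?_
    have h1 : HasFDerivAt F (fderiv ℝ F (q, x)) (q, x) :=
      (hF.differentiable (by simp) _).hasFDerivAt
    have h2 : HasFDerivAt (fun q : P => (q, x)) (ContinuousLinearMap.inl ℝ P X) q :=
      (hasFDerivAt_id q).prodMk (hasFDerivAt_const x q)
    exact h1.comp q h2

theorem contDiff_setIntegral_param_nat {P X : Type} [NormedAddCommGroup P] [NormedSpace ℝ P]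
    [FiniteDimensional ℝ P] [NormedAddCommGroup X] [NormedSpace ℝ X] [SecondCountableTopology X]
    [MeasurableSpace X] [BorelSpace X]
    (μ : Measure X) [IsFiniteMeasureOnCompacts μ] {K : Set X} (hK : IsCompact K) (n : ℕ) :
    ∀ (G : Type) [NormedAddCommGroup G] [NormedSpace ℝ G]
    (F : P × X → G), ContDiff ℝ ∞ F → ContDiff ℝ n (fun p => ∫ x in K, F (p, x) ∂μ) := by
  induction n with
  | zero =>
    intro G _ _ F hF
    exact contDiff_zero.2 (continuous_iff_continuousAt.2 fun p =>
      (hasFDerivAt_setIntegral_param μ hK hF p).continuousAt)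
  | succ n ih =>
    intro G _ _ F hF
    have h := hasFDerivAt_setIntegral_param μ hK hF
    rw [Nat.cast_succ, contDiff_succ_iff_fderiv]
    refine ⟨fun p => (h p).differentiableAt, by simp, ?_⟩
    have : (fderiv ℝ fun p => ∫ x in K, F (p, x) ∂μ) = fun p =>
        ∫ x in K, (fderiv ℝ F (p, x)).comp (ContinuousLinearMap.inl ℝ P X) ∂μ :=
      funext fun p => (h p).fderiv
    rw [this]
    exact ih _ (fun q => (fderiv ℝ F q).comp (ContinuousLinearMap.inl ℝ P X))
      ((hF.fderiv_right (m := ∞) (by simp)).clm_comp contDiff_const)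

theorem contDiff_setIntegral_param {P X G : Type} [NormedAddCommGroup P] [NormedSpace ℝ P]
    [FiniteDimensional ℝ P] [NormedAddCommGroup X] [NormedSpace ℝ X] [SecondCountableTopology X]
    [MeasurableSpace X] [BorelSpace X] [NormedAddCommGroup G] [NormedSpace ℝ G]
    (μ : Measure X) [IsFiniteMeasureOnCompacts μ] {K : Set X} (hK : IsCompact K)
    {F : P × X → G} (hF : ContDiff ℝ ∞ F) : ContDiff ℝ ∞ (fun p => ∫ x in K, F (p, x) ∂μ) :=
  contDiff_infty.2 fun n => contDiff_setIntegral_param_nat μ hK n G F hF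

end ParametricIntegral

variable {n : ℕ}

/-- The directional derivative along a fixed vector. -/
def pd (v : Pt n) (f : Pt n → ℝ) : Pt n → ℝ := fun p => fderiv ℝ f p v

theorem contDiff_pd (v : Pt n) {f : Pt n → ℝ} (hf : ContDiff ℝ ∞ f) : ContDiff ℝ ∞ (pd v f) :=
  (hf.fderiv_right (m := ∞) (by simp)).clm_apply contDiff_const

theorem pd_add (v : Pt n) {f g : Pt n → ℝ} (hf : ContDiff ℝ ∞ f) (hg : ContDiff ℝ ∞ g) :
    pd v (f + g) = pd v f + pd v g := by
  funext p
  simp only [pd, Pi.add_apply]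
  rw [fderiv_add (hf.differentiable (by simp) p) (hg.differentiable (by simp) p)]
  rfl

theorem pd_smul (v : Pt n) (c : ℝ) {f : Pt n → ℝ} (hf : ContDiff ℝ ∞ f) :
    pd v (c • f) = c • pd v f := by
  funext p
  simp only [pd, Pi.smul_apply]
  rw [fderiv_const_smul (hf.differentiable (by simp) p)]
  rfl

theorem pd_mul (v : Pt n) {f g : Pt n → ℝ} (hf : ContDiff ℝ ∞ f) (hg : ContDiff ℝ ∞ g) :
    pd v (f * g) = pd v f * g + f * pd v g := by
  funext p
  simp only [pd, Pi.mul_apply, Pi.add_apply]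
  rw [fderiv_mul (hf.differentiable (by simp) p) (hg.differentiable (by simp) p)]
  simp
  ring

/-- The vertical unit vector. -/
def eY (n : ℕ) : Pt n := (0, 1)

/-- The `i`-th horizontal unit vector. -/
def eX (i : Fin n) : Pt n := (EuclideanSpace.single i 1, 0)

theorem hasDerivAt_slice {f : Pt n → ℝ} (hf : ContDiff ℝ ∞ f) (x : EuclideanSpace ℝ (Fin n))
    (y : ℝ) : HasDerivAt (fun t => f (x, t)) (pd (eY n) f (x, y)) y := by
  have h1 : HasFDerivAt f (fderiv ℝ f (x, y)) (x, y) :=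
    (hf.differentiable (by simp) _).hasFDerivAt
  have h2 : HasDerivAt (fun t : ℝ => (x, t)) (eY n) y :=
    (hasDerivAt_const y x).prodMk (hasDerivAt_id y)
  exact h1.comp_hasDerivAt y h2

theorem fderiv_reflect {f : Pt n → ℝ} (hf : IsEvenSmooth f) (x : EuclideanSpace ℝ (Fin n)) (y : ℝ)
    (v : Pt n) : fderiv ℝ f (x, -y) v = fderiv ℝ f (x, y) (v.1, -v.2) := by
  let r : Pt n →L[ℝ] Pt n := (ContinuousLinearMap.fst ℝ _ _).prod (-(ContinuousLinearMap.snd ℝ _ _))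
  have hr : f ∘ r = f := funext fun p => hf.2 p.1 p.2
  have h1 : HasFDerivAt (f ∘ r) ((fderiv ℝ f (r (x, -y))).comp r) (x, -y) :=
    HasFDerivAt.comp _ (hf.1.differentiable (by simp) _).hasFDerivAt r.hasFDerivAt
  rw [hr] at h1
  rw [h1.fderiv]
  have : r (x, -y) = (x, y) := by simp [r]
  rw [this]
  simp [r]

/-- The space `C^∞_even` as a submodule of the space of functions. -/
def ES (n : ℕ) : Submodule ℝ (Pt n → ℝ) where
  carrier := {f | IsEvenSmooth f}
  add_mem' := fun {f g} hf hg => ⟨hf.1.add hg.1, fun x y => by simp [hf.2, hg.2]⟩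
  zero_mem' := ⟨contDiff_const, fun _ _ => rfl⟩
  smul_mem' := fun c f hf => ⟨contDiff_const.smul hf.1, fun x y => by simp [hf.2]⟩

namespace ES

instance : CoeFun (ES n) fun _ => Pt n → ℝ := ⟨fun f => f.1⟩

@[ext] theorem ext {f g : ES n} (h : ∀ x y, f (x, y) = g (x, y)) : f = g :=
  Subtype.ext (funext fun p => h p.1 p.2)

theorem smooth (f : ES n) : ContDiff ℝ ∞ (f : Pt n → ℝ) := f.2.1

theorem evn (f : ES n) (x y) : f (x, -y) = f (x, y) := f.2.2 x y

@[simp] theorem add_app (f g : ES n) (p : Pt n) : (f + g) p = f p + g p := rfl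
@[simp] theorem sub_app (f g : ES n) (p : Pt n) : (f - g) p = f p - g p := rfl
@[simp] theorem neg_app (f : ES n) (p : Pt n) : (-f) p = -f p := rfl
@[simp] theorem smul_app (c : ℝ) (f : ES n) (p : Pt n) : (c • f) p = c * f p := rfl
@[simp] theorem zero_app (p : Pt n) : (0 : ES n) p = 0 := rfl

theorem ext_of_pos {f g : ES n} (h : ∀ x, ∀ y, 0 < y → f (x, y) = g (x, y)) : f = g := by
  ext x y
  have hne : ∀ y, y ≠ 0 → f (x, y) = g (x, y) := fun y hy => by
    rcases lt_or_gt_of_ne hy with h1 | h1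
    · rw [← evn f, ← evn g]; exact h x _ (by linarith)
    · exact h x y h1
  have hc : ∀ u : ES n, Continuous fun t : ℝ => u (x, t) := fun u =>
    (smooth u).continuous.comp (by fun_prop)
  exact congrFun (Continuous.ext_on (dense_compl_singleton (0 : ℝ)) (hc f) (hc g)
    fun y hy => hne y hy) y

/-- Product of even smooth functions. -/
def mul (w : ES n) : Module.End ℝ (ES n) where
  toFun f := ⟨(w : Pt n → ℝ) * f, (smooth w).mul (smooth f), fun x y => by simp [evn w, evn f]⟩
  map_add' f g := Subtype.ext (by simp [mul_add])
  map_smul' c f := Subtype.ext (by simp)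

@[simp] theorem mul_app (w f : ES n) (p : Pt n) : mul w f p = w p * f p := rfl

/-- Multiplication by `y ^ 2`. -/
def Y : Module.End ℝ (ES n) :=
  mul ⟨fun p => p.2 ^ 2, contDiff_snd.pow 2, fun x y => by simp⟩

@[simp] theorem Y_app (f : ES n) (p : Pt n) : Y f p = p.2 ^ 2 * f p := rfl

theorem Y_injective : Function.Injective (Y : Module.End ℝ (ES n)) := fun f g h =>
  ext_of_pos fun x y hy => by
    have := congrArg (fun u : ES n => u (x, y)) h
    simpa [hy.ne'] using this

/-- Horizontal partial derivatives. -/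
def dX (i : Fin n) : Module.End ℝ (ES n) where
  toFun f := ⟨pd (eX i) f, contDiff_pd _ (smooth f), fun x y => by
    simp [pd, fderiv_reflect f.2, eX]⟩
  map_add' f g := Subtype.ext (pd_add _ (smooth f) (smooth g))
  map_smul' c f := Subtype.ext (pd_smul _ c (smooth f))

theorem dX_app (i : Fin n) (f : ES n) (p : Pt n) : dX i f p = pd (eX i) f p := rfl

/-- The Euler operator `y ∂_y`. -/
def θ : Module.End ℝ (ES n) where
  toFun f := ⟨fun p => p.2 * pd (eY n) f p, contDiff_snd.mul (contDiff_pd _ (smooth f)),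
    fun x y => by
      have h : ((0 : EuclideanSpace ℝ (Fin n)), (-1 : ℝ)) = -(0, 1) := by ext <;> simp
      simp only [pd, fderiv_reflect f.2, eY, h, map_neg]; ring⟩
  map_add' f g := Subtype.ext (by
    simp only [Submodule.coe_add, pd_add _ (smooth f) (smooth g)]; funext p; simp [mul_add])
  map_smul' c f := Subtype.ext (by
    simp only [Submodule.coe_smul, pd_smul _ c (smooth f)]; funext p; simp; ring)

theorem θ_app (f : ES n) (p : Pt n) : θ f p = p.2 * pd (eY n) f p := rfl

/-- Restriction to `y = 0`, extended constantly in `y`. -/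
def r0 : Module.End ℝ (ES n) where
  toFun f := ⟨fun p => f (p.1, 0), (smooth f).comp (by fun_prop), fun x y => rfl⟩
  map_add' f g := rfl
  map_smul' c f := rfl

@[simp] theorem r0_app (f : ES n) (p : Pt n) : r0 f p = f (p.1, 0) := rfl

theorem pd_eY_zero (f : ES n) (x) : pd (eY n) f (x, 0) = 0 := by
  have h := fderiv_reflect f.2 x 0 (eY n)
  have h2 : ((0 : EuclideanSpace ℝ (Fin n)), (-1 : ℝ)) = -(0, 1) := by ext <;> simp
  simp only [neg_zero, eY, h2, map_neg] at h
  simp only [pd, eY]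
  linarith

theorem hadamard_identity (f : ES n) (x : EuclideanSpace ℝ (Fin n)) (y : ℝ) :
    y ^ 2 * ∫ s in Set.Icc (0 : ℝ) 1, (1 - s) * pd (eY n) (pd (eY n) f) (x, s * y)
      = f (x, y) - f (x, 0) := by
  have hs1 : ∀ {u : Pt n → ℝ}, ContDiff ℝ ∞ u → ∀ s : ℝ,
      HasDerivAt (fun s => u (x, s * y)) (y * pd (eY n) u (x, s * y)) s := fun {u} hu s => by
    have h := (hasDerivAt_slice hu x (s * y)).comp s ((hasDerivAt_id s).mul_const y)
    exact h.congr_deriv (by simp [mul_comm])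
  have hp := contDiff_pd (eY n) (smooth f)
  have hD : ∀ s : ℝ, HasDerivAt
      (fun s => (1 - s) * (y * pd (eY n) f (x, s * y)) + f (x, s * y))
      (y ^ 2 * ((1 - s) * pd (eY n) (pd (eY n) f) (x, s * y))) s := fun s => by
    have h1 := ((hasDerivAt_id s).const_sub 1).mul ((hs1 hp s).const_mul y)
    refine (h1.add (hs1 (smooth f) s)).congr_deriv ?_
    simp; ring
  have hcont : Continuous fun s : ℝ =>
      y ^ 2 * ((1 - s) * pd (eY n) (pd (eY n) f) (x, s * y)) := by
    have := (contDiff_pd (eY n) hp).continuous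
    fun_prop
  have h := intervalIntegral.integral_eq_sub_of_hasDerivAt (a := 0) (b := 1)
    (fun s _ => hD s) (hcont.intervalIntegrable _ _)
  rw [integral_Icc_eq_integral_Ioc, ← intervalIntegral.integral_of_le zero_le_one,
    ← intervalIntegral.integral_const_mul, h]
  simp [pd_eY_zero]

/-- Hadamard's quotient `(f - f|_{y=0}) / y^2`. -/
def S : Module.End ℝ (ES n) where
  toFun f := ⟨fun p => ∫ s in Set.Icc (0 : ℝ) 1,
      (1 - s) * pd (eY n) (pd (eY n) f) (p.1, s * p.2), by
    have h2 := contDiff_pd (eY n) (contDiff_pd (eY n) (smooth f))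
    exact contDiff_setIntegral_param volume isCompact_Icc
      (F := fun q : Pt n × ℝ => (1 - q.2) * pd (eY n) (pd (eY n) f) (q.1.1, q.2 * q.1.2))
      (by fun_prop), fun x y => by
      rcases eq_or_ne y 0 with rfl | hy
      · simp
      · have h1 := hadamard_identity f x y
        have h2 := hadamard_identity f x (-y)
        rw [evn f, neg_sq, ← h1] at h2
        exact mul_left_cancel₀ (pow_ne_zero 2 hy) h2⟩
  map_add' f g := Y_injective (by
    ext x y
    simp only [Y_app, add_app, map_add]
    simp only [hadamard_identity, add_app]; ring)
  map_smul' c f := Y_injective (by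
    ext x y
    simp only [Y_app, smul_app, map_smul, RingHom.id_apply]
    simp only [hadamard_identity, smul_app]
    ring)

theorem Y_mul_S : (Y * S : Module.End ℝ (ES n)) = 1 - r0 := by
  ext f x y
  exact hadamard_identity f x y

theorem r0_mul_Y : (r0 * Y : Module.End ℝ (ES n)) = 0 := by
  ext f x y
  simp

theorem S_mul_Y : (S * Y : Module.End ℝ (ES n)) = 1 := by
  refine LinearMap.ext fun f => Y_injective ?_
  have h := congrArg (fun A : Module.End ℝ (ES n) => A (Y f)) Y_mul_S
  have h2 := congrArg (fun A : Module.End ℝ (ES n) => A f) r0_mul_Y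
  simp only [mul_apply, LinearMap.sub_apply, Module.End.one_apply] at h h2 ⊢
  rw [h, h2]; simp

theorem pd_smooth_mul (v : Pt n) (w f : ES n) :
    pd v (mul w f) = pd v w * f + (w : Pt n → ℝ) * pd v f :=
  pd_mul v (smooth w) (smooth f)

theorem pd_sq (v p : Pt n) : pd v (fun p : Pt n => p.2 ^ 2) p = 2 * p.2 * v.2 := by
  have : HasFDerivAt (fun p : Pt n => p.2 ^ 2) _ p :=
    (ContinuousLinearMap.snd ℝ (EuclideanSpace ℝ (Fin n)) ℝ).hasFDerivAt.pow 2
  simp [pd, this.fderiv]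

theorem θ_mul_Y : (θ * Y : Module.End ℝ (ES n)) = Y * (θ + 2) := by
  ext f x y
  simp only [mul_apply, LinearMap.add_apply, θ_app, Y_app, add_app]
  unfold Y
  rw [pd_smooth_mul]
  simp [pd_sq, eY, Module.End.ofNat_apply]
  ring

theorem dX_mul_Y (i : Fin n) : (dX i * Y : Module.End ℝ (ES n)) = Y * dX i := by
  ext f x y
  simp only [mul_apply, Y_app, dX_app]
  unfold Y
  rw [pd_smooth_mul]
  simp [pd_sq, eX]

/-- The horizontal Laplacian. -/
def Lap : Module.End ℝ (ES n) := ∑ i, dX i * dX i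

theorem commute_Lap_Y : (Lap * Y : Module.End ℝ (ES n)) = Y * Lap := by
  simp only [Lap, Finset.sum_mul, Finset.mul_sum, mul_assoc, dX_mul_Y]
  simp only [← mul_assoc, dX_mul_Y]

theorem laplacian_slice (f : ES n) (x : EuclideanSpace ℝ (Fin n)) (y : ℝ) :
    (Δ fun z => f (z, y)) x = Lap f (x, y) := by
  rw [InnerProductSpace.laplacian_eq_iteratedFDeriv_orthonormalBasis _
    (EuclideanSpace.basisFun (Fin n) ℝ)]
  have hd : ∀ {u : Pt n → ℝ}, ContDiff ℝ ∞ u → ∀ z, HasFDerivAt (fun z => u (z, y))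
      ((fderiv ℝ u (z, y)).comp (ContinuousLinearMap.inl ℝ _ _)) z := fun {u} hu z =>
    HasFDerivAt.comp z (hu.differentiable (by simp) _).hasFDerivAt
      ((hasFDerivAt_id z).prodMk (hasFDerivAt_const y z))
  have hfun : ∀ {u : Pt n → ℝ}, ContDiff ℝ ∞ u → ∀ (i : Fin n) z,
      fderiv ℝ (fun z => u (z, y)) z (EuclideanSpace.single i 1) = pd (eX i) u (z, y) := by
    intro u hu i z
    rw [(hd hu z).fderiv]; simp [pd, eX]
  have hc : ContDiff ℝ ∞ fun z => f (z, y) := (smooth f).comp (by fun_prop)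
  simp only [Lap, LinearMap.sum_apply, mul_apply]
  have hsum : ((∑ i, dX i (dX i f) : ES n) : Pt n → ℝ) (x, y)
      = ∑ i, dX i (dX i f) (x, y) := by
    rw [Submodule.coe_sum, Finset.sum_apply]
  rw [hsum]
  refine Finset.sum_congr rfl fun i _ => ?_
  rw [iteratedFDeriv_two_apply]
  simp only [EuclideanSpace.basisFun_apply, Matrix.cons_val_zero, Matrix.cons_val_one]
  have hdd : DifferentiableAt ℝ (fderiv ℝ fun z => f (z, y)) x :=
    (hc.fderiv_right (m := ∞) (by simp)).differentiable (by simp) x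
  have h1 := ((ContinuousLinearMap.apply ℝ ℝ (EuclideanSpace.single i (1 : ℝ))).hasFDerivAt.comp x
    hdd.hasFDerivAt).fderiv
  have h2 : ((ContinuousLinearMap.apply ℝ ℝ (EuclideanSpace.single i (1 : ℝ))) ∘
      (fderiv ℝ fun z => f (z, y))) = fun z => dX i f (z, y) :=
    funext fun z => hfun (smooth f) i z
  rw [h2] at h1
  have h3 := hfun (smooth (dX i f)) i x
  rw [h1] at h3
  simpa [dX_app] using h3

end ES

open Polynomial in
/-- The polynomial with a prescribed list of roots. -/
def rootPoly (l : List ℝ) : ℝ[X] := (l.map fun κ => X - C κ).prod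

section Weyl

variable {A : Type*} [Ring A] [Algebra ℝ A]

/-- The weighted Bessel-type operator `Λ + (y ∂_y + 2 + 2 c) Q`, with `Q = y⁻¹ ∂_y`. -/
def wN (Y Q Λ : A) (c : ℝ) : A := Λ + Y * Q * Q + (2 + 2 * c) • Q

/-- The conjugate `y ^ 2 Λ + (y ∂_y + c) ^ 2` of the hyperbolic Laplacian. -/
def wT (Y Q Λ : A) (c : ℝ) : A := Y * wN Y Q Λ c + (c ^ 2) • 1

/-- The product `N_{c+2(j-1)} ⋯ N_{c+2} N_c`. -/
def wC (Y Q Λ : A) (c : ℝ) : ℕ → A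
  | 0 => 1
  | j + 1 => wN Y Q Λ (c + 2 * j) * wC Y Q Λ c j

variable {Y Q Λ : A}

theorem wT_mul_Y (hQY : Q * Y = Y * Q + (2 : ℝ) • 1) (hY : Λ * Y = Y * Λ) (c : ℝ) :
    wT Y Q Λ c * Y = Y * wT Y Q Λ (c + 2) := by
  have h1 : ∀ z, Q * (Y * z) = Y * (Q * z) + (2 : ℝ) • z := fun z => by
    rw [← mul_assoc, hQY, add_mul, mul_assoc, smul_mul_assoc, one_mul]
  simp only [wT, wN, mul_add, add_mul, mul_assoc, hY, hQY, h1, smul_mul_assoc, mul_smul_comm,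
    one_mul, mul_one, smul_add, smul_smul]
  module

theorem wT_sub (c : ℝ) : wT Y Q Λ c - (c ^ 2) • (1 : A) = Y * wN Y Q Λ c := by
  simp [wT]

open Polynomial in
theorem aeval_mul_of_intertwine {a b y : A} (h : a * y = y * b) (p : ℝ[X]) :
    aeval a p * y = y * aeval b p := by
  induction p using Polynomial.induction_on with
  | C r => simp [Algebra.commutes]
  | add p q hp hq => simp [add_mul, mul_add, hp, hq]
  | monomial n r ih =>
    rw [pow_succ, ← mul_assoc, map_mul, map_mul (aeval b), aeval_X, aeval_X, mul_assoc, h,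
      ← mul_assoc, ih, mul_assoc]

open Polynomial in
theorem aeval_wT_mul_Y_pow (hQY : Q * Y = Y * Q + (2 : ℝ) • 1) (hY : Λ * Y = Y * Λ) (p : ℝ[X])
    (c : ℝ) (j : ℕ) :
    aeval (wT Y Q Λ c) p * Y ^ j = Y ^ j * aeval (wT Y Q Λ (c + 2 * j)) p := by
  induction j generalizing c with
  | zero => simp
  | succ j ih =>
    rw [pow_succ', ← mul_assoc, aeval_mul_of_intertwine (wT_mul_Y hQY hY c), mul_assoc, ih,
      ← mul_assoc]
    congr 4
    push_cast; ring

open Polynomial in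
/-- The polynomial whose roots are `(c + 2 l) ^ 2` for `l < j`. -/
def chainPoly (c : ℝ) (j : ℕ) : ℝ[X] := ∏ l ∈ Finset.range j, (X - C ((c + 2 * (l : ℝ)) ^ 2))

open Polynomial in
theorem aeval_chainPoly (hQY : Q * Y = Y * Q + (2 : ℝ) • 1) (hY : Λ * Y = Y * Λ) (c : ℝ) (j : ℕ) :
    aeval (wT Y Q Λ c) (chainPoly c j) = Y ^ j * wC Y Q Λ c j := by
  induction j with
  | zero => simp [chainPoly, wC]
  | succ j ih =>
    have h0 : aeval (wT Y Q Λ (c + 2 * j)) (X - C ((c + 2 * (j : ℝ)) ^ 2))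
        = Y * wN Y Q Λ (c + 2 * j) := by
      rw [← wT_sub, map_sub, aeval_X, aeval_C, Algebra.algebraMap_eq_smul_one]
    rw [chainPoly, Finset.prod_range_succ, mul_comm, map_mul]
    have ih' := ih
    rw [chainPoly] at ih'
    rw [ih', ← mul_assoc, aeval_wT_mul_Y_pow hQY hY, h0, wC, pow_succ]
    simp only [mul_assoc]

theorem Q_mul_wN (hQY : Q * Y = Y * Q + (2 : ℝ) • 1) (hQ : Λ * Q = Q * Λ) (c : ℝ) :
    Q * wN Y Q Λ c = wN Y Q Λ (c + 1) * Q := by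
  have h1 : ∀ z, Q * (Y * z) = Y * (Q * z) + (2 : ℝ) • z := fun z => by
    rw [← mul_assoc, hQY, add_mul, mul_assoc, smul_mul_assoc, one_mul]
  simp only [wN, mul_add, add_mul, mul_assoc, hQ, h1, smul_mul_assoc, mul_smul_comm]
  module

theorem wN_add (c d : ℝ) : wN Y Q Λ (c + d) = wN Y Q Λ c + (2 * d) • Q := by
  simp only [wN]; module

theorem wN_pow_sub (hQY : Q * Y = Y * Q + (2 : ℝ) • 1) (hQ : Λ * Q = Q * Λ) (c : ℝ) (k : ℕ) :
    Q * wN Y Q Λ (c - 1) ^ k = wN Y Q Λ c ^ k * Q ∧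
    wN Y Q Λ c * wN Y Q Λ (c - 1) ^ k
      = wN Y Q Λ c ^ (k + 1) - (2 * k : ℝ) • (wN Y Q Λ c ^ k * Q) := by
  have hq : Q * wN Y Q Λ (c - 1) = wN Y Q Λ c * Q := by
    have := Q_mul_wN hQY hQ (c - 1); simpa using this
  have hN : wN Y Q Λ (c - 1) = wN Y Q Λ c - (2 : ℝ) • Q := by
    rw [sub_eq_add_neg c 1, wN_add]; module
  have h1 : ∀ k : ℕ, Q * wN Y Q Λ (c - 1) ^ k = wN Y Q Λ c ^ k * Q := fun k => by
    induction k with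
    | zero => simp
    | succ k ih => rw [pow_succ, ← mul_assoc, ih, mul_assoc, hq, ← mul_assoc, pow_succ]
  refine ⟨h1 k, ?_⟩
  induction k with
  | zero => simp
  | succ k ih =>
    have h2 : wN Y Q Λ (c - 1) ^ (k + 1) =
        wN Y Q Λ c * wN Y Q Λ (c - 1) ^ k - (2 : ℝ) • (Q * wN Y Q Λ (c - 1) ^ k) := by
      rw [pow_succ']; conv_lhs => rw [hN]
      rw [sub_mul, smul_mul_assoc, ← hN]
    rw [h2, ih, h1, mul_sub, mul_sub, mul_smul_comm, mul_smul_comm, ← mul_assoc,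
      ← pow_succ', ← pow_succ']
    push_cast
    module

theorem wC_eq_pow (hQY : Q * Y = Y * Q + (2 : ℝ) • 1) (hQ : Λ * Q = Q * Λ) (c : ℝ) (k : ℕ) :
    wC Y Q Λ c (k + 1) = wN Y Q Λ (c + k) ^ (k + 1) := by
  induction k with
  | zero => simp [wC]
  | succ k ih =>
    rw [wC, ih]
    have h := wN_pow_sub hQY hQ (c + (k + 1)) (k + 1)
    rw [show c + ((k : ℝ) + 1) - 1 = c + k by ring] at h
    push_cast
    rw [show c + 2 * ((k : ℝ) + 1) = c + (k + 1) + (k + 1) by ring, wN_add, add_mul,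
      smul_mul_assoc, h.1, h.2]
    push_cast
    module

end Weyl

namespace ES

variable {n : ℕ}

/-- The operator `y⁻¹ ∂_y`. -/
def Q : Module.End ℝ (ES n) := (θ + 2) * S

theorem θ_mul_r0 : (θ * r0 : Module.End ℝ (ES n)) = 0 := by
  ext f x y
  have h : HasDerivAt (fun t : ℝ => r0 f (x, t)) _ y := hasDerivAt_slice (smooth (r0 f)) x y
  have h2 : HasDerivAt (fun t : ℝ => r0 f (x, t)) 0 y :=
    hasDerivAt_const y (f (x, 0))
  simp [θ_app, h.unique h2]

theorem weyl_aux {R : Type*} [Ring R] [Algebra ℝ R] {Y S θ r : R} (h1 : θ * Y = Y * (θ + 2))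
    (h2 : Y * S = 1 - r) (h3 : S * Y = 1) (h4 : θ * r = 0) :
    Y * ((θ + 2) * S) = θ ∧ (θ + 2) * S * Y = Y * ((θ + 2) * S) + (2 : ℝ) • 1 := by
  have h : Y * ((θ + 2) * S) = θ := by rw [← mul_assoc, ← h1, mul_assoc, h2, mul_sub, h4]; simp
  refine ⟨h, ?_⟩
  rw [h, mul_assoc, h3, mul_one, ← Algebra.algebraMap_eq_smul_one, map_ofNat]

theorem Y_mul_Q : (Y * Q : Module.End ℝ (ES n)) = θ :=
  (weyl_aux (R := Module.End ℝ (ES n)) θ_mul_Y Y_mul_S S_mul_Y θ_mul_r0).1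

theorem Q_mul_Y : (Q * Y : Module.End ℝ (ES n)) = Y * Q + (2 : ℝ) • 1 :=
  (weyl_aux (R := Module.End ℝ (ES n)) θ_mul_Y Y_mul_S S_mul_Y θ_mul_r0).2

theorem wT_app (Λ : Module.End ℝ (ES n)) (c : ℝ) (f : ES n) (x y) :
    wT Y Q Λ c f (x, y) = y ^ 2 * Λ f (x, y) + θ (θ f) (x, y) + 2 * c * θ f (x, y)
      + c ^ 2 * f (x, y) := by
  have hq : ∀ u : ES n, y ^ 2 * Q u (x, y) = θ u (x, y) := fun u => by
    rw [← Y_mul_Q]; rfl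
  have hθ : θ (θ f) (x, y) = y ^ 2 * (y ^ 2 * Q (Q f) (x, y) + 2 * Q f (x, y)) := by
    have h : θ (Y (Q f)) (x, y) = (Y * (θ + 2) : Module.End ℝ (ES n)) (Q f) (x, y) := by
      rw [← θ_mul_Y]; rfl
    have h2 : θ f = Y (Q f) := by
      rw [← Y_mul_Q]; rfl
    rw [h2, h]
    simp only [mul_apply, Y_app, LinearMap.add_apply, add_app, hq,
      Module.End.ofNat_apply]
    simp
  rw [hθ, ← hq]
  simp only [wT, wN, LinearMap.add_apply, add_app, mul_apply, Y_app,
    LinearMap.smul_apply, smul_app, Module.End.one_apply]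
  ring

theorem wT_zero (Λ : Module.End ℝ (ES n)) (c : ℝ) (f : ES n) (x) :
    wT Y Q Λ c f (x, 0) = c ^ 2 * f (x, 0) := by
  rw [wT_app]; simp [θ_app]

open Polynomial in
theorem aeval_wT_zero (Λ : Module.End ℝ (ES n)) (c : ℝ) (p : ℝ[X]) (f : ES n) (x) :
    aeval (wT Y Q Λ c) p f (x, 0) = p.eval (c ^ 2) * f (x, 0) := by
  induction p using Polynomial.induction_on with
  | C r => simp [Module.algebraMap_end_apply]
  | add p q hp hq => simp only [map_add, LinearMap.add_apply, add_app, hp, hq, eval_add]; ring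
  | monomial k r ih =>
    rw [pow_succ', mul_left_comm, map_mul, aeval_X, mul_apply, wT_zero, ih]
    simp; ring

theorem Y_pow_app (j : ℕ) (f : ES n) (p : Pt n) : (Y ^ j) f p = p.2 ^ (2 * j) * f p := by
  induction j generalizing f with
  | zero => simp
  | succ j ih => rw [pow_succ, mul_apply, ih, Y_app]; ring

theorem Y_pow_injective (j : ℕ) : Function.Injective ((Y : Module.End ℝ (ES n)) ^ j) := by
  rw [Module.End.coe_pow]; exact Y_injective.iterate j

open Polynomial in
theorem aeval_mul_app (T : Module.End ℝ (ES n)) (p q : ℝ[X]) (f : ES n) :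
    aeval T (p * q) f = aeval T p (aeval T q f) := by
  rw [map_mul]; rfl

open Polynomial in
theorem aeval_Y_pow {Λ : Module.End ℝ (ES n)} (hΛ : Λ * Y = Y * Λ) (p : ℝ[X]) (c : ℝ) (j : ℕ)
    (f : ES n) : aeval (wT Y Q Λ c) p ((Y ^ j) f)
      = (Y ^ j) (aeval (wT Y Q Λ (c + 2 * j)) p f) :=
  congrArg (fun B : Module.End ℝ (ES n) => B f)
    (aeval_wT_mul_Y_pow (A := Module.End ℝ (ES n)) Q_mul_Y hΛ p c j)

open Polynomial in
theorem aeval_chain {Λ : Module.End ℝ (ES n)} (hΛ : Λ * Y = Y * Λ) (c : ℝ) (j : ℕ)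
    (f : ES n) : aeval (wT Y Q Λ c) (chainPoly c j) f = (Y ^ j) (wC Y Q Λ c j f) :=
  congrArg (fun B : Module.End ℝ (ES n) => B f)
    (aeval_chainPoly (A := Module.End ℝ (ES n)) Q_mul_Y hΛ c j)

theorem wC_succ_app {Λ : Module.End ℝ (ES n)} (hQ : Λ * Q = Q * Λ) (c : ℝ) (k : ℕ)
    (f : ES n) : wC Y Q Λ c (k + 1) f = (wN Y Q Λ (c + k) ^ (k + 1)) f :=
  congrArg (fun B : Module.End ℝ (ES n) => B f)
    (wC_eq_pow (A := Module.End ℝ (ES n)) Q_mul_Y hQ c k)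

end ES

section
variable {n : ℕ}
open ES

/-- The conjugated hyperbolic Laplacian acting on even smooth functions. -/
abbrev tX (c : ℝ) : Module.End ℝ (ES n) := wT Y Q Lap c

theorem mem_nhds_pos {x : EuclideanSpace ℝ (Fin n)} {y : ℝ} (hy : 0 < y) {P : Pt n → Prop}
    (h : ∀ p ∈ upper n, P p) : ∀ᶠ t in 𝓝 y, P (x, t) := by
  filter_upwards [lt_mem_nhds hy] with t ht using h (x, t) ht

theorem hasDerivAt_rpow_mul (b : ℝ) (f : ES n) (x) {y : ℝ} (hy : 0 < y) :
    HasDerivAt (fun t => t ^ b * f (x, t)) (y ^ (b - 1) * (b * f (x, y) + θ f (x, y))) y := by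
  have h := (Real.hasDerivAt_rpow_const (p := b) (Or.inl hy.ne')).mul
    (hasDerivAt_slice (smooth f) x y)
  refine h.congr_deriv ?_
  rw [θ_app]
  have : y ^ b = y ^ (b - 1) * y := by rw [← rpow_add_one hy.ne']; simp
  rw [this]; ring

theorem hypLaplacian_pair {u : Pt n → ℝ} {c d : ℝ} {f g : ES n}
    (hu : ∀ p ∈ upper n, u p = p.2 ^ ((n : ℝ) / 2 + c) * f p + p.2 ^ ((n : ℝ) / 2 + d) * g p) :
    ∀ p ∈ upper n, hypLaplacian u p + (n : ℝ) ^ 2 / 4 * u p =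
      p.2 ^ ((n : ℝ) / 2 + c) * tX c f p + p.2 ^ ((n : ℝ) / 2 + d) * tX d g p := by
  rintro ⟨x, y⟩ (hy : 0 < y)
  have hslice : (fun z => u (z, y)) = (y ^ ((n : ℝ) / 2 + c)) • (fun z => f (z, y))
      + (y ^ ((n : ℝ) / 2 + d)) • fun z => g (z, y) := funext fun z => by
    simpa using hu (z, y) hy
  have hsm : ∀ v : ES n, ContDiff ℝ 2 fun z => v (z, y) := fun v =>
    ((smooth v).comp (by fun_prop : ContDiff ℝ ∞ fun z : EuclideanSpace ℝ (Fin n) => (z, y))).of_le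
      (WithTop.coe_le_coe.2 le_top)
  have hlap : (Δ fun z => u (z, y)) x = y ^ ((n : ℝ) / 2 + c) * Lap f (x, y)
      + y ^ ((n : ℝ) / 2 + d) * Lap g (x, y) := by
    rw [hslice, ContDiffAt.laplacian_add (f₁ := (y ^ ((n : ℝ) / 2 + c)) • fun z => f (z, y))
      (f₂ := (y ^ ((n : ℝ) / 2 + d)) • fun z => g (z, y)) ((hsm f).contDiffAt.const_smul (y ^ ((n : ℝ) / 2 + c)))
      ((hsm g).contDiffAt.const_smul (y ^ ((n : ℝ) / 2 + d))), InnerProductSpace.laplacian_smul _ (hsm f).contDiffAt,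
      InnerProductSpace.laplacian_smul _ (hsm g).contDiffAt, laplacian_slice, laplacian_slice]
    simp
  have hd1 : ∀ y, 0 < y → HasDerivAt (fun t => u (x, t))
      (y ^ ((n : ℝ) / 2 + c - 1) * ((((n : ℝ) / 2 + c) • f + θ f : ES n) (x, y)) +
        y ^ ((n : ℝ) / 2 + d - 1) * ((((n : ℝ) / 2 + d) • g + θ g : ES n) (x, y))) y :=
    fun y hy => by
      have h := (hasDerivAt_rpow_mul ((n : ℝ) / 2 + c) f x hy).add
        (hasDerivAt_rpow_mul ((n : ℝ) / 2 + d) g x hy)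
      exact h.congr_of_eventuallyEq (mem_nhds_pos hy hu)
  have hd2 : iteratedDeriv 2 (fun t => u (x, t)) y =
      y ^ ((n : ℝ) / 2 + c - 1 - 1) *
        (((n : ℝ) / 2 + c - 1) * (((n : ℝ) / 2 + c) * f (x, y) + θ f (x, y)) +
          (((n : ℝ) / 2 + c) * θ f (x, y) + θ (θ f) (x, y))) +
      y ^ ((n : ℝ) / 2 + d - 1 - 1) *
        (((n : ℝ) / 2 + d - 1) * (((n : ℝ) / 2 + d) * g (x, y) + θ g (x, y)) +
          (((n : ℝ) / 2 + d) * θ g (x, y) + θ (θ g) (x, y))) := by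
    rw [iteratedDeriv_succ, iteratedDeriv_one]
    have he : deriv (fun t => u (x, t)) =ᶠ[𝓝 y] fun t =>
        t ^ ((n : ℝ) / 2 + c - 1) * ((((n : ℝ) / 2 + c) • f + θ f : ES n) (x, t)) +
        t ^ ((n : ℝ) / 2 + d - 1) * ((((n : ℝ) / 2 + d) • g + θ g : ES n) (x, t)) := by
      filter_upwards [lt_mem_nhds hy] with t ht using (hd1 t ht).deriv
    rw [he.deriv_eq]
    have h := (hasDerivAt_rpow_mul ((n : ℝ) / 2 + c - 1) (((n : ℝ) / 2 + c) • f + θ f) x hy).add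
        (hasDerivAt_rpow_mul ((n : ℝ) / 2 + d - 1) (((n : ℝ) / 2 + d) • g + θ g) x hy)
    refine h.deriv.trans ?_
    simp only [map_add, map_smul, add_app, smul_app]
  have hp : ∀ b : ℝ, y ^ b = y ^ (b - 1 - 1) * y ^ 2 ∧ y ^ (b - 1) = y ^ (b - 1 - 1) * y :=
    fun b => by
      constructor
      · rw [← rpow_natCast y 2, ← rpow_add hy]; congr 1; push_cast; ring
      · rw [← rpow_add_one hy.ne']; congr 1; ring
  simp only [hypLaplacian, hlap, hd2, (hd1 y hy).deriv, wT_app, hu (x, y) hy, add_app, smul_app]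
  rw [(hp ((n : ℝ) / 2 + c)).1, (hp ((n : ℝ) / 2 + c)).2, (hp ((n : ℝ) / 2 + d)).1,
    (hp ((n : ℝ) / 2 + d)).2]
  ring

theorem rootPoly_cons (κ : ℝ) (l : List ℝ) :
    rootPoly (κ :: l) = (Polynomial.X - Polynomial.C κ) * rootPoly l := by
  simp [rootPoly]

theorem rootPoly_append (l₁ l₂ : List ℝ) : rootPoly (l₁ ++ l₂) = rootPoly l₁ * rootPoly l₂ := by
  simp [rootPoly]

open Polynomial in
theorem aeval_rootPoly_cons (T : Module.End ℝ (ES n)) (κ : ℝ) (l : List ℝ) (f : ES n) (p : Pt n) :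
    aeval T (rootPoly (κ :: l)) f p
      = T (aeval T (rootPoly l) f) p - κ * aeval T (rootPoly l) f p := by
  rw [rootPoly_cons, map_mul, map_sub, aeval_X, aeval_C]
  simp [Module.algebraMap_end_apply]

open Polynomial in
theorem factorProd_pair {u : Pt n → ℝ} {c d : ℝ} {f g : ES n}
    (hu : ∀ p ∈ upper n, u p = p.2 ^ ((n : ℝ) / 2 + c) * f p + p.2 ^ ((n : ℝ) / 2 + d) * g p)
    (l : List ℝ) :
    ∀ p ∈ upper n, factorProd l u p =
      p.2 ^ ((n : ℝ) / 2 + c) * aeval (tX c) (rootPoly l) f p +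
      p.2 ^ ((n : ℝ) / 2 + d) * aeval (tX d) (rootPoly l) g p := by
  induction l with
  | nil => simpa [factorProd, rootPoly] using hu
  | cons κ l ih =>
    intro p hp
    have h := hypLaplacian_pair ih p hp
    have h0 := ih p hp
    rw [aeval_rootPoly_cons, aeval_rootPoly_cons]
    change factor κ (factorProd l u) p = _
    rw [factor]
    linear_combination h - κ * h0

/-- `U = f + y^{2[γ]} g` on the half-space. -/
def IsRep (γ : ℝ) (U : Pt n → ℝ) (f g : ES n) : Prop :=
  ∀ p ∈ upper n, U p = f p + p.2 ^ (2 * fract γ) * g p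

theorem MemC.exists_rep {γ : ℝ} {U : Pt n → ℝ} (h : MemC γ U) : ∃ f g : ES n, IsRep γ U f g := by
  obtain ⟨f, g, hf, hg, h⟩ := h
  exact ⟨⟨f, hf⟩, ⟨g, hg⟩, h⟩

theorem two_mul_fract {γ : ℝ} (hγ : 0 ≤ γ) : 2 * fract γ = 2 * γ - 2 * (⌊γ⌋₊ : ℝ) := by
  rw [Int.fract, ← natCast_floor_eq_intCast_floor hγ]; ring

theorem IsRep.mulPow {γ : ℝ} (hγ : 0 ≤ γ) {U : Pt n → ℝ} {f g : ES n} (h : IsRep γ U f g) :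
    ∀ p ∈ upper n, mulPow ((n : ℝ) / 2 - γ) U p = p.2 ^ ((n : ℝ) / 2 + -γ) * f p +
      p.2 ^ ((n : ℝ) / 2 + δ[γ]) * g p := by
  intro p hp
  have hy : 0 < p.2 := hp
  rw [HalfSpace.mulPow, h p hp, mul_add, ← mul_assoc, ← rpow_add hy, two_mul_fract hγ]
  congr 3; all_goals ring_nf

open Polynomial in
theorem IsRep.factorProd {γ : ℝ} (hγ : 0 ≤ γ) {U : Pt n → ℝ} {f g : ES n} (h : IsRep γ U f g)
    (a : ℝ) (l : List ℝ) : ∀ p ∈ upper n,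
    HalfSpace.mulPow (-(n : ℝ) / 2 + γ - a)
      (HalfSpace.factorProd l (HalfSpace.mulPow ((n : ℝ) / 2 - γ) U)) p =
    p.2 ^ (-a) * aeval (tX (-γ)) (rootPoly l) f p + p.2 ^ (2 * fract γ - a) *
      aeval (tX δ[γ]) (rootPoly l) g p := by
  intro p hp
  have hy : 0 < p.2 := hp
  rw [HalfSpace.mulPow, factorProd_pair (h.mulPow hγ) l p hp, mul_add, ← mul_assoc, ← mul_assoc,
    ← rpow_add hy, ← rpow_add hy, two_mul_fract hγ]
  congr 3; all_goals ring_nf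

theorem rpow_mul_sq_pow {y : ℝ} (hy : 0 < y) (b : ℝ) (j : ℕ) :
    y ^ b * y ^ (2 * j) = y ^ (b + 2 * j) := by
  rw [← rpow_natCast, ← rpow_add hy]; push_cast; rfl

theorem tendsto_ES_slice (F : ES n) (x) : Tendsto (fun y => F (x, y)) (𝓝[>] (0 : ℝ))
    (𝓝 (F (x, 0))) :=
  (((smooth F).continuous.comp (by fun_prop : Continuous fun y : ℝ => (x, y))).tendsto 0).mono_left
    nhdsWithin_le_nhds

theorem tendsto_rpow_zero {b : ℝ} (hb : 0 < b) : Tendsto (fun y : ℝ => y ^ b) (𝓝[>] (0 : ℝ))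
    (𝓝 0) := by
  have h := (Real.continuousAt_rpow_const 0 b (Or.inr hb.le)).tendsto
  rw [Real.zero_rpow hb.ne'] at h
  exact h.mono_left nhdsWithin_le_nhds

/-- The lowest coefficient produced by the product of `j` chain factors. -/
def bNorm (c : ℝ) (j : ℕ) : ℝ := (chainPoly c j).eval ((c + 2 * (j : ℝ)) ^ 2)

open Polynomial in
theorem aeval_chain_mul (Λ : Module.End ℝ (ES n)) (hΛ : Λ * Y = Y * Λ) (c : ℝ) (j : ℕ) (q : ℝ[X])
    (f : ES n) :
    aeval (wT Y Q Λ c) (chainPoly c j * q) f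
      = (Y ^ j) (aeval (wT Y Q Λ (c + 2 * j)) q (wC Y Q Λ c j f)) := by
  rw [mul_comm, aeval_mul_app, aeval_chain hΛ, aeval_Y_pow hΛ]

open Polynomial in
theorem wC_Y_pow (Λ : Module.End ℝ (ES n)) (hΛ : Λ * Y = Y * Λ) (c : ℝ) (j : ℕ) (f : ES n) (x) :
    wC Y Q Λ c j ((Y ^ j) f) (x, 0) = bNorm c j * f (x, 0) := by
  have h : (Y ^ j) (wC Y Q Λ c j ((Y ^ j) f))
      = (Y ^ j) (aeval (wT Y Q Λ (c + 2 * j)) (chainPoly c j) f) := by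
    rw [← aeval_chain hΛ, aeval_Y_pow hΛ]
  rw [Y_pow_injective j h, aeval_wT_zero, bNorm]

/-- The constant function `1`. -/
def one : ES n := ⟨fun _ => 1, contDiff_const, fun _ _ => rfl⟩

@[simp] theorem one_app (p : Pt n) : (one : ES n) p = 1 := rfl

open Polynomial in
theorem exists_of_chain_dvd (c : ℝ) (r j : ℕ) (hr : r ≤ j) {l : List ℝ}
    (h : chainPoly (c + 2 * r) (j - r) ∣ rootPoly l) (g : ES n) :
    ∃ G : ES n, aeval (tX c) (rootPoly l) ((Y ^ r) g) = (Y ^ j) G := by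
  obtain ⟨q, hq⟩ := h
  have h1 : aeval (tX c) (rootPoly l) ((Y ^ r) g)
      = (Y ^ r) (aeval (tX (c + 2 * r)) (rootPoly l) g) := aeval_Y_pow commute_Lap_Y _ _ _ _
  rw [h1, hq, aeval_chain_mul _ commute_Lap_Y]
  have h2 : ∀ F : ES n, (Y ^ r) ((Y ^ (j - r)) F) = (Y ^ j) F := fun F => by
    rw [← mul_apply, ← pow_add, Nat.add_sub_of_le hr]
  exact ⟨_, h2 _⟩

section Evaluation

variable {γ : ℝ}

theorem preB_even (hγ : 0 ≤ γ) (ha : 0 < fract γ) {U : Pt n → ℝ} {f g : ES n} {r j : ℕ} (h : IsRep γ U f ((Y ^ r) g)) (hr : r ≤ j)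
    {l : List ℝ} (q : Polynomial ℝ) (h1 : rootPoly l = chainPoly (-γ) j * q)
    (h2 : chainPoly (δ[γ] + 2 * r) (j - r) ∣ rootPoly l) (x) :
    preB γ (2 * (j : ℝ)) l U x
      = q.eval ((-γ + 2 * (j : ℝ)) ^ 2) * wC Y Q Lap (-γ) j f (x, 0) := by
  obtain ⟨G, hG⟩ := exists_of_chain_dvd _ r j hr h2 g
  refine Tendsto.limUnder_eq ?_
  have h3 : Tendsto (fun y : ℝ =>
      aeval (tX (-γ + 2 * j)) q (wC Y Q Lap (-γ) j f) (x, y)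
        + y ^ (2 * fract γ) * G (x, y)) (𝓝[>] 0)
      (𝓝 (q.eval ((-γ + 2 * (j : ℝ)) ^ 2) * wC Y Q Lap (-γ) j f (x, 0) + 0 * G (x, 0))) := by
    rw [← aeval_wT_zero]
    exact (tendsto_ES_slice _ x).add
      ((tendsto_rpow_zero (by positivity)).mul (tendsto_ES_slice G x))
  rw [zero_mul, add_zero] at h3
  refine h3.congr' ?_
  filter_upwards [self_mem_nhdsWithin] with y hy
  have hy : 0 < y := hy
  rw [h.factorProd hγ _ l (x, y) hy, hG, h1, aeval_chain_mul _ commute_Lap_Y, Y_pow_app,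
    Y_pow_app, ← mul_assoc, ← mul_assoc, rpow_mul_sq_pow hy, rpow_mul_sq_pow hy]
  simp

theorem preB_frac (hγ : 0 ≤ γ) {U : Pt n → ℝ} {f g : ES n} {r j : ℕ} (h : IsRep γ U ((Y ^ r) f) g)
    (hr : r ≤ j + 1)
    {l : List ℝ} (q : Polynomial ℝ)
    (h1 : rootPoly l = chainPoly δ[γ] j * q)
    (h2 : chainPoly (-γ + 2 * r) (j + 1 - r) ∣ rootPoly l) (x) :
    preB γ (2 * (j : ℝ) + 2 * fract γ) l U x
      = q.eval ((δ[γ] + 2 * (j : ℝ)) ^ 2) *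
        wC Y Q Lap δ[γ] j g (x, 0) := by
  obtain ⟨G, hG⟩ := exists_of_chain_dvd _ r (j + 1) hr h2 f
  have ha1 := Int.fract_lt_one γ
  refine Tendsto.limUnder_eq ?_
  have h3 : Tendsto (fun y : ℝ => y ^ (2 - 2 * fract γ) * G (x, y) +
      aeval (tX (δ[γ] + 2 * j)) q
        (wC Y Q Lap δ[γ] j g) (x, y)) (𝓝[>] 0)
      (𝓝 (0 * G (x, 0) + q.eval ((δ[γ] + 2 * (j : ℝ)) ^ 2) *
        wC Y Q Lap δ[γ] j g (x, 0))) := by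
    rw [← aeval_wT_zero]
    exact ((tendsto_rpow_zero (by linarith)).mul (tendsto_ES_slice G x)).add
      (tendsto_ES_slice _ x)
  rw [zero_mul, zero_add] at h3
  refine h3.congr' ?_
  filter_upwards [self_mem_nhdsWithin] with y hy
  have hy : 0 < y := hy
  rw [h.factorProd hγ _ l (x, y) hy, hG, h1, aeval_chain_mul _ commute_Lap_Y, Y_pow_app,
    Y_pow_app, ← mul_assoc, ← mul_assoc, rpow_mul_sq_pow hy, rpow_mul_sq_pow hy]
  congr 2
  · congr 1; push_cast; ring
  · ring_nf; simp

theorem isRep_powY_even (j : ℕ) : IsRep γ (powY n (2 * (j : ℝ))) ((Y ^ j) one) ((Y ^ 0) 0) := by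
  intro p hp
  have hy : 0 < p.2 := hp
  simp [powY, Y_pow_app, ← rpow_natCast]

theorem isRep_powY_frac (j : ℕ) :
    IsRep γ (powY n (2 * (j : ℝ) + 2 * fract γ)) ((Y ^ 0) 0) ((Y ^ j) one) := by
  intro p hp
  have hy : 0 < p.2 := hp
  simp [powY, Y_pow_app, rpow_mul_sq_pow hy, add_comm]

theorem eval_rootPoly_ne_zero {l : List ℝ} {κ : ℝ} (h : ∀ μ ∈ l, μ ≠ κ) :
    (rootPoly l).eval κ ≠ 0 := by
  induction l with
  | nil => simp [rootPoly]
  | cons μ l ih =>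
    rw [rootPoly_cons, Polynomial.eval_mul]
    refine mul_ne_zero ?_ (ih fun ν hν => h ν (List.mem_cons_of_mem _ hν))
    simpa [sub_eq_zero] using (h μ List.mem_cons_self).symm

end Evaluation

end

section
variable {n : ℕ} {γ : ℝ}
open ES

theorem ne_intCast_of_fract_pos (ha : 0 < fract γ) (z : ℤ) : γ ≠ z := by
  rintro rfl
  simp at ha

theorem sq_shift_ne (ha : 0 < fract γ) {i j : ℤ} (hij : i ≠ j) :
    (γ - 2 * (i : ℝ)) ^ 2 ≠ (γ - 2 * (j : ℝ)) ^ 2 := by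
  intro h
  rcases sq_eq_sq_iff_eq_or_eq_neg.1 h with h | h
  · exact hij (by exact_mod_cast (by linarith : (i : ℝ) = j))
  · exact ne_intCast_of_fract_pos ha (i + j) (by push_cast; linarith)

theorem bNorm_eq (c : ℝ) (j : ℕ) : bNorm c j =
    ∏ l ∈ Finset.range j, ((c + 2 * (j : ℝ)) ^ 2 - (c + 2 * (l : ℝ)) ^ 2) := by
  simp [bNorm, chainPoly, Polynomial.eval_prod]

theorem bNorm_neg_ne_zero (ha : 0 < fract γ) (j : ℕ) : bNorm (-γ) j ≠ 0 := by
  rw [bNorm_eq, Finset.prod_ne_zero_iff]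
  intro l hl
  have h := sq_shift_ne ha (i := j) (j := l) (by
    have := Finset.mem_range.1 hl; exact_mod_cast this.ne')
  rw [sub_ne_zero]
  intro h2
  apply h
  push_cast
  linarith

theorem bNorm_pos_ne_zero (ha : 0 < fract γ) (m j : ℕ) : bNorm (γ - 2 * (m : ℝ)) j ≠ 0 := by
  rw [bNorm_eq, Finset.prod_ne_zero_iff]
  intro l hl
  have h := sq_shift_ne ha (i := (m : ℤ) - j) (j := (m : ℤ) - l) (by
    have := Finset.mem_range.1 hl; omega)
  rw [sub_ne_zero]
  intro h2
  apply h
  push_cast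
  linarith

theorem normB_even (hγ : 0 ≤ γ) (ha : 0 < fract γ) {U : Pt n → ℝ} {f g : ES n} {r j : ℕ}
    (h : IsRep γ U f ((Y ^ r) g)) (hr : r ≤ j) {l : List ℝ}
    (h1 : chainPoly (-γ) j ∣ rootPoly l)
    (h2 : chainPoly (δ[γ] + 2 * r) (j - r) ∣ rootPoly l)
    (h0 : ∀ κ ∈ l, κ ≠ (-γ + 2 * (j : ℝ)) ^ 2) (x) :
    normB γ (2 * (j : ℝ)) l U x = wC Y Q Lap (-γ) j f (x, 0) / bNorm (-γ) j := by
  obtain ⟨q, hq⟩ := h1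
  have hp : IsRep γ (powY n (2 * (j : ℝ))) ((Y ^ j) one) ((Y ^ r) 0) := by
    simpa using isRep_powY_even (n := n) (γ := γ) j
  have hne := eval_rootPoly_ne_zero h0
  rw [hq, Polynomial.eval_mul] at hne
  rw [normB, preB_even hγ ha h hr q hq h2, preB_even hγ ha hp hr q hq h2,
    wC_Y_pow _ commute_Lap_Y, one_app, mul_one, mul_div_mul_left _ _ (right_ne_zero_of_mul hne)]

theorem normB_frac (hγ : 0 ≤ γ) {U : Pt n → ℝ} {f g : ES n} {r j : ℕ}
    (h : IsRep γ U ((Y ^ r) f) g) (hr : r ≤ j + 1) {l : List ℝ}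
    (h1 : chainPoly δ[γ] j ∣ rootPoly l)
    (h2 : chainPoly (-γ + 2 * r) (j + 1 - r) ∣ rootPoly l)
    (h0 : ∀ κ ∈ l, κ ≠ (δ[γ] + 2 * (j : ℝ)) ^ 2) (x) :
    normB γ (2 * (j : ℝ) + 2 * fract γ) l U x
      = wC Y Q Lap δ[γ] j g (x, 0) / bNorm δ[γ] j := by
  obtain ⟨q, hq⟩ := h1
  have hp : IsRep γ (powY n (2 * (j : ℝ) + 2 * fract γ)) ((Y ^ r) 0) ((Y ^ j) one) := by
    simpa using isRep_powY_frac (n := n) (γ := γ) j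
  have hne := eval_rootPoly_ne_zero h0
  rw [hq, Polynomial.eval_mul] at hne
  rw [normB, preB_frac hγ h hr q hq h2, preB_frac hγ hp hr q hq h2,
    wC_Y_pow _ commute_Lap_Y, one_app, mul_one, mul_div_mul_left _ _ (right_ne_zero_of_mul hne)]

theorem chainPoly_dvd_list {c : ℝ} {J : ℕ} {κ : ℕ → ℝ} {l : List ℕ} (hn : l.Nodup) (e : ℕ → ℕ)
    (he : ∀ i < J, e i ∈ l) (hinj : ∀ i < J, ∀ i' < J, e i = e i' → i = i')
    (hκ : ∀ i < J, (c + 2 * (i : ℝ)) ^ 2 = κ (e i)) : chainPoly c J ∣ rootPoly (l.map κ) := by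
  have h1 : rootPoly (l.map κ) = ∏ i ∈ l.toFinset, (Polynomial.X - Polynomial.C (κ i)) := by
    rw [List.prod_toFinset _ hn, rootPoly, List.map_map]; rfl
  have h2 : chainPoly c J
      = ∏ i ∈ (Finset.range J).image e, (Polynomial.X - Polynomial.C (κ i)) := by
    rw [Finset.prod_image (fun i hi i' hi' h => hinj i (by simpa using hi) i' (by simpa using hi') h),
      chainPoly]
    exact Finset.prod_congr rfl fun i hi => by rw [hκ i (Finset.mem_range.1 hi)]
  rw [h1, h2]
  refine Finset.prod_dvd_prod_of_subset _ _ _ fun i hi => ?_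
  obtain ⟨i', hi', rfl⟩ := Finset.mem_image.1 hi
  exact List.mem_toFinset.2 (he i' (Finset.mem_range.1 hi'))

theorem coe_list_eq (l : List ℕ) : (do let a ← l; pure (a : ℝ)) = l.map fun a : ℕ => (a : ℝ) := by
  induction l with
  | nil => rfl
  | cons a l ih =>
    simp only [List.map_cons, ← ih]
    rfl

theorem evenFactors_eq (γ : ℝ) (j : ℕ) : evenFactors γ j =
    ((List.range j).map fun ℓ : ℕ => (γ - 2 * (ℓ : ℝ)) ^ 2) ++
      (List.range j).map fun ℓ : ℕ => (γ + 2 * (ℓ : ℝ) - 2 * (⌊γ⌋₊ : ℝ)) ^ 2 := by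
  simp only [evenFactors, coe_list_eq, List.map_map, Function.comp_def]

theorem fracFactors_eq (γ : ℝ) (j : ℕ) : fracFactors γ j =
    ((List.range (j + 1)).map fun ℓ : ℕ => (γ - 2 * (ℓ : ℝ)) ^ 2) ++
      (List.range j).map fun ℓ : ℕ => (γ + 2 * (ℓ : ℝ) - 2 * (⌊γ⌋₊ : ℝ)) ^ 2 := by
  simp only [fracFactors, coe_list_eq, List.map_map, Function.comp_def]

theorem evenFactorsEps_eq (γ ε : ℝ) (j : ℕ) : evenFactorsEps γ ε j =
    ((γ - 2 * (j : ℝ)) ^ 2 - ε) ::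
      (((List.range j).map fun ℓ : ℕ => (γ - 2 * (ℓ : ℝ)) ^ 2) ++
        ((List.range' (⌊γ⌋₊ - j + 1) j).filter fun ℓ => ℓ ≠ j).map
          fun ℓ : ℕ => (γ - 2 * (ℓ : ℝ)) ^ 2) := by
  simp only [evenFactorsEps, coe_list_eq, List.map_map, Function.comp_def]

theorem fracFactorsEps_eq (γ ε : ℝ) (j : ℕ) : fracFactorsEps γ ε j =
    ((δ[γ] + 2 * (j : ℝ)) ^ 2 - ε) ::
      ((((List.range (j + 1)).filter fun ℓ => ℓ ≠ ⌊γ⌋₊ - j).map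
          fun ℓ : ℕ => (γ - 2 * (ℓ : ℝ)) ^ 2) ++
        (List.range' (⌊γ⌋₊ - j + 1) j).map fun ℓ : ℕ => (γ - 2 * (ℓ : ℝ)) ^ 2) := by
  simp only [fracFactorsEps, coe_list_eq, List.map_map, Function.comp_def]

theorem opLplus_eq (γ : ℝ) (u : Pt n → ℝ) : opLplus γ u =
    (List.range (⌊γ⌋₊ + 1)).foldr (fun (j : ℕ) v => opD ((n : ℝ) / 2 + γ - 2 * (j : ℝ)) v) u := by
  simp only [opLplus, coe_list_eq, List.foldr_map]

theorem bEvenLow_eq (hγ : 0 ≤ γ) (ha : 0 < fract γ) {U : Pt n → ℝ} {f g : ES n}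
    (h : IsRep γ U f g) {j : ℕ} (hj : 2 * j < 1 + ⌊γ⌋₊) (x) :
    bEvenLow γ j U x = wC Y Q Lap (-γ) j f (x, 0) / bNorm (-γ) j := by
  have h1 : chainPoly (-γ) j ∣ rootPoly ((List.range j).map fun ℓ : ℕ => (γ - 2 * (ℓ : ℝ)) ^ 2) :=
    chainPoly_dvd_list List.nodup_range id (by simp) (by simp) (fun i _ => by simp; ring)
  have h2 : chainPoly δ[γ] j ∣
      rootPoly ((List.range j).map fun ℓ : ℕ => (γ + 2 * (ℓ : ℝ) - 2 * (⌊γ⌋₊ : ℝ)) ^ 2) :=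
    chainPoly_dvd_list List.nodup_range id (by simp) (by simp) (fun i _ => by simp; ring)
  refine normB_even (r := 0) hγ ha (by simpa using h) (Nat.zero_le _) ?_ ?_ ?_ x
  · rw [evenFactors_eq, rootPoly_append]; exact h1.mul_right _
  · rw [evenFactors_eq, rootPoly_append]; simpa using h2.mul_left _
  · intro κ hκ
    simp only [evenFactors_eq, List.mem_append, List.mem_map, List.mem_range] at hκ
    rcases hκ with ⟨ℓ, hℓ, rfl⟩ | ⟨ℓ, hℓ, rfl⟩
    · have := sq_shift_ne ha (i := ℓ) (j := j) (by omega)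
      push_cast at this
      intro h3; apply this; rw [h3]; ring
    · have := sq_shift_ne ha (i := (⌊γ⌋₊ : ℤ) - ℓ) (j := j) (by omega)
      push_cast at this
      intro h3; apply this
      rw [← neg_sq (γ - 2 * (j : ℝ)), show -(γ - 2 * (j : ℝ)) = -γ + 2 * j by ring, ← h3]; ring

theorem bFracLow_eq (hγ : 0 ≤ γ) (ha : 0 < fract γ) {U : Pt n → ℝ} {f g : ES n}
    (h : IsRep γ U f g) {j : ℕ} (hj : 2 * j < ⌊γ⌋₊) (x) :
    bFracLow γ j U x
      = wC Y Q Lap δ[γ] j g (x, 0) / bNorm δ[γ] j := by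
  have h1 : chainPoly (-γ) (j + 1) ∣
      rootPoly ((List.range (j + 1)).map fun ℓ : ℕ => (γ - 2 * (ℓ : ℝ)) ^ 2) :=
    chainPoly_dvd_list List.nodup_range id (by simp) (by simp) (fun i _ => by simp; ring)
  have h2 : chainPoly δ[γ] j ∣
      rootPoly ((List.range j).map fun ℓ : ℕ => (γ + 2 * (ℓ : ℝ) - 2 * (⌊γ⌋₊ : ℝ)) ^ 2) :=
    chainPoly_dvd_list List.nodup_range id (by simp) (by simp) (fun i _ => by simp; ring)
  refine normB_frac (r := 0) hγ (by simpa using h) (Nat.zero_le _) ?_ ?_ ?_ x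
  · rw [fracFactors_eq, rootPoly_append]; exact h2.mul_left _
  · rw [fracFactors_eq, rootPoly_append]; simpa using h1.mul_right _
  · intro κ hκ
    simp only [fracFactors_eq, List.mem_append, List.mem_map, List.mem_range] at hκ
    rcases hκ with ⟨ℓ, hℓ, rfl⟩ | ⟨ℓ, hℓ, rfl⟩
    · have := sq_shift_ne ha (i := ℓ) (j := (⌊γ⌋₊ : ℤ) - j) (by omega)
      push_cast at this
      intro h3; apply this; rw [h3]; ring
    · have := sq_shift_ne ha (i := (⌊γ⌋₊ : ℤ) - ℓ) (j := (⌊γ⌋₊ : ℤ) - j) (by omega)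
      push_cast at this
      intro h3; apply this
      linear_combination h3

theorem sub_r0 (G : ES n) (x y) : G (x, y) - G (x, 0) = y ^ 2 * S G (x, y) :=
  (hadamard_identity G x y).symm

theorem jetMinus_rep (hγ : 0 ≤ γ) (ha : 0 < fract γ) {U : Pt n → ℝ} {f g : ES n}
    (h : IsRep γ U f g) (r : ℕ) (hr : 2 * r < ⌊γ⌋₊) :
    ∃ G, IsRep γ (U - jetMinus γ r U) f ((Y ^ (r + 1)) G) := by
  induction r with
  | zero =>
    refine ⟨S g, fun p hp => ?_⟩
    have h1 := bFracLow_eq hγ ha h hr p.1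
    have h2 := sub_r0 g p.1 p.2
    simp only [wC, bNorm, chainPoly, Finset.range_zero, Finset.prod_empty, Polynomial.eval_one,
      div_one, Module.End.one_apply] at h1
    simp only [Pi.sub_apply, jetMinus, h1, h p hp, Y_pow_app]
    linear_combination p.2 ^ (2 * fract γ) * h2
  | succ r ih =>
    obtain ⟨G, hG⟩ := ih (by omega)
    refine ⟨S G, fun p hp => ?_⟩
    have hy : 0 < p.2 := hp
    have h1 := bFracLow_eq hγ ha hG hr p.1
    rw [wC_Y_pow _ commute_Lap_Y, mul_div_cancel_left₀ _ (bNorm_pos_ne_zero ha _ _)] at h1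
    have h2 := sub_r0 G p.1 p.2
    have h3 := hG p hp
    have h4 : p.2 ^ (2 * ((r : ℝ) + 1) + 2 * fract γ)
        = p.2 ^ (2 * fract γ) * p.2 ^ (2 * (r + 1)) := by
      rw [rpow_mul_sq_pow hy]; push_cast; ring_nf
    simp only [Pi.sub_apply, jetMinus, h1, h4] at h3 ⊢
    rw [Y_pow_app] at h3 ⊢
    linear_combination h3 + p.2 ^ (2 * fract γ) * p.2 ^ (2 * (r + 1)) * h2

theorem jetPlus_rep (hγ : 0 ≤ γ) (ha : 0 < fract γ) {U : Pt n → ℝ} {f g : ES n}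
    (h : IsRep γ U f g) (r : ℕ) (hr : 2 * r < 1 + ⌊γ⌋₊) :
    ∃ F, IsRep γ (U - jetPlus γ r U) ((Y ^ (r + 1)) F) g := by
  induction r with
  | zero =>
    refine ⟨S f, fun p hp => ?_⟩
    have h1 := bEvenLow_eq hγ ha h hr p.1
    have h2 := sub_r0 f p.1 p.2
    simp only [wC, bNorm, chainPoly, Finset.range_zero, Finset.prod_empty, Polynomial.eval_one,
      div_one, Module.End.one_apply] at h1
    simp only [Pi.sub_apply, jetPlus, h1, h p hp, Y_pow_app]
    linear_combination h2
  | succ r ih =>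
    obtain ⟨F, hF⟩ := ih (by omega)
    refine ⟨S F, fun p hp => ?_⟩
    have hy : 0 < p.2 := hp
    have h1 := bEvenLow_eq hγ ha hF hr p.1
    rw [wC_Y_pow _ commute_Lap_Y, mul_div_cancel_left₀ _ (bNorm_neg_ne_zero ha _)] at h1
    have h2 := sub_r0 F p.1 p.2
    have h3 := hF p hp
    have h4 : p.2 ^ (2 * ((r : ℝ) + 1)) = p.2 ^ (2 * (r + 1)) := by
      rw [← rpow_natCast]; push_cast; rfl
    simp only [Pi.sub_apply, jetPlus, h1, h4] at h3 ⊢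
    rw [Y_pow_app] at h3 ⊢
    linear_combination h3 + p.2 ^ (2 * (r + 1)) * h2

theorem limUnder_of_eventually_const {φ : ℝ → ℝ} {c : ℝ} (h : ∀ᶠ ε in 𝓝[≠] (0 : ℝ), φ ε = c) :
    limUnder (𝓝[≠] (0 : ℝ)) φ = c :=
  Tendsto.limUnder_eq (tendsto_const_nhds.congr' (h.mono fun _ h => h.symm))

theorem bEven_eq (hγ : 0 ≤ γ) (ha : 0 < fract γ) {U : Pt n → ℝ} {f g : ES n}
    (h : IsRep γ U f g) {j : ℕ} (hj : j ≤ ⌊γ⌋₊) (x) :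
    bEven γ j U x = wC Y Q Lap (-γ) j f (x, 0) / bNorm (-γ) j := by
  rw [bEven]
  split_ifs with hlt
  · exact bEvenLow_eq hγ ha h hlt x
  obtain ⟨G, hG⟩ := jetMinus_rep hγ ha h (⌊γ⌋₊ - j) (by omega)
  refine limUnder_of_eventually_const ?_
  filter_upwards [self_mem_nhdsWithin] with ε hε
  have hr : ((⌊γ⌋₊ - j + 1 : ℕ) : ℝ) = (⌊γ⌋₊ : ℝ) - j + 1 := by
    push_cast [Nat.cast_sub hj]; ring
  have h1 : chainPoly (-γ) j ∣ rootPoly ((List.range j).map fun ℓ : ℕ => (γ - 2 * (ℓ : ℝ)) ^ 2) :=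
    chainPoly_dvd_list List.nodup_range id (by simp) (by simp) (fun i _ => by simp; ring)
  have h2 : chainPoly (δ[γ] + 2 * (⌊γ⌋₊ - j + 1 : ℕ)) (j - (⌊γ⌋₊ - j + 1)) ∣
      rootPoly ((List.range j).map fun ℓ : ℕ => (γ - 2 * (ℓ : ℝ)) ^ 2) := by
    refine chainPoly_dvd_list List.nodup_range (fun i => j - 1 - i) ?_ ?_ ?_
    · intro i hi; simp only [List.mem_range]; omega
    · intro i hi i' hi' he; omega
    · intro i hi
      have : ((j - 1 - i : ℕ) : ℝ) = (j : ℝ) - 1 - i := by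
        rw [Nat.cast_sub (by omega), Nat.cast_sub (by omega)]; simp
      simp only [this, hr]; ring
  refine normB_even hγ ha hG (by omega) ?_ ?_ ?_ x
  · rw [evenFactorsEps_eq, rootPoly_cons, rootPoly_append]; exact (h1.mul_right _).mul_left _
  · rw [evenFactorsEps_eq, rootPoly_cons, rootPoly_append]; exact (h2.mul_right _).mul_left _
  · intro κ hκ
    simp only [evenFactorsEps_eq, List.mem_cons, List.mem_append, List.mem_map, List.mem_range,
      List.mem_filter] at hκ
    have key : ∀ ℓ : ℕ, ℓ ≠ j → (γ - 2 * (ℓ : ℝ)) ^ 2 ≠ (-γ + 2 * (j : ℝ)) ^ 2 := fun ℓ hℓ => by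
      have := sq_shift_ne ha (i := ℓ) (j := j) (by omega)
      push_cast at this
      intro h3; apply this; rw [h3]; ring
    rcases hκ with rfl | ⟨ℓ, hℓ, rfl⟩ | ⟨ℓ, ⟨-, hℓ⟩, rfl⟩
    · intro h3
      exact hε (show ε = 0 by linear_combination -h3)
    · exact key ℓ (by omega)
    · exact key ℓ (by simpa using hℓ)

theorem bFrac_eq (hγ : 0 ≤ γ) (ha : 0 < fract γ) {U : Pt n → ℝ} {f g : ES n}
    (h : IsRep γ U f g) {j : ℕ} (hj : j ≤ ⌊γ⌋₊) (x) :
    bFrac γ j U x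
      = wC Y Q Lap δ[γ] j g (x, 0) / bNorm δ[γ] j := by
  rw [bFrac]
  split_ifs with hlt
  · exact bFracLow_eq hγ ha h hlt x
  obtain ⟨F, hF⟩ := jetPlus_rep hγ ha h (⌊γ⌋₊ - j) (by omega)
  refine limUnder_of_eventually_const ?_
  filter_upwards [self_mem_nhdsWithin] with ε hε
  have hr : ((⌊γ⌋₊ - j + 1 : ℕ) : ℝ) = (⌊γ⌋₊ : ℝ) - j + 1 := by
    push_cast [Nat.cast_sub hj]; ring
  have h1 : chainPoly δ[γ] j ∣
      rootPoly ((List.range' (⌊γ⌋₊ - j + 1) j).map fun ℓ : ℕ => (γ - 2 * (ℓ : ℝ)) ^ 2) := by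
    refine chainPoly_dvd_list List.nodup_range' (fun i => ⌊γ⌋₊ - i) ?_ ?_ ?_
    · intro i hi; simp only [List.mem_range'_1]; omega
    · intro i hi i' hi' he; omega
    · intro i hi
      simp only [Nat.cast_sub (by omega : i ≤ ⌊γ⌋₊)]; ring
  have h2 : chainPoly (-γ + 2 * (⌊γ⌋₊ - j + 1 : ℕ)) (j + 1 - (⌊γ⌋₊ - j + 1)) ∣
      rootPoly ((List.range' (⌊γ⌋₊ - j + 1) j).map fun ℓ : ℕ => (γ - 2 * (ℓ : ℝ)) ^ 2) := by
    refine chainPoly_dvd_list List.nodup_range' (fun i => ⌊γ⌋₊ - j + 1 + i) ?_ ?_ ?_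
    · intro i hi; simp only [List.mem_range'_1]; omega
    · intro i hi i' hi' he; omega
    · intro i hi
      rw [hr]; simp only [Nat.cast_add, Nat.cast_sub hj]; push_cast; ring
  refine normB_frac hγ hF (by omega) ?_ ?_ ?_ x
  · rw [fracFactorsEps_eq, rootPoly_cons, rootPoly_append]; exact (h1.mul_left _).mul_left _
  · rw [fracFactorsEps_eq, rootPoly_cons, rootPoly_append]; exact (h2.mul_left _).mul_left _
  · intro κ hκ
    simp only [fracFactorsEps_eq, List.mem_cons, List.mem_append, List.mem_map, List.mem_range,
      List.mem_filter, List.mem_range'_1] at hκ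
    have key : ∀ ℓ : ℕ, ℓ ≠ ⌊γ⌋₊ - j →
        (γ - 2 * (ℓ : ℝ)) ^ 2 ≠ (δ[γ] + 2 * (j : ℝ)) ^ 2 := fun ℓ hℓ => by
      have := sq_shift_ne ha (i := ℓ) (j := (⌊γ⌋₊ : ℤ) - j) (by omega)
      push_cast at this
      intro h3; apply this; rw [h3]; ring
    rcases hκ with rfl | ⟨ℓ, ⟨-, hℓ⟩, rfl⟩ | ⟨ℓ, hℓ, rfl⟩
    · intro h3
      exact hε (show ε = 0 by linear_combination -h3)
    · exact key ℓ (by simpa using hℓ)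
    · exact key ℓ (by omega)

theorem opL_eq (hγ : 0 ≤ γ) {U : Pt n → ℝ} {f g : ES n} (h : IsRep γ U f g) :
    ∀ p ∈ upper n, opL γ U p = (-1) ^ (⌊γ⌋₊ + 1) * (wC Y Q Lap (-γ) (⌊γ⌋₊ + 1) f p +
      p.2 ^ (2 * fract γ) * wC Y Q Lap δ[γ] (⌊γ⌋₊ + 1) g p) := by
  have key : ∀ l : List ℕ, ∀ p ∈ upper n,
      l.foldr (fun (j : ℕ) v => opD ((n : ℝ) / 2 + γ - 2 * (j : ℝ)) v) (mulPow ((n : ℝ) / 2 - γ) U) p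
      = p.2 ^ ((n : ℝ) / 2 + -γ) * ((-1 : ℝ) ^ l.length • aeval (tX (-γ))
          (rootPoly (l.map fun ℓ : ℕ => (γ - 2 * (ℓ : ℝ)) ^ 2)) f) p +
        p.2 ^ ((n : ℝ) / 2 + δ[γ]) * ((-1 : ℝ) ^ l.length •
          aeval (tX δ[γ])
          (rootPoly (l.map fun ℓ : ℕ => (γ - 2 * (ℓ : ℝ)) ^ 2)) g) p := by
    intro l
    induction l with
    | nil => simpa [rootPoly] using h.mulPow hγ
    | cons j l ih =>
      intro p hp
      have h1 := hypLaplacian_pair ih p hp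
      have h0 := ih p hp
      simp only [List.map_cons, List.length_cons, smul_app]
      rw [aeval_rootPoly_cons, aeval_rootPoly_cons]
      simp only [map_smul, smul_app] at h1 h0
      rw [List.foldr_cons, opD]
      rw [pow_succ]
      linear_combination -h1 + (γ - 2 * (j : ℝ)) ^ 2 * h0
  intro p hp
  have hy : 0 < p.2 := hp
  have hl1 : rootPoly ((List.range (⌊γ⌋₊ + 1)).map fun ℓ : ℕ => (γ - 2 * (ℓ : ℝ)) ^ 2)
      = chainPoly (-γ) (⌊γ⌋₊ + 1) := by
    rw [chainPoly, rootPoly, List.map_map, ← List.prod_toFinset _ List.nodup_range,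
      List.toFinset_range]
    refine Finset.prod_congr rfl fun i _ => ?_
    simp only [Function.comp]; congr 2; ring
  have hl2 : rootPoly ((List.range (⌊γ⌋₊ + 1)).map fun ℓ : ℕ => (γ - 2 * (ℓ : ℝ)) ^ 2)
      = chainPoly δ[γ] (⌊γ⌋₊ + 1) := by
    rw [chainPoly, rootPoly, List.map_map, ← List.prod_toFinset _ List.nodup_range,
      List.toFinset_range, ← Finset.prod_range_reflect]
    refine Finset.prod_congr rfl fun i hi => ?_
    have hi := Finset.mem_range.1 hi
    have : ((⌊γ⌋₊ + 1 - 1 - i : ℕ) : ℝ) = (⌊γ⌋₊ : ℝ) - i := by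
      rw [Nat.add_sub_cancel, Nat.cast_sub (by omega)]
    simp only [Function.comp, this]; congr 2; ring
  have h1 := key (List.range (⌊γ⌋₊ + 1)) p hp
  conv at h1 => rhs; arg 1; rw [hl1, aeval_chain commute_Lap_Y]
  conv at h1 => rhs; arg 2; rw [hl2, aeval_chain commute_Lap_Y]
  rw [opL, mulPow, opLplus_eq, h1]
  simp only [List.length_range, smul_app, Y_pow_app]
  have e1 : p.2 ^ (-(n : ℝ) / 2 + γ - 2 * ((⌊γ⌋₊ : ℝ) + 1)) * p.2 ^ ((n : ℝ) / 2 + -γ)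
      * p.2 ^ (2 * (⌊γ⌋₊ + 1)) = 1 := by
    rw [← rpow_add hy, rpow_mul_sq_pow hy]
    convert rpow_zero p.2 using 2
    push_cast; ring
  have e2 : p.2 ^ (-(n : ℝ) / 2 + γ - 2 * ((⌊γ⌋₊ : ℝ) + 1))
      * p.2 ^ ((n : ℝ) / 2 + δ[γ])
      * p.2 ^ (2 * (⌊γ⌋₊ + 1)) = p.2 ^ (2 * fract γ) := by
    rw [← rpow_add hy, rpow_mul_sq_pow hy, two_mul_fract hγ]; congr 1; push_cast; ring
  linear_combination (-1) ^ (⌊γ⌋₊ + 1) * wC Y Q Lap (-γ) (⌊γ⌋₊ + 1) f p * e1 +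
    (-1) ^ (⌊γ⌋₊ + 1) * wC Y Q Lap δ[γ] (⌊γ⌋₊ + 1) g p * e2

end

section
open Set Real

/-- `2 z^{μ/2} K_μ(2√z)`, through its integral representation. -/
def besselJ (μ z : ℝ) : ℝ := ∫ s in Ioi (0 : ℝ), s ^ (μ - 1) * exp (-s - z / s)

theorem besselJ_integrand_le {z₀ z s : ℝ} (hz₀ : 0 < z₀) (hz : z₀ ≤ z) (hs : 0 < s) (μ : ℝ) (N : ℕ) :
    s ^ (μ - 1) * exp (-s - z / s) ≤
      N.factorial * z₀⁻¹ ^ N * (exp (-s) * s ^ (μ + N - 1)) := by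
  have h1 : exp (-(z / s)) ≤ N.factorial * z₀⁻¹ ^ N * s ^ N := by
    have h2 := Real.pow_div_factorial_le_exp (z₀ / s) (by positivity) N
    have h3 : exp (z₀ / s) ≤ exp (z / s) := exp_le_exp.2 (by gcongr)
    rw [exp_neg]
    calc (exp (z / s))⁻¹ ≤ ((z₀ / s) ^ N / N.factorial)⁻¹ :=
          inv_anti₀ (by positivity) (h2.trans h3)
      _ = _ := by rw [div_pow, inv_div, inv_pow]; field_simp
  have h4 : s ^ (μ + N - 1) = s ^ (μ - 1) * s ^ N := by
    rw [← rpow_natCast, ← rpow_add hs]; congr 1; ring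
  rw [sub_eq_add_neg (-s), exp_add, h4]
  calc s ^ (μ - 1) * (exp (-s) * exp (-(z / s)))
      ≤ s ^ (μ - 1) * (exp (-s) * (N.factorial * z₀⁻¹ ^ N * s ^ N)) := by gcongr
    _ = _ := by ring

theorem exists_nat_add_pos (μ : ℝ) : ∃ N : ℕ, 0 < μ + N := by
  obtain ⟨N, hN⟩ := exists_nat_gt (-μ)
  exact ⟨N, by linarith⟩

theorem besselJ_aesm (μ z : ℝ) :
    AEStronglyMeasurable (fun s : ℝ => s ^ (μ - 1) * exp (-s - z / s))
      (volume.restrict (Ioi 0)) := by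
  refine ContinuousOn.aestronglyMeasurable (fun s hs => ?_) measurableSet_Ioi
  have hs' : s ≠ 0 := (show (0 : ℝ) < s from hs).ne'
  exact ((continuousAt_rpow_const _ _ (Or.inl hs')).mul
    (by fun_prop (disch := exact hs'))).continuousWithinAt

theorem besselJ_integrable {z : ℝ} (hz : 0 < z) (μ : ℝ) :
    IntegrableOn (fun s : ℝ => s ^ (μ - 1) * exp (-s - z / s)) (Ioi 0) := by
  obtain ⟨N, hN⟩ := exists_nat_add_pos μ
  refine ((GammaIntegral_convergent hN).const_mul (N.factorial * z⁻¹ ^ N)).mono'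
    (besselJ_aesm μ z) ?_
  filter_upwards [ae_restrict_mem measurableSet_Ioi] with s hs
  have hs : 0 < s := hs
  rw [Real.norm_of_nonneg (by positivity)]
  exact besselJ_integrand_le hz le_rfl hs μ N

theorem besselJ_le {z : ℝ} (hz : 0 < z) {μ : ℝ} {N : ℕ} (hN : 0 < μ + N) :
    besselJ μ z ≤ N.factorial * z⁻¹ ^ N * Gamma (μ + N) := by
  rw [Real.Gamma_eq_integral hN, ← integral_const_mul]
  refine setIntegral_mono_on (besselJ_integrable hz μ)
    ((GammaIntegral_convergent hN).const_mul _) measurableSet_Ioi fun s hs =>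
      besselJ_integrand_le hz le_rfl hs μ N

theorem besselJ_pos {z : ℝ} (hz : 0 < z) (μ : ℝ) : 0 < besselJ μ z := by
  rw [besselJ, setIntegral_pos_iff_support_of_nonneg_ae ?_ (besselJ_integrable hz μ)]
  · have : Function.support (fun s : ℝ => s ^ (μ - 1) * exp (-s - z / s)) ∩ Ioi 0 = Ioi 0 := by
      refine inter_eq_right.2 fun s hs => ?_
      have hs : 0 < s := hs
      exact (by positivity : 0 < s ^ (μ - 1) * exp (-s - z / s)).ne'
    rw [this]; simp
  · filter_upwards [ae_restrict_mem measurableSet_Ioi] with s hs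
    have hs : 0 < s := hs
    simp only [Pi.zero_apply]; positivity

theorem hasDerivAt_besselJ {z : ℝ} (hz : 0 < z) (μ : ℝ) :
    HasDerivAt (besselJ μ) (-besselJ (μ - 1) z) z := by
  obtain ⟨N, hN⟩ := exists_nat_add_pos (μ - 1)
  have hz2 : 0 < z / 2 := by positivity
  have h := hasDerivAt_integral_of_dominated_loc_of_deriv_le (𝕜 := ℝ)
    (μ := volume.restrict (Ioi (0 : ℝ)))
    (F := fun z s : ℝ => s ^ (μ - 1) * exp (-s - z / s))
    (F' := fun z s : ℝ => -(s ^ (μ - 1 - 1) * exp (-s - z / s)))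
    (x₀ := z) (s := Ioi (z / 2))
    (bound := fun s => N.factorial * (z / 2)⁻¹ ^ N * (exp (-s) * s ^ (μ - 1 + N - 1)))
    (Ioi_mem_nhds (by linarith)) (Eventually.of_forall fun z => besselJ_aesm μ z)
    (besselJ_integrable hz μ) (besselJ_aesm (μ - 1) z).neg ?_
    ((GammaIntegral_convergent hN).const_mul _) ?_
  · rw [besselJ, ← integral_neg]
    exact h.2
  · filter_upwards [ae_restrict_mem measurableSet_Ioi] with s hs w hw
    have hs : 0 < s := hs
    rw [norm_neg, Real.norm_of_nonneg (by positivity)]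
    exact besselJ_integrand_le hz2 (le_of_lt hw) hs (μ - 1) N
  · filter_upwards [ae_restrict_mem measurableSet_Ioi] with s hs w _
    have hs : 0 < s := hs
    have h1 : HasDerivAt (fun w : ℝ => -s - w / s) (-(1 / s)) w := by
      simpa using ((hasDerivAt_id w).div_const s).const_sub (-s)
    refine (h1.exp.const_mul (s ^ (μ - 1))).congr_deriv ?_
    rw [rpow_sub_one hs.ne' (μ - 1)]
    field_simp

theorem besselJ_neg {z : ℝ} (hz : 0 < z) (μ : ℝ) : besselJ (-μ) z = z ^ (-μ) * besselJ μ z := by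
  have h1 := integral_comp_mul_left_Ioi
    (fun s : ℝ => s ^ (-μ - 1) * exp (-s - z / s)) 0 hz
  have h2 := integral_comp_rpow_Ioi
    (fun t : ℝ => t ^ (-μ - 1) * exp (-(z * t) - 1 / t)) (p := -1) (by norm_num)
  rw [mul_zero] at h1
  have h3 : besselJ (-μ) z = z * ∫ x in Ioi (0 : ℝ),
      (z * x) ^ (-μ - 1) * exp (-(z * x) - z / (z * x)) := by
    rw [h1, smul_eq_mul, ← mul_assoc, mul_inv_cancel₀ hz.ne', one_mul, besselJ]
  have h4 : (∫ x in Ioi (0 : ℝ), (z * x) ^ (-μ - 1) * exp (-(z * x) - z / (z * x)))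
      = z ^ (-μ - 1) * ∫ x in Ioi (0 : ℝ), x ^ (-μ - 1) * exp (-(z * x) - 1 / x) := by
    rw [← integral_const_mul]
    refine integral_Ioi_ext fun x hx => ?_
    rw [mul_rpow hz.le hx.le, mul_assoc]
    congr 4
    field_simp
  have h5 : besselJ μ z = ∫ x in Ioi (0 : ℝ), x ^ (-μ - 1) * exp (-(z * x) - 1 / x) := by
    rw [← h2, besselJ]
    refine integral_Ioi_ext fun x hx => ?_
    simp only [abs_neg, abs_one, one_mul, smul_eq_mul]
    rw [← rpow_mul hx.le, ← mul_assoc, ← rpow_add hx, rpow_neg_one]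
    congr 1
    · congr 1; ring
    · congr 1; field_simp; ring
  rw [h3, h4, ← h5, rpow_sub_one hz.ne']
  field_simp

theorem tendsto_besselJ_zero {μ : ℝ} (hμ : 0 < μ) :
    Tendsto (besselJ μ) (𝓝[>] 0) (𝓝 (Gamma μ)) := by
  rw [Real.Gamma_eq_integral hμ]
  refine tendsto_integral_filter_of_dominated_convergence (fun s => exp (-s) * s ^ (μ - 1))
    (Eventually.of_forall fun z => besselJ_aesm μ z) ?_ (GammaIntegral_convergent hμ) ?_
  · filter_upwards [self_mem_nhdsWithin] with z hz
    filter_upwards [ae_restrict_mem measurableSet_Ioi] with s hs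
    have hs : 0 < s := hs
    rw [Real.norm_of_nonneg (by positivity)]
    simpa using besselJ_integrand_le hz le_rfl hs μ 0
  · filter_upwards [ae_restrict_mem measurableSet_Ioi] with s hs
    have hs : 0 < s := hs
    have h : Continuous fun z : ℝ => s ^ (μ - 1) * exp (-s - z / s) := by fun_prop
    have := (h.tendsto 0).mono_left (nhdsWithin_le_nhds (s := Ioi (0 : ℝ)))
    simpa [mul_comm] using this

theorem tendsto_besselJ_atTop (μ α : ℝ) :
    Tendsto (fun z => z ^ α * besselJ μ z) atTop (𝓝 0) := by
  obtain ⟨N, hN⟩ := exists_nat_gt (max (-μ) (α + 1))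
  have hN1 : 0 < μ + N := by have := (le_max_left _ _).trans_lt hN; linarith
  have hN2 : α + 1 < N := (le_max_right _ _).trans_lt hN
  have h0 : Tendsto (fun z : ℝ => (N.factorial * Gamma (μ + N)) * z ^ (-(N - α))) atTop (𝓝 0) := by
    simpa using (tendsto_rpow_neg_atTop (by linarith : 0 < (N : ℝ) - α)).const_mul
      (N.factorial * Gamma (μ + N))
  refine squeeze_zero' ?_ ?_ h0
  · filter_upwards [eventually_gt_atTop 0] with z hz
    exact mul_nonneg (by positivity) (besselJ_pos hz μ).le
  · filter_upwards [eventually_gt_atTop 0] with z hz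
    calc z ^ α * besselJ μ z ≤ z ^ α * (N.factorial * z⁻¹ ^ N * Gamma (μ + N)) := by
          gcongr; exact besselJ_le hz hN1
      _ = _ := by
          rw [neg_sub, rpow_sub hz, rpow_natCast, inv_pow]; field_simp

/-- The coefficients of the series `∑ zⁱ / (i! (b)_i)`. -/
def besselCoeff (b : ℝ) (i : ℕ) : ℝ := (i.factorial * ∏ l ∈ Finset.range i, (b + l))⁻¹

/-- The entire function `∑ zⁱ / (i! (b)_i)`. -/
def besselF (b z : ℝ) : ℝ := ∑' i, besselCoeff b i * z ^ i

/-- `b` is not an integer. -/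
def NonInt (b : ℝ) : Prop := ∀ z : ℤ, b ≠ z

theorem NonInt.add_int {b : ℝ} (hb : NonInt b) (z : ℤ) : NonInt (b + z) := fun w h =>
  hb (w - z) (by push_cast; linarith)

theorem NonInt.sub_int {b : ℝ} (hb : NonInt b) (z : ℤ) : NonInt (b - z) := fun w h =>
  hb (w + z) (by push_cast; linarith)

theorem NonInt.add_one {b : ℝ} (hb : NonInt b) : NonInt (b + 1) := by
  simpa using hb.add_int 1

theorem NonInt.sub_one {b : ℝ} (hb : NonInt b) : NonInt (b - 1) := by
  simpa using hb.sub_int 1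

theorem NonInt.neg {b : ℝ} (hb : NonInt b) : NonInt (-b) := fun w h =>
  hb (-w) (by push_cast; linarith)

theorem NonInt.one_sub {b : ℝ} (hb : NonInt b) : NonInt (1 - b) := by
  have := hb.neg.add_one
  rwa [neg_add_eq_sub] at this

theorem NonInt.one_add {b : ℝ} (hb : NonInt b) : NonInt (1 + b) := by
  rw [add_comm]; exact hb.add_one

theorem NonInt.ne_zero {b : ℝ} (hb : NonInt b) : b ≠ 0 := by simpa using hb 0

theorem NonInt.add_nat_ne {b : ℝ} (hb : NonInt b) (l : ℕ) : b + l ≠ 0 := by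
  have := (hb.add_int l).ne_zero
  simpa using this

theorem besselCoeff_ne_zero {b : ℝ} (hb : NonInt b) (i : ℕ) : besselCoeff b i ≠ 0 :=
  inv_ne_zero (mul_ne_zero (by positivity) (Finset.prod_ne_zero_iff.2 fun l _ => hb.add_nat_ne l))

theorem besselCoeff_succ {b : ℝ} (hb : NonInt b) (i : ℕ) :
    (i + 1 : ℝ) * besselCoeff b (i + 1) = besselCoeff (b + 1) i / b := by
  have h0 := hb.ne_zero
  have h1 : ∏ l ∈ Finset.range i, (b + 1 + (l : ℝ)) ≠ 0 :=
    Finset.prod_ne_zero_iff.2 fun l _ => hb.add_one.add_nat_ne l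
  rw [besselCoeff, besselCoeff, Finset.prod_range_succ', Nat.factorial_succ]
  have h2 : ∏ k ∈ Finset.range i, (b + ((k + 1 : ℕ) : ℝ)) = ∏ l ∈ Finset.range i, (b + 1 + (l : ℝ)) :=
    Finset.prod_congr rfl fun l _ => by push_cast; ring
  rw [h2]
  have h3 : (i.factorial : ℝ) ≠ 0 := by positivity
  have h4 : (i + 1 : ℝ) ≠ 0 := by positivity
  push_cast
  rw [mul_inv, mul_inv, mul_inv, mul_inv, div_eq_mul_inv, add_zero]
  field_simp

theorem besselCoeff_pred {b : ℝ} (hb : NonInt b) (i : ℕ) :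
    (b - 1 + i) * besselCoeff b i = (b - 1) * besselCoeff (b - 1) i := by
  have h1 : ∀ i : ℕ, ∏ l ∈ Finset.range i, (b + (l : ℝ)) ≠ 0 := fun i =>
    Finset.prod_ne_zero_iff.2 fun l _ => hb.add_nat_ne l
  have h2 : ∀ i : ℕ, ∏ l ∈ Finset.range i, (b - 1 + (l : ℝ)) ≠ 0 := fun i =>
    Finset.prod_ne_zero_iff.2 fun l _ => hb.sub_one.add_nat_ne l
  have h3 : (∏ l ∈ Finset.range i, (b - 1 + (l : ℝ))) * (b - 1 + i)
      = (∏ l ∈ Finset.range i, (b + (l : ℝ))) * (b - 1) := by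
    rw [← Finset.prod_range_succ, Finset.prod_range_succ']
    congr 1
    · exact Finset.prod_congr rfl fun l _ => by push_cast; ring
    · simp
  have h4 : (i.factorial : ℝ) ≠ 0 := by positivity
  have := h1 i
  have := h2 i
  rw [besselCoeff, besselCoeff]
  field_simp
  linear_combination h3

theorem summable_besselCoeff {b : ℝ} (hb : NonInt b) (z : ℝ) :
    Summable fun i => |besselCoeff b i| * |z| ^ i := by
  rcases eq_or_ne z 0 with rfl | hz
  · exact summable_of_ne_finset_zero (s := {0}) fun i hi => by
      have : i ≠ 0 := by simpa using hi
      simp [this]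
  refine summable_of_ratio_test_tendsto_lt_one (l := 0) one_pos
    (Eventually.of_forall fun i => by
      have := besselCoeff_ne_zero hb i
      positivity) ?_
  have h1 : ∀ i : ℕ, besselCoeff b (i + 1) = besselCoeff b i / ((i + 1) * (b + i)) := fun i => by
    rw [besselCoeff, besselCoeff, Finset.prod_range_succ, Nat.factorial_succ, div_eq_mul_inv,
      ← mul_inv]
    push_cast; congr 1; ring
  have h2 : ∀ i : ℕ, ‖|besselCoeff b (i + 1)| * |z| ^ (i + 1)‖ / ‖|besselCoeff b i| * |z| ^ i‖
      = |z| / (|(i : ℝ) + 1| * |b + i|) := fun i => by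
    have h3 := abs_pos.2 (besselCoeff_ne_zero hb i)
    have h4 := abs_pos.2 hz
    have h5 := abs_pos.2 (hb.add_nat_ne i)
    have h6 : 0 < |(i : ℝ) + 1| := abs_pos.2 (by positivity)
    rw [norm_mul, norm_mul, norm_pow, norm_pow, norm_abs_eq_norm, norm_abs_eq_norm,
      norm_abs_eq_norm, Real.norm_eq_abs, Real.norm_eq_abs, Real.norm_eq_abs, h1, abs_div, abs_mul,
      pow_succ]
    field_simp
  simp_rw [h2]
  refine Tendsto.div_atTop tendsto_const_nhds ?_
  refine Tendsto.atTop_mul_atTop₀ ?_ ?_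
  · exact tendsto_abs_atTop_atTop.comp (tendsto_natCast_atTop_atTop.atTop_add tendsto_const_nhds)
  · exact tendsto_abs_atTop_atTop.comp
      (tendsto_const_nhds.add_atTop tendsto_natCast_atTop_atTop)

theorem hasSum_besselF {b : ℝ} (hb : NonInt b) (z : ℝ) :
    HasSum (fun i => besselCoeff b i * z ^ i) (besselF b z) := by
  refine Summable.hasSum (.of_norm ?_)
  simpa [abs_mul, abs_pow] using summable_besselCoeff hb z

theorem besselF_eq_one_add {b : ℝ} (hb : NonInt b) (z : ℝ) :
    besselF b z = 1 + ∑' i, besselCoeff b (i + 1) * z ^ (i + 1) := by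
  rw [besselF, (hasSum_besselF hb z).summable.tsum_eq_zero_add]
  simp [besselCoeff]

theorem besselF_zero (b : ℝ) : besselF b 0 = 1 := by
  rw [besselF, tsum_eq_single 0 (fun i hi => by simp [hi])]
  simp [besselCoeff]

theorem hasDerivAt_besselF {b : ℝ} (hb : NonInt b) (z : ℝ) :
    HasDerivAt (besselF b) (besselF (b + 1) z / b) z := by
  have h0 : besselF b = fun z => 1 + ∑' i, besselCoeff b (i + 1) * z ^ (i + 1) :=
    funext fun z => besselF_eq_one_add hb z
  rw [h0]
  refine HasDerivAt.const_add 1 ?_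
  have h := hasDerivAt_tsum_of_isPreconnected (𝕜 := ℝ) (F := ℝ)
    (g := fun i z => besselCoeff b (i + 1) * z ^ (i + 1))
    (g' := fun i z => besselCoeff (b + 1) i / b * z ^ i)
    (u := fun i => |b|⁻¹ * (|besselCoeff (b + 1) i| * |(|z| + 1)| ^ i))
    (t := Metric.ball 0 (|z| + 1)) (y₀ := 0) (y := z)
    ((summable_besselCoeff hb.add_one _).mul_left _) Metric.isOpen_ball
    (convex_ball _ _).isPreconnected ?_ ?_ (by simp; positivity) (by simp [summable_zero])
    (by simp)
  · convert h using 1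
    rw [besselF, ← tsum_div_const]
    exact tsum_congr fun i => by ring
  · intro i w _
    refine ((hasDerivAt_pow (i + 1) w).const_mul (besselCoeff b (i + 1))).congr_deriv ?_
    rw [← besselCoeff_succ hb]; push_cast; ring
  · intro i w hw
    have hw : |w| < |z| + 1 := by simpa using hw
    rw [norm_mul, norm_div, norm_pow, Real.norm_eq_abs, Real.norm_eq_abs, Real.norm_eq_abs,
      abs_of_pos (by positivity : 0 < |z| + 1)]
    calc _ = |b|⁻¹ * (|besselCoeff (b + 1) i| * |w| ^ i) := by ring
      _ ≤ _ := by gcongr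

theorem mul_deriv_besselF {b : ℝ} (hb : NonInt b) (z : ℝ) :
    z * (besselF (b + 1) z / b) + (b - 1) * besselF b z = (b - 1) * besselF (b - 1) z := by
  have h1 : HasSum (fun i : ℕ => (i : ℝ) * besselCoeff b i * z ^ i) (z * (besselF (b + 1) z / b)) := by
    rw [← hasSum_nat_add_iff' 1]
    have := ((hasSum_besselF hb.add_one z).div_const b).mul_left z
    have e : (fun i : ℕ => ((i + 1 : ℕ) : ℝ) * besselCoeff b (i + 1) * z ^ (i + 1))
        = fun i => z * (besselCoeff (b + 1) i * z ^ i / b) := funext fun i => by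
      have := besselCoeff_succ hb i
      push_cast
      rw [this]; ring
    rw [e]
    simpa using this
  have h2 := (hasSum_besselF hb.sub_one z).mul_left (b - 1)
  have e : (fun i => (b - 1) * (besselCoeff (b - 1) i * z ^ i))
      = fun i : ℕ => (i : ℝ) * besselCoeff b i * z ^ i + (b - 1) * (besselCoeff b i * z ^ i) :=
    funext fun i => by
      rw [← mul_assoc (b - 1) (besselCoeff (b - 1) i), ← besselCoeff_pred hb]; ring
  rw [e] at h2
  exact (h1.add ((hasSum_besselF hb z).mul_left (b - 1))).unique h2

theorem contDiff_besselF {b : ℝ} (hb : NonInt b) : ContDiff ℝ ∞ (besselF b) := by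
  rw [contDiff_infty]
  intro r
  induction r generalizing b with
  | zero =>
    exact contDiff_zero.2 (continuous_iff_continuousAt.2 fun z => (hasDerivAt_besselF hb z).continuousAt)
  | succ r ih =>
    have h : deriv (besselF b) = fun z => besselF (b + 1) z / b :=
      funext fun z => (hasDerivAt_besselF hb z).deriv
    push_cast
    rw [contDiff_succ_iff_deriv]
    refine ⟨fun z => (hasDerivAt_besselF hb z).differentiableAt, by simp, ?_⟩
    rw [h]
    exact (ih hb.add_one).div_const b

/-- The defect in the connection formula for `besselJ`. -/
def besselR (ν z : ℝ) : ℝ :=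
  besselJ ν z - (Gamma ν * besselF (1 - ν) z + Gamma (-ν) * z ^ ν * besselF (1 + ν) z)

theorem NonInt.gamma_eq {ν : ℝ} (hν : NonInt ν) : Gamma (ν + 1) = ν * Gamma ν :=
  Real.Gamma_add_one hν.ne_zero

theorem hasDerivAt_besselR {ν z : ℝ} (hν : NonInt ν) (hz : 0 < z) :
    HasDerivAt (besselR ν) (-besselR (ν - 1) z) z := by
  have h1 := (hasDerivAt_besselF hν.one_sub z).const_mul (Gamma ν)
  have h2 := (((hasDerivAt_id z).rpow_const (p := ν) (Or.inl hz.ne')).const_mul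
    (Gamma (-ν))).mul (hasDerivAt_besselF hν.one_add z)
  refine ((hasDerivAt_besselJ hz ν).sub (h1.add h2)).congr_deriv ?_
  have e1 := mul_deriv_besselF hν.one_add z
  have e2 := hν.sub_one.gamma_eq
  have e3 := hν.neg.gamma_eq
  have h3 := hν.one_sub.ne_zero
  have h4 : z ^ ν = z ^ (ν - 1) * z := by rw [rpow_sub_one hz.ne']; field_simp
  rw [sub_add_cancel] at e2
  simp only [besselR, id, h4]
  rw [show 1 - (ν - 1) = 1 - ν + 1 by ring, show 1 + (ν - 1) = 1 + ν - 1 by ring,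
    show -(ν - 1) = -ν + 1 by ring, e3, e2]
  have h5 : (ν - 1) * Gamma (ν - 1) * (besselF (1 - ν + 1) z / (1 - ν))
      = - (Gamma (ν - 1) * besselF (1 - ν + 1) z) := by
    rw [show ν - 1 = -(1 - ν) by ring]; field_simp
  rw [h5]
  rw [add_sub_cancel_left] at e1 ⊢
  linear_combination -Gamma (-ν) * z ^ (ν - 1) * e1

theorem besselR_neg {ν z : ℝ} (hz : 0 < z) : besselR (-ν) z = z ^ (-ν) * besselR ν z := by
  have h : z ^ (-ν) * z ^ ν = 1 := by rw [← rpow_add hz]; simp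
  rw [besselR, besselR, besselJ_neg hz, neg_neg, sub_neg_eq_add, ← sub_eq_add_neg]
  linear_combination Gamma (-ν) * besselF (1 + ν) z * h

theorem tendsto_besselR_zero {ν : ℝ} (hν : NonInt ν) (h0 : 0 < ν) :
    Tendsto (besselR ν) (𝓝[>] 0) (𝓝 0) := by
  have c1 : ∀ {b : ℝ}, NonInt b → Tendsto (besselF b) (𝓝[>] 0) (𝓝 1) := fun {b} hb => by
    have := (contDiff_besselF hb).continuous.tendsto 0
    rw [besselF_zero] at this
    exact this.mono_left nhdsWithin_le_nhds
  have h1 := (tendsto_rpow_zero (show 0 < ν from h0)).const_mul (Gamma (-ν))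
  have h2 := (tendsto_besselJ_zero h0).sub
    (((c1 hν.one_sub).const_mul (Gamma ν)).add (h1.mul (c1 hν.one_add)))
  simp only [mul_one, mul_zero, add_zero, sub_self] at h2
  exact h2

theorem besselR_eq_zero_of_mem_Ioo {ν : ℝ} (h0 : 0 < ν) (h1 : ν < 1) {z : ℝ} (hz : 0 < z) :
    besselR ν z = 0 := by
  have hν : NonInt ν := fun w h => by
    rw [h] at h0 h1
    have h2 : 0 < w := by exact_mod_cast h0
    have h3 : w < 1 := by exact_mod_cast h1
    omega
  have d1 : ∀ z, 0 < z → HasDerivAt (besselR ν) (-(z ^ (ν - 1) * besselR (1 - ν) z)) z := fun z hz => by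
    refine (hasDerivAt_besselR hν hz).congr_deriv ?_
    rw [show ν - 1 = -(1 - ν) by ring, besselR_neg hz]
  have d2 : ∀ z, 0 < z → HasDerivAt (besselR (1 - ν)) (-(z ^ (-ν) * besselR ν z)) z := fun z hz => by
    refine (hasDerivAt_besselR hν.one_sub hz).congr_deriv ?_
    rw [show 1 - ν - 1 = -ν by ring, besselR_neg hz]
  set P : ℝ → ℝ := fun z => besselR ν z ^ 2 + besselR (1 - ν) z ^ 2
  set W : ℝ → ℝ := fun z => exp (-(z ^ ν / ν + z ^ (1 - ν) / (1 - ν)))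
  have hν1 : 0 < 1 - ν := by linarith
  have dW : ∀ z, 0 < z → HasDerivAt W (-(z ^ (ν - 1) + z ^ (-ν)) * W z) z := fun z hz => by
    have a := ((hasDerivAt_id z).rpow_const (p := ν) (Or.inl hz.ne')).div_const ν
    have b := ((hasDerivAt_id z).rpow_const (p := 1 - ν) (Or.inl hz.ne')).div_const (1 - ν)
    refine ((a.add b).neg.exp).congr_deriv ?_
    simp only [id, W, Pi.add_apply, Pi.neg_apply]
    rw [show 1 - ν - 1 = -ν by ring]
    field_simp
  have dPW : ∀ z, 0 < z → HasDerivAt (fun z => P z * W z)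
      (-(z ^ (ν - 1) + z ^ (-ν)) * (besselR ν z + besselR (1 - ν) z) ^ 2 * W z) z := fun z hz => by
    refine ((((d1 z hz).pow 2).add ((d2 z hz).pow 2)).mul (dW z hz)).congr_deriv ?_
    simp; ring
  have anti : AntitoneOn (fun z => P z * W z) (Ioi 0) := by
    refine antitoneOn_of_deriv_nonpos (convex_Ioi 0)
      (fun z hz => (dPW z hz).continuousAt.continuousWithinAt)
      (fun z hz => (dPW z (by simpa using hz)).differentiableAt.differentiableWithinAt) ?_
    intro z hz
    rw [interior_Ioi] at hz
    have hz : 0 < z := hz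
    rw [(dPW z hz).deriv]
    have : 0 ≤ (z ^ (ν - 1) + z ^ (-ν)) * (besselR ν z + besselR (1 - ν) z) ^ 2 * W z := by
      positivity
    linarith
  have lim : Tendsto (fun z => P z * W z) (𝓝[>] 0) (𝓝 0) := by
    have a := (tendsto_besselR_zero hν h0).pow 2
    have b := (tendsto_besselR_zero hν.one_sub hν1).pow 2
    have c : Tendsto W (𝓝[>] 0) (𝓝 1) := by
      have := (((tendsto_rpow_zero h0).div_const ν).add
        ((tendsto_rpow_zero hν1).div_const (1 - ν))).neg
      have := (Real.continuous_exp.tendsto _).comp this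
      simp only [zero_div, add_zero, neg_zero, exp_zero] at this
      exact this
    simpa using (a.add b).mul c
  have le : P z * W z ≤ 0 := by
    refine ge_of_tendsto lim ?_
    filter_upwards [Ioo_mem_nhdsGT hz] with w hw
    exact anti hw.1 hz hw.2.le
  have hW : 0 < W z := exp_pos _
  have hP : P z ≤ 0 := by
    by_contra! h
    exact absurd le (not_le.2 (mul_pos h hW))
  have : besselR ν z ^ 2 = 0 := le_antisymm (by
    have := sq_nonneg (besselR (1 - ν) z); simp only [P] at hP; linarith) (sq_nonneg _)
  exact pow_eq_zero_iff (two_ne_zero) |>.1 this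

theorem besselR_eq_zero {ν : ℝ} (hν : NonInt ν) {z : ℝ} (hz : 0 < z) : besselR ν z = 0 := by
  have key : ∀ (m : ℕ) (ν : ℝ), NonInt ν → 0 < ν → ν < 1 → ∀ z, 0 < z → besselR (ν - m) z = 0 := by
    intro m
    induction m with
    | zero => intro ν _ h0 h1 z hz; simpa using besselR_eq_zero_of_mem_Ioo h0 h1 hz
    | succ m ih =>
      intro ν hν h0 h1 z hz
      have a := hasDerivAt_besselR (ν := ν - m) (by simpa using hν.sub_int m) hz
      have b : HasDerivAt (besselR (ν - m)) 0 z := by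
        refine (hasDerivAt_const z (0 : ℝ)).congr_of_eventuallyEq ?_
        filter_upwards [lt_mem_nhds hz] with w hw
        exact ih ν hν h0 h1 w hw
      have := a.unique b
      push_cast
      rw [← sub_sub]
      linarith
  have key2 : ∀ ν, NonInt ν → ⌊ν⌋ ≤ 0 → ∀ z, 0 < z → besselR ν z = 0 := by
    intro ν hν hf z hz
    obtain ⟨m, hm⟩ := Int.eq_ofNat_of_zero_le (neg_nonneg.2 hf)
    have e : (⌊ν⌋ : ℝ) = -(m : ℝ) := by
      have h : ⌊ν⌋ = -(m : ℤ) := by omega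
      rw [h]; simp
    have := key m (fract ν) (show NonInt (ν - ⌊ν⌋) from hν.sub_int ⌊ν⌋)
      ((Int.fract_nonneg ν).lt_of_ne fun h => hν ⌊ν⌋ (by rw [Int.fract] at h; linarith))
      (Int.fract_lt_one ν) z hz
    rwa [Int.fract, e, show ν - -(m : ℝ) - m = ν by ring] at this
  rcases le_or_gt ⌊ν⌋ 0 with h | h
  · exact key2 ν hν h z hz
  · have h2 : ⌊-ν⌋ ≤ 0 := by
      have : (1 : ℝ) ≤ ν := by
        have : (1 : ℝ) ≤ ⌊ν⌋ := by exact_mod_cast h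
        exact this.trans (Int.floor_le ν)
      exact Int.floor_le_iff.2 (by push_cast; linarith)
    have := besselR_neg (ν := -ν) hz
    rw [neg_neg, key2 _ hν.neg h2 z hz, mul_zero] at this
    exact this

theorem besselJ_eq {ν : ℝ} (hν : NonInt ν) {z : ℝ} (hz : 0 < z) :
    besselJ ν z = Gamma ν * besselF (1 - ν) z + Gamma (-ν) * z ^ ν * besselF (1 + ν) z := by
  have := besselR_eq_zero hν hz
  rw [besselR] at this; linarith

end

section
open Set ES

/-- The function `y^c f + y^d g` of one variable. -/
def pv (c d : ℝ) (f g : ES 0) (y : ℝ) : ℝ := y ^ c * f (0, y) + y ^ d * g (0, y)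

theorem continuous_slice (f : ES 0) : Continuous fun y : ℝ => f (0, y) :=
  (smooth f).continuous.comp (by fun_prop)

theorem hasDerivAt_pv (c d : ℝ) (f g : ES 0) {y : ℝ} (hy : 0 < y) :
    HasDerivAt (pv c d f g) (y⁻¹ * pv c d (θ f + c • f) (θ g + d • g) y) y := by
  refine ((hasDerivAt_rpow_mul c f 0 hy).add (hasDerivAt_rpow_mul d g 0 hy)).congr_deriv ?_
  rw [pv, rpow_sub_one hy.ne', rpow_sub_one hy.ne']
  simp only [add_app, smul_app]
  field_simp
  ring

theorem pv_add (c d : ℝ) (f g f' g' : ES 0) (y : ℝ) :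
    pv c d (f + f') (g + g') y = pv c d f g y + pv c d f' g' y := by
  simp only [pv, add_app]; ring

theorem pv_sub (c d : ℝ) (f g f' g' : ES 0) (y : ℝ) :
    pv c d (f - f') (g - g') y = pv c d f g y - pv c d f' g' y := by
  simp only [pv, sub_app]; ring

theorem pv_smul (c d r : ℝ) (f g : ES 0) (y : ℝ) :
    pv c d (r • f) (r • g) y = r * pv c d f g y := by
  simp only [pv, smul_app]; ring

/-- Multiplication by `-λ²`, the Fourier symbol of the Laplacian. -/
def lamOp (l : ℝ) : Module.End ℝ (ES 0) := (-(l ^ 2)) • 1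

theorem lamOp_app (l : ℝ) (f : ES 0) : lamOp l f = (-(l ^ 2)) • f := rfl

theorem lamOp_comm (l : ℝ) (B : Module.End ℝ (ES 0)) : lamOp l * B = B * lamOp l := by
  refine LinearMap.ext fun f => ?_
  simp [mul_apply, lamOp_app]

/-- The one-dimensional operator with parameter `λ`. -/
abbrev T1 (l c : ℝ) : Module.End ℝ (ES 0) := wT Y Q (lamOp l) c

theorem T1_app (l c : ℝ) (f : ES 0) (x) (y : ℝ) : T1 l c f (x, y) =
    -(l ^ 2) * y ^ 2 * f (x, y) + θ (θ f) (x, y) + 2 * c * θ f (x, y) + c ^ 2 * f (x, y) := by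
  rw [wT_app, lamOp_app, smul_app]; ring

theorem pv_T1 (l c d : ℝ) (f g : ES 0) (y : ℝ) :
    pv c d (T1 l c f) (T1 l d g) y = pv c d (θ (θ f + c • f) + c • (θ f + c • f))
      (θ (θ g + d • g) + d • (θ g + d • g)) y - l ^ 2 * y ^ 2 * pv c d f g y := by
  simp only [pv, T1_app, map_add, map_smul, add_app, smul_app]; ring

theorem integrableOn_rpow_mul_Ioc {p : ℝ} (hp : -1 < p) {F : ℝ → ℝ} (hF : Continuous F) (R : ℝ) :
    IntegrableOn (fun y => y ^ p * F y) (Ioc 0 R) := by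
  rcases le_or_gt R 0 with h | h
  · simp [h]
  · rw [← intervalIntegrable_iff_integrableOn_Ioc_of_le h.le]
    exact (intervalIntegral.intervalIntegrable_rpow' hp).mul_continuousOn hF.continuousOn

theorem integrableOn_of_Ioc {F : ℝ → ℝ} {R : ℝ} (hF : IntegrableOn F (Ioc 0 R))
    (h0 : ∀ y, R < y → F y = 0) : IntegrableOn F (Ioi 0) := by
  rcases le_or_gt R 0 with h | h
  · exact integrableOn_zero.congr_fun (fun y hy => (h0 y (h.trans_lt hy)).symm) measurableSet_Ioi
  · rw [← Ioc_union_Ioi_eq_Ioi h.le]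
    exact hF.union (integrableOn_zero.congr_fun (fun y hy => (h0 y hy).symm) measurableSet_Ioi)

theorem integrableOn_rpow_mul {p : ℝ} (hp : -1 < p) {F : ℝ → ℝ} (hF : Continuous F) {R : ℝ}
    (h0 : ∀ y, R < y → F y = 0) : IntegrableOn (fun y => y ^ p * F y) (Ioi 0) :=
  integrableOn_of_Ioc (integrableOn_rpow_mul_Ioc hp hF R) fun y hy => by rw [h0 y hy, mul_zero]

theorem integral_Ioi_of_tendsto {W W' : ℝ → ℝ} {A B : ℝ} (hd : ∀ y, 0 < y → HasDerivAt W (W' y) y)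
    (hi : IntegrableOn W' (Ioi 0)) (h0 : Tendsto W (𝓝[>] 0) (𝓝 A)) (h1 : Tendsto W atTop (𝓝 B)) :
    ∫ y in Ioi (0 : ℝ), W' y = B - A := by
  have e : ∀ y : ℝ, 0 < y → Function.update W 0 A =ᶠ[𝓝 y] W := fun y hy => by
    filter_upwards [lt_mem_nhds hy] with z hz
    exact Function.update_of_ne (ne_of_gt hz) _ _
  have := integral_Ioi_of_hasDerivAt_of_tendsto (a := (0 : ℝ)) (f := Function.update W 0 A)
    (f' := W') (m := B) ?_ (fun y hy => (hd y hy).congr_of_eventuallyEq (e y hy)) hi ?_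
  · simpa using this
  · rw [continuousWithinAt_update_same]
    simpa using h0
  · refine h1.congr' ?_
    filter_upwards [eventually_gt_atTop 0] with z hz
    exact (Function.update_of_ne (ne_of_gt hz) _ _).symm

theorem θ_mul (u v : ES 0) : θ (mul u v) = mul (θ u) v + mul u (θ v) := by
  ext x y
  simp only [θ_app, mul_app, add_app]
  rw [show ((mul u v : ES 0) : Pt 0 → ℝ) = (u : Pt 0 → ℝ) * v from rfl,
    pd_mul _ (smooth u) (smooth v)]
  simp only [Pi.add_apply, Pi.mul_apply]
  ring

theorem eq_Y_S {f : ES 0} (h : f (0, 0) = 0) : f = Y (S f) := by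
  ext x y
  have hx : x = 0 := Subsingleton.elim _ _
  have := sub_r0 f x y
  rw [hx] at this ⊢
  rw [Y_app]; linarith

theorem θ_Y_pow (i : ℕ) (f : ES 0) : θ ((Y ^ i) f) = (Y ^ i) (θ f + (2 * i : ℝ) • f) := by
  induction i generalizing f with
  | zero => simp
  | succ i ih =>
    have h : θ (Y f) = Y (θ f + (2 : ℝ) • f) := by
      have := congrArg (fun B : Module.End ℝ (ES 0) => B f) θ_mul_Y
      simp only [mul_apply] at this
      rw [this]; congr 1
      simp [two_smul]
    rw [pow_succ, mul_apply, ih, h, mul_apply, ← map_smul Y, ← map_add Y]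
    congr 2
    push_cast
    module

theorem mem_Y_pow_of_θ {μ : ℝ} {r : ℕ} (hμ : ∀ i : ℕ, i < r → (2 * i : ℝ) ≠ μ) {w χ : ES 0}
    (h : θ w - μ • w = (Y ^ r) χ) : ∃ v, w = (Y ^ r) v := by
  have key : ∀ i ≤ r, ∃ v, w = (Y ^ i) v := by
    intro i
    induction i with
    | zero => exact fun _ => ⟨w, rfl⟩
    | succ i ih =>
      intro hi
      obtain ⟨v, rfl⟩ := ih (by omega)
      refine ⟨S v, ?_⟩
      rw [pow_succ, mul_apply, ← eq_Y_S]
      have h1 : (Y ^ i) (θ v + (2 * i : ℝ) • v - μ • v) = (Y ^ i) ((Y ^ (r - i)) χ) := by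
        rw [map_sub, map_smul, ← θ_Y_pow, h, ← mul_apply, ← pow_add]
        congr 2; omega
      have h2 := congrArg (fun F : ES 0 => F (0, 0)) (Y_pow_injective i h1)
      simp only [sub_app, add_app, smul_app, Y_pow_app] at h2
      rw [θ_app, zero_pow (by omega)] at h2
      have h3 : (2 * i - μ) * v (0, 0) = 0 := by simp at h2; linarith
      exact (mul_eq_zero.1 h3).resolve_left (sub_ne_zero.2 (hμ i (by omega)))
  exact key r le_rfl

theorem wronskian_even {l ν : ℝ} {r : ℕ} (hν : ∀ i : ℕ, (i : ℝ) ≠ ν) {P ψ χ : ES 0}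
    (hP : T1 l (-ν) P = ν ^ 2 • P) (hψ : T1 l (-ν) ψ = ν ^ 2 • ψ + (Y ^ r) χ) :
    ∃ v : ES 0, ∀ y, P (0, y) * θ ψ (0, y) - ψ (0, y) * θ P (0, y) = y ^ (2 * r) * v (0, y) := by
  have h : θ (mul P (θ ψ) - mul ψ (θ P)) - (2 * ν) • (mul P (θ ψ) - mul ψ (θ P))
      = (Y ^ r) (mul P χ) := by
    ext x y
    have h1 := congrArg (fun F : ES 0 => F (x, y)) hP
    have h2 := congrArg (fun F : ES 0 => F (x, y)) hψ
    simp only [T1_app, smul_app, add_app, Y_pow_app] at h1 h2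
    simp only [map_sub, θ_mul, sub_app, add_app, mul_app, smul_app, Y_pow_app]
    linear_combination P (x, y) * h2 - ψ (x, y) * h1
  obtain ⟨v, hv⟩ := mem_Y_pow_of_θ (fun i _ => by
    intro h'; exact hν i (by linarith)) h
  refine ⟨v, fun y => ?_⟩
  have := congrArg (fun F : ES 0 => F (0, y)) hv
  simpa only [sub_app, mul_app, Y_pow_app] using this

theorem θ_eventually_zero {f : ES 0} {R : ℝ} (h : ∀ y, R < y → f (0, y) = 0) :
    ∀ y, R < y → θ f (0, y) = 0 := fun y hy => by
  have h1 := hasDerivAt_slice (smooth f) 0 y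
  have h2 : HasDerivAt (fun t => f (0, t)) 0 y :=
    (hasDerivAt_const y (0 : ℝ)).congr_of_eventuallyEq (by
      filter_upwards [lt_mem_nhds hy] with z hz using h z hz)
  rw [θ_app, h1.unique h2, mul_zero]

theorem T1_eventually_zero {l c : ℝ} {f : ES 0} {R : ℝ} (h : ∀ y, R < y → f (0, y) = 0) :
    ∀ y, R < y → T1 l c f (0, y) = 0 := fun y hy => by
  rw [T1_app, h y hy, θ_eventually_zero h y hy, θ_eventually_zero (θ_eventually_zero h) y hy]
  ring

theorem rpow_mul_tendsto_zero {p : ℝ} (hp : 0 < p) {F : ℝ → ℝ} (hF : Continuous F) :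
    Tendsto (fun y => y ^ p * F y) (𝓝[>] 0) (𝓝 0) := by
  simpa using (tendsto_rpow_zero hp).mul ((hF.tendsto 0).mono_left nhdsWithin_le_nhds)

/-- Green's formula for `y ∂_y` and a pair of solutions. -/
theorem green_formula {l ν α β : ℝ} (hν : NonInt ν) {r r' : ℕ} (hr : ν < r) (hr' : -ν < r')
    {P M ψe ψf χe χf : ES 0} (hP : T1 l (-ν) P = ν ^ 2 • P) (hM : T1 l ν M = ν ^ 2 • M)
    (hψe : T1 l (-ν) ψe = ν ^ 2 • ψe + (Y ^ r) χe) (hψf : T1 l ν ψf = ν ^ 2 • ψf + (Y ^ r') χf)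
    (hP0 : P (0, 0) = 1) (hM0 : M (0, 0) = 1) {R : ℝ}
    (he0 : ∀ y, R < y → ψe (0, y) = 0) (hf0 : ∀ y, R < y → ψf (0, y) = 0) (h0r : 0 < r)
    (h0r' : 0 < r') :
    ∫ y in Ioi (0 : ℝ), y⁻¹ * (pv (-ν) ν (α • P) (β • M) y *
      pv (-ν) ν ((Y ^ r) χe) ((Y ^ r') χf) y) = -(2 * ν * (α * ψf (0, 0) - β * ψe (0, 0))) := by
  have hMn : T1 l (-(-ν)) M = (-ν) ^ 2 • M := by rw [neg_neg, neg_sq]; exact hM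
  have hψfn : T1 l (-(-ν)) ψf = (-ν) ^ 2 • ψf + (Y ^ r') χf := by rw [neg_neg, neg_sq]; exact hψf
  obtain ⟨we, hwe⟩ := wronskian_even (fun i => by simpa using (hν i).symm) hP hψe
  obtain ⟨wf, hwf⟩ := wronskian_even (fun i => by simpa using (hν.neg i).symm) hMn hψfn
  have hχe : ∀ y, (Y ^ r) χe (0, y) = T1 l (-ν) ψe (0, y) - ν ^ 2 * ψe (0, y) := fun y => by
    rw [hψe]; simp
  have hχf : ∀ y, (Y ^ r') χf (0, y) = T1 l ν ψf (0, y) - ν ^ 2 * ψf (0, y) := fun y => by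
    rw [hψf]; simp
  set W : ℝ → ℝ := fun y => pv (-ν) ν (α • P) (β • M) y *
      pv (-ν) ν (θ ψe + (-ν) • ψe) (θ ψf + ν • ψf) y -
      pv (-ν) ν ψe ψf y * pv (-ν) ν (θ (α • P) + (-ν) • α • P) (θ (β • M) + ν • β • M) y with hW
  have hd : ∀ y, 0 < y → HasDerivAt W (y⁻¹ * (pv (-ν) ν (α • P) (β • M) y *
      pv (-ν) ν ((Y ^ r) χe) ((Y ^ r') χf) y)) y := by
    intro y hy
    refine (((hasDerivAt_pv _ _ _ _ hy).mul (hasDerivAt_pv _ _ _ _ hy)).sub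
      ((hasDerivAt_pv _ _ _ _ hy).mul (hasDerivAt_pv _ _ _ _ hy))).congr_deriv ?_
    have e1 := pv_T1 l (-ν) ν ψe ψf y
    have e2 := pv_T1 l (-ν) ν (α • P) (β • M) y
    rw [map_smul, map_smul, hP, hM, smul_comm α, smul_comm β, pv_smul] at e2
    rw [hψe, hψf, pv_add, pv_smul] at e1
    linear_combination (-(y⁻¹ * pv (-ν) ν (α • P) (β • M) y)) * e1 + y⁻¹ * pv (-ν) ν ψe ψf y * e2
  have hWe : ∀ y, 0 < y → W y = α * (y ^ (-2 * ν + 2 * r) * we (0, y))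
      + β * (y ^ (2 * ν + 2 * r') * wf (0, y))
      + (α * (P (0, y) * θ ψf (0, y) - ψf (0, y) * θ P (0, y) + 2 * ν * P (0, y) * ψf (0, y))
      + β * (M (0, y) * θ ψe (0, y) - ψe (0, y) * θ M (0, y) - 2 * ν * M (0, y) * ψe (0, y))) := by
    intro y hy
    have e1 : y ^ (-ν) * y ^ ν = 1 := by rw [← rpow_add hy]; simp
    have e2 : y ^ (-ν) * y ^ (-ν) = y ^ (-2 * ν) := by rw [← rpow_add hy]; congr 1; ring
    have e3 : y ^ ν * y ^ ν = y ^ (2 * ν) := by rw [← rpow_add hy]; congr 1; ring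
    rw [← rpow_mul_sq_pow hy, ← rpow_mul_sq_pow hy, mul_assoc, mul_assoc, ← hwe, ← hwf, ← e2, ← e3]
    simp only [hW, pv, add_app, smul_app, map_smul]
    linear_combination (α * (P (0, y) * θ ψf (0, y) - ψf (0, y) * θ P (0, y) + 2 * ν * P (0, y) * ψf (0, y))
      + β * (M (0, y) * θ ψe (0, y) - ψe (0, y) * θ M (0, y) - 2 * ν * M (0, y) * ψe (0, y))) * e1
  have hci : ∀ F G : ES 0, Continuous fun y : ℝ => F (0, y) * G (0, y) := fun F G =>
    (continuous_slice F).mul (continuous_slice G)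
  have hint : IntegrableOn (fun y => y⁻¹ * (pv (-ν) ν (α • P) (β • M) y *
      pv (-ν) ν ((Y ^ r) χe) ((Y ^ r') χf) y)) (Ioi 0) := by
    have hz1 : ∀ y, max R 0 < y → χe (0, y) = 0 := fun y hy => by
      have h1 := hχe y
      have hR := (le_max_left R 0).trans_lt hy
      rw [Y_pow_app, T1_eventually_zero he0 y hR, he0 y hR, mul_zero, sub_zero] at h1
      exact (mul_eq_zero.1 h1).resolve_left (pow_ne_zero _ ((le_max_right R 0).trans_lt hy).ne')
    have hz2 : ∀ y, max R 0 < y → χf (0, y) = 0 := fun y hy => by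
      have h1 := hχf y
      have hR := (le_max_left R 0).trans_lt hy
      rw [Y_pow_app, T1_eventually_zero hf0 y hR, hf0 y hR, mul_zero, sub_zero] at h1
      exact (mul_eq_zero.1 h1).resolve_left (pow_ne_zero _ ((le_max_right R 0).trans_lt hy).ne')
    have hr1 : (1 : ℝ) ≤ r := by exact_mod_cast h0r
    have hr1' : (1 : ℝ) ≤ r' := by exact_mod_cast h0r'
    have i1 := integrableOn_rpow_mul (p := -1 - 2 * ν + 2 * r) (by linarith) (hci (α • P) χe)
      (fun y hy => by rw [hz1 y hy, mul_zero])
    have i2 := integrableOn_rpow_mul (p := -1 + 2 * r') (by linarith) (hci (α • P) χf)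
      (fun y hy => by rw [hz2 y hy, mul_zero])
    have i3 := integrableOn_rpow_mul (p := -1 + 2 * r) (by linarith) (hci (β • M) χe)
      (fun y hy => by rw [hz1 y hy, mul_zero])
    have i4 := integrableOn_rpow_mul (p := -1 + 2 * ν + 2 * r') (by linarith) (hci (β • M) χf)
      (fun y hy => by rw [hz2 y hy, mul_zero])
    refine (((i1.add i2).add i3).add i4).congr_fun (fun y hy => ?_) measurableSet_Ioi
    have hy : 0 < y := hy
    have e1 : y ^ (-ν) * y ^ ν = 1 := by rw [← rpow_add hy]; simp
    have e2 : y ^ (-1 - 2 * ν) = y⁻¹ * (y ^ (-ν) * y ^ (-ν)) := by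
      rw [← rpow_neg_one, ← rpow_add hy, ← rpow_add hy]; congr 1; ring
    have e3 : y ^ (-1 + 2 * ν) = y⁻¹ * (y ^ ν * y ^ ν) := by
      rw [← rpow_neg_one, ← rpow_add hy, ← rpow_add hy]; congr 1; ring
    simp only [Pi.add_apply, pv, smul_app, Y_pow_app]
    rw [← rpow_mul_sq_pow hy, ← rpow_mul_sq_pow hy, ← rpow_mul_sq_pow hy, ← rpow_mul_sq_pow hy,
      e2, e3, rpow_neg_one]
    linear_combination (-y⁻¹ * (α * P (0, y) * (y ^ (2 * r') * χf (0, y)) +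
      β * M (0, y) * (y ^ (2 * r) * χe (0, y)))) * e1
  have hlim0 : Tendsto W (𝓝[>] 0) (𝓝 (2 * ν * (α * ψf (0, 0) - β * ψe (0, 0)))) := by
    have hc : Continuous fun y : ℝ => α * (P (0, y) * θ ψf (0, y) - ψf (0, y) * θ P (0, y) +
        2 * ν * P (0, y) * ψf (0, y))
      + β * (M (0, y) * θ ψe (0, y) - ψe (0, y) * θ M (0, y) - 2 * ν * M (0, y) * ψe (0, y)) := by
      refine Continuous.congr (((((hci P (θ ψf)).sub (hci ψf (θ P))).add
        ((hci P ψf).const_mul (2 * ν))).const_mul α).add ((((hci M (θ ψe)).sub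
          (hci ψe (θ M))).sub ((hci M ψe).const_mul (2 * ν))).const_mul β)) fun y => ?_
      simp only [Pi.add_apply, Pi.sub_apply]
      ring
    have t1 := (rpow_mul_tendsto_zero (p := -2 * ν + 2 * r) (by linarith)
      (continuous_slice we)).const_mul α
    have t2 := (rpow_mul_tendsto_zero (p := 2 * ν + 2 * r') (by linarith)
      (continuous_slice wf)).const_mul β
    have t3 := (t1.add t2).add ((hc.tendsto 0).mono_left (nhdsWithin_le_nhds (s := Ioi 0)))
    refine Tendsto.congr' ?_ (t3.trans_eq ?_)
    · filter_upwards [self_mem_nhdsWithin] with y hy using (hWe y hy).symm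
    · congr 1
      simp only [θ_app, hP0, hM0]; ring
  have hlim1 : Tendsto W atTop (𝓝 0) := by
    refine Tendsto.congr' ?_ tendsto_const_nhds
    filter_upwards [eventually_gt_atTop R] with y hy
    simp only [hW, pv, add_app, smul_app, he0 y hy, hf0 y hy, θ_eventually_zero he0 y hy,
      θ_eventually_zero hf0 y hy]
    ring
  rw [integral_Ioi_of_tendsto hd hint hlim0 hlim1, zero_sub]

/-- A space of functions on `(0, ∞)`, closed under `y ∂_y`, all of which decay rapidly. -/
def IsDecaying (K : Submodule ℝ (ℝ → ℝ)) : Prop :=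
  ∀ v ∈ K, (∃ w ∈ K, ∀ y, 0 < y → HasDerivAt v (y⁻¹ * w y) y) ∧
    ∀ N : ℝ, Tendsto (fun y => y ^ N * v y) atTop (𝓝 0)

/-- Smooth functions on `(0, ∞)` that decay rapidly at infinity together with all derivatives. -/
def RD (u : ℝ → ℝ) : Prop := ∃ K, IsDecaying K ∧ ∃ v ∈ K, ∀ y, 0 < y → u y = v y

theorem hasDerivAt_congr_pos {u v : ℝ → ℝ} (h : ∀ y, 0 < y → u y = v y) {d y : ℝ} (hy : 0 < y)
    (hv : HasDerivAt v d y) : HasDerivAt u d y :=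
  hv.congr_of_eventuallyEq (by filter_upwards [lt_mem_nhds hy] with z hz using h z hz)

theorem RD.congr {u v : ℝ → ℝ} (hu : RD u) (h : ∀ y, 0 < y → v y = u y) : RD v := by
  obtain ⟨K, hK, w, hw, hwe⟩ := hu
  exact ⟨K, hK, w, hw, fun y hy => (h y hy).trans (hwe y hy)⟩

theorem RD.tendsto {u : ℝ → ℝ} (hu : RD u) (N : ℝ) : Tendsto (fun y => y ^ N * u y) atTop (𝓝 0) := by
  obtain ⟨K, hK, w, hw, hwe⟩ := hu
  refine ((hK w hw).2 N).congr' ?_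
  filter_upwards [eventually_gt_atTop 0] with y hy
  rw [hwe y hy]

theorem RD.tendsto' {u : ℝ → ℝ} (hu : RD u) : Tendsto u atTop (𝓝 0) := by
  simpa using hu.tendsto 0

theorem RD.theta {u w : ℝ → ℝ} (hu : RD u) (h : ∀ y, 0 < y → HasDerivAt u (y⁻¹ * w y) y) : RD w := by
  obtain ⟨K, hK, v, hv, hve⟩ := hu
  obtain ⟨w', hw', hd⟩ := (hK v hv).1
  refine ⟨K, hK, w', hw', fun y hy => ?_⟩
  have := (h y hy).unique (hasDerivAt_congr_pos hve hy (hd y hy))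
  exact mul_left_cancel₀ (inv_ne_zero hy.ne') this

theorem RD.differentiable {u : ℝ → ℝ} (hu : RD u) {y : ℝ} (hy : 0 < y) : ∃ d, HasDerivAt u d y := by
  obtain ⟨K, hK, v, hv, hve⟩ := hu
  obtain ⟨w', hw', hd⟩ := (hK v hv).1
  exact ⟨_, hasDerivAt_congr_pos hve hy (hd y hy)⟩

theorem RD.smul {u : ℝ → ℝ} (hu : RD u) (c : ℝ) : RD fun y => c * u y := by
  obtain ⟨K, hK, v, hv, hve⟩ := hu
  exact ⟨K, hK, c • v, K.smul_mem c hv, fun y hy => by simp [hve y hy]⟩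

theorem IsDecaying.sup {K L : Submodule ℝ (ℝ → ℝ)} (hK : IsDecaying K) (hL : IsDecaying L) :
    IsDecaying (K ⊔ L) := by
  intro v hv
  obtain ⟨v₁, h₁, v₂, h₂, rfl⟩ := Submodule.mem_sup.1 hv
  obtain ⟨⟨w₁, hw₁, d₁⟩, t₁⟩ := hK v₁ h₁
  obtain ⟨⟨w₂, hw₂, d₂⟩, t₂⟩ := hL v₂ h₂
  refine ⟨⟨w₁ + w₂, Submodule.add_mem_sup hw₁ hw₂, fun y hy => ?_⟩, fun N => ?_⟩
  · refine ((d₁ y hy).add (d₂ y hy)).congr_deriv ?_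
    simp only [Pi.add_apply]; ring
  · have := (t₁ N).add (t₂ N)
    rw [add_zero] at this
    refine this.congr fun y => ?_
    simp only [Pi.add_apply]; ring

theorem RD.add {u v : ℝ → ℝ} (hu : RD u) (hv : RD v) : RD fun y => u y + v y := by
  obtain ⟨K, hK, u', hu', hue⟩ := hu
  obtain ⟨L, hL, v', hv', hve⟩ := hv
  exact ⟨K ⊔ L, hK.sup hL, u' + v', Submodule.add_mem_sup hu' hv', fun y hy => by
    simp [hue y hy, hve y hy]⟩

theorem RD.sub {u v : ℝ → ℝ} (hu : RD u) (hv : RD v) : RD fun y => u y - v y :=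
  (hu.add (hv.smul (-1))).congr fun y _ => by ring

theorem rd_zero : RD fun _ => 0 := by
  refine ⟨⊥, ?_, 0, Submodule.zero_mem _, fun _ _ => rfl⟩
  intro v hv
  rw [Submodule.mem_bot] at hv
  subst hv
  exact ⟨⟨0, Submodule.zero_mem _, fun y _ => by simp⟩, by simp⟩

theorem RD.sum {ι : Type*} (s : Finset ι) {u : ι → ℝ → ℝ} (hu : ∀ i ∈ s, RD (u i)) :
    RD fun y => ∑ i ∈ s, u i y := by
  classical
  induction s using Finset.induction_on with
  | empty => simpa using rd_zero
  | insert i s hi ih =>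
    simp only [Finset.sum_insert hi]
    exact (hu i (Finset.mem_insert_self i s)).add
      (ih fun j hj => hu j (Finset.mem_insert_of_mem hj))

/-- Multiplication by a power. -/
def rpowMul (s : ℝ) : (ℝ → ℝ) →ₗ[ℝ] (ℝ → ℝ) where
  toFun v := fun y => y ^ s * v y
  map_add' u v := by funext y; simp [mul_add]
  map_smul' c v := by funext y; simp; ring

theorem RD.rpow_mul {u : ℝ → ℝ} (hu : RD u) (s : ℝ) : RD fun y => y ^ s * u y := by
  obtain ⟨K, hK, v, hv, hve⟩ := hu
  refine ⟨K.map (rpowMul s), ?_, rpowMul s v, Submodule.mem_map_of_mem hv, fun y hy => by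
    simp [rpowMul, hve y hy]⟩
  rintro _ ⟨v, hv, rfl⟩
  obtain ⟨⟨w, hw, d⟩, t⟩ := hK v hv
  refine ⟨⟨rpowMul s (s • v + w), Submodule.mem_map_of_mem (K.add_mem (K.smul_mem s hv) hw),
    fun y hy => ?_⟩, fun N => ?_⟩
  · refine ((Real.hasDerivAt_rpow_const (p := s) (Or.inl hy.ne')).mul (d y hy)).congr_deriv ?_
    simp only [rpowMul, LinearMap.coe_mk, AddHom.coe_mk, Pi.add_apply, Pi.smul_apply, smul_eq_mul]
    rw [rpow_sub_one hy.ne']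
    field_simp
  · refine (t (N + s)).congr' ?_
    filter_upwards [eventually_gt_atTop 0] with y hy
    rw [rpow_add hy]
    simp [rpowMul]; ring

theorem rd_pv (c d : ℝ) {f g : ES 0} {R : ℝ} (hf : ∀ y, R < y → f (0, y) = 0)
    (hg : ∀ y, R < y → g (0, y) = 0) : RD (pv c d f g) := by
  let K : Submodule ℝ (ℝ → ℝ) :=
    { carrier := {v | ∃ f g : ES 0, (∀ y, R < y → f (0, y) = 0) ∧ (∀ y, R < y → g (0, y) = 0) ∧
        v = pv c d f g}
      add_mem' := by
        rintro _ _ ⟨f, g, hf, hg, rfl⟩ ⟨f', g', hf', hg', rfl⟩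
        exact ⟨f + f', g + g', fun y hy => by simp [hf y hy, hf' y hy],
          fun y hy => by simp [hg y hy, hg' y hy], funext fun y => (pv_add c d f g f' g' y).symm⟩
      zero_mem' := ⟨0, 0, by simp, by simp, by funext y; simp [pv]⟩
      smul_mem' := by
        rintro r _ ⟨f, g, hf, hg, rfl⟩
        exact ⟨r • f, r • g, fun y hy => by simp [hf y hy], fun y hy => by simp [hg y hy],
          funext fun y => (pv_smul c d r f g y).symm⟩ }
  refine ⟨K, ?_, pv c d f g, ⟨f, g, hf, hg, rfl⟩, fun _ _ => rfl⟩
  rintro _ ⟨f, g, hf, hg, rfl⟩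
  refine ⟨⟨_, ⟨θ f + c • f, θ g + d • g, ?_, ?_, rfl⟩, fun y hy => hasDerivAt_pv c d f g hy⟩,
    fun N => ?_⟩
  · intro y hy; simp [hf y hy, θ_eventually_zero hf y hy]
  · intro y hy; simp [hg y hy, θ_eventually_zero hg y hy]
  · refine tendsto_const_nhds.congr' ?_
    filter_upwards [eventually_gt_atTop R] with y hy
    simp [pv, hf y hy, hg y hy]

theorem rd_besselJ {l : ℝ} (hl : 0 < l) (μ : ℝ) : RD fun y => besselJ μ (l ^ 2 * y ^ 2 / 4) := by
  let G : Set (ℝ → ℝ) := {v | ∃ α μ : ℝ, v = fun y => y ^ α * besselJ μ (l ^ 2 * y ^ 2 / 4)}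
  refine ⟨Submodule.span ℝ G, ?_, fun y => y ^ (0 : ℝ) * besselJ μ (l ^ 2 * y ^ 2 / 4),
    Submodule.subset_span ⟨0, μ, rfl⟩, fun y _ => by simp⟩
  intro v hv
  induction hv using Submodule.span_induction with
  | mem v hv =>
    obtain ⟨α, μ, rfl⟩ := hv
    refine ⟨⟨α • (fun y => y ^ α * besselJ μ (l ^ 2 * y ^ 2 / 4)) - (l ^ 2 / 2) •
      (fun y => y ^ (α + 2) * besselJ (μ - 1) (l ^ 2 * y ^ 2 / 4)),
      Submodule.sub_mem _ (Submodule.smul_mem _ _ (Submodule.subset_span ⟨α, μ, rfl⟩))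
        (Submodule.smul_mem _ _ (Submodule.subset_span ⟨α + 2, μ - 1, rfl⟩)), fun y hy => ?_⟩,
      fun N => ?_⟩
    · have hz : 0 < l ^ 2 * y ^ 2 / 4 := by positivity
      have h1 : HasDerivAt (fun y : ℝ => l ^ 2 * y ^ 2 / 4) (l ^ 2 * (2 * y) / 4) y := by
        simpa using ((hasDerivAt_pow 2 y).const_mul (l ^ 2)).div_const 4
      have h2 := HasDerivAt.comp y (hasDerivAt_besselJ hz μ) h1
      refine ((Real.hasDerivAt_rpow_const (p := α) (Or.inl hy.ne')).mul h2).congr_deriv ?_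
      simp only [Pi.sub_apply, Pi.smul_apply, smul_eq_mul, Function.comp]
      have e : y ^ (α + 2) = y ^ α * y ^ 2 := by
        have := rpow_mul_sq_pow hy α 1
        simpa using this.symm
      rw [rpow_sub_one hy.ne', e]
      field_simp
      ring
    · have h1 : Tendsto (fun y : ℝ => l ^ 2 * y ^ 2 / 4) atTop atTop :=
        ((tendsto_pow_atTop (two_ne_zero)).const_mul_atTop (by positivity)).atTop_div_const
          (by norm_num)
      have h2 := ((tendsto_besselJ_atTop μ ((N + α) / 2)).comp h1).const_mul
        ((l ^ 2 / 4) ^ (-((N + α) / 2)))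
      rw [mul_zero] at h2
      refine h2.congr' ?_
      filter_upwards [eventually_gt_atTop 0] with y hy
      have e : (l ^ 2 * y ^ 2 / 4) ^ ((N + α) / 2) = (l ^ 2 / 4) ^ ((N + α) / 2) * y ^ (N + α) := by
        rw [show l ^ 2 * y ^ 2 / 4 = l ^ 2 / 4 * y ^ 2 by ring,
          mul_rpow (by positivity) (by positivity), ← rpow_natCast y 2,
          ← rpow_mul hy.le]
        congr 2; push_cast; ring
      have e2 : (l ^ 2 / 4) ^ (-((N + α) / 2)) * (l ^ 2 / 4) ^ ((N + α) / 2) = 1 := by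
        rw [← rpow_add (by positivity)]; simp
      simp only [Function.comp]
      rw [e, rpow_add hy]
      linear_combination (y ^ N * y ^ α * besselJ μ (l ^ 2 * y ^ 2 / 4)) * e2
  | zero =>
    exact ⟨⟨0, Submodule.zero_mem _, fun y _ => by simp⟩, by simp⟩
  | add u v _ _ hu hv =>
    obtain ⟨⟨w₁, hw₁, d₁⟩, t₁⟩ := hu
    obtain ⟨⟨w₂, hw₂, d₂⟩, t₂⟩ := hv
    refine ⟨⟨w₁ + w₂, Submodule.add_mem _ hw₁ hw₂, fun y hy => ?_⟩, fun N => ?_⟩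
    · refine ((d₁ y hy).add (d₂ y hy)).congr_deriv ?_
      simp only [Pi.add_apply]; ring
    · have := (t₁ N).add (t₂ N)
      rw [add_zero] at this
      refine this.congr fun y => ?_
      simp only [Pi.add_apply]; ring
  | smul c v _ hv =>
    obtain ⟨⟨w, hw, d⟩, t⟩ := hv
    refine ⟨⟨c • w, Submodule.smul_mem _ c hw, fun y hy => ?_⟩, fun N => ?_⟩
    · refine ((d y hy).const_mul c).congr_deriv ?_
      simp only [Pi.smul_apply, smul_eq_mul]; ring
    · have := (t N).const_mul c
      rw [mul_zero] at this
      refine this.congr fun y => ?_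
      simp only [Pi.smul_apply, smul_eq_mul]; ring

theorem RD.continuousOn {u : ℝ → ℝ} (hu : RD u) : ContinuousOn u (Ioi 0) := fun y hy => by
  obtain ⟨d, hd⟩ := hu.differentiable (show 0 < y from hy)
  exact hd.continuousAt.continuousWithinAt

theorem RD.integrableOn_Ioi {u v : ℝ → ℝ} (hu : RD u) (hv : RD v) (p : ℝ) :
    IntegrableOn (fun y => y ^ p * (u y * v y)) (Ioi 1) := by
  have h1 : Tendsto (fun y => y ^ (p + 2) * u y * v y) atTop (𝓝 0) := by
    simpa using (hu.tendsto (p + 2)).mul hv.tendsto'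
  have hloc : LocallyIntegrableOn (fun y => y ^ p * (u y * v y)) (Ici 1) := by
    refine ContinuousOn.locallyIntegrableOn ?_ measurableSet_Ici
    have hs : Ici (1 : ℝ) ⊆ Ioi 0 := fun y hy => lt_of_lt_of_le (one_pos : (0 : ℝ) < 1) hy
    refine ContinuousOn.mul (fun y hy => ?_) ((hu.continuousOn.mono hs).mul (hv.continuousOn.mono hs))
    exact (Real.continuousAt_rpow_const _ _ (Or.inl (ne_of_gt (hs hy)))).continuousWithinAt
  refine (hloc.integrableOn_of_isBigO_atTop (g := fun y => y ^ (-2 : ℝ)) ?_ ?_).mono_set Ioi_subset_Ici_self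
  · refine Asymptotics.IsBigO.of_bound 1 ?_
    filter_upwards [eventually_gt_atTop 0, h1.eventually (Metric.ball_mem_nhds 0 one_pos)] with y hy h
    have h : |y ^ (p + 2) * u y * v y| < 1 := by simpa using h
    have e : y ^ p * (u y * v y) = y ^ (-2 : ℝ) * (y ^ (p + 2) * u y * v y) := by
      rw [rpow_add hy, rpow_neg hy.le]; field_simp
    rw [e, norm_mul, mul_comm, Real.norm_eq_abs (_ * _)]
    gcongr
  · exact ⟨Ioi 1, Ioi_mem_atTop 1, integrableOn_Ioi_rpow_of_lt (by norm_num) one_pos⟩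

theorem integrableOn_pv_mul {p c d c' d' : ℝ} (h1 : -1 < p + c + c') (h2 : -1 < p + c + d')
    (h3 : -1 < p + d + c') (h4 : -1 < p + d + d') (f g f' g' : ES 0) (R : ℝ) :
    IntegrableOn (fun y => y ^ p * (pv c d f g y * pv c' d' f' g' y)) (Ioc 0 R) := by
  have hci : ∀ F G : ES 0, Continuous fun y : ℝ => F (0, y) * G (0, y) := fun F G =>
    (continuous_slice F).mul (continuous_slice G)
  refine ((((integrableOn_rpow_mul_Ioc h1 (hci f f') R).add
    (integrableOn_rpow_mul_Ioc h2 (hci f g') R)).add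
    (integrableOn_rpow_mul_Ioc h3 (hci g f') R)).add
    (integrableOn_rpow_mul_Ioc h4 (hci g g') R)).congr_fun (fun y hy => ?_) measurableSet_Ioc
  have hy : 0 < y := hy.1
  simp only [Pi.add_apply, pv, rpow_add hy]
  ring

theorem integrableOn_of_rd {p : ℝ} {u v : ℝ → ℝ} (hu : RD u) (hv : RD v)
    (h : IntegrableOn (fun y => y ^ p * (u y * v y)) (Ioc 0 1)) :
    IntegrableOn (fun y => y ^ p * (u y * v y)) (Ioi 0) := by
  rw [← Ioc_union_Ioi_eq_Ioi zero_le_one]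
  exact h.union (hu.integrableOn_Ioi hv p)

section Pairs

variable {a l : ℝ}

/-- The value `f + y^{2a} g`. -/
def val (a : ℝ) (φ : ES 0 × ES 0) (y : ℝ) : ℝ := pv 0 (2 * a) φ.1 φ.2 y

/-- `y ∂_y` of the value. -/
def dval (a : ℝ) (φ : ES 0 × ES 0) (y : ℝ) : ℝ :=
  pv 0 (2 * a) (θ φ.1) (θ φ.2 + (2 * a) • φ.2) y

theorem val_add (φ ψ : ES 0 × ES 0) (y : ℝ) : val a (φ + ψ) y = val a φ y + val a ψ y :=
  pv_add ..

theorem val_sub (φ ψ : ES 0 × ES 0) (y : ℝ) : val a (φ - ψ) y = val a φ y - val a ψ y :=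
  pv_sub ..

theorem val_smul (r : ℝ) (φ : ES 0 × ES 0) (y : ℝ) : val a (r • φ) y = r * val a φ y :=
  pv_smul ..

theorem hasDerivAt_val (φ : ES 0 × ES 0) {y : ℝ} (hy : 0 < y) :
    HasDerivAt (val a φ) (y⁻¹ * dval a φ y) y := by
  have := hasDerivAt_pv 0 (2 * a) φ.1 φ.2 hy
  rw [zero_smul, add_zero] at this
  exact this

/-- The second order operator `-∂² - (1-2a)/y ∂ + λ²`, on pairs. -/
def L1 (a l : ℝ) : Module.End ℝ (ES 0 × ES 0) :=
  LinearMap.prodMap (-wN Y Q (lamOp l) (-a)) (-wN Y Q (lamOp l) a)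

theorem Y_wN (c : ℝ) (f : ES 0) : Y (wN Y Q (lamOp l) c f) = T1 l c f - c ^ 2 • f := by
  have := congrArg (fun B : Module.End ℝ (ES 0) => B f)
    (wT_sub (A := Module.End ℝ (ES 0)) (Y := Y) (Q := Q) (Λ := lamOp l) c)
  exact this.symm

/-- `(y ∂_y)²` of the value. -/
def ddval (a : ℝ) (φ : ES 0 × ES 0) (y : ℝ) : ℝ :=
  dval a (θ φ.1, θ φ.2 + (2 * a) • φ.2) y

theorem hasDerivAt_dval (φ : ES 0 × ES 0) {y : ℝ} (hy : 0 < y) :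
    HasDerivAt (dval a φ) (y⁻¹ * ddval a φ y) y :=
  hasDerivAt_val (θ φ.1, θ φ.2 + (2 * a) • φ.2) hy

theorem sq_mul_val_L1 (φ : ES 0 × ES 0) (y : ℝ) : y ^ 2 * val a (L1 a l φ) y =
    l ^ 2 * y ^ 2 * val a φ y - (ddval a φ y - 2 * a * dval a φ y) := by
  have h1 := congrArg (fun F : ES 0 => F (0, y)) (Y_wN (l := l) (-a) φ.1)
  have h2 := congrArg (fun F : ES 0 => F (0, y)) (Y_wN (l := l) a φ.2)
  simp only [Y_app, T1_app, sub_app, smul_app] at h1 h2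
  simp only [val, dval, ddval, pv, L1, LinearMap.prodMap_apply, LinearMap.neg_apply, neg_app,
    map_add, map_smul, add_app, smul_app]
  linear_combination -(y ^ (0 : ℝ)) * h1 - y ^ (2 * a) * h2

theorem RD.dval {φ : ES 0 × ES 0} (h : RD (val a φ)) : RD (dval a φ) :=
  h.theta fun _ hy => hasDerivAt_val φ hy

theorem RD.L1 {φ : ES 0 × ES 0} (h : RD (val a φ)) : RD (val a (L1 a l φ)) := by
  have h2 : RD (ddval a φ) := h.dval.theta fun _ hy => hasDerivAt_dval φ hy
  refine ((h.smul (l ^ 2)).sub ((h2.sub (h.dval.smul (2 * a))).rpow_mul (-2))).congr fun y hy => ?_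
  have := sq_mul_val_L1 (a := a) (l := l) φ y
  have hy2 : y ^ (-2 : ℝ) = (y ^ 2)⁻¹ := by
    rw [rpow_neg hy.le]; norm_num
  rw [hy2]
  field_simp
  linarith

theorem dval_eq (φ : ES 0 × ES 0) {y : ℝ} (hy : 0 < y) :
    dval a φ y = pv 2 (2 * a) (Q φ.1) (θ φ.2 + (2 * a) • φ.2) y := by
  have : θ φ.1 (0, y) = y ^ 2 * Q φ.1 (0, y) := by rw [← Y_mul_Q]; rfl
  simp [dval, pv, this]

theorem integrableOn_val_mul (h0 : 0 < a) (h1 : a < 1) {φ ψ : ES 0 × ES 0} (hφ : RD (val a φ))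
    (hψ : RD (val a ψ)) :
    IntegrableOn (fun y => y ^ (1 - 2 * a) * (val a φ y * val a ψ y)) (Ioi 0) :=
  integrableOn_of_rd hφ hψ (integrableOn_pv_mul (by linarith) (by linarith) (by linarith)
    (by linarith) _ _ _ _ _)

theorem integrableOn_dval_mul (h0 : 0 < a) (h1 : a < 1) {φ ψ : ES 0 × ES 0} (hφ : RD (val a φ))
    (hψ : RD (val a ψ)) :
    IntegrableOn (fun y => y ^ (-1 - 2 * a) * (dval a φ y * dval a ψ y)) (Ioi 0) := by
  refine integrableOn_of_rd hφ.dval hψ.dval ?_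
  refine (integrableOn_pv_mul (p := -1 - 2 * a) (c := 2) (d := 2 * a) (c' := 2) (d' := 2 * a)
    (by linarith) (by linarith) (by linarith)
    (by linarith) (Q φ.1) (θ φ.2 + (2 * a) • φ.2) (Q ψ.1) (θ ψ.2 + (2 * a) • ψ.2) 1).congr_fun
    (fun y hy => ?_) measurableSet_Ioc
  simp only
  rw [dval_eq φ hy.1, dval_eq ψ hy.1]

theorem integral_L1_mul (h0 : 0 < a) (h1 : a < 1) {φ ψ : ES 0 × ES 0} (hφ : RD (val a φ))
    (hψ : RD (val a ψ)) :
    ∫ y in Ioi (0 : ℝ), y ^ (1 - 2 * a) * (val a (L1 a l φ) y * val a ψ y) =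
      l ^ 2 * (∫ y in Ioi (0 : ℝ), y ^ (1 - 2 * a) * (val a φ y * val a ψ y)) +
      (∫ y in Ioi (0 : ℝ), y ^ (-1 - 2 * a) * (dval a φ y * dval a ψ y)) +
      2 * a * φ.2 (0, 0) * ψ.1 (0, 0) := by
  have i1 := integrableOn_val_mul h0 h1 hφ hψ
  have i2 := integrableOn_val_mul h0 h1 (hφ.L1 (l := l)) hψ
  have i3 := integrableOn_dval_mul h0 h1 hφ hψ
  have hd : ∀ y, 0 < y → HasDerivAt (fun y => y ^ (-(2 * a)) * dval a φ y * val a ψ y)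
      (l ^ 2 * (y ^ (1 - 2 * a) * (val a φ y * val a ψ y)) -
        y ^ (1 - 2 * a) * (val a (L1 a l φ) y * val a ψ y) +
        y ^ (-1 - 2 * a) * (dval a φ y * dval a ψ y)) y := fun y hy => by
    refine (((Real.hasDerivAt_rpow_const (p := -(2 * a)) (Or.inl hy.ne')).mul
      (hasDerivAt_dval φ hy)).mul (hasDerivAt_val ψ hy)).congr_deriv ?_
    have e1 : y ^ (1 - 2 * a) = y ^ (-1 - 2 * a) * y ^ 2 := by
      have := rpow_mul_sq_pow hy (-1 - 2 * a) 1
      rw [mul_one] at this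
      rw [this]; congr 1; push_cast; ring
    have e2 : y ^ (-(2 * a)) = y ^ (-1 - 2 * a) * y := by
      rw [← rpow_add_one hy.ne']; congr 1; ring
    have e3 : y ^ (-(2 * a) - 1) = y ^ (-1 - 2 * a) := by congr 1; ring
    have := sq_mul_val_L1 (a := a) (l := l) φ y
    rw [e1, e2, e3]
    simp only [Pi.mul_apply]
    rw [e2]
    field_simp
    linear_combination val a ψ y * this
  have hlim0 : Tendsto (fun y => y ^ (-(2 * a)) * dval a φ y * val a ψ y) (𝓝[>] 0)
      (𝓝 (2 * a * φ.2 (0, 0) * ψ.1 (0, 0))) := by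
    have t1 := (rpow_mul_tendsto_zero (p := 2 - 2 * a) (by linarith) (continuous_slice (Q φ.1))).add
      (((continuous_slice (θ φ.2 + (2 * a) • φ.2)).tendsto 0).mono_left
        (nhdsWithin_le_nhds (s := Ioi 0)))
    have t2 := (((continuous_slice ψ.1).tendsto 0).mono_left
        (nhdsWithin_le_nhds (s := Ioi 0))).add
        (rpow_mul_tendsto_zero (p := 2 * a) (by linarith) (continuous_slice ψ.2))
    refine ((t1.mul t2).congr' ?_).trans_eq ?_
    · filter_upwards [self_mem_nhdsWithin] with y hy
      have hy : 0 < y := hy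
      rw [dval_eq φ hy]
      have e1 : y ^ (-(2 * a)) * y ^ (2 : ℝ) = y ^ (2 - 2 * a) := by
        rw [← rpow_add hy]; congr 1; ring
      have e2 : y ^ (-(2 * a)) * y ^ (2 * a) = 1 := by
        rw [← rpow_add hy]; simp
      simp only [pv, val, rpow_zero, one_mul]
      linear_combination -(Q φ.1 (0, y) * (ψ.1 (0, y) + y ^ (2 * a) * ψ.2 (0, y))) * e1 -
        ((θ φ.2 + (2 * a) • φ.2 : ES 0) (0, y) * (ψ.1 (0, y) + y ^ (2 * a) * ψ.2 (0, y))) * e2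
    · congr 1
      simp [θ_app]
  have hlim1 : Tendsto (fun y => y ^ (-(2 * a)) * dval a φ y * val a ψ y) atTop (𝓝 0) := by
    simpa using (hφ.dval.tendsto (-(2 * a))).mul hψ.tendsto'
  have := integral_Ioi_of_tendsto hd (((i1.const_mul (l ^ 2)).sub i2).add i3) hlim0 hlim1
  have e1 := integral_add ((i1.const_mul (l ^ 2)).sub i2) i3
  have e2 := integral_sub (i1.const_mul (l ^ 2)) i2
  rw [integral_const_mul] at e2
  simp only [Pi.sub_apply] at e1
  linarith

end Pairs

theorem θ_eq_of_hasDerivAt {f : ES 0} {d y : ℝ} (h : HasDerivAt (fun t => f (0, t)) d y) :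
    θ f (0, y) = y * d := by
  rw [θ_app, (hasDerivAt_slice (smooth f) 0 y).unique h]

open Classical in
/-- The entire solution of exponent `-ν`, as an even function. -/
def besE (l ν : ℝ) : ES 0 :=
  if h : NonInt ν then
    ⟨fun p => besselF (1 - ν) (l ^ 2 * p.2 ^ 2 / 4),
      (contDiff_besselF h.one_sub).comp (by fun_prop), fun x y => by simp⟩
  else 0

theorem besE_app {l ν : ℝ} (h : NonInt ν) (y : ℝ) :
    besE l ν (0, y) = besselF (1 - ν) (l ^ 2 * y ^ 2 / 4) := by
  rw [besE, dif_pos h]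

theorem besE_zero {l ν : ℝ} (h : NonInt ν) : besE l ν (0, 0) = 1 := by
  rw [besE_app h]; simp [besselF_zero]

theorem hasDerivAt_scale (l y : ℝ) :
    HasDerivAt (fun y : ℝ => l ^ 2 * y ^ 2 / 4) (l ^ 2 * y / 2) y := by
  refine (((hasDerivAt_pow 2 y).const_mul (l ^ 2)).div_const 4).congr_deriv ?_
  simp; ring

theorem T1_besE {l ν : ℝ} (h : NonInt ν) : T1 l (-ν) (besE l ν) = ν ^ 2 • besE l ν := by
  ext x y
  have hx : x = 0 := Subsingleton.elim _ _
  subst hx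
  have hb := h.one_sub
  have hb0 := hb.ne_zero
  have hb1 := hb.add_one.ne_zero
  have e1 : ∀ y, θ (besE l ν) (0, y)
      = y * (besselF (1 - ν + 1) (l ^ 2 * y ^ 2 / 4) / (1 - ν) * (l ^ 2 * y / 2)) := fun y =>
    θ_eq_of_hasDerivAt (by
      have := (hasDerivAt_besselF hb (l ^ 2 * y ^ 2 / 4)).comp y (hasDerivAt_scale l y)
      exact this.congr_of_eventuallyEq (Eventually.of_forall fun t => besE_app h t))
  have e2 := θ_eq_of_hasDerivAt (f := θ (besE l ν)) (y := y) (by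
    have h1 := (((hasDerivAt_besselF hb.add_one (l ^ 2 * y ^ 2 / 4)).comp y
      (hasDerivAt_scale l y)).div_const (1 - ν)).mul (((hasDerivAt_id y).const_mul (l ^ 2)).div_const 2)
    exact ((hasDerivAt_id y).mul h1).congr_of_eventuallyEq (Eventually.of_forall fun t => e1 t))
  have e3 := mul_deriv_besselF hb.add_one (l ^ 2 * y ^ 2 / 4)
  rw [add_sub_cancel_right] at e3
  rw [T1_app, e2, e1, smul_app, besE_app h]
  simp only [Function.comp, id, Pi.mul_apply]
  set z := l ^ 2 * y ^ 2 / 4 with hz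
  have hz2 : l ^ 2 * y ^ 2 = 4 * z := by rw [hz]; ring
  have e4 : besselF (1 - ν + 1 + 1) z / (1 - ν + 1) * z
      = (1 - ν) * besselF (1 - ν) z - (1 - ν) * besselF (1 - ν + 1) z := by linarith
  have e5 : (l ^ 2 * y ^ 2) * (besselF (1 - ν + 1 + 1) z / (1 - ν + 1)) =
      4 * ((1 - ν) * besselF (1 - ν) z - (1 - ν) * besselF (1 - ν + 1) z) := by
    rw [hz2]; linarith
  have e6 : (1 - ν) * (1 - ν)⁻¹ = 1 := mul_inv_cancel₀ hb0
  simp only [div_eq_mul_inv] at e5 ⊢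
  linear_combination (l ^ 2 * y ^ 2 * (1 - ν)⁻¹ / 4) * e5 +
    (l ^ 2 * y ^ 2) * (besselF (1 - ν) z) * e6

theorem T1_besE_neg {l ν : ℝ} (h : NonInt ν) :
    T1 l ν (besE l (-ν)) = ν ^ 2 • besE l (-ν) := by
  have := T1_besE (l := l) h.neg
  rwa [neg_neg, neg_sq] at this

open Polynomial in
theorem aeval_eigen {T : Module.End ℝ (ES 0)} {μ : ℝ} {f : ES 0} (h : T f = μ • f) (p : ℝ[X]) :
    aeval T p f = p.eval μ • f := by
  induction p using Polynomial.induction_on with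
  | C r => simp [Module.algebraMap_end_apply]
  | add p q hp hq => simp only [map_add, LinearMap.add_apply, hp, hq, eval_add, add_smul]
  | monomial k r ih =>
    rw [pow_succ', mul_left_comm, map_mul, aeval_X, mul_apply, ih, map_smul, h, smul_smul]
    rw [eval_mul (p := X), eval_X, mul_comm]

theorem wC_solution_of_lt {l c : ℝ} {i j : ℕ} (hij : i < j) {f : ES 0}
    (h : T1 l (c + 2 * i) f = (c + 2 * (i : ℝ)) ^ 2 • f) :
    wC Y Q (lamOp l) c j ((Y ^ i) f) = 0 := by
  apply Y_pow_injective j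
  rw [← aeval_chain (lamOp_comm l Y), aeval_Y_pow (lamOp_comm l Y), aeval_eigen h, map_zero]
  have : (chainPoly c j).eval ((c + 2 * (i : ℝ)) ^ 2) = 0 := by
    rw [chainPoly, Polynomial.eval_prod]
    exact Finset.prod_eq_zero (Finset.mem_range.2 hij) (by simp)
  rw [this, zero_smul, map_zero]

theorem wC_solution {l c : ℝ} (i j : ℕ) {f : ES 0}
    (h : T1 l (c + 2 * i) f = (c + 2 * (i : ℝ)) ^ 2 • f) :
    wC Y Q (lamOp l) c j ((Y ^ i) f) (0, 0) = if j = i then bNorm c j * f (0, 0) else 0 := by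
  split_ifs with hji
  · subst hji
    exact wC_Y_pow _ (lamOp_comm l Y) _ _ _ _
  · rcases lt_or_gt_of_ne hji with hlt | hlt
    · have : (Y ^ i) f = (Y ^ j) ((Y ^ (i - j)) f) := by
        rw [← mul_apply, ← pow_add]; congr 2; omega
      rw [this, wC_Y_pow _ (lamOp_comm l Y), Y_pow_app]
      change bNorm c j * ((0 : ℝ) ^ (2 * (i - j)) * f (0, 0)) = 0
      rw [zero_pow (by omega), zero_mul, mul_zero]
    · rw [wC_solution_of_lt hlt h]; rfl

theorem prod_erase_range (F : ℕ → ℝ) {j m : ℕ} (hj : j ≤ m) :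
    ∏ i ∈ (Finset.range (m + 1)).erase j, F i
      = (∏ i ∈ Finset.range j, F i) * ∏ i ∈ Finset.range (m - j), F (j + 1 + i) := by
  have h := Finset.prod_update_of_mem (Finset.mem_range.2 (Nat.lt_succ_of_le hj)) F 1
  rw [one_mul, Finset.sdiff_singleton_eq_erase] at h
  rw [← h, show m.succ = j + 1 + (m - j) by omega, Finset.prod_range_add, Finset.prod_range_succ]
  simp only [Function.update_self, mul_one]
  congr 1
  · refine Finset.prod_congr rfl fun i hi => Function.update_of_ne ?_ _ _
    have := Finset.mem_range.1 hi; omega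
  · refine Finset.prod_congr rfl fun i hi => Function.update_of_ne ?_ _ _
    omega

/-- `∏_{i ≠ j} (κ_j - κ_i)`, `i ≤ m`. -/
def bAll (γ : ℝ) (m j : ℕ) : ℝ :=
  ∏ i ∈ (Finset.range (m + 1)).erase j, ((γ - 2 * (j : ℝ)) ^ 2 - (γ - 2 * (i : ℝ)) ^ 2)

open Polynomial in
theorem exists_chain_split (c : ℝ) {j m : ℕ} (hj : j ≤ m) : ∃ q : ℝ[X],
    chainPoly c (m + 1) = chainPoly c j * ((X - C ((c + 2 * (j : ℝ)) ^ 2)) * q) ∧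
    bNorm c j * q.eval ((c + 2 * (j : ℝ)) ^ 2) =
      ∏ i ∈ (Finset.range (m + 1)).erase j, ((c + 2 * (j : ℝ)) ^ 2 - (c + 2 * (i : ℝ)) ^ 2) := by
  refine ⟨∏ i ∈ Finset.range (m - j), (X - C ((c + 2 * ((j + 1 + i : ℕ) : ℝ)) ^ 2)), ?_, ?_⟩
  · rw [chainPoly, chainPoly, show m + 1 = j + 1 + (m - j) by omega, Finset.prod_range_add,
      Finset.prod_range_succ, mul_assoc]
  · rw [prod_erase_range _ hj, bNorm_eq, eval_prod]
    simp

theorem bAll_eq_neg (γ : ℝ) (m j : ℕ) :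
    ∏ i ∈ (Finset.range (m + 1)).erase j, ((-γ + 2 * (j : ℝ)) ^ 2 - (-γ + 2 * (i : ℝ)) ^ 2)
      = bAll γ m j :=
  Finset.prod_congr rfl fun i _ => by ring

theorem bAll_eq_pos (γ : ℝ) {m j : ℕ} (hj : j ≤ m) :
    ∏ i ∈ (Finset.range (m + 1)).erase (m - j), ((γ - 2 * m + 2 * ((m - j : ℕ) : ℝ)) ^ 2
      - (γ - 2 * m + 2 * (i : ℝ)) ^ 2) = bAll γ m j := by
  refine Finset.prod_nbij' (fun i => m - i) (fun i => m - i) ?_ ?_ ?_ ?_ ?_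
  · intro i hi; simp only [Finset.mem_erase, Finset.mem_range] at hi ⊢; omega
  · intro i hi; simp only [Finset.mem_erase, Finset.mem_range] at hi ⊢; omega
  · intro i hi; simp only [Finset.mem_erase, Finset.mem_range] at hi; omega
  · intro i hi; simp only [Finset.mem_erase, Finset.mem_range] at hi; omega
  · intro i hi
    simp only [Finset.mem_erase, Finset.mem_range] at hi
    rw [Nat.cast_sub hj, Nat.cast_sub (by omega)]; ring

theorem gamma_prod {x : ℝ} (hx : NonInt x) (r : ℕ) :
    Gamma (x + 1) = (∏ i ∈ Finset.range r, (x - i)) * Gamma (x + 1 - r) := by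
  induction r with
  | zero => simp
  | succ r ih =>
    have h : NonInt (x - r) := by simpa using hx.sub_int r
    rw [ih, Finset.prod_range_succ, show x + 1 - r = x - r + 1 by ring, h.gamma_eq]
    push_cast
    rw [show x + 1 - (r + 1) = x - r by ring]; ring

theorem gamma_refl_sub {x : ℝ} (hx : NonInt x) (r : ℕ) :
    Gamma (x - r) * Gamma (1 - (x - r))
      = (-1) ^ r * (Gamma x * Gamma (1 - x)) := by
  induction r with
  | zero => simp
  | succ r ih =>
    have h : NonInt (x - r - 1) := by simpa using (hx.sub_int r).sub_one
    have e1 := h.gamma_eq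
    have e2 := h.neg.gamma_eq
    rw [pow_succ, mul_assoc, mul_comm (-1 : ℝ), ← mul_assoc, ← ih]
    push_cast
    rw [sub_add_cancel] at e1
    rw [show x - (r + 1) = x - r - 1 by ring, show 1 - (x - r - 1) = -(x - r - 1) + 1 by ring, e2,
      e1, show 1 - (x - r) = -(x - r - 1) by ring]
    ring

theorem prod_sub_erase {j m : ℕ} (hj : j ≤ m) :
    ∏ i ∈ (Finset.range (m + 1)).erase j, ((i : ℝ) - j)
      = (-1) ^ j * (j.factorial * (m - j).factorial) := by
  rw [prod_erase_range _ hj, ← mul_assoc]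
  congr 1
  · have h1 : ((-1 : ℝ)) ^ j = ∏ _i ∈ Finset.range j, (-1 : ℝ) := by simp
    rw [← Finset.prod_range_reflect, ← Finset.prod_range_add_one_eq_factorial, Nat.cast_prod,
      h1, ← Finset.prod_mul_distrib]
    refine Finset.prod_congr rfl fun i hi => ?_
    have := Finset.mem_range.1 hi
    rw [Nat.cast_sub (by omega), Nat.cast_sub (by omega)]
    push_cast; ring
  · rw [← Finset.prod_range_add_one_eq_factorial, Nat.cast_prod]
    exact Finset.prod_congr rfl fun i _ => by push_cast; ring

theorem sigma_aux {γ : ℝ} (hγ : NonInt γ) {j m : ℕ} (hj : j ≤ m) :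
    4 ^ m * (Gamma (γ - j + 1) * Gamma (j + 1) * Gamma (j + (m : ℝ) - γ + 1) *
      Gamma ((m : ℝ) - j + 1)) = (-1) ^ m * ((γ - 2 * j) * bAll γ m j) *
      (Gamma (γ - 2 * j) * Gamma (1 - (γ - 2 * j))) := by
  have hν : NonInt (γ - 2 * j) := by simpa using hγ.sub_int (2 * j)
  have hγj : NonInt (γ - j) := by simpa using hγ.sub_int j
  have e1 := gamma_prod hγj (m + 1)
  have e2 := gamma_refl_sub hν (m - j)
  have e3 := prod_sub_erase hj
  have e4 : bAll γ m j = 4 ^ m * (∏ i ∈ (Finset.range (m + 1)).erase j, ((i : ℝ) - j)) *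
      ∏ i ∈ (Finset.range (m + 1)).erase j, (γ - j - (i : ℝ)) := by
    have hc : ((Finset.range (m + 1)).erase j).card = m := by
      rw [Finset.card_erase_of_mem (Finset.mem_range.2 (by omega))]; simp
    rw [bAll]
    conv_rhs => rw [← hc, ← Finset.prod_const]
    rw [hc, ← Finset.prod_mul_distrib, ← Finset.prod_mul_distrib]
    exact Finset.prod_congr rfl fun i _ => by ring
  have e5 := Finset.mul_prod_erase (Finset.range (m + 1)) (fun i : ℕ => γ - j - (i : ℝ))
    (Finset.mem_range.2 (by omega : j < m + 1))
  have e6 : Gamma ((j : ℝ) + 1) = j.factorial := Real.Gamma_nat_eq_factorial j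
  have e7 : Gamma ((m : ℝ) - j + 1) = (m - j).factorial := by
    rw [← Nat.cast_sub hj]; exact Real.Gamma_nat_eq_factorial (m - j)
  rw [Nat.cast_sub hj, show γ - 2 * (j : ℝ) - ((m : ℝ) - j) = γ - j - m by ring] at e2
  push_cast at e1
  rw [show γ - (j : ℝ) + 1 - ((m : ℝ) + 1) = γ - j - m by ring, ← e5] at e1
  rw [show (j : ℝ) + m - γ + 1 = 1 - (γ - j - m) by ring, e1, e6, e7, e4, e3]
  have e8 : ((-1 : ℝ)) ^ m * (-1) ^ j = (-1) ^ (m - j) := by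
    obtain ⟨d, rfl⟩ := Nat.exists_eq_add_of_le hj
    rw [Nat.add_sub_cancel_left, pow_add, mul_right_comm, ← mul_pow]; simp
  set PP := ∏ i ∈ (Finset.range (m + 1)).erase j, (γ - j - (i : ℝ))
  linear_combination (4 ^ m * (γ - 2 * j) * PP * j.factorial * (m - j).factorial) * e2 -
    (4 ^ m * (γ - 2 * j) * PP * j.factorial * (m - j).factorial) *
      (Gamma (γ - 2 * j) * Gamma (1 - (γ - 2 * j))) * e8

theorem gamma_mul_ne_zero {x : ℝ} (hx : NonInt x) : Gamma x ≠ 0 :=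
  Real.Gamma_ne_zero fun m h => hx (-m) (by push_cast; exact h)

theorem nonInt_of_fract {γ : ℝ} (ha : 0 < fract γ) : NonInt γ := ne_intCast_of_fract_pos ha

theorem nonInt_sub {γ : ℝ} (ha : 0 < fract γ) (j : ℕ) : NonInt (γ - 2 * j) := by
  simpa using (nonInt_of_fract ha).sub_int (2 * j)

theorem le_floor_half_iff {γ : ℝ} (hγ : 0 ≤ γ) (ha : 0 < fract γ) (j : ℕ) :
    j ≤ ⌊γ / 2⌋₊ ↔ 0 < γ - 2 * j := by
  rw [Nat.le_floor_iff (by positivity)]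
  constructor
  · intro h
    have h1 := (nonInt_sub ha j).ne_zero
    exact lt_of_le_of_ne (by linarith) h1.symm
  · intro h; linarith

theorem sigma_eq {γ : ℝ} (hγ : 0 ≤ γ) (ha : 0 < fract γ) {j : ℕ} (hj : j ≤ ⌊γ⌋₊) :
    sigma γ j = (-1) ^ ⌊γ⌋₊ * (2 * |γ - 2 * j| * bAll γ ⌊γ⌋₊ j) := by
  have h := sigma_aux (nonInt_of_fract ha) hj
  have hν := nonInt_sub ha j
  have g1 := gamma_mul_ne_zero hν
  have g2 := gamma_mul_ne_zero hν.one_sub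
  rw [sigma, mul_assoc 2, h]
  split_ifs with h0 <;> rw [le_floor_half_iff hγ ha] at h0
  · rw [abs_of_pos h0, show 2 * (j : ℝ) - γ + 1 = 1 - (γ - 2 * j) by ring]
    field_simp
  · have h0' : γ - 2 * j < 0 := lt_of_le_of_ne (not_lt.1 h0) hν.ne_zero
    have e1 := hν.gamma_eq
    have e2 := hν.neg.gamma_eq
    have h3 := hν.ne_zero
    have g3 := gamma_mul_ne_zero hν.neg
    rw [abs_of_neg h0', show 1 - (γ - 2 * (j : ℝ)) = -(γ - 2 * j) + 1 by ring, e1, e2,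
      show 2 * (j : ℝ) - γ = -(γ - 2 * j) by ring]
    field_simp

theorem sigma_pos_aux {γ : ℝ} (hγ : 0 ≤ γ) (ha : 0 < fract γ) {j : ℕ} (hj : j ≤ ⌊γ⌋₊) :
    0 < -(sigma γ j * (Gamma (-|γ - 2 * j|) / Gamma |γ - 2 * j|)) := by
  have hν := nonInt_sub ha j
  have hj' : (j : ℝ) ≤ ⌊γ⌋₊ := by exact_mod_cast hj
  have hfl := Nat.floor_le hγ
  have hfl2 := Nat.lt_floor_add_one γ
  have hj0 : (0 : ℝ) ≤ j := by positivity
  have p1 : 0 < Gamma (γ - j + 1) := Real.Gamma_pos_of_pos (by linarith)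
  have p2 : 0 < Gamma ((j : ℝ) + 1) := Real.Gamma_pos_of_pos (by linarith)
  have p3 : 0 < Gamma (j + (⌊γ⌋₊ : ℝ) - γ + 1) := Real.Gamma_pos_of_pos (by linarith)
  have p4 : 0 < Gamma ((⌊γ⌋₊ : ℝ) - j + 1) := Real.Gamma_pos_of_pos (by linarith)
  have key : ∀ x : ℝ, 0 < x → NonInt x →
      -((Gamma x * Gamma (1 - x))⁻¹ * (Gamma (-x) / Gamma x))
        = (x * Gamma x ^ 2)⁻¹ := fun x hx hn => by
    have e2 := hn.neg.gamma_eq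
    have g1 := gamma_mul_ne_zero hn
    have g2 := gamma_mul_ne_zero hn.neg
    rw [show 1 - x = -x + 1 by ring, e2]
    field_simp
  have hfin : ∀ x : ℝ, 0 < x → NonInt x → ∀ K : ℝ, 0 < K →
      0 < -(K / (Gamma x * Gamma (1 - x)) * (Gamma (-x) / Gamma x)) :=
    fun x hx hn K hK => by
      have g1 := Real.Gamma_pos_of_pos hx
      rw [div_eq_mul_inv, mul_assoc, ← mul_neg, key x hx hn]
      positivity
  rw [sigma]
  split_ifs with h0 <;> rw [le_floor_half_iff hγ ha] at h0
  · rw [abs_of_pos h0, show 2 * (j : ℝ) - γ + 1 = 1 - (γ - 2 * j) by ring]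
    exact hfin _ h0 hν _ (by positivity)
  · have h0' : γ - 2 * j < 0 := lt_of_le_of_ne (not_lt.1 h0) hν.ne_zero
    rw [abs_of_neg h0', mul_comm (Gamma (γ - 2 * j + 1)),
      show γ - 2 * j + 1 = 1 - -(γ - 2 * (j : ℝ)) by ring,
      show 2 * (j : ℝ) - γ = -(γ - 2 * j) by ring]
    exact hfin _ (by linarith) hν.neg _ (by positivity)

section Vanishing

variable {a l : ℝ}

theorem wN_Y_pow_succ (c : ℝ) (r : ℕ) (f : ES 0) : ∃ F, wN Y Q (lamOp l) c ((Y ^ (r + 1)) f) = (Y ^ r) F := by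
  refine ⟨T1 l (c + 2 * (r + 1 : ℕ)) f - c ^ 2 • f, Y_injective ?_⟩
  have h := aeval_Y_pow (lamOp_comm l Y) Polynomial.X c (r + 1) f
  rw [Polynomial.aeval_X, Polynomial.aeval_X] at h
  rw [Y_wN, h, ← map_smul (Y ^ (r + 1)), ← map_sub (Y ^ (r + 1)), pow_succ', mul_apply]

theorem exists_Y_pow_of_wC {c : ℝ} (hb : ∀ i, bNorm c i ≠ 0) {r : ℕ} {f : ES 0}
    (h : ∀ i < r, wC Y Q (lamOp l) c i f (0, 0) = 0) : ∃ F, f = (Y ^ r) F := by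
  induction r with
  | zero => exact ⟨f, rfl⟩
  | succ r ih =>
    obtain ⟨F, rfl⟩ := ih fun i hi => h i (by omega)
    have h1 := h r (by omega)
    rw [wC_Y_pow _ (lamOp_comm l Y)] at h1
    refine ⟨S F, ?_⟩
    rw [pow_succ, mul_apply, ← eq_Y_S ((mul_eq_zero.1 h1).resolve_left (hb r))]

theorem L1_pow_vanish {r s : ℕ} {φ : ES 0 × ES 0} (h1 : ∃ F, φ.1 = (Y ^ r) F)
    (h2 : ∃ F, φ.2 = (Y ^ s) F) (i : ℕ) :
    (∃ F, ((L1 a l ^ i) φ).1 = (Y ^ (r - i)) F) ∧ ∃ F, ((L1 a l ^ i) φ).2 = (Y ^ (s - i)) F := by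
  have step : ∀ (c : ℝ) (r : ℕ) (f : ES 0), (∃ F, f = (Y ^ r) F) →
      ∃ F, (-wN Y Q (lamOp l) c) f = (Y ^ (r - 1)) F := by
    rintro c r _ ⟨F, rfl⟩
    cases r with
    | zero => exact ⟨_, rfl⟩
    | succ r =>
      obtain ⟨G, hG⟩ := wN_Y_pow_succ (l := l) c r F
      exact ⟨-G, by rw [LinearMap.neg_apply, hG, map_neg]; rfl⟩
  induction i with
  | zero => exact ⟨h1, h2⟩
  | succ i ih =>
    rw [pow_succ', mul_apply]
    rw [← Nat.sub_sub, ← Nat.sub_sub]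
    exact ⟨step (-a) _ _ ih.1, step a _ _ ih.2⟩

theorem app_zero_of_Y_pow {r : ℕ} (hr : 0 < r) {f : ES 0} (h : ∃ F, f = (Y ^ r) F) :
    f (0, 0) = 0 := by
  obtain ⟨F, rfl⟩ := h
  rw [Y_pow_app, zero_pow (by omega), zero_mul]

end Vanishing

section Coercive

variable {a l : ℝ}

/-- The weighted `L²` product of two pairs. -/
def ip (a : ℝ) (φ ψ : ES 0 × ES 0) : ℝ :=
  ∫ y in Ioi (0 : ℝ), y ^ (1 - 2 * a) * (val a φ y * val a ψ y)

/-- The weighted `L²` norm of the derivative. -/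
def dip (a : ℝ) (φ ψ : ES 0 × ES 0) : ℝ :=
  ∫ y in Ioi (0 : ℝ), y ^ (-1 - 2 * a) * (dval a φ y * dval a ψ y)

theorem ip_comm (φ ψ : ES 0 × ES 0) : ip a φ ψ = ip a ψ φ := by
  simp only [ip, mul_comm (val a φ _)]

theorem dip_comm (φ ψ : ES 0 × ES 0) : dip a φ ψ = dip a ψ φ := by
  simp only [dip, mul_comm (dval a φ _)]

theorem ip_self_nonneg (φ : ES 0 × ES 0) : 0 ≤ ip a φ φ :=
  setIntegral_nonneg measurableSet_Ioi fun y hy => by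
    have hy : 0 < y := hy
    have := mul_self_nonneg (val a φ y)
    positivity

theorem dip_self_nonneg (φ : ES 0 × ES 0) : 0 ≤ dip a φ φ :=
  setIntegral_nonneg measurableSet_Ioi fun y hy => by
    have hy : 0 < y := hy
    have := mul_self_nonneg (dval a φ y)
    positivity

theorem ip_L1 (h0 : 0 < a) (h1 : a < 1) {φ ψ : ES 0 × ES 0} (hφ : RD (val a φ)) (hψ : RD (val a ψ)) :
    ip a (L1 a l φ) ψ = l ^ 2 * ip a φ ψ + dip a φ ψ + 2 * a * φ.2 (0, 0) * ψ.1 (0, 0) :=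
  integral_L1_mul h0 h1 hφ hψ

theorem ip_L1_sq (h0 : 0 < a) (h1 : a < 1) {φ : ES 0 × ES 0} (hφ : RD (val a φ))
    (hz : φ.1 (0, 0) = 0) :
    2 * l ^ 2 * dip a φ φ + l ^ 4 * ip a φ φ ≤ ip a (L1 a l φ) (L1 a l φ) := by
  have e := ip_L1 (l := l) h0 h1 hφ hφ
  rw [hz, mul_zero, add_zero] at e
  have i1 := integrableOn_val_mul h0 h1 hφ hφ
  have i2 := integrableOn_val_mul h0 h1 (hφ.L1 (l := l)) hφ
  have i3 := integrableOn_val_mul h0 h1 (hφ.L1 (l := l)) (hφ.L1 (l := l))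
  have key : 2 * l ^ 2 * ip a (L1 a l φ) φ - l ^ 4 * ip a φ φ ≤ ip a (L1 a l φ) (L1 a l φ) := by
    simp only [ip]
    rw [← integral_const_mul, ← integral_const_mul,
      ← integral_sub (i2.const_mul _) (i1.const_mul _)]
    refine setIntegral_mono_on ((i2.const_mul _).sub (i1.const_mul _)) i3 measurableSet_Ioi
      fun y hy => ?_
    have hy : 0 < y := hy
    have : 0 ≤ y ^ (1 - 2 * a) * (val a (L1 a l φ) y - l ^ 2 * val a φ y) ^ 2 := by positivity
    linarith
  rw [e] at key
  linarith

theorem RD.L1_pow {φ : ES 0 × ES 0} (hφ : RD (val a φ)) (i : ℕ) : RD (val a ((HalfSpace.L1 a l ^ i) φ)) := by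
  induction i with
  | zero => exact hφ
  | succ i ih => rw [pow_succ', mul_apply]; exact ih.L1

theorem ip_L1_pow_shift (h0 : 0 < a) (h1 : a < 1) {φ : ES 0 × ES 0} (hφ : RD (val a φ)) {q : ℕ}
    (hz : ∀ i < q, ((L1 a l ^ i) φ).1 (0, 0) = 0 ∧ ((L1 a l ^ i) φ).2 (0, 0) = 0) (j : ℕ) :
    ∀ i ≤ q, ip a φ ((L1 a l ^ (q + j)) φ)
      = ip a ((L1 a l ^ i) φ) ((L1 a l ^ (q + j - i)) φ) := by
  intro i
  induction i with
  | zero => intro _; rfl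
  | succ i ih =>
    intro hi
    obtain ⟨z1, z2⟩ := hz i (by omega)
    rw [ih (by omega), show q + j - i = (q + j - (i + 1)) + 1 by omega, pow_succ',
      mul_apply, pow_succ', mul_apply, ip_comm,
      ip_L1 h0 h1 (hφ.L1_pow _) (hφ.L1_pow _), ip_L1 h0 h1 (hφ.L1_pow _) (hφ.L1_pow _), z1, z2,
      ip_comm, dip_comm]
    ring

theorem ip_L1_pow_ge (h0 : 0 < a) (h1 : a < 1) {φ : ES 0 × ES 0} (hφ : RD (val a φ)) {q : ℕ}
    (hz : ∀ i < q, ((L1 a l ^ i) φ).1 (0, 0) = 0) (hq : 0 < q) :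
    2 * l ^ (4 * q - 2) * dip a φ φ ≤ ip a ((L1 a l ^ q) φ) ((L1 a l ^ q) φ) := by
  induction q with
  | zero => omega
  | succ q ih =>
    have h := ip_L1_sq (l := l) h0 h1 (hφ.L1_pow (l := l) q) (hz q (by omega))
    rw [← mul_apply, ← pow_succ'] at h
    have hd := dip_self_nonneg (a := a) ((L1 a l ^ q) φ)
    refine le_trans ?_ h
    rcases Nat.eq_zero_or_pos q with rfl | hq
    · have := ip_self_nonneg (a := a) φ
      have h4 : 0 ≤ l ^ 4 * ip a φ φ := by positivity
      simpa using h4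
    · have := ih (fun i hi => hz i (by omega)) hq
      have e : l ^ (4 * (q + 1) - 2) = l ^ 4 * l ^ (4 * q - 2) := by
        rw [← pow_add]; congr 1; omega
      rw [e]
      have h4 : 0 ≤ l ^ 4 := by positivity
      have h5 := mul_le_mul_of_nonneg_left this h4
      have h6 : 0 ≤ 2 * l ^ 2 * dip a ((L1 a l ^ q) φ) ((L1 a l ^ q) φ) := by positivity
      linarith

theorem ip_L1_pow_coercive (h0 : 0 < a) (h1 : a < 1) {φ : ES 0 × ES 0} (hφ : RD (val a φ)) {m : ℕ}
    (hv1 : ∃ F, φ.1 = (Y ^ (m / 2 + 1)) F) (hv2 : ∃ F, φ.2 = (Y ^ (m - m / 2)) F) :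
    l ^ (2 * m) * dip a φ φ ≤ ip a φ ((L1 a l ^ (m + 1)) φ) := by
  set q := m - m / 2 with hq
  have hz1 : ∀ i ≤ m / 2, ((L1 a l ^ i) φ).1 (0, 0) = 0 := fun i hi =>
    app_zero_of_Y_pow (by omega) (L1_pow_vanish hv1 hv2 i).1
  have hz : ∀ i < q, ((L1 a l ^ i) φ).1 (0, 0) = 0 ∧ ((L1 a l ^ i) φ).2 (0, 0) = 0 := fun i hi =>
    ⟨hz1 i (by omega), app_zero_of_Y_pow (by omega) (L1_pow_vanish hv1 hv2 i).2⟩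
  have hd := dip_self_nonneg (a := a) φ
  rcases Nat.even_or_odd m with hm | hm
  · obtain ⟨p, rfl⟩ := hm
    have hqp : q = p := by omega
    have h := ip_L1_pow_shift h0 h1 hφ hz (p + 1) q le_rfl
    rw [show q + (p + 1) = p + p + 1 by omega, show p + p + 1 - q = p + 1 by omega, hqp] at h
    have h' : ip a ((L1 a l ^ p) φ) ((L1 a l ^ (p + 1)) φ) = l ^ 2 *
        ip a ((L1 a l ^ p) φ) ((L1 a l ^ p) φ) + dip a ((L1 a l ^ p) φ) ((L1 a l ^ p) φ) := by
      rw [pow_succ', mul_apply, ip_comm, ip_L1 h0 h1 (hφ.L1_pow _) (hφ.L1_pow _),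
        hz1 p (by omega), mul_zero, add_zero]
    rw [h, h']
    rcases Nat.eq_zero_or_pos p with rfl | hp
    · have := ip_self_nonneg (a := a) φ
      have h4 : 0 ≤ l ^ 2 * ip a φ φ := by positivity
      simpa using h4
    · have h2 := ip_L1_pow_ge (l := l) (q := p) h0 h1 hφ (fun i hi => (hz i (by omega)).1) hp
      have h3 := dip_self_nonneg (a := a) ((L1 a l ^ p) φ)
      have h5 := mul_le_mul_of_nonneg_left h2 (sq_nonneg l)
      have e : l ^ (2 * (p + p)) = l ^ 2 * l ^ (4 * p - 2) := by rw [← pow_add]; congr 1; omega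
      have h6 : 0 ≤ l ^ (2 * (p + p)) * dip a φ φ :=
        mul_nonneg (by rw [pow_mul]; positivity) hd
      rw [e] at h6 ⊢
      linarith
  · obtain ⟨p, rfl⟩ := hm
    have hqp : q = p + 1 := by omega
    have h := ip_L1_pow_shift h0 h1 hφ hz (p + 1) q le_rfl
    rw [show q + (p + 1) = 2 * p + 1 + 1 by omega, show 2 * p + 1 + 1 - q = p + 1 by omega, hqp] at h
    rw [h]
    have h2 := ip_L1_pow_ge (l := l) (q := p + 1) h0 h1 hφ (fun i hi => (hz i (by omega)).1)
      (by omega)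
    have e : 4 * (p + 1) - 2 = 2 * (2 * p + 1) := by omega
    have h6 : 0 ≤ l ^ (2 * (2 * p + 1)) * dip a φ φ :=
      mul_nonneg (by rw [pow_mul]; positivity) hd
    rw [e] at h2
    linarith

theorem val_sq_le (h0 : 0 < a) (h1 : a < 1) {φ : ES 0 × ES 0} (hφ : RD (val a φ))
    (hz : φ.1 (0, 0) = 0) {y : ℝ} (hy : 0 < y) :
    val a φ y ^ 2 ≤ y ^ (2 * a) / (2 * a) * dip a φ φ := by
  have i1 := (integrableOn_dval_mul h0 h1 hφ hφ)
  have i1y : IntegrableOn (fun s => s ^ (-1 - 2 * a) * (dval a φ s * dval a φ s)) (Ioc 0 y) :=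
    i1.mono_set Ioc_subset_Ioi_self
  have i3 : IntegrableOn (fun s : ℝ => s ^ (2 * a - 1)) (Ioc 0 y) := by
    simpa using integrableOn_rpow_mul_Ioc (p := 2 * a - 1) (by linarith) continuous_const (F := fun _ => 1) y
  have i2 : IntegrableOn (fun s => s⁻¹ * dval a φ s) (Ioc 0 y) := by
    refine ((integrableOn_rpow_mul_Ioc (p := 1) (by norm_num) (continuous_slice (Q φ.1)) y).add
      (integrableOn_rpow_mul_Ioc (p := 2 * a - 1) (by linarith)
        (continuous_slice (θ φ.2 + (2 * a) • φ.2)) y)).congr_fun (fun s hs => ?_) measurableSet_Ioc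
    have hs0 : 0 < s := hs.1
    simp only [Pi.add_apply]
    rw [dval_eq φ hs0, pv, rpow_sub_one hs0.ne', rpow_one, rpow_two]
    field_simp
  have e2 : ∫ s in Ioc 0 y, s⁻¹ * dval a φ s = val a φ y := by
    rw [← intervalIntegral.integral_of_le hy.le]
    have := intervalIntegral.integral_eq_sub_of_hasDerivAt_of_tendsto (a := 0) (b := y)
      (f := val a φ) (f' := fun s => s⁻¹ * dval a φ s) (fa := 0) (fb := val a φ y) hy
      (fun s hs => hasDerivAt_val φ hs.1)
      ((intervalIntegrable_iff_integrableOn_Ioc_of_le hy.le).2 i2) ?_ ?_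
    · rw [this, sub_zero]
    · have t := (((continuous_slice φ.1).tendsto 0).mono_left
        (nhdsWithin_le_nhds (s := Ioi 0))).add
        (rpow_mul_tendsto_zero (p := 2 * a) (by linarith) (continuous_slice φ.2))
      rw [hz, add_zero] at t
      refine t.congr fun s => ?_
      simp [val, pv]
    · exact (hasDerivAt_val φ hy).continuousAt.tendsto.mono_left nhdsWithin_le_nhds
  have e3 : ∫ s in Ioc 0 y, s ^ (2 * a - 1) = y ^ (2 * a) / (2 * a) := by
    rw [← intervalIntegral.integral_of_le hy.le, integral_rpow (Or.inl (by linarith)),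
      sub_add_cancel, Real.zero_rpow (by linarith), sub_zero]
  have e1 : ∫ s in Ioc 0 y, s ^ (-1 - 2 * a) * (dval a φ s * dval a φ s) ≤ dip a φ φ :=
    setIntegral_mono_set i1 (by
      filter_upwards [ae_restrict_mem measurableSet_Ioi] with s hs
      have hs : 0 < s := hs
      have := mul_self_nonneg (dval a φ s)
      simp only [Pi.zero_apply]; positivity) Ioc_subset_Ioi_self.eventuallyLE
  have key : ∀ t : ℝ, 0 ≤ (∫ s in Ioc 0 y, s ^ (-1 - 2 * a) * (dval a φ s * dval a φ s))
      - 2 * t * val a φ y + t ^ 2 * (y ^ (2 * a) / (2 * a)) := fun t => by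
    have i12 : IntegrableOn (fun s => s ^ (-1 - 2 * a) * (dval a φ s * dval a φ s) -
      2 * t * (s⁻¹ * dval a φ s)) (Ioc 0 y) := i1y.sub (i2.const_mul _)
    rw [← e2, ← e3, ← integral_const_mul, ← integral_const_mul,
      ← integral_sub i1y (i2.const_mul _), ← integral_add i12 (i3.const_mul _)]
    refine setIntegral_nonneg measurableSet_Ioc fun s hs => ?_
    have hs0 : 0 < s := hs.1
    have e4 : s⁻¹ = s ^ (-1 - 2 * a) * s ^ (2 * a) := by
      rw [← rpow_add hs0, ← rpow_neg_one]; congr 1; ring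
    have e5 : s ^ (2 * a - 1) = s ^ (-1 - 2 * a) * (s ^ (2 * a) * s ^ (2 * a)) := by
      rw [← rpow_add hs0, ← rpow_add hs0]; congr 1; ring
    have : 0 ≤ s ^ (-1 - 2 * a) * (dval a φ s - t * s ^ (2 * a)) ^ 2 := by positivity
    rw [e4, e5]
    linarith
  have hB : 0 < y ^ (2 * a) / (2 * a) := by positivity
  have := key (val a φ y / (y ^ (2 * a) / (2 * a)))
  set B := y ^ (2 * a) / (2 * a)
  have e6 : (val a φ y / B) ^ 2 * B = val a φ y ^ 2 / B := by field_simp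
  have e7 : 2 * (val a φ y / B) * val a φ y = 2 * (val a φ y ^ 2 / B) := by field_simp
  rw [e6, e7] at this
  have h8 : val a φ y ^ 2 / B ≤ dip a φ φ := by linarith
  rwa [div_le_iff₀ hB, mul_comm] at h8

end Coercive

/-- The constant of the connection formula at frequency `l`. -/
def kap (ν l : ℝ) : ℝ := (l ^ 2 / 4) ^ ν * (Gamma (-ν) / Gamma ν)

/-- The coefficient of the branch `y^{-ν}` in the decaying solution. -/
def cA (ν l : ℝ) : ℝ := if 0 < ν then 1 else kap (-ν) l

/-- The decaying solution of `((y ∂_y)² - l² y² - ν²) k = 0`. -/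
def kSol (ν l y : ℝ) : ℝ := pv (-ν) ν (cA ν l • besE l ν) (cA (-ν) l • besE l (-ν)) y

theorem kSol_neg (ν l y : ℝ) : kSol (-ν) l y = kSol ν l y := by
  simp only [kSol, pv, neg_neg]; ring

theorem kSol_abs (ν l y : ℝ) : kSol |ν| l y = kSol ν l y := by
  rcases abs_cases ν with ⟨h, -⟩ | ⟨h, -⟩ <;> rw [h]
  exact kSol_neg ν l y

theorem NonInt.abs {ν : ℝ} (h : NonInt ν) : NonInt |ν| := by
  rcases abs_cases ν with ⟨h', -⟩ | ⟨h', -⟩ <;> rw [h']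
  exacts [h, h.neg]

theorem NonInt.abs_pos {ν : ℝ} (h : NonInt ν) : 0 < |ν| := _root_.abs_pos.2 h.ne_zero

theorem kSol_of_pos {ν l y : ℝ} (h : NonInt ν) (hν : 0 < ν) (hl : 0 < l) (hy : 0 < y) :
    kSol ν l y = y ^ (-ν) * (besselJ ν (l ^ 2 * y ^ 2 / 4) / Gamma ν) := by
  have hz : 0 < l ^ 2 * y ^ 2 / 4 := by positivity
  have g := (Real.Gamma_pos_of_pos hν).ne'
  have e1 : (l ^ 2 * y ^ 2 / 4) ^ ν = (l ^ 2 / 4) ^ ν * (y ^ ν * y ^ ν) := by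
    rw [show l ^ 2 * y ^ 2 / 4 = l ^ 2 / 4 * (y * y) by ring, mul_rpow (by positivity)
      (by positivity), mul_rpow hy.le hy.le]
  have e2 : y ^ (-ν) * y ^ ν = 1 := by rw [← rpow_add hy]; simp
  rw [besselJ_eq h hz, kSol, pv, cA, cA, if_pos hν, if_neg (by linarith), neg_neg, smul_app,
    smul_app, besE_app h, besE_app h.neg, e1, kap, sub_neg_eq_add]
  field_simp
  linear_combination -((l ^ 2 / 4) ^ ν * y ^ ν * Gamma (-ν) * besselF (1 + ν) (l ^ 2 * y ^ 2 / 4)) * e2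

theorem kSol_pos {ν l y : ℝ} (h : NonInt ν) (hl : 0 < l) (hy : 0 < y) : 0 < kSol ν l y := by
  rw [← kSol_abs, kSol_of_pos h.abs h.abs_pos hl hy]
  have := besselJ_pos (show 0 < l ^ 2 * y ^ 2 / 4 by positivity) |ν|
  have := Real.Gamma_pos_of_pos h.abs_pos
  positivity

theorem rd_kSol {ν l : ℝ} (h : NonInt ν) (hl : 0 < l) : RD (kSol ν l) := by
  refine (((rd_besselJ hl |ν|).smul (Gamma |ν|)⁻¹).rpow_mul (-|ν|)).congr fun y hy => ?_
  rw [← kSol_abs, kSol_of_pos h.abs h.abs_pos hl hy]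
  ring

section OneDim

variable {γ l : ℝ}

/-- The decaying solution of index `j`, as a pair. -/
def hPair (γ l : ℝ) (j : ℕ) : ES 0 × ES 0 :=
  (cA (γ - 2 * j) l • (Y ^ j) (besE l (γ - 2 * j)),
    cA (-(γ - 2 * j)) l • (Y ^ (⌊γ⌋₊ - j)) (besE l (-(γ - 2 * j))))

theorem val_hPair (hγ : 0 ≤ γ) {j : ℕ} (hj : j ≤ ⌊γ⌋₊) {y : ℝ} (hy : 0 < y) :
    val (fract γ) (hPair γ l j) y = y ^ γ * kSol (γ - 2 * j) l y := by
  have e1 : y ^ γ * y ^ (-(γ - 2 * (j : ℝ))) = y ^ (0 : ℝ) * y ^ (2 * j) := by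
    rw [rpow_mul_sq_pow hy, ← rpow_add hy]; congr 1; ring
  have e2 : y ^ γ * y ^ (γ - 2 * (j : ℝ)) = y ^ (2 * fract γ) * y ^ (2 * (⌊γ⌋₊ - j)) := by
    rw [rpow_mul_sq_pow hy, ← rpow_add hy, two_mul_fract hγ, Nat.cast_sub hj]; congr 1; ring
  simp only [val, hPair, pv, kSol, smul_app, Y_pow_app]
  linear_combination -(cA (γ - 2 * j) l * besE l (γ - 2 * j) (0, y)) * e1 -
    (cA (-(γ - 2 * j)) l * besE l (-(γ - 2 * j)) (0, y)) * e2

/-- Evaluation at the boundary. -/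
def ev0 : ES 0 →ₗ[ℝ] ℝ where
  toFun f := f (0, 0)
  map_add' _ _ := rfl
  map_smul' _ _ := rfl

/-- The boundary operators `B_{2j}` at frequency `l`. -/
def lowE (γ l : ℝ) (j : ℕ) : ES 0 →ₗ[ℝ] ℝ :=
  (bNorm (-γ) j)⁻¹ • (ev0 ∘ₗ wC Y Q (lamOp l) (-γ) j)

/-- The boundary operators `B_{2γ-2j}` at frequency `l`. -/
def lowF (γ l : ℝ) (j : ℕ) : ES 0 →ₗ[ℝ] ℝ :=
  (bNorm δ[γ] (⌊γ⌋₊ - j))⁻¹ •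
    (ev0 ∘ₗ wC Y Q (lamOp l) δ[γ] (⌊γ⌋₊ - j))

theorem lowE_app (j : ℕ) (f : ES 0) : lowE γ l j f =
    wC Y Q (lamOp l) (-γ) j f (0, 0) / bNorm (-γ) j := by
  rw [div_eq_inv_mul]; rfl

theorem lowF_app (j : ℕ) (f : ES 0) : lowF γ l j f =
    wC Y Q (lamOp l) δ[γ] (⌊γ⌋₊ - j) f (0, 0) /
      bNorm δ[γ] (⌊γ⌋₊ - j) := by
  rw [div_eq_inv_mul]; rfl

theorem lowE_hPair (ha : 0 < fract γ) (i j : ℕ) :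
    lowE γ l i (hPair γ l j).1 = if i = j then cA (γ - 2 * j) l else 0 := by
  have hs : T1 l (-γ + 2 * j) (besE l (γ - 2 * j)) = (-γ + 2 * (j : ℝ)) ^ 2 • besE l (γ - 2 * j) := by
    rw [show -γ + 2 * (j : ℝ) = -(γ - 2 * j) by ring, T1_besE (nonInt_sub ha j), neg_sq]
  rw [hPair, map_smul, lowE_app, wC_solution j i hs, besE_zero (nonInt_sub ha j)]
  have := bNorm_neg_ne_zero ha i
  split_ifs <;> simp [this]

theorem lowF_hPair (ha : 0 < fract γ) {i j : ℕ} (hi : i ≤ ⌊γ⌋₊) (hj : j ≤ ⌊γ⌋₊) :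
    lowF γ l i (hPair γ l j).2 = if i = j then cA (-(γ - 2 * j)) l else 0 := by
  have e : δ[γ] + 2 * ((⌊γ⌋₊ - j : ℕ) : ℝ) = γ - 2 * j := by
    rw [Nat.cast_sub hj]; ring
  have hs : T1 l (δ[γ] + 2 * ((⌊γ⌋₊ - j : ℕ) : ℝ)) (besE l (-(γ - 2 * j)))
      = (δ[γ] + 2 * ((⌊γ⌋₊ - j : ℕ) : ℝ)) ^ 2 • besE l (-(γ - 2 * j)) := by
    rw [e]; exact T1_besE_neg (nonInt_sub ha j)
  rw [hPair, map_smul, lowF_app, wC_solution _ _ hs, besE_zero (nonInt_sub ha j).neg]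
  have := bNorm_pos_ne_zero ha ⌊γ⌋₊ (⌊γ⌋₊ - i)
  have e2 : ⌊γ⌋₊ - i = ⌊γ⌋₊ - j ↔ i = j := by omega
  simp only [e2]
  split_ifs <;> simp [this]

/-- The Dirichlet datum of index `j`. -/
def low (γ l : ℝ) (j : ℕ) : (ES 0 × ES 0) →ₗ[ℝ] ℝ :=
  if 0 < γ - 2 * j then lowE γ l j ∘ₗ LinearMap.fst ℝ _ _ else lowF γ l j ∘ₗ LinearMap.snd ℝ _ _

/-- The Neumann datum of index `j`. -/
def high (γ l : ℝ) (j : ℕ) : (ES 0 × ES 0) →ₗ[ℝ] ℝ :=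
  if 0 < γ - 2 * j then lowF γ l j ∘ₗ LinearMap.snd ℝ _ _ else lowE γ l j ∘ₗ LinearMap.fst ℝ _ _

theorem low_mul_high (j : ℕ) (φ : ES 0 × ES 0) :
    low γ l j φ * high γ l j φ = lowE γ l j φ.1 * lowF γ l j φ.2 := by
  rw [low, high]
  split_ifs
  · rfl
  · exact mul_comm _ _

theorem low_hPair (ha : 0 < fract γ) {i j : ℕ} (hi : i ≤ ⌊γ⌋₊) (hj : j ≤ ⌊γ⌋₊) :
    low γ l i (hPair γ l j) = if i = j then 1 else 0 := by
  rw [low]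
  split_ifs with h0 hij hij
  · subst hij
    exact (lowE_hPair ha i i).trans (by rw [if_pos rfl, cA, if_pos h0])
  · exact (lowE_hPair ha i j).trans (if_neg hij)
  · subst hij
    have : 0 < -(γ - 2 * (i : ℝ)) := by
      have := (nonInt_sub ha i).ne_zero
      exact neg_pos.2 (lt_of_le_of_ne (not_lt.1 h0) this)
    exact (lowF_hPair ha hi hi).trans (by rw [if_pos rfl, cA, if_pos this])
  · exact (lowF_hPair ha hi hj).trans (if_neg hij)

theorem L1_pow_app (a : ℝ) (k : ℕ) (φ : ES 0 × ES 0) : (L1 a l ^ k) φ =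
    ((-1 : ℝ) ^ k • (wN Y Q (lamOp l) (-a) ^ k) φ.1, (-1 : ℝ) ^ k • (wN Y Q (lamOp l) a ^ k) φ.2) := by
  induction k with
  | zero => simp
  | succ k ih =>
    rw [pow_succ', mul_apply, ih, pow_succ' (wN Y Q (lamOp l) (-a)),
      pow_succ' (wN Y Q (lamOp l) a), mul_apply, mul_apply, L1,
      LinearMap.prodMap_apply, LinearMap.neg_apply, LinearMap.neg_apply, map_smul, map_smul, pow_succ]
    simp only [mul_neg, mul_one]
    exact Prod.ext (neg_smul _ _).symm (neg_smul _ _).symm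

theorem L1_pow_eq (hγ : 0 ≤ γ) (φ : ES 0 × ES 0) : (L1 (fract γ) l ^ (⌊γ⌋₊ + 1)) φ =
    ((-1 : ℝ) ^ (⌊γ⌋₊ + 1) • wC Y Q (lamOp l) (-γ) (⌊γ⌋₊ + 1) φ.1,
      (-1 : ℝ) ^ (⌊γ⌋₊ + 1) • wC Y Q (lamOp l) δ[γ] (⌊γ⌋₊ + 1) φ.2) := by
  have h := two_mul_fract hγ
  rw [L1_pow_app, wC_succ_app (lamOp_comm l Q), wC_succ_app (lamOp_comm l Q),
    show -γ + (⌊γ⌋₊ : ℝ) = -fract γ by linarith,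
    show δ[γ] + (⌊γ⌋₊ : ℝ) = fract γ by linarith]

theorem L1_pow_hPair (hγ : 0 ≤ γ) (ha : 0 < fract γ) {j : ℕ} (hj : j ≤ ⌊γ⌋₊) :
    (L1 (fract γ) l ^ (⌊γ⌋₊ + 1)) (hPair γ l j) = 0 := by
  have hs : T1 l (-γ + 2 * j) (besE l (γ - 2 * j)) = (-γ + 2 * (j : ℝ)) ^ 2 • besE l (γ - 2 * j) := by
    rw [show -γ + 2 * (j : ℝ) = -(γ - 2 * j) by ring, T1_besE (nonInt_sub ha j), neg_sq]
  have e : δ[γ] + 2 * ((⌊γ⌋₊ - j : ℕ) : ℝ) = γ - 2 * j := by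
    rw [Nat.cast_sub hj]; ring
  have hs' : T1 l (δ[γ] + 2 * ((⌊γ⌋₊ - j : ℕ) : ℝ)) (besE l (-(γ - 2 * j)))
      = (δ[γ] + 2 * ((⌊γ⌋₊ - j : ℕ) : ℝ)) ^ 2 • besE l (-(γ - 2 * j)) := by
    rw [e]; exact T1_besE_neg (nonInt_sub ha j)
  rw [L1_pow_eq hγ, hPair, map_smul, map_smul, wC_solution_of_lt (by omega) hs,
    wC_solution_of_lt (by omega) hs']
  simp

open Polynomial in
theorem aeval_eventually_zero {c : ℝ} {f : ES 0} {R : ℝ} (h : ∀ y, R < y → f (0, y) = 0) (p : ℝ[X]) :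
    ∀ y, R < y → aeval (T1 l c) p f (0, y) = 0 := by
  induction p using Polynomial.induction_on with
  | C r => intro y hy; rw [aeval_C, Module.algebraMap_end_apply, smul_app, h y hy, mul_zero]
  | add p q hp hq => intro y hy; simp only [map_add, LinearMap.add_apply, add_app, hp y hy, hq y hy, add_zero]
  | monomial k r ih =>
    have := T1_eventually_zero (l := l) (c := c) ih
    rw [pow_succ', mul_left_comm, map_mul, aeval_X]
    simp only [mul_apply]
    exact this

open Polynomial in
theorem exists_psi {c : ℝ} {j m : ℕ} (hj : j ≤ m) (hb : bNorm c j ≠ 0) (f : ES 0) : ∃ ψ : ES 0,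
    T1 l (c + 2 * j) ψ = (c + 2 * (j : ℝ)) ^ 2 • ψ + (Y ^ (m + 1 - j)) (wC Y Q (lamOp l) c (m + 1) f) ∧
    ψ (0, 0) = (∏ i ∈ (Finset.range (m + 1)).erase j, ((c + 2 * (j : ℝ)) ^ 2 - (c + 2 * (i : ℝ)) ^ 2))
      * (wC Y Q (lamOp l) c j f (0, 0) / bNorm c j) ∧
    ∀ R, 0 ≤ R → (∀ y, R < y → f (0, y) = 0) → ∀ y, R < y → ψ (0, y) = 0 := by
  obtain ⟨q, hq1, hq2⟩ := exists_chain_split c hj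
  refine ⟨aeval (T1 l (c + 2 * j)) q (wC Y Q (lamOp l) c j f), ?_, ?_, ?_⟩
  · have h1 := aeval_chain_mul (lamOp l) (lamOp_comm l Y) c j
      ((X - C ((c + 2 * (j : ℝ)) ^ 2)) * q) f
    rw [← hq1, aeval_chain (lamOp_comm l Y)] at h1
    have h2 : (Y ^ (m + 1)) (wC Y Q (lamOp l) c (m + 1) f)
        = (Y ^ j) ((Y ^ (m + 1 - j)) (wC Y Q (lamOp l) c (m + 1) f)) := by
      have : ∀ F : ES 0, (Y ^ (m + 1)) F = (Y ^ j) ((Y ^ (m + 1 - j)) F) := fun F => by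
        rw [← mul_apply, ← pow_add, show j + (m + 1 - j) = m + 1 by omega]
      exact this _
    rw [h2] at h1
    rw [Y_pow_injective j h1, aeval_mul_app, map_sub, aeval_X, aeval_C, LinearMap.sub_apply,
      Module.algebraMap_end_apply]
    abel
  · rw [aeval_wT_zero, ← hq2]; field_simp
  · intro R hR hf y hy
    have h1 := aeval_chain_mul (lamOp l) (lamOp_comm l Y) c j q f
    have h2 := aeval_eventually_zero (l := l) (c := c) hf (chainPoly c j * q) y hy
    rw [h1, Y_pow_app] at h2
    exact (mul_eq_zero.1 h2).resolve_left (pow_ne_zero _ (hR.trans_lt hy).ne')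

/-- Both components of a pair vanish for large `y`. -/
def Cpt (φ : ES 0 × ES 0) : Prop := ∃ R, ∀ y, R < y → φ.1 (0, y) = 0 ∧ φ.2 (0, y) = 0

theorem Cpt.rd {φ : ES 0 × ES 0} (h : Cpt φ) (a : ℝ) : RD (val a φ) := by
  obtain ⟨R, hR⟩ := h
  exact rd_pv 0 (2 * a) (fun y hy => (hR y hy).1) (fun y hy => (hR y hy).2)

theorem rd_hPair (hγ : 0 ≤ γ) (ha : 0 < fract γ) (hl : 0 < l) {j : ℕ} (hj : j ≤ ⌊γ⌋₊) :
    RD (val (fract γ) (hPair γ l j)) :=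
  ((rd_kSol (nonInt_sub ha j) hl).rpow_mul γ).congr fun _ hy => val_hPair hγ hj hy

theorem ip_hPair (hγ : 0 ≤ γ) (ha : 0 < fract γ) {φ : ES 0 × ES 0} (hφ : Cpt φ) {j : ℕ}
    (hj : j ≤ ⌊γ⌋₊) : ip (fract γ) (hPair γ l j) ((L1 (fract γ) l ^ (⌊γ⌋₊ + 1)) φ) =
      sigma γ j * (high γ l j φ - kap |γ - 2 * j| l * low γ l j φ) := by
  set ν := γ - 2 * (j : ℝ) with hν
  set m := ⌊γ⌋₊ with hm
  have hn : NonInt ν := nonInt_sub ha j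
  obtain ⟨R, hR⟩ := hφ
  obtain ⟨ψe, e1, e2, e3⟩ := exists_psi (l := l) hj (bNorm_neg_ne_zero ha j) φ.1
  obtain ⟨ψf, f1, f2, f3⟩ := exists_psi (l := l) (Nat.sub_le m j)
    (bNorm_pos_ne_zero ha m (m - j)) φ.2
  have hmj : γ - 2 * (m : ℝ) + 2 * ((m - j : ℕ) : ℝ) = ν := by rw [Nat.cast_sub hj, hν]; ring
  rw [bAll_eq_pos γ hj, hm, ← lowF_app] at f2
  rw [bAll_eq_neg, ← lowE_app] at e2
  rw [show -γ + 2 * (j : ℝ) = -ν by rw [hν]; ring, neg_sq] at e1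
  rw [hmj, show m + 1 - (m - j) = j + 1 by omega] at f1
  have hflo := Nat.lt_floor_add_one γ
  have hfl := Nat.floor_le hγ
  have hj' : (j : ℝ) ≤ m := by exact_mod_cast hj
  have hj0 : (0 : ℝ) ≤ j := by positivity
  have G := green_formula (α := cA ν l) (β := cA (-ν) l) hn
    (r := m + 1 - j) (r' := j + 1)
    (by rw [Nat.cast_sub (by omega)]; push_cast; rw [hν]; linarith)
    (by push_cast; rw [hν]; linarith) (T1_besE (l := l) hn) (T1_besE_neg hn) e1 f1 (besE_zero hn)
    (besE_zero hn.neg)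
    (e3 (max R 0) (le_max_right _ _) fun y hy => (hR y ((le_max_left _ _).trans_lt hy)).1)
    (f3 (max R 0) (le_max_right _ _) fun y hy => (hR y ((le_max_left _ _).trans_lt hy)).2)
    (by omega) (by omega)
  have hip : ip (fract γ) (hPair γ l j) ((L1 (fract γ) l ^ (m + 1)) φ) =
      (-1) ^ (m + 1) * ∫ y in Ioi (0 : ℝ), y⁻¹ *
        (pv (-ν) ν (cA ν l • besE l ν) (cA (-ν) l • besE l (-ν)) y *
        pv (-ν) ν ((Y ^ (m + 1 - j)) (wC Y Q (lamOp l) (-γ) (m + 1) φ.1))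
          ((Y ^ (j + 1)) (wC Y Q (lamOp l) (γ - 2 * (m : ℝ)) (m + 1) φ.2)) y) := by
    rw [ip, ← integral_const_mul]
    refine integral_Ioi_ext fun y hy => ?_
    rw [L1_pow_eq hγ]
    simp only [val_hPair hγ hj hy]
    rw [val, pv_smul, kSol]
    have x1 : y⁻¹ * (y ^ (-ν) * y ^ (2 * (m + 1 - j))) = y ^ (1 - 2 * fract γ) * y ^ γ := by
      rw [rpow_mul_sq_pow hy, ← rpow_neg_one, ← rpow_add hy, ← rpow_add hy,
        two_mul_fract hγ, Nat.cast_sub (by omega)]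
      congr 1; push_cast; rw [hν]; ring
    have x2 : y⁻¹ * (y ^ ν * y ^ (2 * (j + 1)))
        = y ^ (1 - 2 * fract γ) * y ^ γ * y ^ (2 * fract γ) := by
      rw [rpow_mul_sq_pow hy, ← rpow_neg_one, ← rpow_add hy, ← rpow_add hy,
        ← rpow_add hy, two_mul_fract hγ]
      congr 1; push_cast; rw [hν]; ring
    set K := pv (-ν) ν (cA ν l • besE l ν) (cA (-ν) l • besE l (-ν)) y
    simp only [pv, Y_pow_app, rpow_zero, one_mul]
    linear_combination (-(K * (-1) ^ (m + 1) * wC Y Q (lamOp l) (-γ) (m + 1) φ.1 (0, y))) * x1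
      - (K * (-1) ^ (m + 1) * wC Y Q (lamOp l) (γ - 2 * (m : ℝ)) (m + 1) φ.2 (0, y)) * x2
  rw [hip, G, e2, f2, sigma_eq hγ ha hj, ← hν, ← hm]
  rw [low, high, cA, cA, ← hν]
  rcases lt_or_gt_of_ne hn.ne_zero with h0 | h0
  · rw [if_neg (by linarith), if_pos (by linarith), if_neg (by linarith), if_neg (by linarith),
      abs_of_neg h0]
    simp only [LinearMap.comp_apply, LinearMap.fst_apply, LinearMap.snd_apply]
    ring
  · rw [if_pos h0, if_neg (by linarith), if_pos h0, if_pos h0, abs_of_pos h0, neg_neg]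
    simp only [LinearMap.comp_apply, LinearMap.fst_apply, LinearMap.snd_apply]
    ring

/-- The Dirichlet energy at frequency `l`. -/
def energy1 (γ l : ℝ) (φ : ES 0 × ES 0) : ℝ :=
  ip (fract γ) φ ((L1 (fract γ) l ^ (⌊γ⌋₊ + 1)) φ) -
    ∑ j ∈ Finset.range (⌊γ⌋₊ + 1), sigma γ j * (lowE γ l j φ.1 * lowF γ l j φ.2)

end OneDim

end

section
open Set ES
variable {a γ l : ℝ}

theorem ip_sub_left (h0 : 0 < a) (h1 : a < 1) {φ φ' ψ : ES 0 × ES 0} (hφ : RD (val a φ))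
    (hφ' : RD (val a φ')) (hψ : RD (val a ψ)) : ip a (φ - φ') ψ = ip a φ ψ - ip a φ' ψ := by
  simp only [ip]
  rw [← integral_sub (integrableOn_val_mul h0 h1 hφ hψ) (integrableOn_val_mul h0 h1 hφ' hψ)]
  refine integral_Ioi_ext fun y _ => ?_
  simp only [val_sub]; ring

theorem ip_smul_left (r : ℝ) (φ ψ : ES 0 × ES 0) : ip a (r • φ) ψ = r * ip a φ ψ := by
  simp only [ip]
  rw [← integral_const_mul]
  refine integral_Ioi_ext fun y _ => ?_
  simp only [val_smul]; ring

theorem val_sum {ι : Type*} (s : Finset ι) (φ : ι → ES 0 × ES 0) (y : ℝ) :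
    val a (∑ i ∈ s, φ i) y = ∑ i ∈ s, val a (φ i) y := by
  classical
  induction s using Finset.induction_on with
  | empty =>
    have := val_smul (a := a) 0 0 y
    simpa using this
  | insert i s hi ih => rw [Finset.sum_insert hi, Finset.sum_insert hi, val_add, ih]

theorem ip_sum_left {ι : Type*} (s : Finset ι) (h0 : 0 < a) (h1 : a < 1) (φ : ι → ES 0 × ES 0)
    (ψ : ES 0 × ES 0) (hφ : ∀ i ∈ s, RD (val a (φ i))) (hψ : RD (val a ψ)) :
    ip a (∑ i ∈ s, φ i) ψ = ∑ i ∈ s, ip a (φ i) ψ := by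
  simp only [ip]
  rw [← integral_finsetSum _ fun i hi => integrableOn_val_mul h0 h1 (hφ i hi) hψ]
  refine integral_Ioi_ext fun y _ => ?_
  simp only [val_sum, Finset.sum_mul, Finset.mul_sum]

theorem besselJ_rpow_bounded {μ β : ℝ} (hμ : 0 < μ) (hβ : 0 ≤ β) :
    ∃ B, 0 < B ∧ ∀ z, 0 < z → z ^ β * besselJ μ z ≤ B := by
  have h := (tendsto_besselJ_atTop μ β).eventually (gt_mem_nhds one_pos)
  obtain ⟨Z, hZ⟩ := eventually_atTop.1 h
  set Z' := max Z 1
  have hG := Real.Gamma_pos_of_pos hμ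
  have hZ0 : 0 < Z' := lt_of_lt_of_le one_pos (le_max_right _ _)
  refine ⟨1 + Z' ^ β * Gamma μ, by positivity, fun z hz => ?_⟩
  have hp : 0 < Z' ^ β * Gamma μ := by positivity
  rcases le_total Z' z with h | h
  · have := hZ z ((le_max_left _ _).trans h)
    linarith
  · have h1 : besselJ μ z ≤ Gamma μ := by
      simpa using besselJ_le (μ := μ) (N := 0) hz (by simpa using hμ)
    have h2 : z ^ β ≤ Z' ^ β := rpow_le_rpow hz.le h hβ
    have := mul_le_mul h2 h1 (besselJ_pos hz μ).le (by positivity)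
    linarith

theorem abs_gamma_sub_le (hγ : 0 ≤ γ) {j : ℕ} (hj : j ≤ ⌊γ⌋₊) : |γ - 2 * j| ≤ γ := by
  have : (j : ℝ) ≤ γ := (by exact_mod_cast hj : (j : ℝ) ≤ ⌊γ⌋₊).trans (Nat.floor_le hγ)
  have h0 : (0 : ℝ) ≤ j := by positivity
  rw [abs_le]; constructor <;> linarith

/-- The decaying solutions are bounded by the corresponding power of the frequency. -/
theorem rpow_mul_kSol_le (hγ : 0 ≤ γ) (ha : 0 < fract γ) {j : ℕ} (hj : j ≤ ⌊γ⌋₊) :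
    ∃ B, 0 < B ∧ ∀ l, 0 < l → ∀ y, 0 < y →
      y ^ γ * kSol (γ - 2 * j) l y ≤ B * l ^ (|γ - 2 * (j : ℝ)| - γ) := by
  have hn := nonInt_sub ha j
  have hg := Real.Gamma_pos_of_pos hn.abs_pos
  set μ := |γ - 2 * (j : ℝ)| with hμ
  have hle : μ ≤ γ := abs_gamma_sub_le hγ hj
  obtain ⟨B, hB, hBz⟩ := besselJ_rpow_bounded (β := (γ - μ) / 2) hn.abs_pos (by linarith)
  refine ⟨2 ^ (γ - μ) * B / Gamma μ, by positivity, fun l hl y hy => ?_⟩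
  have hz : 0 < l ^ 2 * y ^ 2 / 4 := by positivity
  have h := hBz _ hz
  have e1 : (l ^ 2 * y ^ 2 / 4) ^ ((γ - μ) / 2) = (l * y / 2) ^ (γ - μ) := by
    rw [show l ^ 2 * y ^ 2 / 4 = (l * y / 2) ^ (2 : ℝ) by rw [rpow_two]; ring,
      ← rpow_mul (by positivity)]
    congr 1; ring
  have e2 : (l * y / 2) ^ (γ - μ) = l ^ (γ - μ) * y ^ (γ - μ) / 2 ^ (γ - μ) := by
    rw [Real.div_rpow (by positivity) (by norm_num), mul_rpow hl.le hy.le]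
  have e3 : l ^ (μ - γ) * l ^ (γ - μ) = 1 := by rw [← rpow_add hl]; simp
  rw [e1, e2] at h
  rw [← kSol_abs, kSol_of_pos hn.abs hn.abs_pos hl hy, ← hμ, ← mul_assoc, ← rpow_add hy,
    ← sub_eq_add_neg]
  have h2 : (0 : ℝ) < 2 ^ (γ - μ) := by positivity
  have h3 : 0 < l ^ (μ - γ) := by positivity
  calc y ^ (γ - μ) * (besselJ μ (l ^ 2 * y ^ 2 / 4) / Gamma μ)
      = (l ^ (μ - γ) * l ^ (γ - μ)) * (y ^ (γ - μ) * (besselJ μ (l ^ 2 * y ^ 2 / 4) / Gamma μ)) := by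
        rw [e3, one_mul]
    _ = 2 ^ (γ - μ) / Gamma μ * l ^ (μ - γ) *
          (l ^ (γ - μ) * y ^ (γ - μ) / 2 ^ (γ - μ) * besselJ μ (l ^ 2 * y ^ 2 / 4)) := by field_simp
    _ ≤ 2 ^ (γ - μ) / Gamma μ * l ^ (μ - γ) * B := by gcongr
    _ = _ := by ring

theorem kap_eq {ν : ℝ} (hl : 0 < l) :
    kap ν l = l ^ (2 * ν) * ((4 : ℝ) ^ (-ν) * (Gamma (-ν) / Gamma ν)) := by
  rw [kap, Real.div_rpow (by positivity) (by norm_num), rpow_neg (by norm_num), rpow_mul hl.le,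
    rpow_two]
  ring

/-- The part of a pair without Dirichlet data. -/
def core (γ l : ℝ) (φ : ES 0 × ES 0) : ES 0 × ES 0 :=
  φ - ∑ j ∈ Finset.range (⌊γ⌋₊ + 1), low γ l j φ • hPair γ l j

theorem low_core (ha : 0 < fract γ) (φ : ES 0 × ES 0) {i : ℕ} (hi : i ≤ ⌊γ⌋₊) :
    low γ l i (core γ l φ) = 0 := by
  rw [core, map_sub, map_sum, Finset.sum_eq_single_of_mem i (Finset.mem_range.2 (by omega)),
    map_smul, low_hPair ha hi hi, if_pos rfl, smul_eq_mul, mul_one, sub_self]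
  intro j hj hji
  rw [map_smul, low_hPair ha hi (Nat.lt_succ_iff.1 (Finset.mem_range.1 hj)), if_neg hji.symm, smul_zero]

theorem low_pos_iff (hγ : 0 ≤ γ) (ha : 0 < fract γ) (j : ℕ) : 0 < γ - 2 * (j : ℝ) ↔ j ≤ ⌊γ⌋₊ / 2 := by
  rw [← le_floor_half_iff hγ ha, ← Nat.floor_div_ofNat]

theorem core_vanish (hγ : 0 ≤ γ) (ha : 0 < fract γ) (φ : ES 0 × ES 0) :
    (∃ F, (core γ l φ).1 = (Y ^ (⌊γ⌋₊ / 2 + 1)) F) ∧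
      ∃ F, (core γ l φ).2 = (Y ^ (⌊γ⌋₊ - ⌊γ⌋₊ / 2)) F := by
  constructor
  · refine exists_Y_pow_of_wC (l := l) (bNorm_neg_ne_zero ha) fun i hi => ?_
    have h := low_core (l := l) ha φ (i := i) (by omega)
    rw [low, if_pos ((low_pos_iff hγ ha i).2 (by omega)), LinearMap.comp_apply, LinearMap.fst_apply,
      lowE_app] at h
    exact (div_eq_zero_iff.1 h).resolve_right (bNorm_neg_ne_zero ha i)
  · refine exists_Y_pow_of_wC (l := l) (bNorm_pos_ne_zero ha ⌊γ⌋₊) fun i hi => ?_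
    have h := low_core (l := l) ha φ (i := ⌊γ⌋₊ - i) (by omega)
    rw [low, if_neg (by rw [low_pos_iff hγ ha]; omega), LinearMap.comp_apply, LinearMap.snd_apply,
      lowF_app, show ⌊γ⌋₊ - (⌊γ⌋₊ - i) = i by omega] at h
    exact (div_eq_zero_iff.1 h).resolve_right (bNorm_pos_ne_zero ha _ i)

theorem rd_core (hγ : 0 ≤ γ) (ha : 0 < fract γ) (hl : 0 < l) {φ : ES 0 × ES 0} (hφ : Cpt φ) :
    RD (val (fract γ) (core γ l φ)) := by
  refine ((hφ.rd (fract γ)).sub (RD.sum (Finset.range (⌊γ⌋₊ + 1)) fun j hj =>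
    (rd_hPair hγ ha hl (Nat.lt_succ_iff.1 (Finset.mem_range.1 hj))).smul (low γ l j φ))).congr fun y _ => ?_
  simp only [core, val_sub, val_sum, val_smul]

theorem energy1_eq (hγ : 0 ≤ γ) (ha : 0 < fract γ) (hl : 0 < l) {φ : ES 0 × ES 0} (hφ : Cpt φ) :
    energy1 γ l φ =
      ip (fract γ) (core γ l φ) ((L1 (fract γ) l ^ (⌊γ⌋₊ + 1)) (core γ l φ)) +
      ∑ j ∈ Finset.range (⌊γ⌋₊ + 1), -(sigma γ j * kap |γ - 2 * j| l) * low γ l j φ ^ 2 := by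
  have h1 := Int.fract_lt_one γ
  have e1 : (L1 (fract γ) l ^ (⌊γ⌋₊ + 1)) (core γ l φ) = (L1 (fract γ) l ^ (⌊γ⌋₊ + 1)) φ := by
    rw [core, map_sub, map_sum, Finset.sum_eq_zero, sub_zero]
    intro j hj
    rw [map_smul, L1_pow_hPair hγ ha (Nat.lt_succ_iff.1 (Finset.mem_range.1 hj)), smul_zero]
  have hL : RD (val (fract γ) ((L1 (fract γ) l ^ (⌊γ⌋₊ + 1)) φ)) := (hφ.rd _).L1_pow _
  have hs : ∀ j ∈ Finset.range (⌊γ⌋₊ + 1), RD (val (fract γ) (low γ l j φ • hPair γ l j)) :=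
    fun j hj => ((rd_hPair hγ ha hl (Nat.lt_succ_iff.1 (Finset.mem_range.1 hj))).smul
      (low γ l j φ)).congr fun y _ => val_smul ..
  have hS : RD (val (fract γ) (∑ j ∈ Finset.range (⌊γ⌋₊ + 1), low γ l j φ • hPair γ l j)) :=
    (RD.sum _ hs).congr fun y _ => val_sum ..
  rw [e1, core, ip_sub_left ha h1 (hφ.rd _) hS hL, ip_sum_left _ ha h1 _ _ hs hL, energy1,
    sub_add, ← Finset.sum_sub_distrib]
  congr 1
  refine Finset.sum_congr rfl fun j hj => ?_
  rw [ip_smul_left, ip_hPair hγ ha hφ (Nat.lt_succ_iff.1 (Finset.mem_range.1 hj)), ← low_mul_high]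
  ring

theorem neg_sigma_kap_pos (hγ : 0 ≤ γ) (ha : 0 < fract γ) (hl : 0 < l) {j : ℕ} (hj : j ≤ ⌊γ⌋₊) :
    0 < -(sigma γ j * kap |γ - 2 * j| l) := by
  have := sigma_pos_aux hγ ha hj
  rw [kap_eq hl]
  have h2 : 0 < l ^ (2 * |γ - 2 * (j : ℝ)|) * (4 : ℝ) ^ (-|γ - 2 * (j : ℝ)|) := by positivity
  have := mul_pos h2 this
  linarith

theorem val_hPair_sq_le (hγ : 0 ≤ γ) (ha : 0 < fract γ) {j : ℕ} (hj : j ≤ ⌊γ⌋₊) :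
    ∃ M, 0 ≤ M ∧ ∀ l, 0 < l → ∀ y, 0 < y → val (fract γ) (hPair γ l j) y ^ 2
      ≤ M * l ^ (-(2 * γ)) * -(sigma γ j * kap |γ - 2 * j| l) := by
  obtain ⟨B, hB, h⟩ := rpow_mul_kSol_le hγ ha hj
  have hs := sigma_pos_aux hγ ha hj
  set s := -(sigma γ j * (Gamma (-|γ - 2 * (j : ℝ)|) / Gamma |γ - 2 * (j : ℝ)|)) with hsd
  set μ := |γ - 2 * (j : ℝ)| with hμ
  refine ⟨B ^ 2 / (s * 4 ^ (-μ)), by positivity, fun l hl y hy => ?_⟩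
  have h4 : (0 : ℝ) < 4 ^ (-μ) := by positivity
  rw [val_hPair hγ hj hy, kap_eq hl]
  have hk := kSol_pos (nonInt_sub ha j) hl hy
  have e : l ^ (-(2 * γ)) * l ^ (2 * μ) = (l ^ (μ - γ)) ^ 2 := by
    rw [← rpow_add hl, ← rpow_natCast, ← rpow_mul hl.le]; congr 1; push_cast; ring
  calc _ ≤ (B * l ^ (μ - γ)) ^ 2 := by
        have := h l hl y hy
        gcongr
    _ = B ^ 2 / (s * 4 ^ (-μ)) * (l ^ (-(2 * γ)) * l ^ (2 * μ)) * (s * 4 ^ (-μ)) := by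
        rw [e]; field_simp
    _ = _ := by rw [hsd]; ring

/-- The energy at frequency `l` controls the function pointwise. -/
theorem energy1_coercive (hγ : 0 ≤ γ) (ha : 0 < fract γ) : ∃ C, 0 < C ∧ ∀ l, 0 < l →
    ∀ φ, Cpt φ → 0 ≤ energy1 γ l φ ∧ ∀ y, 0 < y → val (fract γ) φ y ^ 2 ≤
      C * (l ^ (-(2 * γ)) * (1 + (l * y) ^ (2 * fract γ))) * energy1 γ l φ := by
  choose! M hM0 hM using fun j (hj : j ≤ ⌊γ⌋₊) => val_hPair_sq_le hγ ha hj
  have h1 := Int.fract_lt_one γ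
  set a := fract γ with hadef
  set m := ⌊γ⌋₊ with hm
  set r := Finset.range (m + 1) with hr
  have hrm : ∀ j ∈ r, j ≤ m := fun j hj => Nat.lt_succ_iff.1 (Finset.mem_range.1 hj)
  have hMs : 0 ≤ ∑ j ∈ r, M j := Finset.sum_nonneg fun j hj => hM0 j (hrm j hj)
  refine ⟨2 * (1 / (2 * a) + (m + 1) * ∑ j ∈ r, M j), by positivity, fun l hl φ hφ => ?_⟩
  have hrd := rd_core hγ ha hl hφ
  obtain ⟨v1, v2⟩ := core_vanish (l := l) hγ ha φ
  have hc := ip_L1_pow_coercive (l := l) ha h1 hrd v1 v2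
  have hd := dip_self_nonneg (a := a) (core γ l φ)
  rw [energy1_eq hγ ha hl hφ]
  set I := ip a (core γ l φ) ((L1 a l ^ (m + 1)) (core γ l φ)) with hI
  set t : ℕ → ℝ := fun j => -(sigma γ j * kap |γ - 2 * j| l) * low γ l j φ ^ 2 with ht
  have ht0 : ∀ j ∈ r, 0 ≤ t j := fun j hj =>
    mul_nonneg (neg_sigma_kap_pos hγ ha hl (hrm j hj)).le (sq_nonneg _)
  have hT0 := Finset.sum_nonneg ht0
  have hlm : 0 < l ^ (2 * m) := by positivity
  have hI0 : 0 ≤ I := le_trans (by positivity) hc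
  refine ⟨add_nonneg hI0 hT0, fun y hy => ?_⟩
  have hv : val a φ y = val a (core γ l φ) y + ∑ j ∈ r, low γ l j φ * val a (hPair γ l j) y := by
    simp only [core, val_sub, val_sum, val_smul]; ring
  have b1 : val a (core γ l φ) y ^ 2 ≤ 1 / (2 * a) * (l ^ (-(2 * γ)) * (l * y) ^ (2 * a)) * I := by
    refine (val_sq_le ha h1 hrd (app_zero_of_Y_pow (by omega) v1) hy).trans ?_
    have e : l ^ (-(2 * γ)) * (l * y) ^ (2 * a) = y ^ (2 * a) / l ^ (2 * m) := by
      rw [mul_rpow hl.le hy.le, ← mul_assoc, ← rpow_add hl,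
        show -(2 * γ) + 2 * a = -((2 * m : ℕ) : ℝ) by
          rw [hadef, two_mul_fract hγ]; push_cast; ring, rpow_neg hl.le, rpow_natCast]
      field_simp
    rw [e]
    calc _ = 1 / (2 * a) * (y ^ (2 * a) / l ^ (2 * m)) * (l ^ (2 * m) * dip a (core γ l φ) (core γ l φ)) := by
          field_simp
      _ ≤ _ := by gcongr
  have b2 : (∑ j ∈ r, low γ l j φ * val a (hPair γ l j) y) ^ 2
      ≤ (m + 1) * (∑ j ∈ r, M j) * l ^ (-(2 * γ)) * ∑ j ∈ r, t j := by
    have := sq_sum_le_card_mul_sum_sq (s := r) (f := fun j => low γ l j φ * val a (hPair γ l j) y)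
    rw [hr, Finset.card_range, ← hr] at this
    refine this.trans ?_
    push_cast
    rw [mul_assoc, mul_assoc]
    refine mul_le_mul_of_nonneg_left ?_ (by positivity)
    rw [Finset.mul_sum, Finset.mul_sum]
    refine Finset.sum_le_sum fun j hj => ?_
    have h3 := hM j (hrm j hj) l hl y hy
    have h4 : M j ≤ ∑ j ∈ r, M j := Finset.single_le_sum (fun i hi => hM0 i (hrm i hi)) hj
    calc _ = low γ l j φ ^ 2 * val a (hPair γ l j) y ^ 2 := by ring
      _ ≤ low γ l j φ ^ 2 * (M j * l ^ (-(2 * γ)) * -(sigma γ j * kap |γ - 2 * j| l)) := by gcongr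
      _ = M j * (l ^ (-(2 * γ)) * t j) := by rw [ht]; ring
      _ ≤ _ := mul_le_mul_of_nonneg_right h4 (mul_nonneg (by positivity) (ht0 j hj))
  have hp : 0 ≤ (l * y) ^ (2 * a) := by positivity
  have hL : 0 < l ^ (-(2 * γ)) := by positivity
  set P := (l * y) ^ (2 * a)
  set Λ := l ^ (-(2 * γ))
  set Ms := ∑ j ∈ r, M j
  set Ts := ∑ j ∈ r, t j
  have s1 : val a φ y ^ 2 ≤ 2 * (val a (core γ l φ) y ^ 2 + (∑ j ∈ r, low γ l j φ * val a (hPair γ l j) y) ^ 2) := by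
    rw [hv]; exact add_sq_le
  have s2 : 1 / (2 * a) * (Λ * P) * I ≤ 1 / (2 * a) * (Λ * (1 + P)) * (I + Ts) := by
    gcongr <;> linarith
  have s3 : (m + 1) * Ms * Λ * Ts ≤ (m + 1) * Ms * (Λ * (1 + P)) * (I + Ts) := by
    have : Λ ≤ Λ * (1 + P) := by nlinarith
    have h5 : Ts ≤ I + Ts := by linarith
    gcongr ((m + 1) * Ms * ?_ * ?_)
  calc _ ≤ _ := s1
    _ ≤ 2 * (1 / (2 * a) * (Λ * (1 + P)) * (I + Ts) + (m + 1) * Ms * (Λ * (1 + P)) * (I + Ts)) := by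
      linarith
    _ = _ := by ring

end

section
open Set ES
variable {n : ℕ} {γ : ℝ}
local notation "𝔼" => EuclideanSpace ℝ (Fin n)

/-- The angular frequency. -/
local notation "ℓ[" ξ "]" => 2 * Real.pi * ‖ξ‖

/-- `f` vanishes for `|x| > R`. -/
def XSupp (R : ℝ) (f : ES n) : Prop := ∀ p : Pt n, R < ‖p.1‖ → f p = 0

theorem XSupp.pd_eq_zero {R : ℝ} {f : ES n} (h : XSupp R f) (v : Pt n) {p : Pt n} (hp : R < ‖p.1‖) :
    pd v f p = 0 := by
  have : (f : Pt n → ℝ) =ᶠ[𝓝 p] fun _ => 0 := by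
    filter_upwards [(isOpen_lt continuous_const (by fun_prop : Continuous fun p : Pt n => ‖p.1‖)).mem_nhds hp]
      with q hq using h q hq
  rw [pd, this.fderiv_eq]; simp

theorem XSupp.dx {R : ℝ} {f : ES n} (h : XSupp R f) (i : Fin n) : XSupp R (dX i f) :=
  fun _ hp => h.pd_eq_zero _ hp

theorem XSupp.add {R : ℝ} {f g : ES n} (hf : XSupp R f) (hg : XSupp R g) : XSupp R (f + g) :=
  fun p hp => by rw [add_app, hf p hp, hg p hp, add_zero]

theorem XSupp.smul {R : ℝ} {f : ES n} (hf : XSupp R f) (c : ℝ) : XSupp R (c • f) :=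
  fun p hp => by rw [smul_app, hf p hp, mul_zero]

theorem XSupp.ymul {R : ℝ} {f : ES n} (hf : XSupp R f) : XSupp R (Y f) :=
  fun p hp => by rw [Y_app, hf p hp, mul_zero]

theorem sum_app {ι : Type*} (s : Finset ι) (f : ι → ES n) (p : Pt n) :
    (∑ i ∈ s, f i) p = ∑ i ∈ s, f i p := by
  rw [Submodule.coe_sum, Finset.sum_apply]

theorem Lap_app (f : ES n) (p : Pt n) : Lap f p = ∑ i, dX i (dX i f) p := by
  rw [Lap, LinearMap.sum_apply, sum_app]; rfl

theorem XSupp.lap {R : ℝ} {f : ES n} (hf : XSupp R f) : XSupp R (Lap f) := fun p hp => by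
  rw [Lap_app]
  exact Finset.sum_eq_zero fun i _ => (hf.dx i).dx i p hp

theorem Y_Q_app (f : ES n) (p : Pt n) : p.2 ^ 2 * Q f p = θ f p := by
  rw [← Y_mul_Q]; rfl

theorem XSupp.qmap {R : ℝ} {f : ES n} (hf : XSupp R f) : XSupp R (Q f) := by
  have h0 : ∀ p : Pt n, R < ‖p.1‖ → p.2 ≠ 0 → Q f p = 0 := fun p hp hy => by
    have := Y_Q_app f p
    rw [θ_app, hf.pd_eq_zero _ hp, mul_zero] at this
    exact (mul_eq_zero.1 this).resolve_left (pow_ne_zero _ hy)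
  intro p hp
  rcases ne_or_eq p.2 0 with hy | hy
  · exact h0 p hp hy
  · have h1 := tendsto_ES_slice (Q f) p.1
    have h2 : Tendsto (fun y => Q f (p.1, y)) (𝓝[>] (0 : ℝ)) (𝓝 0) :=
      tendsto_const_nhds.congr' (by
        filter_upwards [self_mem_nhdsWithin] with y hy using (h0 (p.1, y) hp (ne_of_gt hy)).symm)
    rw [show p = (p.1, 0) from Prod.ext rfl hy]
    exact tendsto_nhds_unique h1 h2

theorem XSupp.wn {R : ℝ} {f : ES n} (hf : XSupp R f) (c : ℝ) : XSupp R (wN Y Q Lap c f) :=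
  (hf.lap.add hf.qmap.qmap.ymul).add (hf.qmap.smul _)

theorem XSupp.wc {R : ℝ} {f : ES n} (hf : XSupp R f) (c : ℝ) (j : ℕ) : XSupp R (wC Y Q Lap c j f) := by
  induction j with
  | zero => exact hf
  | succ j ih => exact ih.wn _

theorem contDiff_slice (f : ES n) (y : ℝ) : ContDiff ℝ ∞ fun x => f (x, y) :=
  (smooth f).comp (by fun_prop)

theorem XSupp.hasCompactSupport {R : ℝ} {f : ES n} (hf : XSupp R f) (y : ℝ) :
    HasCompactSupport fun x => f (x, y) :=
  HasCompactSupport.of_support_subset_isCompact (isCompact_closedBall 0 R) fun x hx => by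
    rw [mem_closedBall_zero_iff]
    by_contra h
    exact hx (hf (x, y) (not_le.1 h))

theorem fderiv_slice (f : ES n) (i : Fin n) (x : 𝔼) (y : ℝ) :
    fderiv ℝ (fun z => f (z, y)) x (EuclideanSpace.single i 1) = dX i f (x, y) := by
  have h : HasFDerivAt (fun z => f (z, y))
      ((fderiv ℝ f (x, y)).comp (ContinuousLinearMap.inl ℝ _ _)) x :=
    HasFDerivAt.comp x ((smooth f).differentiable (by simp) _).hasFDerivAt
      ((hasFDerivAt_id x).prodMk (hasFDerivAt_const y x))
  rw [h.fderiv, dX_app]; simp [pd, eX]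

theorem integral_dX_mul {R : ℝ} {f g : ES n} (h : XSupp R f ∨ XSupp R g) (i : Fin n) (y z : ℝ) :
    ∫ x, f (x, y) * dX i g (x, z) = -∫ x, dX i f (x, y) * g (x, z) := by
  have hI : ∀ f g : ES n, XSupp R f ∨ XSupp R g → Integrable fun x : 𝔼 => f (x, y) * g (x, z) :=
    fun f g h => by
    refine Continuous.integrable_of_hasCompactSupport
      ((contDiff_slice f y).continuous.mul (contDiff_slice g z).continuous) ?_
    rcases h with h | h
    · exact (h.hasCompactSupport y).mul_right
    · exact (h.hasCompactSupport z).mul_left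
  have := integral_mul_fderiv_eq_neg_fderiv_mul_of_integrable (μ := volume)
    (f := fun x => f (x, y)) (g := fun x => g (x, z)) (v := EuclideanSpace.single i (1 : ℝ))
    (by simp only [fderiv_slice]; exact hI _ _ (h.imp (fun h => h.dx i) id))
    (by simp only [fderiv_slice]; exact hI _ _ (h.imp id fun h => h.dx i)) (hI f g h)
    (fun x _ => (contDiff_slice f y).differentiable (by simp) x)
    (fun x _ => (contDiff_slice g z).differentiable (by simp) x)
  simpa only [fderiv_slice] using this

theorem integrable_slice_mul {R : ℝ} {f g : ES n} (h : XSupp R f ∨ XSupp R g) (y z : ℝ) :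
    Integrable fun x : 𝔼 => f (x, y) * g (x, z) := by
  refine Continuous.integrable_of_hasCompactSupport
    ((contDiff_slice f y).continuous.mul (contDiff_slice g z).continuous) ?_
  rcases h with h | h
  · exact (h.hasCompactSupport y).mul_right
  · exact (h.hasCompactSupport z).mul_left

theorem integral_Lap_mul {R : ℝ} {f g : ES n} (h : XSupp R f ∨ XSupp R g) (y z : ℝ) :
    ∫ x, Lap f (x, y) * g (x, z) = ∫ x, f (x, y) * Lap g (x, z) := by
  simp only [Lap_app, Finset.sum_mul, Finset.mul_sum]
  rw [integral_finsetSum _ fun i _ => integrable_slice_mul (h.imp (fun h => (h.dx i).dx i) id) y z,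
    integral_finsetSum _ fun i _ => integrable_slice_mul (h.imp id fun h => (h.dx i).dx i) y z]
  refine Finset.sum_congr rfl fun i _ => ?_
  have h1 := integral_dX_mul (h.imp id fun h => h.dx i) i y z
  have h2 := integral_dX_mul (h.imp (fun h => h.dx i) id) i y z
  rw [h1, h2, neg_neg]

/-- Integration in `x` against a weight. -/
def fint (R : ℝ) (w : ES n) : ES n →ₗ[ℝ] ES 0 where
  toFun f := ⟨fun p => ∫ x in Metric.closedBall (0 : 𝔼) R, f (x, p.2) * w (x, 0),
    contDiff_setIntegral_param (P := Pt 0) (X := 𝔼) volume (isCompact_closedBall 0 R)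
      (F := fun q => f (q.2, q.1.2) * w (q.2, 0))
      (((smooth f).comp (by fun_prop)).mul ((smooth w).comp (by fun_prop))),
    fun x y => by simp only [evn f]⟩
  map_add' f g := Subtype.ext <| funext fun p => by
    have hi : ∀ f : ES n, IntegrableOn (fun x : 𝔼 => f (x, p.2) * w (x, 0)) (Metric.closedBall 0 R) :=
      fun f => ((contDiff_slice f p.2).continuous.mul
        (contDiff_slice w 0).continuous).continuousOn.integrableOn_compact (isCompact_closedBall 0 R)
    change _ = (∫ x in Metric.closedBall (0 : 𝔼) R, f (x, p.2) * w (x, 0)) + ∫ x in _, g (x, p.2) * w (x, 0)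
    rw [← integral_add (hi f) (hi g)]
    simp only [add_app, add_mul]
  map_smul' c f := Subtype.ext <| funext fun p => by
    change _ = c * ∫ x in Metric.closedBall (0 : 𝔼) R, f (x, p.2) * w (x, 0)
    rw [← integral_const_mul]
    simp only [smul_app, mul_assoc]

theorem fint_app (R : ℝ) (w f : ES n) (p : Pt 0) :
    fint R w f p = ∫ x in Metric.closedBall (0 : 𝔼) R, f (x, p.2) * w (x, 0) := rfl

theorem fint_eq {R : ℝ} {w f : ES n} (h : XSupp R f ∨ XSupp R w) (p : Pt 0) :
    fint R w f p = ∫ x, f (x, p.2) * w (x, 0) := by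
  rw [fint_app]
  refine setIntegral_eq_integral_of_forall_compl_eq_zero fun x hx => ?_
  have hx : R < ‖x‖ := by simpa using hx
  rcases h with h | h
  · exact mul_eq_zero_of_left (h (x, p.2) hx) _
  · exact mul_eq_zero_of_right _ (h (x, 0) hx)

theorem fint_Y (R : ℝ) (w f : ES n) : fint R w (Y f) = Y (fint R w f) := by
  refine Subtype.ext (funext fun p => ?_)
  change fint R w (Y f) p = p.2 ^ 2 * fint R w f p
  rw [fint_app, fint_app, ← integral_const_mul]
  simp only [Y_app, mul_assoc]

theorem fint_θ (R : ℝ) (w f : ES n) : fint R w (θ f) = θ (fint R w f) := by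
  refine ext_of_pos fun q y _ => ?_
  set F : ℝ × 𝔼 → ℝ := fun r => f (r.2, r.1) * w (r.2, 0) with hF
  have hFs : ContDiff ℝ ∞ F := ((smooth f).comp (by fun_prop)).mul ((smooth w).comp (by fun_prop))
  have h1 := (hasFDerivAt_setIntegral_param (volume : Measure 𝔼) (isCompact_closedBall 0 R) hFs y).hasDerivAt
  have h2 : HasDerivAt (fun t => fint R w f (q, t)) _ y := hasDerivAt_slice (smooth (fint R w f)) q y
  have h3 := h2.unique h1
  have hc : Continuous fun x => (fderiv ℝ F (y, x)).comp (ContinuousLinearMap.inl ℝ ℝ 𝔼) :=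
    ((hFs.continuous_fderiv (by simp)).comp (by fun_prop : Continuous fun x : 𝔼 => (y, x))).clm_comp
      continuous_const
  rw [ContinuousLinearMap.integral_apply
    (hc.continuousOn.integrableOn_compact (isCompact_closedBall 0 R))] at h3
  rw [θ_app, h3, fint_app, ← integral_const_mul]
  refine integral_ext fun x => ?_
  have h4 : HasDerivAt (fun t => F (t, x)) (pd (eY n) f (x, y) * w (x, 0)) y :=
    (hasDerivAt_slice (smooth f) x y).mul_const (w (x, 0))
  have h5 : HasDerivAt (fun t => F (t, x)) (((fderiv ℝ F (y, x)).comp (ContinuousLinearMap.inl ℝ ℝ 𝔼)) 1) y := by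
    have h6 : HasFDerivAt F (fderiv ℝ F (y, x)) (y, x) := (hFs.differentiable (by simp) (y, x)).hasFDerivAt
    have h7 : HasFDerivAt (fun t : ℝ => (t, x)) (ContinuousLinearMap.inl ℝ ℝ 𝔼) y :=
      (hasFDerivAt_id y).prodMk (hasFDerivAt_const x y)
    exact (h6.comp y h7).hasDerivAt
  simp only [θ_app]
  rw [← h4.unique h5]; ring

theorem fint_Q (R : ℝ) (w f : ES n) : fint R w (Q f) = Q (fint R w f) := by
  refine Y_injective ?_
  have e : ∀ {m : ℕ} (u : ES m), Y (Q u) = θ u := fun u => by rw [← Y_mul_Q]; rfl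
  rw [← fint_Y, e, e, fint_θ]

theorem fint_Lap {R : ℝ} {w f : ES n} (h : XSupp R f ∨ XSupp R w) :
    fint R w (Lap f) = fint R (Lap w) f := by
  refine Subtype.ext (funext fun p => ?_)
  rw [fint_eq (h.imp (fun h => h.lap) id), fint_eq (h.imp id fun h => h.lap), integral_Lap_mul h]

theorem fint_smul_weight (R c : ℝ) (w f : ES n) : fint R (c • w) f = c • fint R w f := by
  refine Subtype.ext (funext fun p => ?_)
  change fint R (c • w) f p = c * fint R w f p
  rw [fint_app, fint_app, ← integral_const_mul]
  refine integral_ext fun x => ?_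
  simp only [smul_app]; ring

/-- The plane wave `cos (2π ⟨x, ξ⟩ - s)`. -/
def trig (s : ℝ) (ξ : 𝔼) : ES n :=
  ⟨fun p => Real.cos (2 * Real.pi * inner ℝ p.1 ξ - s),
    ((contDiff_const.mul (contDiff_fst.inner ℝ contDiff_const)).sub contDiff_const).cos, fun _ _ => rfl⟩

theorem trig_app (s : ℝ) (ξ : 𝔼) (p : Pt n) :
    trig s ξ p = Real.cos (2 * Real.pi * inner ℝ p.1 ξ - s) := rfl

theorem dX_trig (s : ℝ) (ξ : 𝔼) (i : Fin n) :
    dX i (trig s ξ) = (2 * Real.pi * ξ i) • trig (s - Real.pi / 2) ξ := by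
  refine Subtype.ext (funext fun p => ?_)
  have h1 : HasFDerivAt (fun p : Pt n => 2 * Real.pi * inner ℝ p.1 ξ - s)
      ((2 * Real.pi) • ((innerSL ℝ ξ).comp (ContinuousLinearMap.fst ℝ _ _))) p := by
    have := (((innerSL ℝ ξ).comp (ContinuousLinearMap.fst ℝ 𝔼 ℝ)).hasFDerivAt (x := p)).const_mul (2 * Real.pi)
    refine (this.sub_const s).congr_of_eventuallyEq (Eventually.of_forall fun q => ?_)
    simp [real_inner_comm]
  have h2 := h1.cos
  change pd (eX i) (fun p : Pt n => Real.cos (2 * Real.pi * inner ℝ p.1 ξ - s)) p = _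
  rw [pd, h2.fderiv]
  change _ = (2 * Real.pi * ξ i) * trig (s - Real.pi / 2) ξ p
  rw [trig_app, show 2 * Real.pi * inner ℝ p.1 ξ - (s - Real.pi / 2)
    = 2 * Real.pi * inner ℝ p.1 ξ - s + Real.pi / 2 by ring, Real.cos_add_pi_div_two]
  simp [eX, EuclideanSpace.inner_single_right]
  ring

theorem trig_sub_pi (s : ℝ) (ξ : 𝔼) : trig (s - Real.pi) ξ = -trig s ξ := by
  refine Subtype.ext (funext fun p => ?_)
  change trig (s - Real.pi) ξ p = -trig s ξ p
  rw [trig_app, trig_app, show 2 * Real.pi * inner ℝ p.1 ξ - (s - Real.pi)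
    = 2 * Real.pi * inner ℝ p.1 ξ - s + Real.pi by ring, Real.cos_add_pi]

theorem Lap_trig (s : ℝ) (ξ : 𝔼) : Lap (trig s ξ) = (-(ℓ[ξ] ^ 2)) • trig s ξ := by
  refine Subtype.ext (funext fun p => ?_)
  change Lap (trig s ξ) p = -(ℓ[ξ] ^ 2) * trig s ξ p
  rw [Lap_app, mul_pow, EuclideanSpace.norm_sq_eq, Finset.mul_sum, ← Finset.sum_neg_distrib,
    Finset.sum_mul]
  refine Finset.sum_congr rfl fun i _ => ?_
  rw [dX_trig, map_smul, dX_trig, show s - Real.pi / 2 - Real.pi / 2 = s - Real.pi by ring, trig_sub_pi]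
  simp only [smul_app, neg_app, Real.norm_eq_abs, sq_abs]
  ring

theorem fint_trig_Lap {R : ℝ} {f : ES n} (h : XSupp R f) (s : ℝ) (ξ : 𝔼) :
    fint R (trig s ξ) (Lap f) = lamOp ℓ[ξ] (fint R (trig s ξ) f) := by
  rw [fint_Lap (Or.inl h), Lap_trig, fint_smul_weight]; rfl

theorem fint_trig_wN {R : ℝ} {f : ES n} (h : XSupp R f) (s : ℝ) (ξ : 𝔼) (c : ℝ) :
    fint R (trig s ξ) (wN Y Q Lap c f)
      = wN Y Q (lamOp ℓ[ξ]) c (fint R (trig s ξ) f) := by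
  change fint R (trig s ξ) (Lap f + Y (Q (Q f)) + (2 + 2 * c) • Q f) =
    lamOp ℓ[ξ] (fint R (trig s ξ) f) + Y (Q (Q (fint R (trig s ξ) f)))
      + (2 + 2 * c) • Q (fint R (trig s ξ) f)
  rw [map_add, map_add, map_smul, fint_trig_Lap h, fint_Y, fint_Q, fint_Q]

theorem fint_trig_wC {R : ℝ} {f : ES n} (h : XSupp R f) (s : ℝ) (ξ : 𝔼) (c : ℝ) (j : ℕ) :
    fint R (trig s ξ) (wC Y Q Lap c j f)
      = wC Y Q (lamOp ℓ[ξ]) c j (fint R (trig s ξ) f) := by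
  induction j with
  | zero => rfl
  | succ j ih =>
    change fint R (trig s ξ) (wN Y Q Lap (c + 2 * j) (wC Y Q Lap c j f)) =
      wN Y Q (lamOp ℓ[ξ]) (c + 2 * j) (wC Y Q (lamOp ℓ[ξ]) c j (fint R (trig s ξ) f))
    rw [fint_trig_wN (h.wc c j), ih]

theorem continuous_fint_trig (R s : ℝ) (f : ES n) :
    Continuous fun q : 𝔼 × ℝ => fint R (trig s q.1) f (0, q.2) :=
  (contDiff_setIntegral_param (P := 𝔼 × ℝ) (X := 𝔼) volume (isCompact_closedBall 0 R)
    (F := fun q => f (q.2, q.1.2) * Real.cos (2 * Real.pi * inner ℝ q.2 q.1.1 - s))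
    (((smooth f).comp (by fun_prop)).mul (((contDiff_const.mul
      (contDiff_snd.inner ℝ (contDiff_fst.comp contDiff_fst))).sub contDiff_const).cos))).continuous

theorem fint_trig_bound {R : ℝ} (f : ES n) (T : ℝ) : ∃ C, 0 ≤ C ∧ ∀ s ξ y, |y| ≤ T →
    |fint R (trig s ξ) f (0, y)| ≤ C := by
  obtain ⟨B, hB⟩ := ((isCompact_closedBall (0 : 𝔼) R).prod (isCompact_Icc (a := -T) (b := T))).exists_bound_of_continuousOn
    (smooth f).continuous.continuousOn
  refine ⟨|B| * (volume : Measure 𝔼).real (Metric.closedBall 0 R), by positivity, fun s ξ y hy => ?_⟩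
  rw [fint_app, ← Real.norm_eq_abs]
  refine norm_setIntegral_le_of_norm_le_const
    (isCompact_closedBall (0 : 𝔼) R).measure_lt_top fun x hx => ?_
  rw [norm_mul, trig_app]
  have h1 := (hB (x, y) ⟨hx, abs_le.1 hy⟩).trans (le_abs_self B)
  have h2 := Real.abs_cos_le_one (2 * Real.pi * inner ℝ x ξ - s)
  calc _ ≤ |B| * 1 := mul_le_mul h1 h2 (abs_nonneg _) (abs_nonneg _)
    _ = _ := mul_one _

theorem fint_trig_decay {R : ℝ} {f : ES n} (h : XSupp R f) (N : ℕ) (T : ℝ) : ∃ C, 0 ≤ C ∧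
    ∀ s (ξ : 𝔼) y, |y| ≤ T →
      |fint R (trig s ξ) f (0, y)| ≤ C * ((1 + ‖ξ‖ ^ 2) ^ N)⁻¹ := by
  induction N generalizing f with
  | zero => simpa using fint_trig_bound f T
  | succ N ih =>
    have h' : XSupp R (f + (-1 : ℝ) • Lap f) := h.add (h.lap.smul _)
    obtain ⟨C, hC, hb⟩ := ih h'
    refine ⟨C, hC, fun s ξ y hy => ?_⟩
    have h1 := hb s ξ y hy
    have e : fint R (trig s ξ) (f + (-1 : ℝ) • Lap f) (0, y)
        = (1 + ℓ[ξ] ^ 2) * fint R (trig s ξ) f (0, y) := by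
      rw [map_add, map_smul, fint_trig_Lap h, add_app, smul_app]
      change _ + -1 * (-(ℓ[ξ] ^ 2) * fint R (trig s ξ) f (0, y)) = _
      ring
    rw [e, abs_mul, abs_of_pos (by positivity)] at h1
    have hp : 1 + ‖ξ‖ ^ 2 ≤ 1 + ℓ[ξ] ^ 2 := by
      have := Real.pi_gt_three
      have h1 : 1 ≤ 2 * Real.pi := by linarith
      have h2 : ‖ξ‖ ≤ ℓ[ξ] := le_mul_of_one_le_left (norm_nonneg _) h1
      have := pow_le_pow_left₀ (norm_nonneg ξ) h2 2
      linarith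
    have h2 : (1 + ‖ξ‖ ^ 2) * |fint R (trig s ξ) f (0, y)| ≤ C * ((1 + ‖ξ‖ ^ 2) ^ N)⁻¹ :=
      (mul_le_mul_of_nonneg_right hp (abs_nonneg _)).trans h1
    have hq : 0 < 1 + ‖ξ‖ ^ 2 := by positivity
    rw [pow_succ, mul_inv, ← mul_assoc, ← div_eq_mul_inv _ (1 + ‖ξ‖ ^ 2), le_div_iff₀ hq, mul_comm]
    exact h2

theorem fourier_ofReal {u : 𝔼 → ℝ} (hu : Integrable u) (ξ : 𝔼) :
    𝓕 (fun x => (u x : ℂ)) ξ = ((∫ x, u x * Real.cos (2 * Real.pi * inner ℝ x ξ - 0) : ℝ) : ℂ) -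
      ((∫ x, u x * Real.cos (2 * Real.pi * inner ℝ x ξ - Real.pi / 2) : ℝ) : ℂ) * Complex.I := by
  have hi : ∀ s, Integrable fun x => u x * Real.cos (2 * Real.pi * inner ℝ x ξ - s) := fun s =>
    hu.mul_bdd (c := 1) (by fun_prop) (Eventually.of_forall fun x => Real.abs_cos_le_one _)
  rw [Real.fourier_eq', ← integral_complex_ofReal, ← integral_complex_ofReal, ← integral_mul_const,
    ← integral_sub (hi 0).ofReal ((hi _).ofReal.mul_const _)]
  refine integral_ext fun x => ?_
  simp only [smul_eq_mul, sub_zero, Real.cos_sub_pi_div_two]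
  rw [Complex.exp_mul_I]
  push_cast
  rw [show (-2 * (Real.pi : ℂ) * (inner ℝ x ξ : ℝ)) = -(2 * Real.pi * (inner ℝ x ξ : ℝ)) by ring,
    Complex.cos_neg, Complex.sin_neg]
  ring

theorem plancherel {u v : 𝔼 → ℝ} (hu : ContDiff ℝ ∞ u) (hu' : HasCompactSupport u)
    (hv : ContDiff ℝ ∞ v) (hv' : HasCompactSupport v) : ∫ x, u x * v x = ∫ ξ : 𝔼,
      ((∫ x, u x * Real.cos (2 * Real.pi * inner ℝ x ξ - 0)) *
        (∫ x, v x * Real.cos (2 * Real.pi * inner ℝ x ξ - 0)) +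
      (∫ x, u x * Real.cos (2 * Real.pi * inner ℝ x ξ - Real.pi / 2)) *
        ∫ x, v x * Real.cos (2 * Real.pi * inner ℝ x ξ - Real.pi / 2)) := by
  have hc : ∀ {u : 𝔼 → ℝ}, HasCompactSupport u → HasCompactSupport fun x => (u x : ℂ) :=
    fun h => h.comp_left (g := Complex.ofReal) rfl
  have hd : ∀ {u : 𝔼 → ℝ}, ContDiff ℝ ∞ u → ContDiff ℝ ∞ fun x => (u x : ℂ) :=
    fun h => Complex.ofRealCLM.contDiff.comp h
  let fu := (hc hu').toSchwartzMap (hd hu)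
  let fv := (hc hv').toSchwartzMap (hd hv)
  have h := SchwartzMap.integral_inner_fourier_fourier fu fv
  have e1 : ∫ x, inner ℂ (fu x) (fv x) = ((∫ x, u x * v x : ℝ) : ℂ) := by
    rw [← integral_complex_ofReal]
    refine integral_ext fun x => ?_
    change inner ℂ (u x : ℂ) (v x : ℂ) = _
    simp [mul_comm]
  have hint : Integrable fun ξ => inner ℂ (𝓕 fu ξ) (𝓕 fv ξ) := by
    simp only [RCLike.inner_apply]
    refine (𝓕 fv).integrable.mul_bdd (c := SchwartzMap.seminorm ℂ 0 0 (𝓕 fu)) ?_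
      (Eventually.of_forall fun ξ => ?_)
    · exact (Complex.continuous_conj.comp (𝓕 fu).continuous).aestronglyMeasurable
    · rw [RCLike.norm_conj]; exact SchwartzMap.norm_le_seminorm ℂ _ ξ
  have h3 := congrArg Complex.re (h.trans e1)
  rw [Complex.ofReal_re] at h3
  rw [← h3, ← Complex.reCLM_apply, ← ContinuousLinearMap.integral_comp_comm _ hint]
  refine integral_ext fun ξ => ?_
  have iu := hu.continuous.integrable_of_hasCompactSupport hu' (μ := volume)
  have iv := hv.continuous.integrable_of_hasCompactSupport hv' (μ := volume)
  have k1 : 𝓕 fu ξ = 𝓕 (fun x => (u x : ℂ)) ξ := by rw [SchwartzMap.fourier_coe]; rfl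
  have k2 : 𝓕 fv ξ = 𝓕 (fun x => (v x : ℂ)) ξ := by rw [SchwartzMap.fourier_coe]; rfl
  simp only [k1, k2, fourier_ofReal iu, fourier_ofReal iv]
  simp
  ring

theorem MemCc.exists_rep {Φ : Pt n → ℝ} (h : MemCc γ Φ) : ∃ (f g : ES n) (R : ℝ), 0 < R ∧
    IsRep γ Φ f g ∧ ∀ p : Pt n, R < ‖p‖ → f p = 0 ∧ g p = 0 := by
  obtain ⟨hC, R, hR⟩ := h
  obtain ⟨f, g, hfg⟩ := hC.exists_rep
  set r := max R 0 with hr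
  have hr0 : 0 ≤ r := le_max_right _ _
  let b1 : ContDiffBump (0 : 𝔼) := ⟨r + 1, r + 2, by linarith, by linarith⟩
  let b2 : ContDiffBump (0 : ℝ) := ⟨r + 1, r + 2, by linarith, by linarith⟩
  let c : ES n := ⟨fun p => b1 p.1 * b2 p.2,
    (b1.contDiff.comp contDiff_fst).mul (b2.contDiff.comp contDiff_snd), fun x y => by
      simp only [b2.neg]⟩
  have hc1 : ∀ p : Pt n, ‖p‖ ≤ r → c p = 1 := fun p hp => by
    change b1 p.1 * b2 p.2 = 1
    have h1 := (norm_fst_le p).trans hp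
    have h2 := (norm_snd_le p).trans hp
    rw [b1.one_of_mem_closedBall (by rw [mem_closedBall_zero_iff]; change _ ≤ r + 1; linarith),
      b2.one_of_mem_closedBall (by rw [mem_closedBall_zero_iff]; change _ ≤ r + 1; linarith), one_mul]
  have hc0 : ∀ p : Pt n, r + 2 < ‖p‖ → c p = 0 := fun p hp => by
    change b1 p.1 * b2 p.2 = 0
    rw [Prod.norm_def, lt_max_iff] at hp
    rcases hp with hp | hp
    · rw [b1.zero_of_le_dist (by rw [dist_zero_right]; exact hp.le), zero_mul]
    · rw [b2.zero_of_le_dist (by rw [dist_zero_right]; exact hp.le), mul_zero]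
  refine ⟨mul c f, mul c g, r + 2, by linarith, fun p hp => ?_, fun p hp => ?_⟩
  · change Φ p = c p * f p + p.2 ^ (2 * fract γ) * (c p * g p)
    rcases le_or_gt ‖p‖ r with h | h
    · rw [hc1 p h, hfg p hp]; ring
    · have := hfg p hp
      rw [hR p hp ((le_max_left _ _).trans_lt h)] at *
      linear_combination c p * this
  · exact ⟨mul_eq_zero_of_left (hc0 p hp) _, mul_eq_zero_of_left (hc0 p hp) _⟩

/-- Vanishing outside a ball. -/
def BSupp (R : ℝ) (f : ES n) : Prop := ∀ p : Pt n, R < ‖p‖ → f p = 0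

theorem BSupp.xsupp {R : ℝ} {f : ES n} (h : BSupp R f) : XSupp R f :=
  fun p hp => h p (hp.trans_le (norm_fst_le p))

/-- The cosine or sine transform of a pair. -/
def ftr (R s : ℝ) (ξ : 𝔼) (f g : ES n) : ES 0 × ES 0 := (fint R (trig s ξ) f, fint R (trig s ξ) g)

theorem val_ftr {R : ℝ} {f g : ES n} (hf : XSupp R f) (hg : XSupp R g) (a s : ℝ) (ξ : 𝔼) (y : ℝ) :
    val a (ftr R s ξ f g) y =
      ∫ x, (f (x, y) + y ^ (2 * a) * g (x, y)) * Real.cos (2 * Real.pi * inner ℝ x ξ - s) := by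
  rw [val, pv, ftr, fint_eq (Or.inl hf), fint_eq (Or.inl hg), rpow_zero, one_mul,
    ← integral_const_mul, ← integral_add (integrable_slice_mul (Or.inl hf) y 0)
      ((integrable_slice_mul (Or.inl hg) y 0).const_mul _)]
  refine integral_ext fun x => ?_
  simp only [trig_app]; ring

theorem cpt_ftr {R : ℝ} {f g : ES n} (hf : BSupp R f) (hg : BSupp R g) (s : ℝ) (ξ : 𝔼) :
    Cpt (ftr R s ξ f g) := by
  refine ⟨R, fun y hy => ?_⟩
  have h : ∀ f : ES n, BSupp R f → fint R (trig s ξ) f (0, y) = 0 := fun f hf => by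
    rw [fint_app]
    refine integral_eq_zero_of_ae (Eventually.of_forall fun x => ?_)
    exact mul_eq_zero_of_left (hf (x, y) (hy.trans_le ((le_abs_self y).trans (norm_snd_le (x, y))))) _
  exact ⟨h f hf, h g hg⟩

theorem measurable_val_ftr (R a s : ℝ) (f g : ES n) :
    Measurable fun q : 𝔼 × ℝ => val a (ftr R s q.1 f g) q.2 := by
  unfold val pv
  exact ((measurable_snd.pow_const _).mul (continuous_fint_trig R s f).measurable).add
    ((measurable_snd.pow_const _).mul (continuous_fint_trig R s g).measurable)

theorem val_ftr_decay {a R : ℝ} (ha : 0 ≤ a) {f g : ES n} (hf : XSupp R f) (hg : XSupp R g) (N : ℕ)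
    (T : ℝ) : ∃ C, 0 ≤ C ∧ ∀ s (ξ : 𝔼) y, 0 < y → y ≤ T →
      |val a (ftr R s ξ f g) y| ≤ C * ((1 + ‖ξ‖ ^ 2) ^ N)⁻¹ := by
  obtain ⟨C, hC, h1⟩ := fint_trig_decay hf N T
  obtain ⟨D, hD, h2⟩ := fint_trig_decay hg N T
  refine ⟨C + |T| ^ (2 * a) * D, by positivity, fun s ξ y hy hyT => ?_⟩
  have hyT' : |y| ≤ T := by rwa [abs_of_pos hy]
  rw [val, pv, rpow_zero, one_mul]
  have h3 : y ^ (2 * a) ≤ |T| ^ (2 * a) :=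
    rpow_le_rpow hy.le (hyT.trans (le_abs_self T)) (by linarith)
  have h4 : 0 ≤ y ^ (2 * a) := by positivity
  calc _ ≤ |fint R (trig s ξ) f (0, y)| + |y ^ (2 * a) * fint R (trig s ξ) g (0, y)| := abs_add_le _ _
    _ = |fint R (trig s ξ) f (0, y)| + y ^ (2 * a) * |fint R (trig s ξ) g (0, y)| := by
        rw [abs_mul, abs_of_nonneg h4]
    _ ≤ C * ((1 + ‖ξ‖ ^ 2) ^ N)⁻¹ + |T| ^ (2 * a) * (D * ((1 + ‖ξ‖ ^ 2) ^ N)⁻¹) := by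
        gcongr
        · exact h1 s ξ y hyT'
        · exact h2 s ξ y hyT'
    _ = _ := by ring

theorem integrable_inv_pow : Integrable fun ξ : 𝔼 => ((1 + ‖ξ‖ ^ 2) ^ (n + 1))⁻¹ := by
  have h := integrable_rpow_neg_one_add_norm_sq (E := 𝔼) (μ := volume) (r := 2 * ((n + 1 : ℕ) : ℝ)) (by
    rw [finrank_euclideanSpace_fin]; push_cast; linarith [(Nat.cast_nonneg n : (0 : ℝ) ≤ n)])
  refine h.congr (Eventually.of_forall fun ξ => ?_)
  simp only
  rw [show -(2 * ((n + 1 : ℕ) : ℝ)) / 2 = -((n + 1 : ℕ) : ℝ) by ring, rpow_neg (by positivity),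
    rpow_natCast]

theorem integrable_prod_val {a : ℝ} (h0 : 0 < a) (h1 : a < 1) {R : ℝ} {f g f' g' : ES n}
    (hf : BSupp R f) (hg : BSupp R g) (hf' : XSupp R f') (hg' : XSupp R g') (s : ℝ) :
    Integrable (fun q : 𝔼 × ℝ => q.2 ^ (1 - 2 * a) *
      (val a (ftr R s q.1 f g) q.2 * val a (ftr R s q.1 f' g') q.2))
      ((volume : Measure 𝔼).prod (volume.restrict (Ioi (0 : ℝ)))) := by
  obtain ⟨C, hC, hb⟩ := val_ftr_decay h0.le hf.xsupp hg.xsupp (n + 1) R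
  obtain ⟨D, hD, hd⟩ := val_ftr_decay h0.le hf' hg' 0 R
  have hi : Integrable ((Ioc 0 R).indicator fun y : ℝ => C * D * y ^ (1 - 2 * a)) (volume.restrict (Ioi (0 : ℝ))) := by
    rw [integrable_indicator_iff measurableSet_Ioc]
    have := (integrableOn_rpow_mul_Ioc (p := 1 - 2 * a) (by linarith) continuous_const (F := fun _ => C * D) R)
    refine IntegrableOn.mono_measure (this.congr_fun (fun y _ => mul_comm _ _) measurableSet_Ioc)
      Measure.restrict_le_self
  refine (integrable_inv_pow.mul_prod hi).mono' ?_ ?_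
  · exact ((measurable_snd.pow_const _).mul ((measurable_val_ftr R a s f g).mul
      (measurable_val_ftr R a s f' g'))).aestronglyMeasurable
  · have hm : (volume : Measure 𝔼).prod (volume.restrict (Ioi (0 : ℝ)))
        = ((volume : Measure 𝔼).prod volume).restrict (univ ×ˢ Ioi 0) := by
      rw [← Measure.prod_restrict, Measure.restrict_univ]
    rw [hm]
    filter_upwards [ae_restrict_mem (MeasurableSet.univ.prod measurableSet_Ioi)] with q hq
    have hy : 0 < q.2 := hq.2
    have hp : 0 < ((1 + ‖q.1‖ ^ 2) ^ (n + 1))⁻¹ := by positivity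
    have hy1 : 0 ≤ q.2 ^ (1 - 2 * a) := by positivity
    rcases le_or_gt q.2 R with h | h
    · rw [indicator_of_mem (show q.2 ∈ Ioc 0 R from ⟨hy, h⟩), norm_mul, norm_mul, Real.norm_of_nonneg hy1]
      have e1 := hb s q.1 q.2 hy h
      have e2 := hd s q.1 q.2 hy h
      rw [pow_zero, inv_one, mul_one] at e2
      calc _ ≤ q.2 ^ (1 - 2 * a) * (C * ((1 + ‖q.1‖ ^ 2) ^ (n + 1))⁻¹ * D) := by
            refine mul_le_mul_of_nonneg_left (mul_le_mul e1 e2 (norm_nonneg _) (by positivity)) hy1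
        _ = _ := by ring
    · have hz : val a (ftr R s q.1 f g) q.2 = 0 := by
        have e : ∀ f : ES n, BSupp R f → fint R (trig s q.1) f (0, q.2) = 0 := fun f hf => by
          rw [fint_app]
          refine integral_eq_zero_of_ae (Eventually.of_forall fun x => ?_)
          exact mul_eq_zero_of_left
            (hf (x, q.2) (h.trans_le ((le_abs_self q.2).trans (norm_snd_le (x, q.2))))) _
        rw [val, pv, ftr, e f hf, e g hg, mul_zero, mul_zero, add_zero]
      rw [hz, zero_mul, mul_zero, norm_zero, indicator_of_notMem fun h' => not_lt.2 h'.2 h, mul_zero]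

theorem integrable_fint_mul {R : ℝ} {f g : ES n} (hf : XSupp R f) (hg : XSupp R g) (s : ℝ) :
    Integrable fun ξ : 𝔼 => fint R (trig s ξ) f (0, 0) * fint R (trig s ξ) g (0, 0) := by
  obtain ⟨C, hC, hb⟩ := fint_trig_decay hf (n + 1) 0
  obtain ⟨D, hD, hd⟩ := fint_trig_decay hg 0 0
  have hm : ∀ f : ES n, Continuous fun ξ : 𝔼 => fint R (trig s ξ) f (0, 0) := fun f => by
    have h1 : Continuous fun ξ : 𝔼 => (ξ, (0 : ℝ)) := by fun_prop
    have h2 := (continuous_fint_trig R s f).comp h1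
    exact h2
  have hm2 := (hm f).mul (hm g)
  refine (integrable_inv_pow.const_mul (C * D)).mono' hm2.aestronglyMeasurable
    (Eventually.of_forall fun ξ => ?_)
  have e1 := hb s ξ 0 abs_zero.le
  have e2 := hd s ξ 0 abs_zero.le
  rw [pow_zero, inv_one, mul_one] at e2
  rw [norm_mul]
  calc _ ≤ C * ((1 + ‖ξ‖ ^ 2) ^ (n + 1))⁻¹ * D := mul_le_mul e1 e2 (abs_nonneg _) (by positivity)
    _ = _ := by ring

theorem plancherel_pair {R : ℝ} {f g f' g' : ES n} (hf : XSupp R f) (hg : XSupp R g) (hf' : XSupp R f')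
    (hg' : XSupp R g') (a y : ℝ) :
    ∫ x, (f (x, y) + y ^ (2 * a) * g (x, y)) * (f' (x, y) + y ^ (2 * a) * g' (x, y)) =
      ∫ ξ : 𝔼, (val a (ftr R 0 ξ f g) y * val a (ftr R 0 ξ f' g') y +
        val a (ftr R (Real.pi / 2) ξ f g) y * val a (ftr R (Real.pi / 2) ξ f' g') y) := by
  have hs : ∀ f g : ES n, ContDiff ℝ ∞ fun x => f (x, y) + y ^ (2 * a) * g (x, y) := fun f g =>
    (contDiff_slice f y).add (contDiff_const.mul (contDiff_slice g y))
  have hc : ∀ f g : ES n, XSupp R f → XSupp R g →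
      HasCompactSupport fun x => f (x, y) + y ^ (2 * a) * g (x, y) := fun f g hf hg =>
    (hf.hasCompactSupport y).add ((hg.hasCompactSupport y).mul_left)
  rw [plancherel (hs f g) (hc f g hf hg) (hs f' g') (hc f' g' hf' hg')]
  simp only [val_ftr hf hg, val_ftr hf' hg']

theorem plancherel_zero {R : ℝ} {f g : ES n} (hf : XSupp R f) (hg : XSupp R g) :
    ∫ x, f (x, 0) * g (x, 0) = ∫ ξ : 𝔼, (fint R (trig 0 ξ) f (0, 0) * fint R (trig 0 ξ) g (0, 0) +
        fint R (trig (Real.pi / 2) ξ) f (0, 0) * fint R (trig (Real.pi / 2) ξ) g (0, 0)) := by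
  rw [plancherel (contDiff_slice f 0) (hf.hasCompactSupport 0) (contDiff_slice g 0)
    (hg.hasCompactSupport 0)]
  simp only [fint_eq (Or.inl hf), fint_eq (Or.inl hg), trig_app]

theorem integral_upper {a : ℝ} (h0 : 0 < a) (h1 : a < 1) {R : ℝ} {f g f' g' : ES n}
    (hf : BSupp R f) (hg : BSupp R g) :
    ∫ p in upper n, (f p + p.2 ^ (2 * a) * g p) * (f' p + p.2 ^ (2 * a) * g' p) * p.2 ^ (1 - 2 * a) =
      ∫ y in Ioi (0 : ℝ), y ^ (1 - 2 * a) *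
        ∫ x, (f (x, y) + y ^ (2 * a) * g (x, y)) * (f' (x, y) + y ^ (2 * a) * g' (x, y)) := by
  have hm : (volume : Measure (Pt n)).restrict (upper n)
      = (volume : Measure 𝔼).prod (volume.restrict (Ioi (0 : ℝ))) := by
    have : upper n = univ ×ˢ Ioi (0 : ℝ) := by ext p; simp [upper]
    rw [this, Measure.volume_eq_prod, ← Measure.prod_restrict, Measure.restrict_univ]
  set u : Pt n → ℝ := fun p => f p + p.2 ^ (2 * a) * g p
  set v : Pt n → ℝ := fun p => f' p + p.2 ^ (2 * a) * g' p
  have hbd : ∀ f : ES n, ∃ B, 0 ≤ B ∧ ∀ p : Pt n, ‖p‖ ≤ R → |f p| ≤ B := fun f => by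
    obtain ⟨B, hB⟩ := (isCompact_closedBall (0 : Pt n) R).exists_bound_of_continuousOn
      (smooth f).continuous.continuousOn
    exact ⟨|B|, abs_nonneg _, fun p hp => (hB p (by simpa using hp)).trans (le_abs_self B)⟩
  have hbd2 : ∀ f g : ES n, ∃ B, 0 ≤ B ∧ ∀ p : Pt n, 0 < p.2 → ‖p‖ ≤ R →
      |f p + p.2 ^ (2 * a) * g p| ≤ B := fun f g => by
    obtain ⟨B, hB, h⟩ := hbd f
    obtain ⟨D, hD, h'⟩ := hbd g
    refine ⟨B + |R| ^ (2 * a) * D, by positivity, fun p hp hpR => (abs_add_le _ _).trans ?_⟩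
    rw [abs_mul, abs_of_nonneg (by positivity : 0 ≤ p.2 ^ (2 * a))]
    have h3 : p.2 ^ (2 * a) ≤ |R| ^ (2 * a) :=
      rpow_le_rpow hp.le ((le_abs_self _).trans ((norm_snd_le p).trans (hpR.trans (le_abs_self R)))) (by linarith)
    gcongr
    · exact h p hpR
    · exact h' p hpR
  obtain ⟨B, hB, hu⟩ := hbd2 f g
  obtain ⟨D, hD, hv⟩ := hbd2 f' g'
  have hmeas : ∀ f g : ES n, Measurable fun p : Pt n => f p + p.2 ^ (2 * a) * g p := fun f g =>
    (smooth f).continuous.measurable.add ((measurable_snd.pow_const _).mul (smooth g).continuous.measurable)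
  have hI : Integrable (fun p => u p * v p * p.2 ^ (1 - 2 * a))
      ((volume : Measure 𝔼).prod (volume.restrict (Ioi (0 : ℝ)))) := by
    have hi : Integrable ((Ioc 0 R).indicator fun y : ℝ => B * D * y ^ (1 - 2 * a)) (volume.restrict (Ioi (0 : ℝ))) := by
      rw [integrable_indicator_iff measurableSet_Ioc]
      have := (integrableOn_rpow_mul_Ioc (p := 1 - 2 * a) (by linarith) continuous_const (F := fun _ => B * D) R)
      exact IntegrableOn.mono_measure (this.congr_fun (fun y _ => mul_comm _ _) measurableSet_Ioc)
        Measure.restrict_le_self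
    have hi2 : Integrable ((Metric.closedBall (0 : 𝔼) R).indicator fun _ => (1 : ℝ)) := by
      rw [integrable_indicator_iff Metric.isClosed_closedBall.measurableSet]
      exact integrableOn_const (isCompact_closedBall _ _).measure_lt_top.ne
    refine (hi2.mul_prod hi).mono' (((hmeas f g).mul (hmeas f' g')).mul
      (measurable_snd.pow_const _)).aestronglyMeasurable ?_
    rw [← hm]
    filter_upwards [ae_restrict_mem (isOpen_lt continuous_const continuous_snd).measurableSet] with p hp
    have hp : 0 < p.2 := hp
    have hy1 : 0 ≤ p.2 ^ (1 - 2 * a) := by positivity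
    rcases le_or_gt ‖p‖ R with h | h
    · rw [indicator_of_mem (by simpa using (norm_fst_le p).trans h), indicator_of_mem
        (show p.2 ∈ Ioc 0 R from ⟨hp, (le_abs_self _).trans ((norm_snd_le p).trans h)⟩), norm_mul, norm_mul, Real.norm_of_nonneg hy1,
        one_mul]
      exact mul_le_mul_of_nonneg_right (mul_le_mul (hu p hp h) (hv p hp h) (norm_nonneg _) hB) hy1
    · have : u p = 0 := by simp only [u]; rw [hf p h, hg p h, mul_zero, add_zero]
      rw [this, zero_mul, zero_mul, norm_zero]
      refine mul_nonneg (indicator_nonneg (fun _ _ => zero_le_one) _) (indicator_nonneg (fun y hy => ?_) _)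
      have : 0 < y := hy.1
      positivity
  rw [hm, integral_prod_symm _ hI]
  refine integral_Ioi_ext fun y _ => ?_
  simp only [u, v]
  rw [← integral_const_mul]
  exact integral_ext fun x => by ring

theorem energy1_ftr (hγ : 0 ≤ γ) {R : ℝ} {f g : ES n} (hf : XSupp R f) (hg : XSupp R g) (s : ℝ) (ξ : 𝔼) :
    energy1 γ ℓ[ξ] (ftr R s ξ f g) =
      (∫ y in Ioi (0 : ℝ), y ^ (1 - 2 * fract γ) * (val (fract γ) (ftr R s ξ f g) y *
        val (fract γ) (ftr R s ξ ((-1 : ℝ) ^ (⌊γ⌋₊ + 1) • wC Y Q Lap (-γ) (⌊γ⌋₊ + 1) f)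
          ((-1 : ℝ) ^ (⌊γ⌋₊ + 1) • wC Y Q Lap δ[γ] (⌊γ⌋₊ + 1) g)) y)) -
      ∑ j ∈ Finset.range (⌊γ⌋₊ + 1), sigma γ j / (bNorm (-γ) j * bNorm δ[γ] (⌊γ⌋₊ - j)) *
        (fint R (trig s ξ) (wC Y Q Lap (-γ) j f) (0, 0) *
          fint R (trig s ξ) (wC Y Q Lap δ[γ] (⌊γ⌋₊ - j) g) (0, 0)) := by
  rw [energy1, ip, L1_pow_eq hγ]
  simp only [ftr, map_smul, fint_trig_wC hf, fint_trig_wC hg, lowE_app, lowF_app]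
  congr 1
  refine Finset.sum_congr rfl fun j _ => ?_
  rw [div_mul_div_comm, mul_div_assoc', mul_comm_div, mul_div_assoc]

/-- The sum of the energies of the cosine and sine transforms. -/
def edens (γ R : ℝ) (f g : ES n) (ξ : 𝔼) : ℝ :=
  energy1 γ ℓ[ξ] (ftr R 0 ξ f g) +
    energy1 γ ℓ[ξ] (ftr R (Real.pi / 2) ξ f g)

theorem integrable_energy1 (hγ : 0 ≤ γ) (ha : 0 < fract γ) {R : ℝ} {f g : ES n} (hf : BSupp R f)
    (hg : BSupp R g) (s : ℝ) : (Integrable fun ξ : 𝔼 => energy1 γ ℓ[ξ] (ftr R s ξ f g)) ∧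
      Measurable fun ξ : 𝔼 => energy1 γ ℓ[ξ] (ftr R s ξ f g) := by
  simp only [energy1_ftr hγ hf.xsupp hg.xsupp]
  have hm : ∀ f : ES n, Measurable fun ξ : 𝔼 => fint R (trig s ξ) f (0, 0) := fun f => by
    have h1 : Continuous fun ξ : 𝔼 => (ξ, (0 : ℝ)) := by fun_prop
    have h2 := (continuous_fint_trig R s f).comp h1
    exact h2.measurable
  constructor
  · refine Integrable.sub ?_ (integrable_finsetSum _ fun j _ => (integrable_fint_mul ?_ ?_ s).const_mul _)
    · exact (integrable_prod_val ha (Int.fract_lt_one γ) hf hg ((hf.xsupp.wc _ _).smul _)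
        ((hg.xsupp.wc _ _).smul _) s).integral_prod_left
    · exact hf.xsupp.wc _ _
    · exact hg.xsupp.wc _ _
  · refine Measurable.sub ?_ (Finset.measurable_fun_sum _ fun j _ => ((hm _).mul (hm _)).const_mul _)
    refine (StronglyMeasurable.integral_prod_right (f := fun (ξ : 𝔼) (y : ℝ) =>
      y ^ (1 - 2 * fract γ) * (val (fract γ) (ftr R s ξ f g) y *
        val (fract γ) (ftr R s ξ ((-1 : ℝ) ^ (⌊γ⌋₊ + 1) • wC Y Q Lap (-γ) (⌊γ⌋₊ + 1) f)
          ((-1 : ℝ) ^ (⌊γ⌋₊ + 1) • wC Y Q Lap δ[γ] (⌊γ⌋₊ + 1) g)) y)) ?_).measurable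
    exact ((measurable_snd.pow_const _).mul ((measurable_val_ftr R _ s f g).mul
      (measurable_val_ftr R _ s _ _))).stronglyMeasurable

theorem sum_split (γ : ℝ) (F : ℕ → ℝ) : (∑ j ∈ Finset.range (⌊γ / 2⌋₊ + 1), F j) +
    ∑ j ∈ Finset.Icc (⌊γ / 2⌋₊ + 1) ⌊γ⌋₊, F j = ∑ j ∈ Finset.range (⌊γ⌋₊ + 1), F j := by
  have h : ⌊γ / 2⌋₊ = ⌊γ⌋₊ / 2 := Nat.floor_div_ofNat γ 2
  have e : Finset.Icc (⌊γ / 2⌋₊ + 1) ⌊γ⌋₊ = Finset.Ico (⌊γ / 2⌋₊ + 1) (⌊γ⌋₊ + 1) := by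
    ext j; simp only [Finset.mem_Icc, Finset.mem_Ico]; omega
  rw [e, Finset.sum_range_add_sum_Ico _ (by omega)]

theorem integral_edens (hγ : 0 ≤ γ) (ha : 0 < fract γ) {R : ℝ} {Φ : Pt n → ℝ} {f g : ES n}
    (h : IsRep γ Φ f g) (hf : BSupp R f) (hg : BSupp R g) :
    ∫ ξ : 𝔼, edens γ R f g ξ = energy γ Φ := by
  have h1 := Int.fract_lt_one γ
  set a := fract γ with hadef
  set m := ⌊γ⌋₊ with hm
  set F := (-1 : ℝ) ^ (m + 1) • wC Y Q Lap (-γ) (m + 1) f with hF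
  set G := (-1 : ℝ) ^ (m + 1) • wC Y Q Lap (γ - 2 * (m : ℝ)) (m + 1) g with hG
  have hFs : XSupp R F := (hf.xsupp.wc _ _).smul _
  have hGs : XSupp R G := (hg.xsupp.wc _ _).smul _
  have e1 : (∫ p in upper n, Φ p * opL γ Φ p * p.2 ^ (1 - 2 * a)) = ∫ y in Ioi (0 : ℝ), y ^ (1 - 2 * a) *
      ∫ x, (f (x, y) + y ^ (2 * a) * g (x, y)) * (F (x, y) + y ^ (2 * a) * G (x, y)) := by
    rw [← integral_upper ha h1 hf hg]
    refine setIntegral_congr_fun (isOpen_lt continuous_const continuous_snd).measurableSet fun p hp => ?_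
    rw [h p hp, opL_eq hγ h p hp, hF, hG, smul_app, smul_app]
    ring
  have e2 : ∀ j ∈ Finset.range (m + 1), (∫ x, bEven γ j Φ x * bFrac γ (m - j) Φ x) =
      (∫ ξ : 𝔼, (fint R (trig 0 ξ) (wC Y Q Lap (-γ) j f) (0, 0) *
          fint R (trig 0 ξ) (wC Y Q Lap (γ - 2 * (m : ℝ)) (m - j) g) (0, 0) +
        fint R (trig (Real.pi / 2) ξ) (wC Y Q Lap (-γ) j f) (0, 0) *
          fint R (trig (Real.pi / 2) ξ) (wC Y Q Lap (γ - 2 * (m : ℝ)) (m - j) g) (0, 0))) /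
          (bNorm (-γ) j * bNorm (γ - 2 * (m : ℝ)) (m - j)) := fun j hj => by
    have hj' : j ≤ m := Nat.lt_succ_iff.1 (Finset.mem_range.1 hj)
    rw [← plancherel_zero (hf.xsupp.wc _ _) (hg.xsupp.wc _ _), ← integral_div]
    refine integral_ext fun x => ?_
    rw [bEven_eq hγ ha h hj', bFrac_eq hγ ha h (Nat.sub_le _ _), div_mul_div_comm]
  have e3 : energy γ Φ = (∫ p in upper n, Φ p * opL γ Φ p * p.2 ^ (1 - 2 * a)) -
      ∑ j ∈ Finset.range (m + 1), sigma γ j * ∫ x, bEven γ j Φ x * bFrac γ (m - j) Φ x := by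
    rw [← sum_split, energy, dirichletForm, sub_sub]
    simp only [mul_comm (bFrac γ _ Φ _), ← hm, ← hadef]
  have i1 := fun s => integrable_prod_val ha h1 hf hg hFs hGs s
  have iS : ∀ s j, Integrable fun ξ : 𝔼 => fint R (trig s ξ) (wC Y Q Lap (-γ) j f) (0, 0) *
      fint R (trig s ξ) (wC Y Q Lap (γ - 2 * (m : ℝ)) (m - j) g) (0, 0) := fun s j =>
    integrable_fint_mul (hf.xsupp.wc _ _) (hg.xsupp.wc _ _) s
  have key : ∀ s, ∫ ξ : 𝔼, energy1 γ ℓ[ξ] (ftr R s ξ f g) =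
      (∫ y in Ioi (0 : ℝ), y ^ (1 - 2 * a) *
        ∫ ξ : 𝔼, val a (ftr R s ξ f g) y * val a (ftr R s ξ F G) y) -
      ∑ j ∈ Finset.range (m + 1), sigma γ j / (bNorm (-γ) j * bNorm (γ - 2 * (m : ℝ)) (m - j)) *
        ∫ ξ : 𝔼, fint R (trig s ξ) (wC Y Q Lap (-γ) j f) (0, 0) *
          fint R (trig s ξ) (wC Y Q Lap (γ - 2 * (m : ℝ)) (m - j) g) (0, 0) := fun s => by
    simp only [energy1_ftr hγ hf.xsupp hg.xsupp]
    rw [integral_sub (i1 s).integral_prod_left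
      (integrable_finsetSum _ fun j _ => (iS s j).const_mul _),
      integral_finsetSum _ fun j _ => (iS s j).const_mul _]
    congr 1
    · rw [integral_integral_swap (i1 s)]
      simp only [integral_const_mul]
    · simp only [integral_const_mul, hm]
  have iy : ∀ s, IntegrableOn (fun y : ℝ => y ^ (1 - 2 * a) *
        ∫ ξ : 𝔼, val a (ftr R s ξ f g) y * val a (ftr R s ξ F G) y) (Ioi 0) := fun s => by
    have := (i1 s).integral_prod_right
    simp only [integral_const_mul] at this
    exact this
  have iv : ∀ s, ∀ y ∈ Ioi (0 : ℝ), Integrable fun ξ : 𝔼 => val a (ftr R s ξ f g) y * val a (ftr R s ξ F G) y :=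
    fun s y (hy : 0 < y) => by
    obtain ⟨C, hC, hb⟩ := val_ftr_decay ha.le hf.xsupp hg.xsupp (n + 1) y
    obtain ⟨D, hD, hd⟩ := val_ftr_decay ha.le hFs hGs 0 y
    have hmm : ∀ f g : ES n, Measurable fun ξ : 𝔼 => val a (ftr R s ξ f g) y := fun f g => by
      have h1 : Measurable fun ξ : 𝔼 => (ξ, y) := by fun_prop
      have h2 := (measurable_val_ftr R a s f g).comp h1
      exact h2
    have hm2 := (hmm f g).mul (hmm F G)
    refine (integrable_inv_pow.const_mul (C * D)).mono' hm2.aestronglyMeasurable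
      (Eventually.of_forall fun ξ => ?_)
    have e1 := hb s ξ y hy le_rfl
    have e2 := hd s ξ y hy le_rfl
    rw [pow_zero, inv_one, mul_one] at e2
    rw [norm_mul]
    calc _ ≤ C * ((1 + ‖ξ‖ ^ 2) ^ (n + 1))⁻¹ * D := mul_le_mul e1 e2 (abs_nonneg _) (by positivity)
      _ = _ := by ring
  simp only [edens]
  rw [integral_add (integrable_energy1 hγ ha hf hg 0).1 (integrable_energy1 hγ ha hf hg _).1, key, key,
    e3, e1, Finset.sum_congr rfl fun j hj => congrArg (sigma γ j * ·) (e2 j hj), sub_add_sub_comm, ← integral_add (iy 0) (iy _),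
    ← Finset.sum_add_distrib]
  congr 1
  · refine integral_Ioi_ext fun y hy => ?_
    rw [plancherel_pair hf.xsupp hg.xsupp hFs hGs, integral_add (iv 0 y hy) (iv _ y hy), mul_add]
  · refine Finset.sum_congr rfl fun j _ => ?_
    rw [integral_add (iS 0 j) (iS _ j)]
    ring

theorem edens_nonneg_bound (hγ : 0 ≤ γ) (ha : 0 < fract γ) : ∃ C, 0 < C ∧ ∀ (R : ℝ) (f g : ES n),
    BSupp R f → BSupp R g → ∀ ξ : 𝔼, ξ ≠ 0 → 0 ≤ edens γ R f g ξ ∧ ∀ y, 0 < y →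
      ‖((val (fract γ) (ftr R 0 ξ f g) y : ℝ) : ℂ) -
        ((val (fract γ) (ftr R (Real.pi / 2) ξ f g) y : ℝ) : ℂ) * Complex.I‖ ^ 2 ≤
      C * (ℓ[ξ] ^ (-(2 * γ)) * (1 + (ℓ[ξ] * y) ^ (2 * fract γ)))
        * edens γ R f g ξ := by
  obtain ⟨C, hC, h⟩ := energy1_coercive hγ ha
  refine ⟨C, hC, fun R f g hf hg ξ hξ => ?_⟩
  have hl : 0 < ℓ[ξ] := by have := norm_pos_iff.2 hξ; positivity
  obtain ⟨p1, b1⟩ := h _ hl _ (cpt_ftr hf hg 0 ξ)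
  obtain ⟨p2, b2⟩ := h _ hl _ (cpt_ftr hf hg (Real.pi / 2) ξ)
  refine ⟨add_nonneg p1 p2, fun y hy => ?_⟩
  have := b1 y hy
  have := b2 y hy
  rw [← Complex.normSq_eq_norm_sq, Complex.normSq_apply, edens]
  simp
  nlinarith

/-- The Fourier transform in the horizontal variable. -/
def slF (Φ : Pt n → ℝ) (ξ : 𝔼) (y : ℝ) : ℂ := 𝓕 (fun x => (Φ (x, y) : ℂ)) ξ

theorem slF_eq {Φ : Pt n → ℝ} {R : ℝ} {f g : ES n} (h : IsRep γ Φ f g) (hf : XSupp R f) (hg : XSupp R g)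
    (ξ : 𝔼) {y : ℝ} (hy : 0 < y) : slF Φ ξ y = ((val (fract γ) (ftr R 0 ξ f g) y : ℝ) : ℂ) -
        ((val (fract γ) (ftr R (Real.pi / 2) ξ f g) y : ℝ) : ℂ) * Complex.I := by
  have e : (fun x : 𝔼 => (Φ (x, y) : ℂ)) = fun x =>
      ((f (x, y) + y ^ (2 * fract γ) * g (x, y) : ℝ) : ℂ) := funext fun x => by rw [h (x, y) hy]
  have hi : Integrable fun x : 𝔼 => f (x, y) + y ^ (2 * fract γ) * g (x, y) :=
    Continuous.integrable_of_hasCompactSupport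
      ((contDiff_slice f y).continuous.add ((contDiff_slice g y).continuous.const_mul _))
      ((hf.hasCompactSupport y).add ((hg.hasCompactSupport y).mul_left))
  rw [slF, e, fourier_ofReal hi, val_ftr hf hg, val_ftr hf hg]

/-- The energy is the integral of a density controlling the Fourier transform pointwise. -/
theorem exists_energy_density (hγ : 0 ≤ γ) (ha : 0 < fract γ) (n : ℕ) : ∃ C, 0 < C ∧
    ∀ Φ : Pt n → ℝ, MemCc γ Φ → ∃ e : EuclideanSpace ℝ (Fin n) → ℝ, Measurable e ∧ Integrable e ∧
      (∀ ξ, ξ ≠ 0 → 0 ≤ e ξ) ∧ ∫ ξ, e ξ = energy γ Φ ∧ ∀ ξ, ξ ≠ 0 → ∀ y, 0 < y →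
        ‖slF Φ ξ y‖ ^ 2 ≤ C * (ℓ[ξ] ^ (-(2 * γ)) *
          (1 + (ℓ[ξ] * y) ^ (2 * fract γ))) * e ξ := by
  obtain ⟨C, hC, h⟩ := edens_nonneg_bound (n := n) hγ ha
  refine ⟨C, hC, fun Φ hΦ => ?_⟩
  obtain ⟨f, g, R, -, hrep, hfg⟩ := hΦ.exists_rep
  have hf : BSupp R f := fun p hp => (hfg p hp).1
  have hg : BSupp R g := fun p hp => (hfg p hp).2
  have i0 := integrable_energy1 hγ ha hf hg 0
  have i1 := integrable_energy1 hγ ha hf hg (Real.pi / 2)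
  refine ⟨edens γ R f g, i0.2.add i1.2, i0.1.add i1.1, fun ξ hξ => (h R f g hf hg ξ hξ).1,
    integral_edens hγ ha hrep hf hg, fun ξ hξ y hy => ?_⟩
  rw [slF_eq hrep hf.xsupp hg.xsupp ξ hy]
  exact (h R f g hf hg ξ hξ).2 y hy

theorem integrableOn_rpow_mul_inv_pow {c : ℝ} (hc : -1 < c) {M : ℕ} (hM : c + 1 < M) :
    IntegrableOn (fun y : ℝ => y ^ c * ((1 + y) ^ M)⁻¹) (Ioi 0) := by
  have hm : ∀ s : Set ℝ, AEStronglyMeasurable (fun y : ℝ => y ^ c * ((1 + y) ^ M)⁻¹) (volume.restrict s) := fun s =>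
    (by fun_prop : Measurable fun y : ℝ => y ^ c * ((1 + y) ^ M)⁻¹).aestronglyMeasurable
  rw [← Ioc_union_Ioi_eq_Ioi zero_le_one]
  refine IntegrableOn.union ?_ ?_
  · have h := integrableOn_rpow_mul_Ioc hc continuous_const (F := fun _ => 1) 1
    refine Integrable.mono' h (hm _) ?_
    filter_upwards [ae_restrict_mem measurableSet_Ioc] with y hy
    have hy0 : 0 < y := hy.1
    rw [Real.norm_of_nonneg (by positivity)]
    gcongr
    exact inv_le_one_of_one_le₀ (one_le_pow₀ (by linarith))
  · have h := integrableOn_Ioi_rpow_of_lt (a := c - M) (by linarith) one_pos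
    refine Integrable.mono' h (hm _) ?_
    filter_upwards [ae_restrict_mem measurableSet_Ioi] with y hy
    have hy1 : (1 : ℝ) < y := hy
    have hy0 : 0 < y := by linarith
    rw [Real.norm_of_nonneg (by positivity), rpow_sub hy0, rpow_natCast, div_eq_mul_inv]
    gcongr
    linarith

/-- The inverse Fourier transform of a real function. -/
def fi (ρ : 𝔼 → ℝ) (ξ : 𝔼) : ℂ := 𝓕⁻ (fun x => (ρ x : ℂ)) ξ

theorem exists_schwartz {ρ : 𝔼 → ℝ} (h : ContDiff ℝ ∞ ρ) (h' : HasCompactSupport ρ) :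
    ∃ S T : SchwartzMap 𝔼 ℂ, (∀ x, S x = ρ x) ∧ (∀ ξ, T ξ = fi ρ ξ) ∧ 𝓕 T = S := by
  let S : SchwartzMap 𝔼 ℂ := (h'.comp_left (g := Complex.ofReal) rfl).toSchwartzMap
    (Complex.ofRealCLM.contDiff.comp h)
  refine ⟨S, 𝓕⁻ S, fun x => rfl, fun ξ => ?_, FourierTransform.fourier_fourierInv_eq S⟩
  rw [SchwartzMap.fourierInv_coe]; rfl

theorem fi_decay {ρ : 𝔼 → ℝ} (h : ContDiff ℝ ∞ ρ) (h' : HasCompactSupport ρ) (N : ℕ) :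
    ∃ C, 0 ≤ C ∧ ∀ ξ, ‖fi ρ ξ‖ ≤ C * ((1 + ‖ξ‖) ^ N)⁻¹ := by
  obtain ⟨S, T, -, hT, -⟩ := exists_schwartz h h'
  refine ⟨2 ^ N * ((Finset.Iic (N, 0)).sup fun m => SchwartzMap.seminorm ℝ m.1 m.2) T, by positivity,
    fun ξ => ?_⟩
  have := SchwartzMap.one_add_le_sup_seminorm_apply (𝕜 := ℝ) (m := (N, 0)) (k := N) (n := 0) le_rfl le_rfl T ξ
  rw [norm_iteratedFDeriv_zero, hT] at this
  have hp : 0 < (1 + ‖ξ‖) ^ N := by positivity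
  rw [← div_eq_mul_inv, le_div_iff₀ hp, mul_comm]
  exact this

theorem continuous_fi {ρ : 𝔼 → ℝ} (h : ContDiff ℝ ∞ ρ) (h' : HasCompactSupport ρ) : Continuous (fi ρ) := by
  obtain ⟨S, T, -, hT, -⟩ := exists_schwartz h h'
  rw [← funext hT]; exact T.continuous

theorem integrable_fi {ρ : 𝔼 → ℝ} (h : ContDiff ℝ ∞ ρ) (h' : HasCompactSupport ρ) : Integrable (fi ρ) := by
  obtain ⟨S, T, -, hT, -⟩ := exists_schwartz h h'
  rw [← funext hT]; exact T.integrable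

theorem memLp_rpow_fi (hn : 0 < n) {ρ : 𝔼 → ℝ} (h : ContDiff ℝ ∞ ρ) (h' : HasCompactSupport ρ) {b : ℝ}
    (hb : -((n : ℝ) / 2) < b) : MemLp (fun ξ => ‖ξ‖ ^ b * ‖fi ρ ξ‖) 2 := by
  have : Nonempty (Fin n) := ⟨⟨0, hn⟩⟩
  have hm : AEStronglyMeasurable fun ξ : 𝔼 => ‖ξ‖ ^ b * ‖fi ρ ξ‖ :=
    ((measurable_norm.pow_const b).mul (continuous_fi h h').norm.measurable).aestronglyMeasurable
  rw [memLp_two_iff_integrable_sq hm]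
  obtain ⟨N, hN⟩ := exists_nat_gt (2 * b + n)
  obtain ⟨C, hC, hd⟩ := fi_decay h h' N
  have hc : (((n - 1 : ℕ) : ℕ) : ℝ) = n - 1 := by rw [Nat.cast_sub hn]; simp
  have hI : Integrable fun ξ : 𝔼 => (fun y : ℝ => y ^ (2 * b) * ((1 + y) ^ N)⁻¹) ‖ξ‖ := by
    rw [integrable_fun_norm_addHaar volume (f := fun y : ℝ => y ^ (2 * b) * ((1 + y) ^ N)⁻¹)]
    refine (integrableOn_rpow_mul_inv_pow (c := 2 * b + (n - 1)) (M := N) (by linarith)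
      (by linarith)).congr_fun (fun y hy => ?_) measurableSet_Ioi
    have hy : 0 < y := hy
    simp only [finrank_euclideanSpace_fin, smul_eq_mul]
    rw [rpow_add hy, ← hc, rpow_natCast]
    ring
  refine (hI.const_mul (C ^ 2)).mono' (hm.pow 2) (Eventually.of_forall fun ξ => ?_)
  rw [Real.norm_of_nonneg (by positivity), mul_pow, ← rpow_natCast, ← rpow_mul (norm_nonneg ξ),
    show b * ((2 : ℕ) : ℝ) = 2 * b by push_cast; ring]
  have h1 : ((1 + ‖ξ‖) ^ N)⁻¹ ≤ 1 := inv_le_one_of_one_le₀ (one_le_pow₀ (by linarith [norm_nonneg ξ]))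
  have h0 : 0 ≤ ((1 + ‖ξ‖) ^ N)⁻¹ := by positivity
  calc ‖ξ‖ ^ (2 * b) * ‖fi ρ ξ‖ ^ 2 ≤ ‖ξ‖ ^ (2 * b) * (C * ((1 + ‖ξ‖) ^ N)⁻¹) ^ 2 := by
        gcongr; exact hd ξ
    _ = C ^ 2 * (‖ξ‖ ^ (2 * b) * (((1 + ‖ξ‖) ^ N)⁻¹ * ((1 + ‖ξ‖) ^ N)⁻¹)) := by ring
    _ ≤ C ^ 2 * (‖ξ‖ ^ (2 * b) * (((1 + ‖ξ‖) ^ N)⁻¹ * 1)) := by gcongr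
    _ = _ := by rw [mul_one]

/-- Vanishing outside a compact subset of `(0, ∞)`. -/
def CSupp (χ : ℝ → ℝ) : Prop := ∃ p q, 0 < p ∧ ∀ y, y ∉ Icc p q → χ y = 0

theorem upper_measure : (volume : Measure (Pt n)).restrict (upper n)
    = (volume : Measure 𝔼).prod (volume.restrict (Ioi (0 : ℝ))) := by
  have : upper n = univ ×ˢ Ioi (0 : ℝ) := by ext p; simp [upper]
  rw [this, Measure.volume_eq_prod, ← Measure.prod_restrict, Measure.restrict_univ]

theorem measurableSet_upper : MeasurableSet (upper n) :=
  (isOpen_lt continuous_const continuous_snd).measurableSet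

theorem integrable_upper_test {V : Pt n → ℝ} (hV : ContinuousOn V (upper n)) {ρ : 𝔼 → ℝ}
    (hρ : Continuous ρ) (hρ' : HasCompactSupport ρ) {χ : ℝ → ℝ} (hχ : Continuous χ) (hχ' : CSupp χ) :
    IntegrableOn (fun p => V p * (ρ p.1 * χ p.2)) (upper n) := by
  obtain ⟨p, q, hp, hpq⟩ := hχ'
  have hK : IsCompact (tsupport ρ ×ˢ Icc p q) := IsCompact.prod hρ' isCompact_Icc
  have hsub : tsupport ρ ×ˢ Icc p q ⊆ upper n := fun z hz => hp.trans_le hz.2.1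
  refine IntegrableOn.of_forall_sdiff_eq_zero (s := tsupport ρ ×ˢ Icc p q) ?_ measurableSet_upper fun z hz => ?_
  · exact ((hV.mono hsub).mul (by fun_prop)).integrableOn_compact hK
  · have h2 := hz.2
    rw [Set.mem_prod, not_and_or] at h2
    rcases h2 with h | h
    · rw [image_eq_zero_of_notMem_tsupport h, zero_mul, mul_zero]
    · rw [hpq _ h, mul_zero, mul_zero]

theorem IsRep.continuousOn {V : Pt n → ℝ} {f g : ES n} (h : IsRep γ V f g) : ContinuousOn V (upper n) := by
  refine ContinuousOn.congr (f := fun p => f p + p.2 ^ (2 * fract γ) * g p) ?_ h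
  refine (smooth f).continuous.continuousOn.add (ContinuousOn.mul (fun p hp => ?_)
    (smooth g).continuous.continuousOn)
  exact (continuousAt_snd.rpow_const (Or.inl (ne_of_gt (show 0 < p.2 from hp)))).continuousWithinAt

theorem MemCc.slF_props {Φ : Pt n → ℝ} (h : MemCc γ Φ) :
    Measurable ({q : 𝔼 × ℝ | 0 < q.2}.indicator fun q => slF Φ q.1 q.2) ∧
    (∀ T, ∃ C, ∀ (ξ : 𝔼) y, 0 < y → y ≤ T → ‖slF Φ ξ y‖ ≤ C) ∧
    (∀ ξ, ContinuousOn (slF Φ ξ) (Ioi 0)) ∧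
    ∀ y, 0 < y → ContDiff ℝ ∞ (fun x => Φ (x, y)) ∧ HasCompactSupport fun x => Φ (x, y) := by
  obtain ⟨f, g, R, -, hrep, hfg⟩ := h.exists_rep
  have hf : BSupp R f := fun p hp => (hfg p hp).1
  have hg : BSupp R g := fun p hp => (hfg p hp).2
  have ha := Int.fract_nonneg γ
  refine ⟨?_, fun T => ?_, fun ξ => ?_, fun y hy => ?_⟩
  · have h1 : Measurable fun q : 𝔼 × ℝ => ((val (fract γ) (ftr R 0 q.1 f g) q.2 : ℝ) : ℂ) -
        ((val (fract γ) (ftr R (Real.pi / 2) q.1 f g) q.2 : ℝ) : ℂ) * Complex.I :=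
      (Complex.measurable_ofReal.comp (measurable_val_ftr R _ 0 f g)).sub
        ((Complex.measurable_ofReal.comp (measurable_val_ftr R _ _ f g)).mul_const _)
    rw [indicator_congr (s := {q : 𝔼 × ℝ | 0 < q.2}) (g := fun q : 𝔼 × ℝ => ((val (fract γ) (ftr R 0 q.1 f g) q.2 : ℝ) : ℂ) -
      ((val (fract γ) (ftr R (Real.pi / 2) q.1 f g) q.2 : ℝ) : ℂ) * Complex.I)
      fun q hq => slF_eq hrep hf.xsupp hg.xsupp q.1 hq]
    exact h1.indicator (isOpen_lt continuous_const continuous_snd).measurableSet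
  · obtain ⟨C, hC, hb⟩ := val_ftr_decay ha hf.xsupp hg.xsupp 0 T
    refine ⟨C + C, fun ξ y hy hyT => ?_⟩
    rw [slF_eq hrep hf.xsupp hg.xsupp ξ hy]
    refine (norm_sub_le _ _).trans ?_
    have e1 := hb 0 ξ y hy hyT
    have e2 := hb (Real.pi / 2) ξ y hy hyT
    rw [pow_zero, inv_one, mul_one] at e1 e2
    rw [norm_mul, Complex.norm_I, mul_one, Complex.norm_real, Complex.norm_real]
    exact add_le_add e1 e2
  · refine ContinuousOn.congr ?_ fun y hy => slF_eq hrep hf.xsupp hg.xsupp ξ hy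
    have hc : ∀ s, ContinuousOn (val (fract γ) (ftr R s ξ f g)) (Ioi 0) := fun s y hy =>
      (hasDerivAt_val _ hy).continuousAt.continuousWithinAt
    exact (Complex.continuous_ofReal.comp_continuousOn (hc 0)).sub
      ((Complex.continuous_ofReal.comp_continuousOn (hc _)).mul continuousOn_const)
  · have e : (fun x : 𝔼 => Φ (x, y)) = fun x => f (x, y) + y ^ (2 * fract γ) * g (x, y) :=
      funext fun x => hrep (x, y) hy
    rw [e]
    exact ⟨(contDiff_slice f y).add (contDiff_const.mul (contDiff_slice g y)),
      (hf.xsupp.hasCompactSupport y).add ((hg.xsupp.hasCompactSupport y).mul_left)⟩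

theorem integral_mul_eq_fourier {u ρ : 𝔼 → ℝ} (hu : ContDiff ℝ ∞ u) (hu' : HasCompactSupport u)
    (hρ : ContDiff ℝ ∞ ρ) (hρ' : HasCompactSupport ρ) :
    ((∫ x, u x * ρ x : ℝ) : ℂ) = ∫ ξ, fi ρ ξ * 𝓕 (fun x => (u x : ℂ)) ξ := by
  obtain ⟨S, T, hS, hT, hTS⟩ := exists_schwartz hρ hρ'
  obtain ⟨V, -, hV, -, -⟩ := exists_schwartz hu hu'
  have h := SchwartzMap.integral_fourier_mul_eq V T
  rw [hTS] at h
  rw [← integral_complex_ofReal]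
  have e : ∀ ξ, 𝓕 V ξ = 𝓕 (fun x => (u x : ℂ)) ξ := fun ξ => by
    rw [SchwartzMap.fourier_coe, ← funext hV]
  simp only [e, hV, hS, hT] at h
  simp only [mul_comm (fi ρ _), h]
  push_cast
  rfl

theorem MemCc.pairing {Φ : Pt n → ℝ} (h : MemCc γ Φ) {ρ : 𝔼 → ℝ} (hρ : ContDiff ℝ ∞ ρ)
    (hρ' : HasCompactSupport ρ) {χ : ℝ → ℝ} (hχ : Continuous χ) (hχ' : CSupp χ) :
    ((∫ p in upper n, Φ p * (ρ p.1 * χ p.2) : ℝ) : ℂ) =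
      ∫ ξ, fi ρ ξ * ∫ y in Ioi (0 : ℝ), slF Φ ξ y * χ y := by
  obtain ⟨h1, h2, -, h4⟩ := h.slF_props
  obtain ⟨f, g, hrep⟩ := h.1.exists_rep
  have hI := integrable_upper_test hrep.continuousOn hρ.continuous hρ' hχ hχ'
  obtain ⟨p, q, hp, hpq⟩ := hχ'
  obtain ⟨C, hC⟩ := h2 q
  have hIc : Integrable (fun z : 𝔼 × ℝ => fi ρ z.1 * (slF Φ z.1 z.2 * χ z.2))
      ((volume : Measure 𝔼).prod (volume.restrict (Ioi (0 : ℝ)))) := by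
    have hχi : Integrable (fun y => C * |χ y|) (volume.restrict (Ioi (0 : ℝ))) := by
      refine (Continuous.integrable_of_hasCompactSupport (by fun_prop) ?_).restrict
      exact HasCompactSupport.of_support_subset_isCompact (isCompact_Icc (a := p) (b := q)) fun y hy => by
        by_contra h
        exact hy (by simp [hpq y h])
    have hae : ∀ᵐ z ∂((volume : Measure 𝔼).prod (volume.restrict (Ioi (0 : ℝ)))), 0 < z.2 := by
      rw [← upper_measure]; exact ae_restrict_mem measurableSet_upper
    refine ((integrable_fi hρ hρ').norm.mul_prod hχi).mono' ?_ ?_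
    · have h5 : Measurable fun z : 𝔼 × ℝ => fi ρ z.1 *
          ({q : 𝔼 × ℝ | 0 < q.2}.indicator (fun q => slF Φ q.1 q.2) z * χ z.2) :=
        ((continuous_fi hρ hρ').measurable.comp measurable_fst).mul
          (h1.mul (Complex.measurable_ofReal.comp (hχ.measurable.comp measurable_snd)))
      refine h5.aestronglyMeasurable.congr ?_
      filter_upwards [hae] with z hz
      rw [indicator_of_mem (show z ∈ {q : 𝔼 × ℝ | 0 < q.2} from hz)]
    · filter_upwards [hae] with z hz
      rw [norm_mul, norm_mul, Complex.norm_real, Real.norm_eq_abs]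
      refine mul_le_mul_of_nonneg_left ?_ (norm_nonneg _)
      by_cases hq : z.2 ∈ Icc p q
      · exact mul_le_mul_of_nonneg_right (hC _ _ hz hq.2) (abs_nonneg _)
      · rw [hpq _ hq]; simp
  rw [upper_measure]
  rw [IntegrableOn, upper_measure] at hI
  rw [integral_prod_symm _ hI, ← integral_complex_ofReal]
  simp only [← integral_const_mul]
  rw [integral_integral_swap hIc]
  refine integral_Ioi_ext fun y hy => ?_
  have e := integral_mul_eq_fourier (h4 y hy).1 (h4 y hy).2 hρ hρ'
  have e1 : ∫ x : 𝔼, Φ (x, y) * (ρ x * χ y) = (∫ x, Φ (x, y) * ρ x) * χ y := by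
    rw [← integral_mul_const]
    exact integral_ext fun x => by ring
  rw [e1, Complex.ofReal_mul, e, ← integral_mul_const]
  exact integral_ext fun x => by simp only [slF]; ring

theorem MemCc.sub {Φ Ψ : Pt n → ℝ} (h : MemCc γ Φ) (h' : MemCc γ Ψ) : MemCc γ (Φ - Ψ) := by
  obtain ⟨⟨f, g, hf, hg, e⟩, R, hR⟩ := h
  obtain ⟨⟨f', g', hf', hg', e'⟩, R', hR'⟩ := h'
  refine ⟨⟨f - f', g - g', ⟨hf.1.sub hf'.1, fun x y => ?_⟩, ⟨hg.1.sub hg'.1, fun x y => ?_⟩,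
    fun p hp => ?_⟩, max R R', fun p hp hpR => ?_⟩
  · rw [Pi.sub_apply, Pi.sub_apply, hf.2, hf'.2]
  · rw [Pi.sub_apply, Pi.sub_apply, hg.2, hg'.2]
  · simp only [Pi.sub_apply, e p hp, e' p hp]; ring
  · rw [Pi.sub_apply, hR p hp ((le_max_left _ _).trans_lt hpR),
      hR' p hp ((le_max_right _ _).trans_lt hpR), sub_zero]

theorem slF_sub {Φ Ψ : Pt n → ℝ} (h : MemCc γ Φ) (h' : MemCc γ Ψ) (ξ : 𝔼) {y : ℝ} (hy : 0 < y) :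
    slF (Φ - Ψ) ξ y = slF Φ ξ y - slF Ψ ξ y := by
  have hI : ∀ {Θ : Pt n → ℝ}, MemCc γ Θ → Integrable fun x : 𝔼 => (Θ (x, y) : ℂ) := fun hΘ => by
    obtain ⟨-, -, -, h4⟩ := hΘ.slF_props
    exact ((h4 y hy).1.continuous.integrable_of_hasCompactSupport (h4 y hy).2).ofReal
  simp only [slF, Real.fourier_eq, Pi.sub_apply, Complex.ofReal_sub, smul_sub]
  exact integral_sub ((Real.fourierIntegral_convergent_iff ξ).2 (hI h))
    ((Real.fourierIntegral_convergent_iff ξ).2 (hI h'))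

/-- A measurable kernel on `ℝⁿ × (0, ∞)` with the decay of the Fourier transform of a function of finite
energy. -/
structure IsKernel (γ : ℝ) (G : 𝔼 → ℝ → ℂ) (A : 𝔼 → ℝ) : Prop where
  meas : Measurable (Function.uncurry G)
  measA : Measurable A
  nonneg : ∀ ξ, 0 ≤ A ξ
  memLp : MemLp A 2
  bound : ∀ ξ y, 0 < y → ‖G ξ y‖ ≤
    A ξ * (ℓ[ξ] ^ (-γ) * (1 + (ℓ[ξ] * y) ^ fract γ))

theorem CSupp.integrableOn {χ : ℝ → ℝ} (hχ : ContinuousOn χ (Ioi 0)) (h : CSupp χ) :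
    IntegrableOn χ (Ioi 0) := by
  obtain ⟨p, q, hp, hpq⟩ := h
  refine IntegrableOn.of_forall_sdiff_eq_zero (s := Icc p q) ?_ measurableSet_Ioi fun z hz => hpq z hz.2
  exact (hχ.mono fun z hz => hp.trans_le hz.1).integrableOn_compact isCompact_Icc

theorem CSupp.mul {χ : ℝ → ℝ} (h : CSupp χ) (f : ℝ → ℝ) : CSupp fun y => f y * χ y := by
  obtain ⟨p, q, hp, hpq⟩ := h
  exact ⟨p, q, hp, fun y hy => by simp only [hpq y hy, mul_zero]⟩

theorem CSupp.abs {χ : ℝ → ℝ} (h : CSupp χ) : CSupp fun y => |χ y| := by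
  obtain ⟨p, q, hp, hpq⟩ := h
  exact ⟨p, q, hp, fun y hy => by simp only [hpq y hy, abs_zero]⟩

theorem continuousOn_rpow_mul {χ : ℝ → ℝ} (hχ : ContinuousOn χ (Ioi 0)) (a : ℝ) :
    ContinuousOn (fun y : ℝ => y ^ a * χ y) (Ioi 0) :=
  (continuousOn_id.rpow_const fun _ hy => Or.inl (ne_of_gt hy)).mul hχ

/-- The bound for the pairing of a kernel with `χ`. -/
def kerBd (γ : ℝ) (χ : ℝ → ℝ) (ξ : 𝔼) : ℝ :=
  ℓ[ξ] ^ (-γ) * (∫ y in Ioi (0 : ℝ), |χ y|) +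
    ℓ[ξ] ^ (-γ) * ℓ[ξ] ^ fract γ *
      ∫ y in Ioi (0 : ℝ), y ^ fract γ * |χ y|

namespace IsKernel

variable {G : EuclideanSpace ℝ (Fin n) → ℝ → ℂ} {A : EuclideanSpace ℝ (Fin n) → ℝ}

theorem integrableOn_bound {χ : ℝ → ℝ} (hχ : ContinuousOn χ (Ioi 0)) (hχ' : CSupp χ) (ξ : 𝔼) :
    IntegrableOn (fun y => A ξ * (ℓ[ξ] ^ (-γ) *
      (1 + (ℓ[ξ] * y) ^ fract γ)) * |χ y|) (Ioi 0) ∧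
    ∫ y in Ioi (0 : ℝ), A ξ * (ℓ[ξ] ^ (-γ) *
      (1 + (ℓ[ξ] * y) ^ fract γ)) * |χ y| = A ξ * kerBd γ χ ξ := by
  have h1 := CSupp.integrableOn hχ.abs hχ'.abs
  have h2 := CSupp.integrableOn (continuousOn_rpow_mul hχ.abs (fract γ)) (hχ'.abs.mul _)
  have e : EqOn (fun y => A ξ * (ℓ[ξ] ^ (-γ) *
      (1 + (ℓ[ξ] * y) ^ fract γ)) * |χ y|) (fun y =>
      A ξ * ℓ[ξ] ^ (-γ) * |χ y| + A ξ * (ℓ[ξ] ^ (-γ) *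
        ℓ[ξ] ^ fract γ) * (y ^ fract γ * |χ y|)) (Ioi 0) := fun y hy => by
    simp only
    rw [mul_rpow (by positivity) (le_of_lt hy)]; ring
  have i1 := h1.const_mul (A ξ * ℓ[ξ] ^ (-γ))
  have i2 := h2.const_mul (A ξ * (ℓ[ξ] ^ (-γ) * ℓ[ξ] ^ fract γ))
  refine ⟨IntegrableOn.congr_fun (i1.add i2) (fun y hy => (e hy).symm) measurableSet_Ioi, ?_⟩
  rw [setIntegral_congr_fun measurableSet_Ioi e, integral_add i1 i2, integral_const_mul, integral_const_mul,
    kerBd]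
  ring

theorem integrableOn (hG : IsKernel γ G A) {χ : ℝ → ℝ} (hχ : ContinuousOn χ (Ioi 0)) (hχ' : CSupp χ)
    (ξ : 𝔼) : IntegrableOn (fun y => G ξ y * χ y) (Ioi 0) := by
  refine (integrableOn_bound (γ := γ) (A := A) hχ hχ' ξ).1.mono' ?_ ?_
  · exact (hG.meas.comp measurable_prodMk_left).aestronglyMeasurable.mul
      (Complex.continuous_ofReal.comp_aestronglyMeasurable (hχ.aestronglyMeasurable measurableSet_Ioi))
  · filter_upwards [ae_restrict_mem measurableSet_Ioi] with y hy
    rw [norm_mul, Complex.norm_real, Real.norm_eq_abs]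
    exact mul_le_mul_of_nonneg_right (hG.bound ξ y hy) (abs_nonneg _)

theorem norm_integral_le (hG : IsKernel γ G A) {χ : ℝ → ℝ} (hχ : ContinuousOn χ (Ioi 0)) (hχ' : CSupp χ)
    (ξ : 𝔼) : ‖∫ y in Ioi (0 : ℝ), G ξ y * χ y‖ ≤ A ξ * kerBd γ χ ξ := by
  rw [← (integrableOn_bound (γ := γ) (A := A) hχ hχ' ξ).2]
  refine norm_integral_le_of_norm_le (integrableOn_bound (γ := γ) (A := A) hχ hχ' ξ).1 ?_
  filter_upwards [ae_restrict_mem measurableSet_Ioi] with y hy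
  rw [norm_mul, Complex.norm_real, Real.norm_eq_abs]
  exact mul_le_mul_of_nonneg_right (hG.bound ξ y hy) (abs_nonneg _)

theorem measurable_integral (hG : IsKernel γ G A) {χ : ℝ → ℝ} (hχ : ContinuousOn χ (Ioi 0)) :
    Measurable fun ξ => ∫ y in Ioi (0 : ℝ), G ξ y * χ y := by
  have hm : Measurable ((Ioi (0 : ℝ)).indicator χ) := by
    rw [← piecewise_eq_indicator]
    exact hχ.measurable_piecewise continuousOn_const measurableSet_Ioi
  have h : StronglyMeasurable (Function.uncurry fun (ξ : 𝔼) y =>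
      G ξ y * (((Ioi (0 : ℝ)).indicator χ y : ℝ) : ℂ)) :=
    (hG.meas.mul (Complex.measurable_ofReal.comp (hm.comp measurable_snd))).stronglyMeasurable
  have h2 := (h.integral_prod_right (ν := volume.restrict (Ioi (0 : ℝ)))).measurable
  have e : (fun ξ => ∫ y in Ioi (0 : ℝ), G ξ y * χ y) = fun ξ => ∫ y in Ioi (0 : ℝ),
      G ξ y * (((Ioi (0 : ℝ)).indicator χ y : ℝ) : ℂ) := funext fun ξ =>
    integral_Ioi_ext fun y hy => by rw [indicator_of_mem (mem_Ioi.2 hy)]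
  rw [e]; exact h2

end IsKernel

theorem integrable_fi_mul_bound (hγ0 : 0 < γ) (hγn : γ < (n : ℝ) / 2) {A : 𝔼 → ℝ} (hA : MemLp A 2)
    {ρ : 𝔼 → ℝ} (hρ : ContDiff ℝ ∞ ρ) (hρ' : HasCompactSupport ρ) (χ : ℝ → ℝ) :
    Integrable fun ξ => ‖fi ρ ξ‖ * (A ξ * kerBd γ χ ξ) := by
  have hn : 0 < n := by
    rcases Nat.eq_zero_or_pos n with h | h
    · rw [h] at hγn; norm_num at hγn; linarith
    · exact h
  have ha := Int.fract_nonneg γ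
  have key : ∀ b : ℝ, -((n : ℝ) / 2) < b → Integrable fun ξ => A ξ * (‖ξ‖ ^ b * ‖fi ρ ξ‖) := fun b hb =>
    hA.integrable_mul (memLp_rpow_fi hn hρ hρ' hb)
  have k1 := (key (-γ) (by linarith)).const_mul ((2 * Real.pi) ^ (-γ) * ∫ y in Ioi (0 : ℝ), |χ y|)
  have k2 := (key (-γ + fract γ) (by linarith)).const_mul
    ((2 * Real.pi) ^ (-γ) * (2 * Real.pi) ^ (fract γ) * ∫ y in Ioi (0 : ℝ), y ^ fract γ * |χ y|)
  refine (k1.add k2).congr ?_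
  have : Nonempty (Fin n) := ⟨⟨0, hn⟩⟩
  have hne : ∀ᵐ ξ : 𝔼, ξ ≠ 0 := by simp [ae_iff]
  filter_upwards [hne] with ξ hξ
  have h0 : 0 < ‖ξ‖ := norm_pos_iff.2 hξ
  simp only [Pi.add_apply, kerBd]
  rw [mul_rpow (by positivity) h0.le, mul_rpow (by positivity) h0.le, rpow_add h0]
  ring

theorem IsKernel.integrable_fi_mul {G : 𝔼 → ℝ → ℂ} {A : 𝔼 → ℝ} (hG : IsKernel γ G A) (hγ0 : 0 < γ)
    (hγn : γ < (n : ℝ) / 2) {ρ : 𝔼 → ℝ} (hρ : ContDiff ℝ ∞ ρ) (hρ' : HasCompactSupport ρ) {χ : ℝ → ℝ}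
    (hχ : ContinuousOn χ (Ioi 0)) (hχ' : CSupp χ) :
    Integrable fun ξ => fi ρ ξ * ∫ y in Ioi (0 : ℝ), G ξ y * χ y := by
  refine (integrable_fi_mul_bound hγ0 hγn hG.memLp hρ hρ' χ).mono' ?_ (Eventually.of_forall fun ξ => ?_)
  · exact ((continuous_fi hρ hρ').measurable.mul (hG.measurable_integral hχ)).aestronglyMeasurable
  · rw [norm_mul]
    exact mul_le_mul_of_nonneg_left (hG.norm_integral_le hχ hχ' ξ) (norm_nonneg _)

/-- A series of densities with geometrically decreasing integrals is summable almost everywhere, after taking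
square roots, with square-integrable sum. -/
theorem exists_sqrt_majorant {e : ℕ → 𝔼 → ℝ} (hm : ∀ k, Measurable (e k)) (hi : ∀ k, Integrable (e k))
    (hn : ∀ᵐ ξ, ∀ k, 0 ≤ e k ξ) {M : ℝ} (hM : ∀ k, ∫ ξ, e k ξ ≤ M * (1 / 16) ^ k) :
    ∃ A : 𝔼 → ℝ, Measurable A ∧ (∀ ξ, 0 ≤ A ξ) ∧ MemLp A 2 ∧ ∃ Z : Set 𝔼, MeasurableSet Z ∧ (∀ᵐ ξ, ξ ∈ Z) ∧
      ∀ ξ ∈ Z, ∀ k, √(e k ξ) ≤ (1 / 2) ^ k * A ξ := by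
  set H : 𝔼 → ENNReal := fun ξ => ∑' k, ENNReal.ofReal (4 ^ k * e k ξ) with hH
  have hHm : Measurable H := Measurable.tsum fun k => ((hm k).const_mul _).ennreal_ofReal
  have hfin : ∫⁻ ξ, H ξ ≠ ⊤ := by
    rw [lintegral_tsum fun k => ((hm k).const_mul _).ennreal_ofReal.aemeasurable]
    have h1 : ∀ k, ∫⁻ ξ, ENNReal.ofReal (4 ^ k * e k ξ) ≤ ENNReal.ofReal (|M| * (1 / 4) ^ k) := fun k => by
      rw [← ofReal_integral_eq_lintegral_ofReal ((hi k).const_mul _) ?_, integral_const_mul]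
      · refine ENNReal.ofReal_le_ofReal ?_
        calc (4 : ℝ) ^ k * ∫ ξ, e k ξ ≤ 4 ^ k * (M * (1 / 16) ^ k) := by gcongr; exact hM k
          _ = M * (1 / 4) ^ k := by
            rw [mul_left_comm, ← mul_pow]; norm_num
          _ ≤ _ := by gcongr; exact le_abs_self M
      · filter_upwards [hn] with ξ h
        exact mul_nonneg (by positivity) (h k)
    refine ne_top_of_le_ne_top ?_ (ENNReal.tsum_le_tsum h1)
    have hs : Summable fun k : ℕ => |M| * (1 / 4 : ℝ) ^ k :=
      (summable_geometric_of_lt_one (by norm_num) (by norm_num)).mul_left _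
    rw [← ENNReal.ofReal_tsum_of_nonneg (fun k => by positivity) hs]
    exact ENNReal.ofReal_ne_top
  refine ⟨fun ξ => √(H ξ).toReal, hHm.ennreal_toReal.sqrt, fun ξ => Real.sqrt_nonneg _, ?_,
    {ξ | H ξ < ⊤}, hHm measurableSet_Iio, ae_lt_top hHm hfin, fun ξ hξ k => ?_⟩
  · rw [memLp_two_iff_integrable_sq hHm.ennreal_toReal.sqrt.aestronglyMeasurable]
    simp only [Real.sq_sqrt ENNReal.toReal_nonneg]
    exact integrable_toReal_of_lintegral_ne_top hHm.aemeasurable hfin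
  · have h1 : ENNReal.ofReal (4 ^ k * e k ξ) ≤ H ξ := ENNReal.le_tsum k
    have h2 : 4 ^ k * e k ξ ≤ (H ξ).toReal := (ENNReal.ofReal_le_iff_le_toReal (ne_of_lt hξ)).1 h1
    have h3 : (1 / 2 : ℝ) ^ k * √(H ξ).toReal = √((1 / 4) ^ k * (H ξ).toReal) := by
      rw [Real.sqrt_mul (by positivity), show (1 / 4 : ℝ) ^ k = ((1 / 2) ^ k) ^ 2 by
        rw [← pow_mul, mul_comm k 2, pow_mul]; norm_num, Real.sqrt_sq (by positivity)]
    rw [h3]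
    refine Real.sqrt_le_sqrt ?_
    calc e k ξ = (1 / 4) ^ k * (4 ^ k * e k ξ) := by rw [← mul_assoc, ← mul_pow]; norm_num
      _ ≤ _ := by gcongr

theorem IsKernel.of_tendsto {F : ℕ → 𝔼 → ℝ → ℂ} {G : 𝔼 → ℝ → ℂ} {A : 𝔼 → ℝ} (hF : ∀ N, IsKernel γ (F N) A)
    (h : ∀ ξ y, Tendsto (fun N => F N ξ y) atTop (𝓝 (G ξ y))) : IsKernel γ G A where
  meas := measurable_of_tendsto_metrizable (fun N => (hF N).meas)
    (tendsto_pi_nhds.2 fun q => h q.1 q.2)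
  measA := (hF 0).measA
  nonneg := (hF 0).nonneg
  memLp := (hF 0).memLp
  bound := fun ξ y hy => le_of_tendsto (h ξ y).norm (Eventually.of_forall fun N => (hF N).bound ξ y hy)

theorem IsKernel.tendsto_pairing (hγ0 : 0 < γ) (hγn : γ < (n : ℝ) / 2) {F : ℕ → 𝔼 → ℝ → ℂ} {G : 𝔼 → ℝ → ℂ}
    {A : 𝔼 → ℝ} (hF : ∀ N, IsKernel γ (F N) A) (h : ∀ ξ y, Tendsto (fun N => F N ξ y) atTop (𝓝 (G ξ y)))
    {ρ : 𝔼 → ℝ} (hρ : ContDiff ℝ ∞ ρ) (hρ' : HasCompactSupport ρ) {χ : ℝ → ℝ}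
    (hχ : ContinuousOn χ (Ioi 0)) (hχ' : CSupp χ) :
    Tendsto (fun N => ∫ ξ, fi ρ ξ * ∫ y in Ioi (0 : ℝ), F N ξ y * χ y) atTop
      (𝓝 (∫ ξ, fi ρ ξ * ∫ y in Ioi (0 : ℝ), G ξ y * χ y)) := by
  refine tendsto_integral_of_dominated_convergence _
    (fun N => ((continuous_fi hρ hρ').measurable.mul ((hF N).measurable_integral hχ)).aestronglyMeasurable)
    (integrable_fi_mul_bound hγ0 hγn (hF 0).memLp hρ hρ' χ)
    (fun N => Eventually.of_forall fun ξ => ?_) (Eventually.of_forall fun ξ => Tendsto.const_mul _ ?_)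
  · rw [norm_mul]
    exact mul_le_mul_of_nonneg_left ((hF N).norm_integral_le hχ hχ' ξ) (norm_nonneg _)
  · refine tendsto_integral_of_dominated_convergence _ (fun N => ((hF N).integrableOn hχ hχ' ξ).1)
      (IsKernel.integrableOn_bound (γ := γ) (A := A) hχ hχ' ξ).1 (fun N => ?_)
      (Eventually.of_forall fun y => (h ξ y).mul_const _)
    filter_upwards [ae_restrict_mem measurableSet_Ioi] with y hy
    rw [norm_mul, Complex.norm_real, Real.norm_eq_abs]
    exact mul_le_mul_of_nonneg_right ((hF N).bound ξ y hy) (abs_nonneg _)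

theorem tendsto_integral_upper {Φ : ℕ → Pt n → ℝ} {U : Pt n → ℝ} (hΦ : ∀ i, ContinuousOn (Φ i) (upper n))
    (hU : ContinuousOn U (upper n)) (h : ∀ K : Set (Pt n), IsCompact K → K ⊆ upper n →
      Tendsto (fun i => eLpNorm (Φ i - U) 2 (volume.restrict K)) atTop (𝓝 0)) {ρ : 𝔼 → ℝ}
    (hρ : Continuous ρ) (hρ' : HasCompactSupport ρ) {χ : ℝ → ℝ} (hχ : Continuous χ) (hχ' : CSupp χ) :
    Tendsto (fun i => ∫ p in upper n, Φ i p * (ρ p.1 * χ p.2)) atTop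
      (𝓝 (∫ p in upper n, U p * (ρ p.1 * χ p.2))) := by
  have hi := fun i => integrable_upper_test (hΦ i) hρ hρ' hχ hχ'
  have hiU := integrable_upper_test hU hρ hρ' hχ hχ'
  obtain ⟨p, q, hp, hpq⟩ := hχ'
  set K : Set (Pt n) := tsupport ρ ×ˢ Icc p q
  have hK : IsCompact K := IsCompact.prod hρ' isCompact_Icc
  have hsub : K ⊆ upper n := fun z hz => hp.trans_le hz.2.1
  have hz : ∀ V : Pt n → ℝ, ∫ z in upper n, V z * (ρ z.1 * χ z.2) = ∫ z in K, V z * (ρ z.1 * χ z.2) := fun V => by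
    refine setIntegral_eq_of_subset_of_forall_sdiff_eq_zero measurableSet_upper hsub fun z hz => ?_
    have h2 := hz.2
    rw [Set.mem_prod, not_and_or] at h2
    rcases h2 with h | h
    · rw [image_eq_zero_of_notMem_tsupport h, zero_mul, mul_zero]
    · rw [hpq _ h, mul_zero, mul_zero]
  obtain ⟨C, hC⟩ := hK.exists_bound_of_continuousOn
    (f := fun z : Pt n => ρ z.1 * χ z.2) (by fun_prop : Continuous fun z : Pt n => ρ z.1 * χ z.2).continuousOn
  simp only [hz]
  refine tendsto_integral_of_L1' _ (hiU.mono_set hsub).1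
    (Eventually.of_forall fun i => (hi i).mono_set hsub) ?_
  have hlim : Tendsto (fun i => ENNReal.ofReal C * (eLpNorm (Φ i - U) 2 (volume.restrict K) *
      (volume.restrict K) univ ^ (1 / ENNReal.toReal 1 - 1 / ENNReal.toReal 2))) atTop (𝓝 0) := by
    have h1 : (volume.restrict K) univ ^ (1 / ENNReal.toReal 1 - 1 / ENNReal.toReal 2) ≠ ⊤ := by
      rw [Measure.restrict_apply_univ]
      exact ENNReal.rpow_ne_top_of_nonneg (by norm_num) hK.measure_lt_top.ne
    have h2 := ENNReal.Tendsto.const_mul (a := ENNReal.ofReal C) (ENNReal.Tendsto.mul_const (h K hK hsub)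
      (Or.inr h1)) (Or.inr ENNReal.ofReal_ne_top)
    simpa using h2
  refine tendsto_of_tendsto_of_tendsto_of_le_of_le tendsto_const_nhds hlim (fun _ => zero_le) fun i => ?_
  have hm : AEStronglyMeasurable (Φ i - U) (volume.restrict K) :=
    (((hΦ i).sub hU).mono hsub).aestronglyMeasurable hK.measurableSet
  refine (eLpNorm_le_mul_eLpNorm_of_ae_le_mul (g := Φ i - U) (c := C) ?_ 1).trans
    (mul_le_mul_right (eLpNorm_le_eLpNorm_mul_rpow_measure_univ (by norm_num) hm) _)
  filter_upwards [ae_restrict_mem hK.measurableSet] with z hz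
  rw [Pi.sub_apply, ← sub_mul, norm_mul, mul_comm]
  exact mul_le_mul_of_nonneg_right (hC z hz) (norm_nonneg _)

theorem exists_rapid_subsequence {E : ℕ × ℕ → ℝ} (h : Tendsto E atTop (𝓝 0)) :
    ∃ s : ℕ → ℕ, Tendsto s atTop atTop ∧ ∀ k, E (s (k + 1), s k) ≤ (1 / 16) ^ k := by
  have h1 : ∀ k : ℕ, ∃ N, ∀ i j, N ≤ i → N ≤ j → E (i, j) < (1 / 16) ^ k := fun k => by
    obtain ⟨a, ha⟩ := eventually_atTop.1 (h.eventually (gt_mem_nhds (show (0 : ℝ) < (1 / 16) ^ k by positivity)))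
    exact ⟨max a.1 a.2, fun i j hi hj => ha (i, j) ⟨(le_max_left _ _).trans hi, (le_max_right _ _).trans hj⟩⟩
  choose N hN using h1
  have hs : ∀ k, N k ≤ ∑ j ∈ Finset.range (k + 1), N j := fun k =>
    Finset.single_le_sum (f := N) (fun _ _ => Nat.zero_le _) (Finset.self_mem_range_succ k)
  refine ⟨fun k => ∑ j ∈ Finset.range (k + 1), N j + k, tendsto_atTop_mono (fun k => Nat.le_add_left _ _) tendsto_id,
    fun k => (hN k _ _ ?_ ((hs k).trans (Nat.le_add_right _ _))).le⟩
  simp only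
  rw [Finset.sum_range_succ]
  exact (hs k).trans ((Nat.le_add_right _ _).trans (Nat.le_add_right _ _))

/-- An element of the energy space is represented, in the Fourier variable, by a kernel. -/
theorem exists_kernel (hγ0 : 0 < γ) (hγn : γ < (n : ℝ) / 2) (ha : 0 < fract γ) {U : Pt n → ℝ}
    (hC : MemC γ U) (hH : MemH γ U) : ∃ (G : 𝔼 → ℝ → ℂ) (A : 𝔼 → ℝ), IsKernel γ G A ∧
      ∀ {ρ : 𝔼 → ℝ}, ContDiff ℝ ∞ ρ → HasCompactSupport ρ → ∀ {χ : ℝ → ℝ}, Continuous χ → CSupp χ →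
        ((∫ p in upper n, U p * (ρ p.1 * χ p.2) : ℝ) : ℂ) = ∫ ξ, fi ρ ξ * ∫ y in Ioi (0 : ℝ), G ξ y * χ y := by
  have hn : 0 < n := by
    rcases Nat.eq_zero_or_pos n with h | h
    · rw [h] at hγn; norm_num at hγn; linarith
    · exact h
  have : Nonempty (Fin n) := ⟨⟨0, hn⟩⟩
  have hne : ∀ᵐ ξ : 𝔼, ξ ≠ 0 := by simp [ae_iff]
  obtain ⟨Φ, hΦ, hE, hK⟩ := hH
  obtain ⟨s, hs, hsE⟩ := exists_rapid_subsequence hE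
  let D : ℕ → Pt n → ℝ := fun k => Nat.casesOn k (Φ (s 0)) fun k => Φ (s (k + 1)) - Φ (s k)
  have hD : ∀ k, MemCc γ (D k) := fun k => by
    cases k with
    | zero => exact hΦ _
    | succ k => exact (hΦ _).sub (hΦ _)
  obtain ⟨C, hC0, hdens⟩ := exists_energy_density hγ0.le ha n
  choose e hem hei he0 heE heb using fun k => hdens (D k) (hD k)
  obtain ⟨A₀, hA0m, hA0, hA0L, Z, hZm, hZ, hZb⟩ := exists_sqrt_majorant hem hei
    (hne.mono fun ξ hξ k => he0 k ξ hξ) (M := max (energy γ (D 0)) 16) fun k => by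
      rw [heE]
      cases k with
      | zero => simp
      | succ k =>
        refine (hsE k).trans ?_
        calc (1 / 16 : ℝ) ^ k = 16 * (1 / 16) ^ (k + 1) := by rw [pow_succ]; ring
          _ ≤ _ := by gcongr; exact le_max_right _ _
  set W : 𝔼 → ℝ → ℝ := fun ξ y => ℓ[ξ] ^ (-γ) * (1 + (ℓ[ξ] * y) ^ fract γ)
  have hW : ∀ ξ y, 0 < y → 0 ≤ W ξ y := fun ξ y hy => by positivity
  have hbd : ∀ k, ∀ ξ ∈ Z, ξ ≠ 0 → ∀ y, 0 < y → ‖slF (D k) ξ y‖ ≤ (1 / 2) ^ k * (√C * A₀ ξ * W ξ y) := by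
    intro k ξ hξ hξ0 y hy
    have hl : 0 ≤ ℓ[ξ] := by positivity
    have h1 : ‖slF (D k) ξ y‖ ≤ √C * W ξ y * √(e k ξ) := by
      rw [← abs_of_nonneg (norm_nonneg (slF (D k) ξ y))]
      refine abs_le_of_sq_le_sq ((heb k ξ hξ0 y hy).trans ?_) (mul_nonneg (mul_nonneg (Real.sqrt_nonneg _)
        (hW ξ y hy)) (Real.sqrt_nonneg _))
      rw [mul_pow, mul_pow, Real.sq_sqrt hC0.le, Real.sq_sqrt (he0 k ξ hξ0)]
      refine mul_le_mul_of_nonneg_right (mul_le_mul_of_nonneg_left ?_ hC0.le) (he0 k ξ hξ0)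
      have e1 : ∀ {x : ℝ} (c : ℝ), 0 ≤ x → x ^ (2 * c) = (x ^ c) ^ 2 := fun {x} c hx => by
        rw [← rpow_natCast, ← rpow_mul hx]; congr 1; push_cast; ring
      rw [mul_pow, show -(2 * γ) = 2 * -γ by ring, e1 _ hl, e1 _ (by positivity)]
      have h0 : 0 ≤ (ℓ[ξ] * y) ^ fract γ := by positivity
      gcongr
      nlinarith
    refine h1.trans ?_
    calc √C * W ξ y * √(e k ξ) ≤ √C * W ξ y * ((1 / 2) ^ k * A₀ ξ) :=
          mul_le_mul_of_nonneg_left (hZb ξ hξ k) (mul_nonneg (Real.sqrt_nonneg _) (hW ξ y hy))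
      _ = _ := by ring
  have hsum : ∀ N ξ y, 0 < y → ∑ k ∈ Finset.range (N + 1), slF (D k) ξ y = slF (Φ (s N)) ξ y := by
    intro N ξ y hy
    induction N with
    | zero => rw [zero_add, Finset.sum_range_one]; rfl
    | succ N ih =>
      rw [Finset.sum_range_succ, ih]
      change _ + slF (Φ (s (N + 1)) - Φ (s N)) ξ y = _
      rw [slF_sub (hΦ _) (hΦ _) ξ hy]; ring
  set Q : Set (𝔼 × ℝ) := (Z ∩ {0}ᶜ) ×ˢ Ioi 0
  have hQ : MeasurableSet Q := (hZm.inter (measurableSet_singleton 0).compl).prod measurableSet_Ioi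
  let F : ℕ → 𝔼 → ℝ → ℂ := fun N ξ y => Q.indicator (fun q => slF (Φ (s N)) q.1 q.2) (ξ, y)
  let G : 𝔼 → ℝ → ℂ := fun ξ y => Q.indicator (fun q => ∑' k, slF (D k) q.1 q.2) (ξ, y)
  have hgeo : Summable fun k : ℕ => (1 / 2 : ℝ) ^ k :=
    summable_geometric_of_lt_one (by norm_num) (by norm_num)
  have hgeo2 : ∑' k : ℕ, (1 / 2 : ℝ) ^ k = 2 := tsum_geometric_two
  have hF : ∀ N, IsKernel γ (F N) fun ξ => 2 * √C * A₀ ξ := fun N => by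
    refine ⟨?_, hA0m.const_mul _, fun ξ => mul_nonneg (by positivity) (hA0 ξ), hA0L.const_mul _, fun ξ y hy => ?_⟩
    · obtain ⟨h1, -⟩ := (hΦ (s N)).slF_props
      have h2 := h1.indicator hQ
      rw [indicator_indicator, inter_eq_left.2 (show Q ⊆ {q : 𝔼 × ℝ | 0 < q.2} from fun q hq => hq.2)] at h2
      exact h2
    · by_cases hq : (ξ, y) ∈ Q
      · change ‖Q.indicator _ (ξ, y)‖ ≤ _
        rw [indicator_of_mem hq]
        simp only
        rw [← hsum N ξ y hy]
        refine (norm_sum_le _ _).trans ((Finset.sum_le_sum fun k _ => hbd k ξ hq.1.1 hq.1.2 y hy).trans ?_)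
        rw [← Finset.sum_mul]
        have h3 := hgeo.sum_le_tsum (Finset.range (N + 1)) fun _ _ => by positivity
        rw [hgeo2] at h3
        calc _ ≤ 2 * (√C * A₀ ξ * W ξ y) := mul_le_mul_of_nonneg_right h3
              (mul_nonneg (mul_nonneg (Real.sqrt_nonneg _) (hA0 ξ)) (hW ξ y hy))
          _ = _ := by ring
      · change ‖Q.indicator _ (ξ, y)‖ ≤ _
        rw [indicator_of_notMem hq, norm_zero]
        exact mul_nonneg (mul_nonneg (by positivity) (hA0 ξ)) (hW ξ y hy)
  have hFG : ∀ ξ y, Tendsto (fun N => F N ξ y) atTop (𝓝 (G ξ y)) := fun ξ y => by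
    by_cases hq : (ξ, y) ∈ Q
    · have h1 : Summable fun k => slF (D k) ξ y := Summable.of_norm_bounded
        (hgeo.mul_right (√C * A₀ ξ * W ξ y)) fun k => hbd k ξ hq.1.1 hq.1.2 y hq.2
      have h2 := (h1.hasSum.tendsto_sum_nat).comp (tendsto_add_atTop_nat 1)
      have e1 : (fun N => F N ξ y) = (fun N => ∑ k ∈ Finset.range N, slF (D k) ξ y) ∘ fun N => N + 1 :=
        funext fun N => by
          change Q.indicator _ (ξ, y) = _
          rw [indicator_of_mem hq]
          exact (hsum N ξ y hq.2).symm
      have e2 : G ξ y = ∑' k, slF (D k) ξ y := indicator_of_mem hq _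
      rw [e1, e2]; exact h2
    · have e1 : ∀ N, F N ξ y = 0 := fun N => indicator_of_notMem hq _
      have e2 : G ξ y = 0 := indicator_of_notMem hq _
      simp only [e1, e2]; exact tendsto_const_nhds
  refine ⟨G, _, IsKernel.of_tendsto hF hFG, fun {ρ} hρ hρ' {χ} hχ hχ' => ?_⟩
  have hcont : ∀ {V : Pt n → ℝ}, MemC γ V → ContinuousOn V (upper n) := fun hV => by
    obtain ⟨f, g, h⟩ := hV.exists_rep
    exact h.continuousOn
  have t1 := (tendsto_integral_upper (fun i => hcont (hΦ i).1) (hcont hC) hK hρ.continuous hρ' hχ hχ').comp hs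
  have t2 := IsKernel.tendsto_pairing hγ0 hγn hF hFG hρ hρ' hχ.continuousOn hχ'
  refine tendsto_nhds_unique ((Complex.continuous_ofReal.tendsto _).comp t1) (t2.congr fun N => ?_)
  have e1 := (hΦ (s N)).pairing hρ hρ' hχ hχ'
  simp only [Function.comp_apply]
  rw [e1]
  refine integral_congr_ae ?_
  filter_upwards [hZ, hne] with ξ hξ hξ0
  congr 1
  refine integral_Ioi_ext fun y hy => ?_
  have : F N ξ y = slF (Φ (s N)) ξ y := indicator_of_mem (show (ξ, y) ∈ Q from ⟨⟨hξ, hξ0⟩, hy⟩) _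
  simp only [this]

/-- Smooth functions with compact support in `(0, ∞)`. -/
def TF : Submodule ℝ (ℝ → ℝ) where
  carrier := {χ | ContDiff ℝ ∞ χ ∧ CSupp χ}
  add_mem' := by
    rintro f g ⟨hf, p, q, hp, h⟩ ⟨hg, p', q', hp', h'⟩
    refine ⟨hf.add hg, min p p', max q q', lt_min hp hp', fun y hy => ?_⟩
    have h1 : y ∉ Icc p q := fun hm => hy ⟨(min_le_left _ _).trans hm.1, hm.2.trans (le_max_left _ _)⟩
    have h2 : y ∉ Icc p' q' := fun hm => hy ⟨(min_le_right _ _).trans hm.1, hm.2.trans (le_max_right _ _)⟩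
    rw [Pi.add_apply, h y h1, h' y h2, add_zero]
  zero_mem' := ⟨contDiff_const, 1, 1, one_pos, fun _ _ => rfl⟩
  smul_mem' := by
    rintro c f ⟨hf, p, q, hp, h⟩
    exact ⟨contDiff_const.smul hf, p, q, hp, fun y hy => by rw [Pi.smul_apply, h y hy, smul_zero]⟩

namespace TF

instance : CoeFun TF fun _ => ℝ → ℝ := ⟨fun f => f.1⟩

theorem contDiff (χ : TF) : ContDiff ℝ ∞ (χ : ℝ → ℝ) := χ.2.1

theorem cSupp (χ : TF) : CSupp χ := χ.2.2

theorem continuous (χ : TF) : Continuous (χ : ℝ → ℝ) := χ.2.1.continuous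

@[simp] theorem add_app (f g : TF) (y : ℝ) : (f + g) y = f y + g y := rfl
@[simp] theorem sub_app (f g : TF) (y : ℝ) : (f - g) y = f y - g y := rfl
@[simp] theorem smul_app (c : ℝ) (f : TF) (y : ℝ) : (c • f) y = c * f y := rfl
@[simp] theorem zero_app (y : ℝ) : (0 : TF) y = 0 := rfl

theorem ext {f g : TF} (h : ∀ y, f y = g y) : f = g := Subtype.ext (funext h)

theorem cSupp_deriv {χ : ℝ → ℝ} (h : CSupp χ) : CSupp fun y => y * deriv χ y := by
  obtain ⟨p, q, hp, h⟩ := h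
  refine ⟨p, q, hp, fun y hy => ?_⟩
  have : χ =ᶠ[𝓝 y] fun _ => 0 := by
    filter_upwards [isClosed_Icc.isOpen_compl.mem_nhds (show y ∈ (Icc p q)ᶜ from hy)] with z hz using h z hz
  simp only
  rw [this.deriv_eq, deriv_const, mul_zero]

/-- The Euler operator. -/
def θ : Module.End ℝ TF where
  toFun χ := ⟨fun y => y * deriv χ y,
    contDiff_id.mul ((contDiff_infty_iff_deriv.1 (contDiff χ)).2), cSupp_deriv (cSupp χ)⟩
  map_add' f g := ext fun y => by
    change y * deriv (f.1 + g.1) y = y * deriv f y + y * deriv g y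
    rw [deriv_add ((contDiff f).differentiable (by simp) y) ((contDiff g).differentiable (by simp) y)]; ring
  map_smul' c f := ext fun y => by
    change y * deriv (c • f.1) y = c * (y * deriv f y)
    rw [deriv_const_smul _ ((contDiff f).differentiable (by simp) y), smul_eq_mul]; ring

theorem hasDerivAt (χ : TF) {y : ℝ} (hy : y ≠ 0) : HasDerivAt χ (y⁻¹ * θ χ y) y := by
  have h := ((contDiff χ).differentiable (by simp) y).hasDerivAt
  refine h.congr_deriv ?_
  change _ = y⁻¹ * (y * deriv χ y)
  field_simp

theorem θ_eq {χ : TF} {y d : ℝ} (h : HasDerivAt χ d y) : θ χ y = y * d := by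
  change y * deriv χ y = _
  rw [h.deriv]

/-- Multiplication by `y ^ 2`. -/
def Y : Module.End ℝ TF where
  toFun χ := ⟨fun y => y ^ 2 * χ y, (contDiff_id.pow 2).mul (contDiff χ), (cSupp χ).mul _⟩
  map_add' f g := ext fun y => by change y ^ 2 * (f y + g y) = y ^ 2 * f y + y ^ 2 * g y; ring
  map_smul' c f := ext fun y => by change y ^ 2 * (c * f y) = c * (y ^ 2 * f y); ring

@[simp] theorem Y_app (χ : TF) (y : ℝ) : Y χ y = y ^ 2 * χ y := rfl

/-- The operator `(y ∂_y)² - l² y²`. -/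
def SL (l : ℝ) : Module.End ℝ TF := θ * θ - (l ^ 2) • Y

theorem SL_eq (l : ℝ) (χ : TF) : SL l χ = θ (θ χ) - (l ^ 2) • Y χ := rfl

theorem integrableOn_mul {u : ℝ → ℝ} (hu : ContinuousOn u (Ioi 0)) (χ : TF) :
    IntegrableOn (fun y => y⁻¹ * (u y * χ y)) (Ioi 0) := by
  refine CSupp.integrableOn (continuousOn_id.inv₀ (fun y hy => ne_of_gt hy) |>.mul
    (hu.mul (continuous χ).continuousOn)) ?_
  obtain ⟨p, q, hp, h⟩ := (cSupp χ)
  exact ⟨p, q, hp, fun y hy => by simp only [h y hy, mul_zero]⟩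

theorem integral_by_parts {u w : ℝ → ℝ} (h : ∀ y, 0 < y → HasDerivAt u (y⁻¹ * w y) y)
    (hw : ContinuousOn w (Ioi 0)) (χ : TF) :
    ∫ y in Ioi (0 : ℝ), y⁻¹ * (w y * χ y) = -∫ y in Ioi (0 : ℝ), y⁻¹ * (u y * θ χ y) := by
  have hu : ContinuousOn u (Ioi 0) := fun y hy => (h y hy).continuousAt.continuousWithinAt
  have i1 := integrableOn_mul hw χ
  have i2 := integrableOn_mul hu (θ χ)
  rw [eq_neg_iff_add_eq_zero, ← integral_add i1 i2]
  obtain ⟨p, q, hp, hχ⟩ := (cSupp χ)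
  have hd : ∀ y ∈ Ioi (0 : ℝ), HasDerivAt (fun y => u y * χ y) (y⁻¹ * (w y * χ y) + y⁻¹ * (u y * θ χ y)) y :=
    fun y hy => ((h y hy).mul ((hasDerivAt χ) (ne_of_gt hy))).congr_deriv (by ring)
  have hχ0 : ∀ y < p, u y * χ y = 0 := fun y hy => by
    rw [hχ y fun hm => absurd hm.1 (not_le.2 hy), mul_zero]
  have l0 : ContinuousAt (fun y => u y * χ y) 0 := by
    refine (continuousAt_const (y := (0 : ℝ))).congr ?_
    filter_upwards [gt_mem_nhds hp] with y hy using (hχ0 y hy).symm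
  have l1 : Tendsto (fun y => u y * χ y) atTop (𝓝 0) := by
    refine tendsto_const_nhds.congr' ?_
    filter_upwards [eventually_gt_atTop q] with y hy
    rw [hχ y fun hm => absurd hm.2 (not_le.2 hy), mul_zero]
  rw [integral_Ioi_of_hasDerivAt_of_tendsto l0.continuousWithinAt hd (i1.add i2) l1, hχ0 0 hp, sub_zero]

end TF

theorem continuousOn_pv (c d : ℝ) (f g : ES 0) : ContinuousOn (pv c d f g) (Ioi 0) := fun _ hy =>
  (hasDerivAt_pv c d f g hy).continuousAt.continuousWithinAt

/-- The double Euler operator moves onto the test function. -/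
theorem integral_pv_theta_sq (c d : ℝ) (f g : ES 0) (χ : TF) :
    ∫ y in Ioi (0 : ℝ), y⁻¹ * (pv c d (θ (θ f + c • f) + c • (θ f + c • f))
      (θ (θ g + d • g) + d • (θ g + d • g)) y * χ y) =
      ∫ y in Ioi (0 : ℝ), y⁻¹ * (pv c d f g y * TF.θ (TF.θ χ) y) := by
  rw [TF.integral_by_parts (fun y hy => hasDerivAt_pv c d _ _ hy) (continuousOn_pv _ _ _ _),
    TF.integral_by_parts (fun y hy => hasDerivAt_pv c d _ _ hy) (continuousOn_pv _ _ _ _), neg_neg]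

theorem fint_tX {R : ℝ} {w : ES n} (hw : XSupp R w) (c : ℝ) (f : ES n) :
    fint R w (tX c f) = Y (fint R (Lap w) f) + (θ (θ (fint R w f) + c • fint R w f) +
      c • (θ (fint R w f) + c • fint R w f)) := by
  have h : tX c f = Y (Lap f) + (θ (θ f + c • f) + c • (θ f + c • f)) := by
    ext x y
    rw [tX, wT_app]
    simp only [add_app, Y_app, map_add, map_smul, smul_app]
    ring
  rw [h]
  simp only [map_add, map_smul, fint_Y, fint_θ, fint_Lap (Or.inr hw)]

theorem fi_eq_fint {R : ℝ} {w : ES n} (hw : XSupp R w) (ξ : 𝔼) : fi (fun x => w (x, 0)) ξ =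
    ((fint R (trig 0 (-ξ)) w (0, 0) : ℝ) : ℂ) - ((fint R (trig (Real.pi / 2) (-ξ)) w (0, 0) : ℝ) : ℂ) * Complex.I := by
  rw [fi, Real.fourierInv_eq_fourier_neg, fourier_ofReal
    ((contDiff_slice w 0).continuous.integrable_of_hasCompactSupport (hw.hasCompactSupport 0)),
    fint_eq (Or.inl hw), fint_eq (Or.inl hw)]
  rfl

theorem fi_Lap {R : ℝ} {w : ES n} (hw : XSupp R w) (ξ : 𝔼) : fi (fun x => Lap w (x, 0)) ξ =
    -(((ℓ[ξ] ^ 2 : ℝ) : ℂ)) * fi (fun x => w (x, 0)) ξ := by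
  rw [fi_eq_fint hw.lap, fi_eq_fint hw, fint_Lap (Or.inl hw), fint_Lap (Or.inl hw), Lap_trig, Lap_trig,
    fint_smul_weight, fint_smul_weight, norm_neg]
  simp only [smul_app]
  push_cast
  ring

theorem CSupp.continuous_rpow_mul {χ : ℝ → ℝ} (h : CSupp χ) (hχ : Continuous χ) (c : ℝ) :
    Continuous fun y : ℝ => y ^ c * χ y := by
  obtain ⟨p, q, hp, h⟩ := h
  rw [continuous_iff_continuousAt]
  intro y
  rcases lt_or_ge y p with hy | hy
  · refine (continuousAt_const (y := (0 : ℝ))).congr ?_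
    filter_upwards [gt_mem_nhds hy] with z hz
    rw [h z fun hm => absurd hm.1 (not_le.2 hz), mul_zero]
  · exact (continuousAt_id.rpow_const (Or.inl (hp.trans_le hy).ne')).mul hχ.continuousAt

theorem IsKernel.integrableOn_rpow {G : 𝔼 → ℝ → ℂ} {A : 𝔼 → ℝ} (hG : IsKernel γ G A) (ξ : 𝔼) (χ : TF) :
    IntegrableOn (fun y => G ξ y * ((y ^ (-γ - 1) * χ y : ℝ) : ℂ)) (Ioi 0) :=
  hG.integrableOn (continuousOn_rpow_mul (TF.continuous χ).continuousOn _) ((TF.cSupp χ).mul _) ξ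

/-- The functional on test functions given by a kernel, in the normalization adapted to `(y ∂_y)²`. -/
def IsKernel.flat {G : 𝔼 → ℝ → ℂ} {A : 𝔼 → ℝ} (hG : IsKernel γ G A) (ξ : 𝔼) : TF →ₗ[ℝ] ℂ where
  toFun χ := ∫ y in Ioi (0 : ℝ), G ξ y * ((y ^ (-γ - 1) * χ y : ℝ) : ℂ)
  map_add' χ ψ := by
    rw [← integral_add (hG.integrableOn_rpow ξ χ) (hG.integrableOn_rpow ξ ψ)]
    refine integral_ext fun y => ?_
    simp only [TF.add_app]; push_cast; ring
  map_smul' c χ := by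
    rw [RingHom.id_apply, Complex.real_smul, ← integral_const_mul]
    refine integral_ext fun y => ?_
    simp only [TF.smul_app]; push_cast; ring

theorem IsKernel.flat_app {G : 𝔼 → ℝ → ℂ} {A : 𝔼 → ℝ} (hG : IsKernel γ G A) (ξ : 𝔼) (χ : TF) :
    hG.flat ξ χ = ∫ y in Ioi (0 : ℝ), G ξ y * ((y ^ (-γ - 1) * χ y : ℝ) : ℂ) := rfl

/-- `G` represents `U` in the Fourier variable. -/
def Represents (U : Pt n → ℝ) (G : 𝔼 → ℝ → ℂ) : Prop :=
  ∀ {ρ : 𝔼 → ℝ}, ContDiff ℝ ∞ ρ → HasCompactSupport ρ → ∀ {χ : ℝ → ℝ}, Continuous χ → CSupp χ →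
    ((∫ p in upper n, U p * (ρ p.1 * χ p.2) : ℝ) : ℂ) = ∫ ξ, fi ρ ξ * ∫ y in Ioi (0 : ℝ), G ξ y * χ y

theorem integral_pv_fint (hγ : 0 ≤ γ) {U : Pt n → ℝ} {f g : ES n} (h : IsRep γ U f g) {R : ℝ} {w : ES n}
    (hw : XSupp R w) (χ : TF) :
    ∫ y in Ioi (0 : ℝ), y⁻¹ * (pv (-γ) δ[γ] (fint R w f) (fint R w g) y * χ y) =
      ∫ p in upper n, U p * (w (p.1, 0) * (p.2 ^ (-γ - 1) * χ p.2)) := by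
  have hI := integrable_upper_test h.continuousOn (contDiff_slice w 0).continuous (hw.hasCompactSupport 0)
    ((TF.cSupp χ).continuous_rpow_mul (TF.continuous χ) (-γ - 1)) ((TF.cSupp χ).mul _)
  rw [IntegrableOn, upper_measure] at hI
  rw [upper_measure, integral_prod_symm _ hI]
  refine integral_Ioi_ext fun y hy => ?_
  have hi : ∀ u : ES n, Integrable fun x : 𝔼 => u (x, y) * w (x, 0) := fun u =>
    Continuous.integrable_of_hasCompactSupport
      ((contDiff_slice u y).continuous.mul (contDiff_slice w 0).continuous) (hw.hasCompactSupport 0).mul_left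
  have e : ∀ x : 𝔼, U (x, y) * (w (x, 0) * (y ^ (-γ - 1) * χ y)) = y ^ (-γ - 1) * χ y *
      (f (x, y) * w (x, 0)) + y ^ (-γ - 1) * χ y * y ^ (2 * fract γ) * (g (x, y) * w (x, 0)) := fun x => by
    rw [h (x, y) hy]; ring
  simp only [e]
  rw [integral_add ((hi f).const_mul _) ((hi g).const_mul _), integral_const_mul, integral_const_mul, pv,
    fint_eq (Or.inr hw), fint_eq (Or.inr hw), show δ[γ] = -γ + 2 * fract γ by
      rw [two_mul_fract hγ]; ring, rpow_add hy, rpow_sub_one hy.ne']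
  ring

open Polynomial in
/-- The horizontal average of the conjugated operator polynomial applied to a representative. -/
def avg (γ : ℝ) (f g : ES n) (R : ℝ) (p : ℝ[X]) (w : ES n) : ℝ → ℝ :=
  pv (-γ) δ[γ] (fint R w (aeval (tX (-γ)) p f))
    (fint R w (aeval (tX δ[γ]) p g))

open Polynomial in
theorem integral_avg_X_mul {f g : ES n} {R : ℝ} {w : ES n} (hw : XSupp R w) (p : ℝ[X]) (χ : TF) :
    ∫ y in Ioi (0 : ℝ), y⁻¹ * (avg γ f g R (X * p) w y * χ y) =
      (∫ y in Ioi (0 : ℝ), y⁻¹ * (avg γ f g R p (Lap w) y * TF.Y χ y)) +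
        ∫ y in Ioi (0 : ℝ), y⁻¹ * (avg γ f g R p w y * TF.θ (TF.θ χ) y) := by
  have e : ∀ c (u : ES n), fint R w (aeval (tX c) (X * p) u) = Y (fint R (Lap w) (aeval (tX c) p u)) +
      (θ (θ (fint R w (aeval (tX c) p u)) + c • fint R w (aeval (tX c) p u)) +
        c • (θ (fint R w (aeval (tX c) p u)) + c • fint R w (aeval (tX c) p u))) := fun c u => by
    rw [aeval_mul_app, aeval_X, fint_tX hw]
  have hY : ∀ c d (u v : ES 0) (y : ℝ), pv c d (Y u) (Y v) y * χ y = pv c d u v y * TF.Y χ y := fun c d u v y => by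
    simp only [pv, Y_app, TF.Y_app]; ring
  unfold avg
  rw [e, e, ← integral_pv_theta_sq, ← integral_add (TF.integrableOn_mul (continuousOn_pv _ _ _ _) _)
    (TF.integrableOn_mul (continuousOn_pv _ _ _ _) _)]
  refine integral_ext fun y => ?_
  simp only [pv_add, add_mul, hY, mul_add]

open Polynomial in
theorem pairing_poly (hγ0 : 0 < γ) (hγn : γ < (n : ℝ) / 2) {U : Pt n → ℝ} {f g : ES n} (h : IsRep γ U f g)
    {G : 𝔼 → ℝ → ℂ} {A : 𝔼 → ℝ} (hG : IsKernel γ G A) (hU : Represents U G) (p : ℝ[X]) {R : ℝ} :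
    ∀ {w : ES n}, XSupp R w → ∀ χ : TF,
      Integrable (fun ξ => fi (fun x => w (x, 0)) ξ * hG.flat ξ (aeval (TF.SL ℓ[ξ]) p χ)) ∧
      ((∫ y in Ioi (0 : ℝ), y⁻¹ * (avg γ f g R p w y * χ y) : ℝ) : ℂ) =
        ∫ ξ, fi (fun x => w (x, 0)) ξ * hG.flat ξ (aeval (TF.SL ℓ[ξ]) p χ) := by
  have hC : ∀ (r : ℝ) {w : ES n}, XSupp R w → ∀ χ : TF,
      Integrable (fun ξ => fi (fun x => w (x, 0)) ξ * hG.flat ξ (aeval (TF.SL ℓ[ξ]) (C r) χ)) ∧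
      ((∫ y in Ioi (0 : ℝ), y⁻¹ * (avg γ f g R (C r) w y * χ y) : ℝ) : ℂ) =
        ∫ ξ, fi (fun x => w (x, 0)) ξ * hG.flat ξ (aeval (TF.SL ℓ[ξ]) (C r) χ) := by
    intro r w hw χ
    simp only [aeval_C, Module.algebraMap_end_apply, avg, map_smul, mul_smul_comm, pv_smul]
    have hχ1 := (TF.cSupp χ).continuous_rpow_mul (TF.continuous χ) (-γ - 1)
    have hχ2 := (TF.cSupp χ).mul fun y => y ^ (-γ - 1)
    refine ⟨Integrable.smul r (hG.integrable_fi_mul hγ0 hγn (contDiff_slice w 0) (hw.hasCompactSupport 0)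
      hχ1.continuousOn hχ2), ?_⟩
    have e := hU (contDiff_slice w 0) (hw.hasCompactSupport 0) hχ1 hχ2
    rw [← integral_pv_fint hγ0.le h hw χ] at e
    rw [integral_smul, Complex.real_smul]
    simp only [IsKernel.flat_app]
    rw [← e, ← Complex.ofReal_mul, ← integral_const_mul]
    congr 1
    refine integral_ext fun y => ?_
    ring
  induction p using Polynomial.induction_on with
  | C r => exact hC r
  | add p q hp hq =>
    intro w hw χ
    obtain ⟨p1, p2⟩ := hp hw χ
    obtain ⟨q1, q2⟩ := hq hw χ
    simp only [map_add, LinearMap.add_apply, mul_add]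
    refine ⟨p1.add q1, ?_⟩
    rw [integral_add p1 q1, ← p2, ← q2, ← Complex.ofReal_add, ← integral_add
      (f := fun y => y⁻¹ * (avg γ f g R p w y * χ y)) (g := fun y => y⁻¹ * (avg γ f g R q w y * χ y))
      (TF.integrableOn_mul (continuousOn_pv _ _ _ _) _) (TF.integrableOn_mul (continuousOn_pv _ _ _ _) _)]
    congr 1
    refine integral_ext fun y => ?_
    simp only [avg, map_add, LinearMap.add_apply, pv_add]; ring
  | monomial k r ih =>
    intro w hw χ
    rw [pow_succ', mul_left_comm]
    obtain ⟨p1, p2⟩ := ih hw.lap (TF.Y χ)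
    obtain ⟨q1, q2⟩ := ih hw (TF.θ (TF.θ χ))
    rw [integral_avg_X_mul hw, Complex.ofReal_add, p2, q2, ← integral_add p1 q1]
    have e : ∀ ξ : 𝔼, fi (fun x => w (x, 0)) ξ * hG.flat ξ (aeval (TF.SL ℓ[ξ]) (X * (C r * X ^ k)) χ)
        = fi (fun x => Lap w (x, 0)) ξ * hG.flat ξ (aeval (TF.SL ℓ[ξ]) (C r * X ^ k) (TF.Y χ)) +
          fi (fun x => w (x, 0)) ξ *
            hG.flat ξ (aeval (TF.SL ℓ[ξ]) (C r * X ^ k) (TF.θ (TF.θ χ))) := fun ξ => by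
      rw [mul_comm X, map_mul, aeval_X, mul_apply, TF.SL_eq, map_sub, map_smul, map_sub, map_smul,
        fi_Lap hw, Complex.real_smul]
      ring
    simp only [e]
    exact ⟨p1.add q1, trivial⟩

theorem fi_eq (ρ : 𝔼 → ℝ) (ξ : 𝔼) :
    fi ρ ξ = ∫ x, Complex.exp (↑(2 * Real.pi * inner ℝ x ξ) * Complex.I) * (ρ x : ℂ) := by
  rw [fi, Real.fourierInv_eq']
  rfl

theorem fi_translate (ρ : 𝔼 → ℝ) (a ξ : 𝔼) : fi (fun x => ρ (x + a)) ξ =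
    Complex.exp (↑(-2 * Real.pi * inner ℝ ξ a) * Complex.I) * fi ρ ξ := by
  rw [fi_eq, fi_eq, ← integral_const_mul, ← integral_add_right_eq_self (fun x : 𝔼 =>
    Complex.exp (↑(-2 * Real.pi * inner ℝ ξ a) * Complex.I) *
      (Complex.exp (↑(2 * Real.pi * inner ℝ x ξ) * Complex.I) * (ρ x : ℂ))) a]
  refine integral_ext fun x => ?_
  rw [← mul_assoc, ← Complex.exp_add, inner_add_left, real_inner_comm ξ a]
  congr 2
  push_cast
  ring

theorem fi_bump_ne_zero {N : ℝ} (hN : 0 < N) (b : ContDiffBump (0 : 𝔼)) (hb : b.rOut ≤ 1 / (8 * N)) {ξ : 𝔼}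
    (hξ : ‖ξ‖ ≤ N) : fi b ξ ≠ 0 := by
  have hc : Continuous fun x : 𝔼 => Complex.exp (↑(2 * Real.pi * inner ℝ x ξ) * Complex.I) * ((b x : ℝ) : ℂ) := by
    have := b.continuous
    fun_prop
  have hs : HasCompactSupport fun x : 𝔼 =>
      Complex.exp (↑(2 * Real.pi * inner ℝ x ξ) * Complex.I) * ((b x : ℝ) : ℂ) :=
    (b.hasCompactSupport.comp_left (g := Complex.ofReal) rfl).mul_left
  have hi := hc.integrable_of_hasCompactSupport (μ := volume) hs
  have h1 : (fi b ξ).re = ∫ x, Real.cos (2 * Real.pi * inner ℝ x ξ) * b x := by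
    rw [fi_eq]
    refine (integral_re hi).symm.trans (integral_ext fun x => ?_)
    simp only [RCLike.re_to_complex, Complex.re_mul_ofReal, Complex.exp_ofReal_mul_I_re]
  have h2 : ∀ x, Real.cos (Real.pi / 4) * b x ≤ Real.cos (2 * Real.pi * inner ℝ x ξ) * b x := fun x => by
    rcases le_or_gt b.rOut ‖x‖ with h | h
    · rw [b.zero_of_le_dist (by rwa [dist_zero_right]), mul_zero, mul_zero]
    · refine mul_le_mul_of_nonneg_right ?_ b.nonneg
      have h3 : |inner ℝ x ξ| ≤ 1 / 8 := (abs_real_inner_le_norm x ξ).trans <| by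
        calc ‖x‖ * ‖ξ‖ ≤ 1 / (8 * N) * N := by gcongr; exact h.le.trans hb
          _ = 1 / 8 := by field_simp
      rw [← Real.cos_abs (2 * Real.pi * inner ℝ x ξ), abs_mul, abs_of_pos (by positivity : 0 < 2 * Real.pi)]
      have hpi := Real.pi_pos
      exact Real.cos_le_cos_of_nonneg_of_le_pi (by positivity) (by nlinarith) (by nlinarith)
  have h3 : 0 < (fi b ξ).re := by
    rw [h1]
    refine lt_of_lt_of_le ?_ (integral_mono (b.integrable.const_mul _) ?_ h2)
    · rw [integral_const_mul]
      have := b.integral_pos (μ := volume)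
      have : 0 < Real.cos (Real.pi / 4) := by rw [Real.cos_pi_div_four]; positivity
      positivity
    · exact Continuous.integrable_of_hasCompactSupport (by have := b.continuous; fun_prop)
        b.hasCompactSupport.mul_left
  intro h
  rw [h] at h3
  exact lt_irrefl _ h3

theorem ae_eq_zero_of_fourier_eq_zero {K : 𝔼 → ℂ} (hK : Integrable K) (h : ∀ a, 𝓕 K a = 0) :
    ∀ᵐ ξ, K ξ = 0 := by
  refine ae_eq_zero_of_integral_contDiff_smul_eq_zero hK.locallyIntegrable fun ψ hψ hψ' => ?_
  obtain ⟨S, T, hS, -, hTS⟩ := exists_schwartz hψ hψ'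
  have e := VectorFourier.integral_fourierIntegral_smul_eq_flip (e := Real.fourierChar) (μ := volume)
    (ν := volume) (L := innerₗ 𝔼) Real.continuous_fourierChar continuous_inner T.integrable hK
  have e1 : ∀ ξ, VectorFourier.fourierIntegral Real.fourierChar volume (innerₗ 𝔼) T ξ = ψ ξ := fun ξ => by
    rw [← hS, ← hTS, SchwartzMap.fourier_coe]; rfl
  have e2 : ∀ x, VectorFourier.fourierIntegral Real.fourierChar volume (innerₗ 𝔼).flip K x = 0 := fun x => by
    rw [← h x, flip_innerₗ]; rfl
  simp only [e1, e2, smul_zero, integral_zero] at e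
  exact e

theorem ae_eq_zero_of_pairing {H : 𝔼 → ℂ} (h : ∀ ρ : 𝔼 → ℝ, ContDiff ℝ ∞ ρ → HasCompactSupport ρ →
    Integrable (fun ξ => fi ρ ξ * H ξ) ∧ ∫ ξ, fi ρ ξ * H ξ = 0) : ∀ᵐ ξ, H ξ = 0 := by
  have key : ∀ N : ℕ, ∀ᵐ ξ : 𝔼, ‖ξ‖ ≤ N + 1 → H ξ = 0 := fun N => by
    have hN : (0 : ℝ) < N + 1 := by positivity
    let b : ContDiffBump (0 : 𝔼) := ⟨1 / (16 * (N + 1)), 1 / (8 * (N + 1)), by positivity, by gcongr; norm_num⟩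
    have hz := ae_eq_zero_of_fourier_eq_zero (h b b.contDiff b.hasCompactSupport).1 fun a => by
      have h2 := (h (fun x => b (x + a)) (b.contDiff.comp (contDiff_id.add contDiff_const))
        (b.hasCompactSupport.comp_homeomorph (Homeomorph.addRight a))).2
      rw [Real.fourier_eq', ← h2]
      refine integral_ext fun ξ => ?_
      simp only [smul_eq_mul]
      rw [fi_translate]; ring
    filter_upwards [hz] with ξ hξ hn
    exact (mul_eq_zero.1 hξ).resolve_left (fi_bump_ne_zero hN b le_rfl hn)
  filter_upwards [ae_all_iff.2 key] with ξ hξ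
  obtain ⟨N, hN⟩ := exists_nat_ge ‖ξ‖
  exact hξ N (hN.trans (by linarith))

/-- Test functions supported in a fixed interval. -/
def TFN (N : ℕ) : Type := {χ : TF // ∀ y, y ∉ Icc (1 / ((N : ℝ) + 1)) (N + 1) → χ y = 0}

/-- The jet of a test function along the Euler operator. -/
def jet (N : ℕ) (χ : TFN N) (k : ℕ) : C(Icc (1 / ((N : ℝ) + 1)) (N + 1), ℝ) :=
  ⟨fun y => (TF.θ ^ k) χ.1 y, (TF.continuous _).comp continuous_subtype_val⟩

instance (N : ℕ) : TopologicalSpace (TFN N) := TopologicalSpace.induced (jet N) inferInstance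

instance (N : ℕ) : SecondCountableTopology (TFN N) :=
  TopologicalSpace.secondCountableTopology_induced _ _ (jet N)

theorem exists_TFN (χ : TF) : ∃ N, ∃ ψ : TFN N, ψ.1 = χ := by
  obtain ⟨p, q, hp, h⟩ := TF.cSupp χ
  obtain ⟨N, hN⟩ := exists_nat_gt (max (1 / p) q)
  refine ⟨N, ⟨χ, fun y hy => h y fun hm => hy ⟨?_, ?_⟩⟩, rfl⟩
  · have h1 : 1 / p < N + 1 := (le_max_left _ _).trans_lt (hN.trans (by linarith))
    exact ((one_div_le (by positivity) hp).2 h1.le).trans hm.1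
  · exact hm.2.trans ((le_max_right _ _).trans (hN.le.trans (by linarith)))

/-- Operators that preserve the interval of support and are continuous for the jet topology. -/
def JetCont (N : ℕ) (B : TFN N → TF) : Prop :=
  (∀ χ, ∀ y, y ∉ Icc (1 / ((N : ℝ) + 1)) (N + 1) → B χ y = 0) ∧
    ∀ k, Continuous fun χ => (⟨fun y => (TF.θ ^ k) (B χ) y, (TF.continuous _).comp continuous_subtype_val⟩ :
      C(Icc (1 / ((N : ℝ) + 1)) (N + 1), ℝ))

namespace JetCont

variable {N : ℕ} {B B' : TFN N → TF}

theorem coe : JetCont N fun χ => χ.1 :=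
  ⟨fun χ => χ.2, fun k => ((continuous_apply k).comp (continuous_induced_dom (f := jet N))).congr fun _ => rfl⟩

theorem add (h : JetCont N B) (h' : JetCont N B') : JetCont N fun χ => B χ + B' χ := by
  refine ⟨fun χ y hy => ?_, fun k => ((h.2 k).add (h'.2 k)).congr fun χ => ?_⟩
  · rw [TF.add_app, h.1 χ y hy, h'.1 χ y hy, add_zero]
  · ext y
    change _ = (TF.θ ^ k) (B χ + B' χ) y
    rw [map_add]; rfl

theorem smul (h : JetCont N B) (c : ℝ) : JetCont N fun χ => c • B χ := by
  refine ⟨fun χ y hy => ?_, fun k => ((h.2 k).const_smul c).congr fun χ => ?_⟩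
  · rw [TF.smul_app, h.1 χ y hy, mul_zero]
  · ext y
    change _ = (TF.θ ^ k) (c • B χ) y
    rw [map_smul]; rfl

theorem theta (h : JetCont N B) : JetCont N fun χ => TF.θ (B χ) := by
  refine ⟨fun χ y hy => ?_, fun k => ((h.2 (k + 1)).congr fun χ => by
    ext y
    change (TF.θ ^ (k + 1)) (B χ) y = (TF.θ ^ k) (TF.θ (B χ)) y
    rw [pow_succ]; rfl)⟩
  have : (B χ : ℝ → ℝ) =ᶠ[𝓝 y] fun _ => 0 := by
    filter_upwards [isClosed_Icc.isOpen_compl.mem_nhds hy] with z hz using h.1 χ z hz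
  rw [TF.θ_eq ((hasDerivAt_const y (0 : ℝ)).congr_of_eventuallyEq this), mul_zero]

theorem θ_Y (χ : TF) : TF.θ (TF.Y χ) = TF.Y (TF.θ χ) + (2 : ℝ) • TF.Y χ := TF.ext fun y => by
  have h := ((hasDerivAt_pow 2 y).mul ((TF.contDiff χ).differentiable (by simp) y).hasDerivAt)
  rw [TF.θ_eq (χ := TF.Y χ) h]
  change _ = y ^ 2 * (y * deriv χ y) + 2 * (y ^ 2 * χ y)
  push_cast; ring

theorem mulY (h : JetCont N B) : JetCont N fun χ => TF.Y (B χ) := by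
  refine ⟨fun χ y hy => by rw [TF.Y_app, h.1 χ y hy, mul_zero], fun k => ?_⟩
  induction k generalizing B with
  | zero =>
    have hc := (continuous_const (y := (⟨fun y => (y : ℝ) ^ 2, by fun_prop⟩ :
      C(Icc (1 / ((N : ℝ) + 1)) (N + 1), ℝ)))).mul (h.2 0)
    exact hc
  | succ k ih =>
    refine ((ih h.theta).add ((ih h).const_smul (2 : ℝ))).congr fun χ => ?_
    ext y
    change _ = (TF.θ ^ (k + 1)) (TF.Y (B χ)) y
    rw [pow_succ, mul_apply, θ_Y, map_add, map_smul]; rfl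

open Polynomial in
theorem aeval_SL (h : JetCont N B) (l : ℝ) (p : ℝ[X]) : JetCont N fun χ => aeval (TF.SL l) p (B χ) := by
  induction p using Polynomial.induction_on generalizing B with
  | C r => simp only [aeval_C, Module.algebraMap_end_apply]; exact h.smul r
  | add p q hp hq => simp only [map_add, LinearMap.add_apply]; exact (hp h).add (hq h)
  | monomial k r ih =>
    have e : ∀ χ, aeval (TF.SL l) (C r * X ^ (k + 1)) (B χ)
        = aeval (TF.SL l) (C r * X ^ k) (TF.θ (TF.θ (B χ)) + (-(l ^ 2)) • TF.Y (B χ)) := fun χ => by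
      rw [pow_succ, ← mul_assoc, map_mul, aeval_X, mul_apply, TF.SL_eq]
      congr 1
      module
    simp only [e]
    exact ih (h.theta.theta.add (h.mulY.smul _))

theorem continuous_integral (h : JetCont N B) {H : ℝ → ℂ}
    (hH : IntegrableOn H (Icc (1 / ((N : ℝ) + 1)) (N + 1))) :
    Continuous fun χ => ∫ y in Icc (1 / ((N : ℝ) + 1)) (N + 1), H y * (B χ y : ℂ) := by
  have hab : 1 / ((N : ℝ) + 1) ≤ N + 1 :=
    (div_le_one_of_le₀ (by linarith [N.cast_nonneg (α := ℝ)]) (by positivity)).trans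
      (by linarith [N.cast_nonneg (α := ℝ)])
  let Ψ : C(Icc (1 / ((N : ℝ) + 1)) (N + 1), ℝ) → ℂ := fun u =>
    ∫ y in Icc (1 / ((N : ℝ) + 1)) (N + 1), H y * ((IccExtend hab u y : ℝ) : ℂ)
  have hi : ∀ u : C(Icc (1 / ((N : ℝ) + 1)) (N + 1), ℝ),
      IntegrableOn (fun y => H y * ((IccExtend hab u y : ℝ) : ℂ)) (Icc (1 / ((N : ℝ) + 1)) (N + 1)) := fun u => by
    refine hH.mul_bdd (c := ‖u‖) ?_ (Eventually.of_forall fun y => ?_)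
    · exact (Complex.continuous_ofReal.comp (u.continuous.Icc_extend' (h := hab))).aestronglyMeasurable
    · rw [Complex.norm_real]; exact u.norm_coe_le_norm _
  have hΨ : Continuous Ψ := by
    refine LipschitzWith.continuous (K := Real.toNNReal (∫ y in Icc (1 / ((N : ℝ) + 1)) (N + 1), ‖H y‖))
      (LipschitzWith.of_dist_le_mul fun u v => ?_)
    rw [Real.coe_toNNReal _ (integral_nonneg fun _ => norm_nonneg _), dist_eq_norm, ← integral_sub (hi u) (hi v),
      ← integral_mul_const]
    refine norm_integral_le_of_norm_le (hH.norm.mul_const _) (Eventually.of_forall fun y => ?_)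
    rw [← mul_sub, norm_mul, ← Complex.ofReal_sub, Complex.norm_real]
    refine mul_le_mul_of_nonneg_left ?_ (norm_nonneg _)
    exact (dist_eq_norm (u _) (v _)).symm.le.trans (ContinuousMap.dist_apply_le_dist _)
  refine (hΨ.comp (h.2 0)).congr fun χ => ?_
  refine setIntegral_congr_fun measurableSet_Icc fun y hy => ?_
  rw [IccExtend_of_mem _ _ hy]
  rfl

end JetCont

open Polynomial in
/-- If the functionals vanish almost everywhere for each test function, they vanish simultaneously for all test
functions almost everywhere. -/
theorem IsKernel.ae_forall {G : 𝔼 → ℝ → ℂ} {A : 𝔼 → ℝ} (hG : IsKernel γ G A) (p : ℝ[X])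
    (h : ∀ χ : TF, ∀ᵐ ξ, hG.flat ξ (aeval (TF.SL ℓ[ξ]) p χ) = 0) :
    ∀ᵐ ξ, ∀ χ : TF, hG.flat ξ (aeval (TF.SL ℓ[ξ]) p χ) = 0 := by
  choose D hDc hDd using fun N => TopologicalSpace.exists_countable_dense (TFN N)
  have h1 : ∀ᵐ ξ, ∀ N, ∀ χ ∈ D N, hG.flat ξ (aeval (TF.SL ℓ[ξ]) p χ.1) = 0 :=
    ae_all_iff.2 fun N => (ae_ball_iff (hDc N)).2 fun χ _ => h χ.1
  filter_upwards [h1] with ξ hξ χ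
  obtain ⟨N, ψ, rfl⟩ := exists_TFN χ
  have hj := (JetCont.coe (N := N)).aeval_SL ℓ[ξ] p
  have hpos : (0 : ℝ) < 1 / ((N : ℝ) + 1) := by positivity
  have hsub : Icc (1 / ((N : ℝ) + 1)) (N + 1) ⊆ Ioi 0 := fun y hy => hpos.trans_le hy.1
  have e : ∀ χ : TFN N, hG.flat ξ (aeval (TF.SL ℓ[ξ]) p χ.1) =
      ∫ y in Icc (1 / ((N : ℝ) + 1)) (N + 1), (G ξ y * ((y ^ (-γ - 1) : ℝ) : ℂ)) *
        (aeval (TF.SL ℓ[ξ]) p χ.1 y : ℂ) := fun χ => by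
    rw [hG.flat_app]
    refine (setIntegral_eq_of_subset_of_forall_sdiff_eq_zero measurableSet_Ioi hsub fun z hz => ?_).trans ?_
    · rw [hj.1 χ z hz.2]; simp
    · refine setIntegral_congr_fun measurableSet_Icc fun y _ => ?_
      push_cast; ring
  have hH : IntegrableOn (fun y => G ξ y * ((y ^ (-γ - 1) : ℝ) : ℂ)) (Icc (1 / ((N : ℝ) + 1)) (N + 1)) := by
    have hb : ContinuousOn (fun y : ℝ => A ξ * (ℓ[ξ] ^ (-γ) *
        (1 + ℓ[ξ] ^ fract γ * y ^ fract γ)) * y ^ (-γ - 1))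
        (Icc (1 / ((N : ℝ) + 1)) (N + 1)) := by
      have hr : ∀ c : ℝ, ContinuousOn (fun y : ℝ => y ^ c) (Icc (1 / ((N : ℝ) + 1)) (N + 1)) := fun c =>
        continuousOn_id.rpow_const fun y hy => Or.inl (ne_of_gt (hsub hy))
      exact (continuousOn_const.mul (continuousOn_const.mul (continuousOn_const.add
        (continuousOn_const.mul (hr _))))).mul (hr _)
    refine (hb.integrableOn_compact isCompact_Icc).mono' ?_ ?_
    · exact ((hG.meas.comp measurable_prodMk_left).mul
        (Complex.measurable_ofReal.comp (measurable_id.pow_const _))).aestronglyMeasurable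
    · filter_upwards [ae_restrict_mem measurableSet_Icc] with y hy
      have hy0 : 0 < y := hsub hy
      rw [norm_mul, Complex.norm_real, Real.norm_of_nonneg (by positivity),
        ← mul_rpow (by positivity) hy0.le]
      exact mul_le_mul_of_nonneg_right (hG.bound ξ y hy0) (by positivity)
  have hc := hj.continuous_integral hH
  have hcl : IsClosed {χ : TFN N | hG.flat ξ (aeval (TF.SL ℓ[ξ]) p χ.1) = 0} := by
    simp only [e]; exact isClosed_eq hc continuous_const
  exact hcl.closure_subset_iff.2 (hξ N) (hDd N ψ)

theorem RD.contDiffOn {u : ℝ → ℝ} (hu : RD u) : ContDiffOn ℝ ∞ u (Ioi 0) := by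
  obtain ⟨K, hK, v, hv, e⟩ := hu
  refine ContDiffOn.congr ?_ e
  rw [contDiffOn_infty]
  intro m
  clear e
  induction m generalizing v with
  | zero =>
    obtain ⟨⟨w, -, hw⟩, -⟩ := hK v hv
    rw [Nat.cast_zero, contDiffOn_zero]
    exact fun y hy => (hw y hy).continuousAt.continuousWithinAt
  | succ m ih =>
    obtain ⟨⟨w, hwK, hw⟩, -⟩ := hK v hv
    rw [Nat.cast_succ, contDiffOn_succ_iff_deriv_of_isOpen isOpen_Ioi]
    refine ⟨fun y hy => (hw y hy).differentiableAt.differentiableWithinAt, by simp, ?_⟩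
    refine ((contDiffOn_id.inv fun y hy => ne_of_gt hy).mul (ih w hwK)).congr fun y hy => ?_
    exact (hw y hy).deriv

namespace TF

/-- Product of a function that is smooth on `(0, ∞)` and a test function. -/
def smulTF {v : ℝ → ℝ} (hv : ContDiffOn ℝ ∞ v (Ioi 0)) (χ : TF) : TF :=
  ⟨fun y => v y * χ y, by
    obtain ⟨p, q, hp, h⟩ := cSupp χ
    rw [contDiff_iff_contDiffAt]
    intro y
    rcases lt_or_ge y p with hy | hy
    · refine (contDiffAt_const (c := (0 : ℝ))).congr_of_eventuallyEq ?_
      filter_upwards [gt_mem_nhds hy] with z hz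
      rw [h z fun hm => absurd hm.1 (not_le.2 hz), mul_zero]
    · exact (hv.contDiffAt (isOpen_Ioi.mem_nhds (hp.trans_le hy))).mul (contDiff χ).contDiffAt,
    (cSupp χ).mul v⟩

@[simp] theorem smulTF_app {v : ℝ → ℝ} (hv : ContDiffOn ℝ ∞ v (Ioi 0)) (χ : TF) (y : ℝ) :
    smulTF hv χ y = v y * χ y := rfl

theorem eq_zero_of_nonpos (χ : TF) {y : ℝ} (hy : y ≤ 0) : χ y = 0 := by
  obtain ⟨p, q, hp, h⟩ := cSupp χ
  exact h y fun hm => absurd (hp.trans_le hm.1) (not_lt.2 hy)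

theorem ext_of_pos {f g : TF} (h : ∀ y, 0 < y → f y = g y) : f = g := ext fun y => by
  rcases lt_or_ge 0 y with hy | hy
  · exact h y hy
  · rw [eq_zero_of_nonpos f hy, eq_zero_of_nonpos g hy]

theorem θ_smulTF {v w : ℝ → ℝ} (hv : ContDiffOn ℝ ∞ v (Ioi 0)) (hw : ContDiffOn ℝ ∞ w (Ioi 0))
    (h : ∀ y, 0 < y → HasDerivAt v (y⁻¹ * w y) y) (χ : TF) :
    θ (smulTF hv χ) = smulTF hw χ + smulTF hv (θ χ) := ext_of_pos fun y hy => by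
  rw [θ_eq (χ := smulTF hv χ) ((h y hy).mul (hasDerivAt χ hy.ne'))]
  simp only [add_app, smulTF_app]
  field_simp

theorem θ_eq_zero {χ : TF} (h : ∀ y < 1, χ y = 0) : ∀ y < 1, θ χ y = 0 := fun y hy => by
  have : (χ : ℝ → ℝ) =ᶠ[𝓝 y] fun _ => 0 := by filter_upwards [gt_mem_nhds hy] with t ht using h t ht
  rw [θ_eq ((hasDerivAt_const y (0 : ℝ)).congr_of_eventuallyEq this), mul_zero]

/-- Dilation of a test function. -/
def dil (t : ℝ) (ht : 0 < t) (χ : TF) : TF :=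
  ⟨fun y => χ (t * y), (contDiff χ).comp (contDiff_const.mul contDiff_id), by
    obtain ⟨p, q, hp, h⟩ := cSupp χ
    refine ⟨p / t, q / t, by positivity, fun y hy => h _ fun hm => hy ⟨?_, ?_⟩⟩
    · rw [div_le_iff₀ ht, mul_comm]; exact hm.1
    · rw [le_div_iff₀ ht, mul_comm]; exact hm.2⟩

@[simp] theorem dil_app {t : ℝ} (ht : 0 < t) (χ : TF) (y : ℝ) : dil t ht χ y = χ (t * y) := rfl

theorem θ_dil {t : ℝ} (ht : 0 < t) (χ : TF) : θ (dil t ht χ) = dil t ht (θ χ) := ext_of_pos fun y hy => by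
  have h : HasDerivAt (fun y => χ (t * y)) _ y :=
    (hasDerivAt χ (mul_pos ht hy).ne').comp y ((hasDerivAt_id y).const_mul t)
  rw [θ_eq (χ := dil t ht χ) h, dil_app]
  field_simp

theorem SL_dil {t : ℝ} (ht : 0 < t) (χ : TF) : SL t (dil t ht χ) = dil t ht (SL 1 χ) := by
  rw [SL_eq, SL_eq, θ_dil, θ_dil]
  refine ext fun y => ?_
  simp only [sub_app, smul_app, dil_app, Y_app]
  ring

open Polynomial in
theorem aeval_SL_dil {t : ℝ} (ht : 0 < t) (p : ℝ[X]) (χ : TF) :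
    aeval (SL t) p (dil t ht χ) = dil t ht (aeval (SL 1) p χ) := by
  induction p using Polynomial.induction_on generalizing χ with
  | C r => simp only [aeval_C, Module.algebraMap_end_apply]; rfl
  | add p q hp hq => simp only [map_add, LinearMap.add_apply, hp, hq]; rfl
  | monomial k r ih =>
    rw [pow_succ, ← mul_assoc, map_mul, map_mul (aeval (SL 1)), aeval_X, aeval_X, mul_apply,
      mul_apply, SL_dil, ih]

theorem inv_contDiffOn : ContDiffOn ℝ ∞ (fun y : ℝ => y⁻¹) (Ioi 0) :=
  contDiffOn_id.inv fun _ hy => ne_of_gt hy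

theorem exists_primitive (χ : TF) (h : ∫ y in Ioi (0 : ℝ), y⁻¹ * χ y = 0) : ∃ v : TF, θ v = χ := by
  set g : TF := smulTF inv_contDiffOn χ with hg
  obtain ⟨p, q, hp, hpq⟩ := cSupp g
  have hq : ∀ y, q < y → g y = 0 := fun y hy => hpq y fun hm => absurd hm.2 (not_le.2 hy)
  have hp' : ∀ y, y < p → g y = 0 := fun y hy => hpq y fun hm => absurd hm.1 (not_le.2 hy)
  have hd : ∀ y, HasDerivAt (fun y => ∫ t in (0 : ℝ)..y, g t) (g y) y := fun y =>
    intervalIntegral.integral_hasDerivAt_right ((continuous g).intervalIntegrable _ _)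
      (continuous g).stronglyMeasurable.stronglyMeasurableAtFilter (continuous g).continuousAt
  have hsm : ContDiff ℝ ∞ fun y => ∫ t in (0 : ℝ)..y, g t := by
    rw [contDiff_infty_iff_deriv]
    refine ⟨fun y => (hd y).differentiableAt, ?_⟩
    rw [funext fun y => (hd y).deriv]
    exact contDiff g
  refine ⟨⟨fun y => ∫ t in (0 : ℝ)..y, g t, hsm, p, max q 0, hp, fun y hy => ?_⟩, ?_⟩
  · rw [mem_Icc, not_and_or, not_le, not_le] at hy
    rcases hy with hy | hy
    · refine (intervalIntegral.integral_congr (g := fun _ => 0) fun t ht => hp' t ?_).trans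
        intervalIntegral.integral_zero
      exact ht.2.trans_lt (max_lt hp hy)
    · have hy0 : 0 < y := (le_max_right _ _).trans_lt hy
      simp only
      rw [intervalIntegral.integral_of_le hy0.le]
      refine Eq.trans (Eq.symm ?_) h
      refine (setIntegral_eq_of_subset_of_forall_sdiff_eq_zero measurableSet_Ioi Ioc_subset_Ioi_self
        fun z hz => hq z ?_)
      by_contra hc
      exact hz.2 ⟨hz.1, (not_lt.1 hc).trans ((le_max_left _ _).trans hy.le)⟩
  · refine ext_of_pos fun y hy => ?_
    rw [θ_eq (hd y), hg, smulTF_app]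
    field_simp

/-- Families of test functions escaping to infinity with rapid decay. -/
inductive Escaping : (ℕ → TF) → Prop
  | base {v : ℝ → ℝ} (hv : RD v) (z : TF) (hz : ∀ y < 1, z y = 0) :
    Escaping fun R => smulTF hv.contDiffOn (dil ((R : ℝ) + 1)⁻¹ (by positivity) z)
  | add {r s : ℕ → TF} : Escaping r → Escaping s → Escaping fun R => r R + s R

namespace Escaping

variable {r : ℕ → TF}

theorem smul (h : Escaping r) (c : ℝ) : Escaping fun R => c • r R := by
  induction h with
  | base hv z hz =>
    have := Escaping.base hv (c • z) fun y hy => by rw [smul_app, hz y hy, mul_zero]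
    refine cast (congrArg _ (funext fun R => ext fun y => ?_)) this
    simp only [smulTF_app, dil_app, smul_app]; ring
  | add _ _ h1 h2 => simp only [smul_add]; exact h1.add h2

theorem theta (h : Escaping r) : Escaping fun R => θ (r R) := by
  induction h with
  | @base v hv z hz =>
    obtain ⟨K, hK, u, hu, e⟩ := id hv
    obtain ⟨⟨w, hw, hd⟩, -⟩ := hK u hu
    have hwR : RD w := ⟨K, hK, w, hw, fun _ _ => rfl⟩
    refine cast (congrArg _ (funext fun R => ?_)) ((Escaping.base hwR z hz).add (Escaping.base hv (θ z) (θ_eq_zero hz)))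
    rw [θ_smulTF hv.contDiffOn hwR.contDiffOn fun y hy => hasDerivAt_congr_pos e hy (hd y hy), θ_dil]
  | add _ _ h1 h2 => simp only [map_add]; exact h1.add h2

theorem mulY (h : Escaping r) : Escaping fun R => Y (r R) := by
  induction h with
  | @base v hv z hz =>
    refine cast (congrArg _ (funext fun R => ext_of_pos fun y hy => ?_)) (Escaping.base (hv.rpow_mul 2) z hz)
    simp only [smulTF_app, dil_app, Y_app, rpow_two]; ring
  | add _ _ h1 h2 => simp only [map_add]; exact h1.add h2

open Polynomial in
theorem aeval_SL (h : Escaping r) (l : ℝ) (p : ℝ[X]) : Escaping fun R => aeval (SL l) p (r R) := by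
  induction p using Polynomial.induction_on generalizing r with
  | C c => simp only [aeval_C, Module.algebraMap_end_apply]; exact h.smul c
  | add p q hp hq => simp only [map_add, LinearMap.add_apply]; exact (hp h).add (hq h)
  | monomial k c ih =>
    have e : ∀ R, aeval (SL l) (C c * X ^ (k + 1)) (r R)
        = aeval (SL l) (C c * X ^ k) (θ (θ (r R)) + (-(l ^ 2)) • Y (r R)) := fun R => by
      rw [pow_succ, ← mul_assoc, map_mul, aeval_X, mul_apply, SL_eq]
      congr 1
      module
    simp only [e]
    exact ih (h.theta.theta.add (h.mulY.smul _))

theorem tendsto_integral (h : Escaping r) : (∀ R, ∀ y < 1, r R y = 0) ∧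
    (∀ R, IntegrableOn (fun y => |r R y|) (Ioi 0)) ∧
    Tendsto (fun R => ∫ y in Ioi (0 : ℝ), |r R y|) atTop (𝓝 0) := by
  have hint : ∀ χ : TF, IntegrableOn (fun y => |χ y|) (Ioi 0) := fun χ =>
    CSupp.integrableOn (continuous χ).continuousOn.abs (cSupp χ).abs
  induction h with
  | @base v hv z hz =>
    refine ⟨fun R y hy => ?_, fun R => hint _, ?_⟩
    · rcases lt_or_ge 0 y with h0 | h0
      · rw [smulTF_app, dil_app, hz, mul_zero]
        have : ((R : ℝ) + 1)⁻¹ ≤ 1 := inv_le_one_of_one_le₀ (by linarith [R.cast_nonneg (α := ℝ)])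
        nlinarith
      · exact eq_zero_of_nonpos _ h0
    · obtain ⟨p, q, hp, hpq⟩ := cSupp z
      obtain ⟨C, hC⟩ := (isCompact_Icc (a := p) (b := q)).exists_bound_of_continuousOn (continuous z).continuousOn
      have hzC : ∀ y, |z y| ≤ |C| := fun y => by
        by_cases hy : y ∈ Icc p q
        · exact (hC y hy).trans (le_abs_self _)
        · rw [hpq y hy, abs_zero]; exact abs_nonneg _
      have hev : ∀ᶠ R : ℕ in atTop, ∀ y, (R : ℝ) + 1 ≤ y → |v y| ≤ (y ^ 2)⁻¹ := by
        obtain ⟨M, hM⟩ := eventually_atTop.1 ((hv.tendsto 2).eventually (Metric.ball_mem_nhds 0 one_pos))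
        filter_upwards [eventually_ge_atTop ⌈M⌉₊] with R hR y hy
        have hRy : M ≤ y := (Nat.ceil_le.1 hR).trans (by linarith)
        have h0 : 0 < y := lt_of_lt_of_le (by positivity) hy
        have h1 := hM y hRy
        rw [dist_zero_right, Real.norm_eq_abs, rpow_two, abs_mul, abs_of_pos (by positivity)] at h1
        rw [← one_div, le_div_iff₀ (by positivity), mul_comm]
        exact h1.le
      have hlim := (tendsto_one_div_add_atTop_nhds_zero_nat (𝕜 := ℝ)).const_mul (|C| * max q 1)
      rw [mul_zero] at hlim
      refine tendsto_of_tendsto_of_tendsto_of_le_of_le' tendsto_const_nhds hlim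
        (Eventually.of_forall fun R => integral_nonneg fun y => abs_nonneg _) ?_
      filter_upwards [hev] with R hR
      have hR0 : (0 : ℝ) < R + 1 := by positivity
      set I : Set ℝ := Icc ((R : ℝ) + 1) ((R + 1) * max q 1)
      have hle : (R : ℝ) + 1 ≤ (R + 1) * max q 1 := le_mul_of_one_le_right hR0.le (le_max_right _ _)
      have hz0 : ∀ y ∈ Ioi (0 : ℝ) \ I, |smulTF hv.contDiffOn (dil ((R : ℝ) + 1)⁻¹ (by positivity) z) y| = 0 := by
        intro y hy
        rw [smulTF_app, dil_app]
        have h3 := hy.2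
        rw [mem_Icc, not_and_or, not_le, not_le] at h3
        rcases h3 with h3 | h3
        · rw [hz _ (by rw [inv_mul_lt_iff₀ hR0, mul_one]; exact h3), mul_zero, abs_zero]
        · rw [hpq _ fun hm => ?_, mul_zero, abs_zero]
          have h4 := hm.2
          rw [inv_mul_le_iff₀ hR0] at h4
          exact absurd (h4.trans (mul_le_mul_of_nonneg_left (le_max_left q 1) hR0.le)) (not_le.2 h3)
      rw [setIntegral_eq_of_subset_of_forall_sdiff_eq_zero (s := I) measurableSet_Ioi
        (fun y hy => hR0.trans_le hy.1) hz0]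
      refine (Real.le_norm_self _).trans ((norm_setIntegral_le_of_norm_le_const (C := |C| * (((R : ℝ) + 1) ^ 2)⁻¹)
        isCompact_Icc.measure_lt_top fun y hy => ?_).trans ?_)
      · rw [Real.norm_eq_abs, abs_abs, smulTF_app, dil_app, abs_mul, mul_comm]
        have h5 : (y ^ 2)⁻¹ ≤ (((R : ℝ) + 1) ^ 2)⁻¹ := by
          have := hy.1
          gcongr
        exact mul_le_mul (hzC _) ((hR y hy.1).trans h5) (abs_nonneg _) (abs_nonneg _)
      · rw [Real.volume_real_Icc_of_le hle]
        have h6 : 0 ≤ |C| := abs_nonneg _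
        calc |C| * (((R : ℝ) + 1) ^ 2)⁻¹ * ((R + 1) * max q 1 - (R + 1))
            ≤ |C| * (((R : ℝ) + 1) ^ 2)⁻¹ * ((R + 1) * max q 1) := by gcongr; linarith
          _ = |C| * max q 1 * (1 / ((R : ℝ) + 1)) := by field_simp
  | @add r s _ _ h1 h2 =>
    refine ⟨fun R y hy => by rw [add_app, h1.1 R y hy, h2.1 R y hy, add_zero], fun R => hint _, ?_⟩
    have h3 := h1.2.2.add h2.2.2
    rw [add_zero] at h3
    refine squeeze_zero (fun R => integral_nonneg fun y => abs_nonneg _) (fun R => ?_) h3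
    rw [← integral_add (h1.2.1 R) (h2.2.1 R)]
    exact integral_mono (hint _) ((h1.2.1 R).add (h2.2.1 R)) fun y => abs_add_le _ _

end Escaping

theorem exists_bump : ∃ η : TF, (∀ y, 0 ≤ η y) ∧ (∀ y < 1, η y = 0) ∧ η 2 = 1 := by
  let b : ContDiffBump (2 : ℝ) := ⟨1 / 2, 1, by norm_num, by norm_num⟩
  have hz : ∀ y, y ∉ Icc (1 : ℝ) 3 → b y = 0 := fun y hy => b.zero_of_le_dist (by
    change 1 ≤ dist y 2
    rw [Real.dist_eq, le_abs]
    rw [mem_Icc, not_and_or, not_le, not_le] at hy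
    rcases hy with h | h
    · right; linarith
    · left; linarith)
  exact ⟨⟨b, b.contDiff, 1, 3, one_pos, hz⟩, fun y => b.nonneg, fun y hy => hz y fun h => absurd h.1 (not_le.2 hy),
    b.one_of_mem_closedBall (Metric.mem_closedBall_self (by norm_num))⟩

theorem integral_pos {k : ℝ → ℝ} (hk : ContinuousOn k (Ioi 0)) (hk0 : ∀ y, 0 < y → 0 < k y) {η : TF}
    (h0 : ∀ y, 0 ≤ η y) (h2 : η 2 = 1) : 0 < ∫ y in Ioi (0 : ℝ), y⁻¹ * (k y * η y) := by
  rw [setIntegral_pos_iff_support_of_nonneg_ae ?_ (integrableOn_mul hk η)]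
  · have hopen : IsOpen (Ioi (0 : ℝ) ∩ η ⁻¹' Ioi 0) := isOpen_Ioi.inter (isOpen_Ioi.preimage (continuous η))
    refine lt_of_lt_of_le (hopen.measure_pos volume ⟨2, ?_, ?_⟩) (measure_mono fun y hy => ⟨?_, hy.1⟩)
    · norm_num
    · rw [mem_preimage, h2]; norm_num
    · have h1 : 0 < y := hy.1
      have h3 : 0 < η y := hy.2
      have := hk0 y h1
      rw [Function.mem_support]
      positivity
  · filter_upwards [ae_restrict_mem measurableSet_Ioi] with y hy
    have h1 : 0 < y := hy
    have := hk0 y h1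
    exact mul_nonneg (inv_nonneg.2 h1.le) (mul_nonneg this.le (h0 y))

theorem integral_dil {t : ℝ} (ht : 0 < t) (χ : ℝ → ℝ) :
    ∫ y in Ioi (0 : ℝ), y⁻¹ * χ (t * y) = ∫ y in Ioi (0 : ℝ), y⁻¹ * χ y := by
  have h := integral_comp_mul_left_Ioi (fun y => y⁻¹ * χ y) 0 ht
  rw [mul_zero, smul_eq_mul] at h
  rw [eq_inv_mul_iff_mul_eq₀ ht.ne'] at h
  rw [← h, ← integral_const_mul]
  refine integral_ext fun y => ?_
  rw [mul_inv]
  field_simp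

theorem hasDerivAt_theta_aux {k k₁ : ℝ → ℝ} {l κ : ℝ} (hk : RD k) (hk1 : ∀ y, 0 < y → HasDerivAt k (y⁻¹ * k₁ y) y)
    (hk2 : ∀ y, 0 < y → HasDerivAt k₁ (y⁻¹ * ((l ^ 2 * y ^ 2 + κ) * k y)) y) (φ : TF) :
    SL l (smulTF hk.contDiffOn φ) - κ • smulTF hk.contDiffOn φ =
      smulTF hk.contDiffOn (θ (θ φ)) + (2 : ℝ) • smulTF (hk.theta hk1).contDiffOn (θ φ) := by
  have h1 := hk.theta hk1
  have h2 := h1.theta hk2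
  rw [SL_eq, θ_smulTF hk.contDiffOn h1.contDiffOn hk1, map_add, θ_smulTF hk.contDiffOn h1.contDiffOn hk1,
    θ_smulTF h1.contDiffOn h2.contDiffOn hk2]
  refine ext fun y => ?_
  simp only [sub_app, add_app, smul_app, smulTF_app, Y_app]
  ring

open Polynomial in
/-- A functional of controlled growth that annihilates the range of `(y ∂_y)² - l² y² - κ` also annihilates the
test functions orthogonal to the decaying solution. -/
theorem eq_zero_of_orthogonal {F : TF →ₗ[ℝ] ℂ} {k k₁ : ℝ → ℝ} {l κ : ℝ} (hk : RD k) (hpos : ∀ y, 0 < y → 0 < k y)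
    (hk1 : ∀ y, 0 < y → HasDerivAt k (y⁻¹ * k₁ y) y)
    (hk2 : ∀ y, 0 < y → HasDerivAt k₁ (y⁻¹ * ((l ^ 2 * y ^ 2 + κ) * k y)) y) {C : ℝ}
    (hF : ∀ χ : TF, (∀ y < 1, χ y = 0) → ‖F χ‖ ≤ C * ∫ y in Ioi (0 : ℝ), |χ y|) {B : ℝ[X]}
    (h0 : ∀ φ, F (aeval (SL l) B (SL l φ - κ • φ)) = 0) {χ : TF}
    (hχ : ∫ y in Ioi (0 : ℝ), y⁻¹ * (k y * χ y) = 0) : F (aeval (SL l) B χ) = 0 := by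
  have h1 := hk.theta hk1
  obtain ⟨v, hv⟩ := exists_primitive (smulTF hk.contDiffOn χ) hχ
  have hki : ContDiffOn ℝ ∞ (fun y => (k y)⁻¹) (Ioi 0) := hk.contDiffOn.inv fun y hy => (hpos y hy).ne'
  set u : TF := smulTF hki (smulTF hki v) with hu
  obtain ⟨η, hη0, hη1, hη2⟩ := exists_bump
  have hc0 : 0 < ∫ y in Ioi (0 : ℝ), y⁻¹ * η y := by
    have := integral_pos (k := fun _ => 1) continuousOn_const (fun _ _ => one_pos) hη0 hη2
    simpa using this
  set c : ℝ := (∫ y in Ioi (0 : ℝ), y⁻¹ * u y) / ∫ y in Ioi (0 : ℝ), y⁻¹ * η y with hc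
  let ηR : ℕ → TF := fun R => dil ((R : ℝ) + 1)⁻¹ (by positivity) η
  have hint : ∀ χ : TF, IntegrableOn (fun y => y⁻¹ * χ y) (Ioi 0) := fun χ => by
    have := integrableOn_mul (u := fun _ => 1) continuousOn_const χ
    simpa using this
  have hφ : ∀ R, ∃ φ : TF, θ φ = u - c • ηR R := fun R => by
    refine exists_primitive _ ?_
    have e : (fun y => y⁻¹ * (u - c • ηR R) y) = fun y => y⁻¹ * u y - c * (y⁻¹ * ηR R y) := funext fun y => by
      rw [sub_app, smul_app]; ring
    rw [e, integral_sub (hint u) ((hint (ηR R)).const_mul c), integral_const_mul]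
    have e2 := integral_dil (t := ((R : ℝ) + 1)⁻¹) (by positivity) η
    change _ - c * ∫ y in Ioi (0 : ℝ), y⁻¹ * η (((R : ℝ) + 1)⁻¹ * y) = 0
    rw [e2, hc, div_mul_cancel₀ _ hc0.ne', sub_self]
  choose φ hφ using hφ
  have hkey : smulTF hk.contDiffOn (θ u) + (2 : ℝ) • smulTF h1.contDiffOn u = χ := ext_of_pos fun y hy => by
    have hkv : ∀ ψ : TF, HasDerivAt (smulTF hki ψ) (-(y⁻¹ * k₁ y) / k y ^ 2 * ψ y + (k y)⁻¹ * (y⁻¹ * θ ψ y)) y :=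
      fun ψ => ((hk1 y hy).inv (hpos y hy).ne').mul (hasDerivAt ψ hy.ne')
    have e1 := θ_eq (hkv (smulTF hki v))
    have e2 := θ_eq (hkv v)
    have e3 : θ v y = k y * χ y := by rw [hv]; rfl
    have := (hpos y hy).ne'
    simp only [add_app, smul_app, smulTF_app, hu]
    rw [e1, e2, e3, smulTF_app]
    field_simp
    ring
  have hesc := ((Escaping.base hk (θ η) (θ_eq_zero hη1)).add ((Escaping.base h1 η hη1).smul 2)).smul c
  have heq : ∀ R : ℕ, F (aeval (SL l) B χ) = F (aeval (SL l) B (c • (smulTF hk.contDiffOn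
      (dil ((R : ℝ) + 1)⁻¹ (by positivity) (θ η)) + (2 : ℝ) • smulTF h1.contDiffOn
        (dil ((R : ℝ) + 1)⁻¹ (by positivity) η)))) := fun R => by
    have h2 := h0 (smulTF hk.contDiffOn (φ R))
    rw [hasDerivAt_theta_aux hk hk1 hk2, hφ R] at h2
    have e : smulTF hk.contDiffOn (θ (u - c • ηR R)) + (2 : ℝ) • smulTF h1.contDiffOn (u - c • ηR R) =
        χ - c • (smulTF hk.contDiffOn (dil ((R : ℝ) + 1)⁻¹ (by positivity) (θ η)) +
          (2 : ℝ) • smulTF h1.contDiffOn (dil ((R : ℝ) + 1)⁻¹ (by positivity) η)) := by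
      rw [map_sub, map_smul, θ_dil]
      conv_rhs => rw [← hkey]
      refine ext fun y => ?_
      simp only [sub_app, add_app, smul_app, smulTF_app]
      ring
    rw [e, map_sub, map_sub, sub_eq_zero] at h2
    exact h2
  obtain ⟨t1, -, t2⟩ := (hesc.aeval_SL l B).tendsto_integral
  have t3 := t2.const_mul C
  rw [mul_zero] at t3
  have t4 := squeeze_zero_norm (fun R => hF _ (t1 R)) t3
  exact tendsto_nhds_unique (tendsto_const_nhds.congr heq) t4

end TF

theorem chainPoly_reflect (γ : ℝ) (m : ℕ) : chainPoly (γ - 2 * (m : ℝ)) (m + 1) = chainPoly (-γ) (m + 1) := by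
  rw [chainPoly, chainPoly, ← Finset.prod_range_reflect]
  refine Finset.prod_congr rfl fun i hi => ?_
  have hi := Finset.mem_range.1 hi
  rw [Nat.add_sub_cancel, Nat.cast_sub (by omega)]
  congr 2
  ring

theorem avg_eq {R : ℝ} {w : ES n} (hw : XSupp R w) (f g : ES n) (p : Polynomial ℝ) (y : ℝ) :
    avg γ f g R p w y = y ^ (-γ) * (∫ x, aeval (tX (-γ)) p f (x, y) * w (x, 0)) +
      y ^ δ[γ] *
        ∫ x, aeval (tX δ[γ]) p g (x, y) * w (x, 0) := by
  rw [avg, pv, fint_eq (Or.inr hw), fint_eq (Or.inr hw)]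

theorem avg_eq_zero (hγ : 0 ≤ γ) {U : Pt n → ℝ} {f g : ES n} (h : IsRep γ U f g)
    (hL : ∀ p ∈ upper n, opL γ U p = 0) {R : ℝ} {w : ES n} (hw : XSupp R w) {y : ℝ} (hy : 0 < y) :
    avg γ f g R (chainPoly (-γ) (⌊γ⌋₊ + 1)) w y = 0 := by
  rw [avg_eq hw, ← integral_const_mul, ← integral_const_mul, ← integral_add]
  · refine integral_eq_zero_of_ae (Eventually.of_forall fun x => ?_)
    simp only [Pi.zero_apply]
    have e1 : aeval (tX (-γ)) (chainPoly (-γ) (⌊γ⌋₊ + 1)) f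
        = (Y ^ (⌊γ⌋₊ + 1)) (wC Y Q Lap (-γ) (⌊γ⌋₊ + 1) f) := aeval_chain commute_Lap_Y _ _ _
    have e2 : aeval (tX δ[γ]) (chainPoly (-γ) (⌊γ⌋₊ + 1)) g
        = (Y ^ (⌊γ⌋₊ + 1)) (wC Y Q Lap δ[γ] (⌊γ⌋₊ + 1) g) := by
      rw [← chainPoly_reflect]; exact aeval_chain commute_Lap_Y _ _ _
    have e3 := hL (x, y) hy
    rw [opL_eq hγ h (x, y) hy] at e3
    have e4 := (mul_eq_zero.1 e3).resolve_left (pow_ne_zero _ (by norm_num))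
    rw [e1, e2, Y_pow_app, Y_pow_app, show δ[γ] = -γ + 2 * fract γ by
      rw [two_mul_fract hγ]; ring, rpow_add hy]
    rw [show -γ + 2 * fract γ = δ[γ] by rw [two_mul_fract hγ]; ring]
    simp only at e4 ⊢
    linear_combination y ^ (-γ) * y ^ (2 * (⌊γ⌋₊ + 1)) * w (x, 0) * e4
  · exact (integrable_slice_mul (Or.inr hw) _ _).const_mul _
  · exact (integrable_slice_mul (Or.inr hw) _ _).const_mul _

/-- A horizontal test function as an element of `ES n`. -/
def lift (ρ : 𝔼 → ℝ) (h : ContDiff ℝ ∞ ρ) : ES n := ⟨fun p => ρ p.1, h.comp contDiff_fst, fun _ _ => rfl⟩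

theorem exists_xsupp_lift {ρ : 𝔼 → ℝ} (h : ContDiff ℝ ∞ ρ) (h' : HasCompactSupport ρ) :
    ∃ R, XSupp R (lift ρ h) := by
  obtain ⟨R, hR⟩ := h'.isCompact.isBounded.exists_norm_le
  refine ⟨R, fun p hp => ?_⟩
  by_contra hne
  exact absurd (hR p.1 (subset_tsupport _ hne)) (not_le.2 hp)

theorem flat_eq_zero (hγ0 : 0 < γ) (hγn : γ < (n : ℝ) / 2) {U : Pt n → ℝ} {f g : ES n} (h : IsRep γ U f g)
    {G : 𝔼 → ℝ → ℂ} {A : 𝔼 → ℝ} (hG : IsKernel γ G A) (hU : Represents U G)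
    (hL : ∀ p ∈ upper n, opL γ U p = 0) : ∀ᵐ ξ, ∀ χ : TF,
      hG.flat ξ (aeval (TF.SL ℓ[ξ]) (chainPoly (-γ) (⌊γ⌋₊ + 1)) χ) = 0 := by
  refine hG.ae_forall _ fun χ => ae_eq_zero_of_pairing fun ρ hρ hρ' => ?_
  obtain ⟨R, hR⟩ := exists_xsupp_lift hρ hρ'
  obtain ⟨h1, h2⟩ := pairing_poly hγ0 hγn h hG hU (chainPoly (-γ) (⌊γ⌋₊ + 1)) hR χ
  refine ⟨h1, h2.symm.trans ?_⟩
  rw [setIntegral_congr_fun (g := fun _ => 0) measurableSet_Ioi fun y hy => by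
    simp only [avg_eq_zero hγ0.le h hL hR hy, zero_mul, mul_zero]]
  simp

theorem exists_kSol_ode {ν : ℝ} (h : NonInt ν) (l : ℝ) : ∃ k₁ : ℝ → ℝ,
    (∀ y, 0 < y → HasDerivAt (kSol ν l) (y⁻¹ * k₁ y) y) ∧
    ∀ y, 0 < y → HasDerivAt k₁ (y⁻¹ * ((l ^ 2 * y ^ 2 + ν ^ 2) * kSol ν l y)) y := by
  refine ⟨_, fun y hy => hasDerivAt_pv (-ν) ν _ _ hy, fun y hy => (hasDerivAt_pv (-ν) ν _ _ hy).congr_deriv ?_⟩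
  have e := pv_T1 l (-ν) ν (cA ν l • besE l ν) (cA (-ν) l • besE l (-ν)) y
  rw [map_smul, map_smul, T1_besE h, T1_besE_neg h, smul_comm, smul_comm (cA (-ν) l), pv_smul] at e
  change _ = y⁻¹ * ((l ^ 2 * y ^ 2 + ν ^ 2) * pv (-ν) ν (cA ν l • besE l ν) (cA (-ν) l • besE l (-ν)) y)
  rw [eq_sub_iff_add_eq] at e
  rw [← e]; ring

theorem kSol_scale {ν l y : ℝ} (h : NonInt ν) (hl : 0 < l) (hy : 0 < y) :
    kSol ν l y = l ^ |ν| * kSol ν 1 (l * y) := by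
  rw [← kSol_abs, ← kSol_abs ν 1, kSol_of_pos h.abs h.abs_pos hl hy,
    kSol_of_pos h.abs h.abs_pos one_pos (mul_pos hl hy), mul_rpow hl.le hy.le, rpow_neg hl.le]
  have : l ^ |ν| ≠ 0 := (rpow_pos_of_pos hl _).ne'
  rw [show (1 : ℝ) ^ 2 * (l * y) ^ 2 / 4 = l ^ 2 * y ^ 2 / 4 by ring]
  field_simp

theorem IsKernel.norm_flat_le {G : 𝔼 → ℝ → ℂ} {A : 𝔼 → ℝ} (hγ : 0 ≤ γ) (hG : IsKernel γ G A) (ξ : 𝔼) :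
    ∃ C, ∀ χ : TF, (∀ y < 1, χ y = 0) → ‖hG.flat ξ χ‖ ≤ C * ∫ y in Ioi (0 : ℝ), |χ y| := by
  refine ⟨A ξ * (ℓ[ξ] ^ (-γ) * (1 + ℓ[ξ] ^ fract γ)), fun χ hχ => ?_⟩
  rw [hG.flat_app, ← integral_const_mul]
  refine norm_integral_le_of_norm_le
    ((CSupp.integrableOn (TF.continuous χ).continuousOn.abs (TF.cSupp χ).abs).const_mul _) ?_
  filter_upwards [ae_restrict_mem measurableSet_Ioi] with y hy
  have hy : 0 < y := hy
  rw [norm_mul, Complex.norm_real, Real.norm_eq_abs, abs_mul, abs_of_pos (by positivity), ← mul_assoc]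
  rcases lt_or_ge y 1 with h1 | h1
  · rw [hχ y h1, abs_zero, mul_zero, mul_zero]
  · refine mul_le_mul_of_nonneg_right ?_ (abs_nonneg _)
    refine (mul_le_mul_of_nonneg_right (hG.bound ξ y hy) (by positivity)).trans ?_
    have hA := hG.nonneg ξ
    have h2 : y ^ (-γ - 1) ≤ 1 := rpow_le_one_of_one_le_of_nonpos h1 (by linarith)
    have h3 : y ^ fract γ * y ^ (-γ - 1) ≤ 1 := by
      rw [← rpow_add hy]
      exact rpow_le_one_of_one_le_of_nonpos h1 (by linarith [Int.fract_lt_one γ])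
    have e : A ξ * (ℓ[ξ] ^ (-γ) * (1 + (ℓ[ξ] * y) ^ fract γ)) * y ^ (-γ - 1) =
        A ξ * (ℓ[ξ] ^ (-γ) * (y ^ (-γ - 1) +
          ℓ[ξ] ^ fract γ * (y ^ fract γ * y ^ (-γ - 1)))) := by
      rw [mul_rpow (by positivity) hy.le]; ring
    rw [e]
    gcongr
    exact mul_le_of_le_one_right (by positivity) h3

theorem IsKernel.norm_flat_dil_le {G : 𝔼 → ℝ → ℂ} {A : 𝔼 → ℝ} (hG : IsKernel γ G A) (ψ : TF) :
    ∃ C, 0 ≤ C ∧ ∀ ξ : 𝔼, ξ ≠ 0 →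
      ‖∫ y in Ioi (0 : ℝ), G ξ y * ((y ^ (-γ - 1) * ψ (ℓ[ξ] * y) : ℝ) : ℂ)‖ ≤ C * A ξ := by
  refine ⟨∫ y in Ioi (0 : ℝ), y⁻¹ * ((1 + y ^ fract γ) * y ^ (-γ) * |ψ y|), ?_, fun ξ hξ => ?_⟩
  · refine setIntegral_nonneg measurableSet_Ioi fun y hy => ?_
    have hy : 0 < y := hy
    positivity
  · have hl : 0 < ℓ[ξ] := by have := norm_pos_iff.2 hξ; positivity
    set l := ℓ[ξ] with hldef
    have hψ : IntegrableOn (fun y => y⁻¹ * ((1 + (l * y) ^ fract γ) * (l * y) ^ (-γ) * |ψ (l * y)|)) (Ioi 0) := by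
      have hr : ∀ c : ℝ, ContinuousOn (fun y : ℝ => (l * y) ^ c) (Ioi 0) := fun c =>
        (continuousOn_const.mul continuousOn_id).rpow_const fun y hy => Or.inl (mul_pos hl hy).ne'
      have hc := (CSupp.integrableOn (χ := fun y => y⁻¹ * ((1 + (l * y) ^ fract γ) * (l * y) ^ (-γ) *
        |TF.dil l hl ψ y|)) ?_ (((TF.cSupp (TF.dil l hl ψ)).abs.mul _).mul _))
      · exact hc
      · exact (continuousOn_id.inv₀ fun y hy => ne_of_gt hy).mul (((continuousOn_const.add (hr _)).mul (hr _)).mul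
          (TF.continuous (TF.dil l hl ψ)).continuousOn.abs)
    have e := TF.integral_dil hl fun y => (1 + y ^ fract γ) * y ^ (-γ) * |ψ y|
    rw [← e, mul_comm, ← integral_const_mul]
    refine norm_integral_le_of_norm_le (hψ.const_mul _) ?_
    filter_upwards [ae_restrict_mem measurableSet_Ioi] with y hy
    have hy : 0 < y := hy
    rw [norm_mul, Complex.norm_real, Real.norm_eq_abs, abs_mul, abs_of_pos (by positivity : 0 < y ^ (-γ - 1))]
    refine (mul_le_mul_of_nonneg_right (hG.bound ξ y hy) (by positivity)).trans_eq ?_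
    rw [← hldef, mul_rpow hl.le hy.le, mul_rpow hl.le hy.le, rpow_sub_one hy.ne']
    field_simp

open Polynomial in
theorem exists_coeff (hγ : 0 ≤ γ) {G : 𝔼 → ℝ → ℂ} {A : 𝔼 → ℝ} (hG : IsKernel γ G A) {ν : ℝ} (hν : NonInt ν)
    {B : ℝ[X]} (hn : ∀ᵐ ξ : 𝔼, ξ ≠ 0)
    (h : ∀ᵐ ξ, ∀ χ : TF, hG.flat ξ (aeval (TF.SL ℓ[ξ]) (B * (X - C (ν ^ 2))) χ) = 0) :
    ∃ a : 𝔼 → ℂ, Measurable a ∧ (∃ K, 0 ≤ K ∧ ∀ ξ, ξ ≠ 0 → ‖a ξ‖ ≤ K * ℓ[ξ] ^ (-|ν|) * A ξ) ∧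
      ∀ᵐ ξ, ∀ χ : TF, hG.flat ξ (aeval (TF.SL ℓ[ξ]) B χ) =
        a ξ * ((∫ y in Ioi (0 : ℝ), y⁻¹ * (kSol ν ℓ[ξ] y * χ y) : ℝ) : ℂ) := by
  obtain ⟨χ₀, hχ0, -, hχ2⟩ := TF.exists_bump
  have hk1 := rd_kSol hν one_pos
  set c₀ : ℝ := ∫ y in Ioi (0 : ℝ), y⁻¹ * (kSol ν 1 y * χ₀ y) with hc₀
  have hc0 : 0 < c₀ := TF.integral_pos hk1.continuousOn (fun y hy => kSol_pos hν one_pos hy) hχ0 hχ2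
  set ψ : TF := aeval (TF.SL 1) B χ₀ with hψ
  obtain ⟨K, hK0, hK⟩ := hG.norm_flat_dil_le ψ
  refine ⟨fun ξ => ((ℓ[ξ] ^ (-|ν|) / c₀ : ℝ) : ℂ) *
    ∫ y in Ioi (0 : ℝ), G ξ y * ((y ^ (-γ - 1) * ψ (ℓ[ξ] * y) : ℝ) : ℂ), ?_, ⟨K / c₀, by positivity,
    fun ξ hξ => ?_⟩, ?_⟩
  · refine (Complex.measurable_ofReal.comp (((measurable_norm.const_mul _).pow_const _).div_const _)).mul ?_
    have hm : StronglyMeasurable (Function.uncurry fun (ξ : 𝔼) (y : ℝ) =>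
        G ξ y * ((y ^ (-γ - 1) * ψ (ℓ[ξ] * y) : ℝ) : ℂ)) := by
      refine (hG.meas.mul (Complex.measurable_ofReal.comp ((measurable_snd.pow_const _).mul ?_))).stronglyMeasurable
      have hcont : Continuous fun q : 𝔼 × ℝ => ψ (2 * Real.pi * ‖q.1‖ * q.2) := by
        have := TF.continuous ψ
        fun_prop
      exact hcont.measurable
    exact (hm.integral_prod_right (ν := volume.restrict (Ioi (0 : ℝ)))).measurable
  · rw [norm_mul, Complex.norm_real, Real.norm_of_nonneg (by positivity)]
    refine (mul_le_mul_of_nonneg_left (hK ξ hξ) (by positivity)).trans_eq ?_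
    ring
  · filter_upwards [h, hn] with ξ hξ hξ0 χ
    have hl : 0 < ℓ[ξ] := by have := norm_pos_iff.2 hξ0; positivity
    set l := ℓ[ξ] with hldef
    obtain ⟨k₁, hd1, hd2⟩ := exists_kSol_ode hν l
    obtain ⟨C', hC'⟩ := hG.norm_flat_le hγ ξ
    have hk := rd_kSol hν hl
    set χl := TF.dil l hl χ₀ with hχl
    have hcl : ∫ y in Ioi (0 : ℝ), y⁻¹ * (kSol ν l y * χl y) = l ^ |ν| * c₀ := by
      rw [hc₀, ← TF.integral_dil hl fun y => kSol ν 1 y * χ₀ y, ← integral_const_mul]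
      refine integral_Ioi_ext fun y hy => ?_
      simp only [hχl, TF.dil_app]
      rw [kSol_scale hν hl hy]; ring
    have hcl0 : l ^ |ν| * c₀ ≠ 0 := (mul_pos (rpow_pos_of_pos hl _) hc0).ne'
    set I : ℝ := ∫ y in Ioi (0 : ℝ), y⁻¹ * (kSol ν l y * χ y) with hI
    have horth : ∫ y in Ioi (0 : ℝ), y⁻¹ * (kSol ν l y * (χ - (I / (l ^ |ν| * c₀)) • χl) y) = 0 := by
      have e : (fun y => y⁻¹ * (kSol ν l y * (χ - (I / (l ^ |ν| * c₀)) • χl) y)) = fun y =>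
          y⁻¹ * (kSol ν l y * χ y) - I / (l ^ |ν| * c₀) * (y⁻¹ * (kSol ν l y * χl y)) := funext fun y => by
        rw [TF.sub_app, TF.smul_app]; ring
      rw [e, integral_sub (TF.integrableOn_mul hk.continuousOn χ)
        ((TF.integrableOn_mul hk.continuousOn χl).const_mul _), integral_const_mul, hcl, ← hI,
        div_mul_cancel₀ _ hcl0, sub_self]
    have hz := TF.eq_zero_of_orthogonal (F := hG.flat ξ) (B := B) hk (fun y hy => kSol_pos hν hl hy) hd1 hd2 hC'
      (fun φ => by
        have := hξ φ
        rw [map_mul, mul_apply, map_sub, aeval_X, aeval_C] at this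
        exact this) horth
    rw [map_sub, map_sub, map_smul, map_smul, sub_eq_zero, hχl, TF.aeval_SL_dil, ← hψ] at hz
    rw [hz, Complex.real_smul, hG.flat_app]
    simp only [TF.dil_app]
    rw [rpow_neg hl.le]
    push_cast
    have h1 : ((l ^ |ν| : ℝ) : ℂ) ≠ 0 := Complex.ofReal_ne_zero.2 (rpow_pos_of_pos hl _).ne'
    have h2 : (c₀ : ℂ) ≠ 0 := Complex.ofReal_ne_zero.2 hc0.ne'
    field_simp

theorem taylor_even (E : ES 0) (r : ℕ) (y : ℝ) : E (0, y) =
    ∑ i ∈ Finset.range r, (S ^ i) E (0, 0) * y ^ (2 * i) + y ^ (2 * r) * (S ^ r) E (0, y) := by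
  induction r with
  | zero => simp
  | succ r ih =>
    have := sub_r0 ((S ^ r) E) 0 y
    rw [ih, Finset.sum_range_succ, pow_succ' S r, mul_apply]
    linear_combination y ^ (2 * r) * this

/-- A function of the form `y^{-μ} E + y^μ F` with its first branch expanded. -/
theorem pv_expansion (μ : ℝ) (E F : ES 0) (r : ℕ) {y : ℝ} (hy : 0 < y) : pv (-μ) μ E F y =
    ∑ i ∈ Finset.range r, (S ^ i) E (0, 0) * y ^ (2 * (i : ℝ) - μ) +
      y ^ μ * pv (2 * (r : ℝ) - 2 * μ) 0 ((S ^ r) E) F y := by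
  have e : ∀ i : ℕ, y ^ (2 * (i : ℝ) - μ) = y ^ (-μ) * y ^ (2 * i) := fun i => by
    rw [← rpow_natCast y (2 * i), ← rpow_add hy]; push_cast; ring_nf
  have e2 : y ^ μ * y ^ (2 * (r : ℝ) - 2 * μ) = y ^ (-μ) * y ^ (2 * r) := by
    rw [← e, ← rpow_add hy]; ring_nf
  simp only [pv, e, rpow_zero]
  rw [taylor_even E r y, mul_add, Finset.mul_sum,
    Finset.sum_congr rfl fun i _ => (by ring : y ^ (-μ) * ((S ^ i) E (0, 0) * y ^ (2 * i)) =
      (S ^ i) E (0, 0) * (y ^ (-μ) * y ^ (2 * i)))]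
  linear_combination -(S ^ r) E (0, y) * e2

theorem tendsto_pv_zero {d : ℝ} (hd : 0 < d) (E F : ES 0) :
    Tendsto (pv d 0 E F) (𝓝[>] 0) (𝓝 (F (0, 0))) := by
  have h1 : Tendsto (fun y : ℝ => y ^ d) (𝓝[>] 0) (𝓝 0) := by
    have := (Real.continuousAt_rpow_const 0 d (Or.inr hd.le)).tendsto
    rw [Real.zero_rpow hd.ne'] at this
    exact this.mono_left nhdsWithin_le_nhds
  have h2 : ∀ G : ES 0, Tendsto (fun y => G (0, y)) (𝓝[>] (0 : ℝ)) (𝓝 (G (0, 0))) := fun G =>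
    (continuous_slice G).continuousAt.tendsto.mono_left nhdsWithin_le_nhds
  have := (h1.mul (h2 E)).add ((h2 F).const_mul 1)
  rw [zero_mul, zero_add, one_mul] at this
  exact this.congr fun y => by rw [pv, rpow_zero]

theorem bounded_of_tendsto {K : ℝ → ℝ} {L : ℝ} (hK : ContinuousOn K (Ioi 0)) (h0 : Tendsto K (𝓝[>] 0) (𝓝 L))
    (h1 : Tendsto K atTop (𝓝 0)) : ∃ C, ∀ y, 0 < y → |K y| ≤ C := by
  obtain ⟨δ, hδ, hb⟩ := mem_nhdsGT_iff_exists_Ioo_subset.1 (h0.abs.eventually (gt_mem_nhds (lt_add_one |L|)))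
  obtain ⟨M, hM⟩ := eventually_atTop.1 (h1.abs.eventually (gt_mem_nhds (show |(0 : ℝ)| < 1 by norm_num)))
  have hδ : 0 < δ := hδ
  obtain ⟨C, hC⟩ := isCompact_Icc.exists_bound_of_continuousOn
    (hK.mono fun y (hy : y ∈ Icc (δ / 2) M) => (half_pos hδ).trans_le hy.1)
  refine ⟨max (|L| + 1) (max 1 C), fun y hy => ?_⟩
  rcases lt_or_ge y δ with h | h
  · exact (le_of_lt (hb ⟨hy, h⟩)).trans (le_max_left _ _)
  · rcases le_or_gt M y with h' | h'
    · exact (hM y h').le.trans ((le_max_left _ _).trans (le_max_right _ _))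
    · exact (hC y ⟨by linarith, h'.le⟩).trans ((le_max_right _ _).trans (le_max_right _ _))

namespace TF

theorem continuousOn_rpow (c : ℝ) : ContinuousOn (fun y : ℝ => y ^ c) (Ioi 0) :=
  continuousOn_id.rpow_const fun _ hy => Or.inl (ne_of_gt hy)

/-- The Mellin moment of a test function. -/
def mellin (c : ℝ) (χ : TF) : ℝ := ∫ y in Ioi (0 : ℝ), y⁻¹ * (y ^ c * χ y)

theorem mellin_θ_add (c d : ℝ) (χ : TF) : mellin c (θ χ + d • χ) = (d - c) * mellin c χ := by
  have h := integral_by_parts (u := fun y => y ^ c) (w := fun y => c * y ^ c) (fun y hy =>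
    (Real.hasDerivAt_rpow_const (Or.inl hy.ne')).congr_deriv (by rw [rpow_sub_one hy.ne']; ring))
    (continuousOn_const.mul (continuousOn_rpow c)) χ
  have e : (fun y : ℝ => y⁻¹ * (y ^ c * (θ χ + d • χ) y)) = fun y =>
      y⁻¹ * (y ^ c * θ χ y) + d * (y⁻¹ * (y ^ c * χ y)) := funext fun y => by
    rw [add_app, smul_app]; ring
  have e' : (fun y : ℝ => y⁻¹ * (c * y ^ c * χ y)) = fun y => c * (y⁻¹ * (y ^ c * χ y)) := funext fun y => by ring
  rw [e', integral_const_mul] at h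
  rw [mellin, e, integral_add (integrableOn_mul (continuousOn_rpow c) _)
    ((integrableOn_mul (continuousOn_rpow c) _).const_mul _), integral_const_mul, mellin]
  linear_combination h

theorem exists_moments {μ : ℝ} (s : ℝ) (r : ℕ) (h : ∀ i < r, 2 * (i : ℝ) - μ ≠ s) :
    ∃ χ : TF, (∀ i < r, mellin (2 * (i : ℝ) - μ) χ = 0) ∧ mellin s χ ≠ 0 := by
  induction r with
  | zero =>
    obtain ⟨η, h0, -, h2⟩ := exists_bump
    exact ⟨η, fun i hi => absurd hi (by omega),
      (integral_pos (continuousOn_rpow s) (fun y hy => rpow_pos_of_pos hy s) h0 h2).ne'⟩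
  | succ r ih =>
    obtain ⟨χ, h1, h2⟩ := ih fun i hi => h i (by omega)
    refine ⟨θ χ + (2 * (r : ℝ) - μ) • χ, fun i hi => ?_, ?_⟩
    · rw [mellin_θ_add]
      rcases Nat.lt_succ_iff_lt_or_eq.1 hi with hi | rfl
      · rw [h1 i hi, mul_zero]
      · rw [sub_self, zero_mul]
    · rw [mellin_θ_add]
      exact mul_ne_zero (sub_ne_zero.2 (h r (by omega))) h2

theorem tendsto_mellin {H : ℝ → ℝ} {L : ℝ} (hH : ContinuousOn H (Ioi 0)) (h0 : Tendsto H (𝓝[>] 0) (𝓝 L))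
    (s : ℝ) (χ : TF) : Tendsto (fun t => ∫ y in Ioi (0 : ℝ), y⁻¹ * (y ^ s * H (t * y) * χ y)) (𝓝[>] 0)
      (𝓝 (L * mellin s χ)) := by
  obtain ⟨p, q, hp, hpq⟩ := cSupp χ
  have hmul : ∀ {y : ℝ}, 0 < y → Tendsto (fun t : ℝ => t * y) (𝓝[>] 0) (𝓝[>] 0) := fun {y} hy => by
    refine tendsto_nhdsWithin_iff.2 ⟨?_, eventually_mem_nhdsWithin.mono fun t ht => mul_pos ht hy⟩
    have : Tendsto (fun t : ℝ => t * y) (𝓝 0) (𝓝 (0 * y)) := (continuous_mul_const y).tendsto 0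
    rw [zero_mul] at this
    exact this.mono_left nhdsWithin_le_nhds
  obtain ⟨δ, hδ, hb⟩ := mem_nhdsGT_iff_exists_Ioo_subset.1 (h0.abs.eventually (gt_mem_nhds (lt_add_one |L|)))
  have hδ : 0 < δ := hδ
  have hq : 0 < |q| + 1 := by positivity
  rw [mellin, ← integral_const_mul]
  refine tendsto_integral_filter_of_dominated_convergence
    (fun y => (|L| + 1) * |y⁻¹ * (y ^ s * χ y)|) ?_ ?_ ?_ ?_
  · filter_upwards [self_mem_nhdsWithin] with t ht
    exact (integrableOn_mul ((continuousOn_rpow s).mul (hH.comp (by fun_prop) fun y hy => mem_Ioi.2 (mul_pos (mem_Ioi.1 ht) hy))) χ).1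
  · filter_upwards [Ioo_mem_nhdsGT (div_pos hδ hq)] with t ht
    filter_upwards [ae_restrict_mem measurableSet_Ioi] with y hy
    rw [show y⁻¹ * (y ^ s * H (t * y) * χ y) = H (t * y) * (y⁻¹ * (y ^ s * χ y)) by ring, norm_mul]
    by_cases hyq : y ∈ Icc p q
    · refine mul_le_mul_of_nonneg_right (le_of_lt (hb ⟨mul_pos ht.1 hy, ?_⟩)) (norm_nonneg _)
      have h1 := (lt_div_iff₀ hq).1 ht.2
      have h2 : t * y ≤ t * (|q| + 1) :=
        mul_le_mul_of_nonneg_left (hyq.2.trans ((le_abs_self q).trans (by linarith))) ht.1.le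
      linarith
    · simp [hpq y hyq]
  · exact ((integrableOn_mul (continuousOn_rpow s) χ).abs).const_mul _
  · filter_upwards [ae_restrict_mem measurableSet_Ioi] with y hy
    have := ((h0.comp (hmul hy)).mul_const (y⁻¹ * (y ^ s * χ y)))
    exact this.congr fun t => by simp only [Function.comp]; ring

/-- Pairing of a function with an expansion at `0` against a dilated test function without the
corresponding moments. -/
theorem integral_expansion {u H : ℝ → ℝ} {c : ℕ → ℝ} {μ s : ℝ} {r : ℕ}
    (hu : ∀ y, 0 < y → u y = ∑ i ∈ Finset.range r, c i * y ^ (2 * (i : ℝ) - μ) + y ^ s * H y)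
    (hH : ContinuousOn H (Ioi 0)) {χ : TF} (hχ : ∀ i < r, mellin (2 * (i : ℝ) - μ) χ = 0) {t : ℝ} (ht : 0 < t) :
    ∫ y in Ioi (0 : ℝ), y⁻¹ * (u y * dil t⁻¹ (inv_pos.2 ht) χ y) =
      t ^ s * ∫ y in Ioi (0 : ℝ), y⁻¹ * (y ^ s * H (t * y) * χ y) := by
  have e := integral_dil (inv_pos.2 ht) fun y => u (t * y) * χ y
  simp only [mul_inv_cancel_left₀ ht.ne'] at e
  simp only [dil_app]
  rw [e, ← integral_const_mul]
  have hi : ∀ i : ℕ, IntegrableOn (fun y => c i * t ^ (2 * (i : ℝ) - μ) * (y⁻¹ * (y ^ (2 * (i : ℝ) - μ) * χ y)))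
      (Ioi 0) := fun i => (integrableOn_mul (continuousOn_rpow _) χ).const_mul _
  have hH' : IntegrableOn (fun y => t ^ s * (y⁻¹ * (y ^ s * H (t * y) * χ y))) (Ioi 0) :=
    (integrableOn_mul ((continuousOn_rpow s).mul (hH.comp (by fun_prop) fun y hy => mul_pos ht hy)) χ).const_mul _
  have e2 : ∫ y in Ioi (0 : ℝ), ∑ i ∈ Finset.range r,
      c i * t ^ (2 * (i : ℝ) - μ) * (y⁻¹ * (y ^ (2 * (i : ℝ) - μ) * χ y)) = 0 := by
    rw [integral_finsetSum _ fun i _ => hi i]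
    refine Finset.sum_eq_zero fun i hi => ?_
    rw [integral_const_mul, ← mellin, hχ i (Finset.mem_range.1 hi), mul_zero]
  have e3 := integral_add (integrable_finsetSum (Finset.range r) fun i _ => hi i) hH'
  rw [e2, zero_add] at e3
  rw [← e3]
  refine integral_Ioi_ext fun y hy => ?_
  rw [hu _ (mul_pos ht hy), mul_rpow ht.le hy.le, add_mul, mul_add, Finset.sum_mul, Finset.mul_sum]
  congr 1
  · refine Finset.sum_congr rfl fun i _ => ?_
    rw [mul_rpow ht.le hy.le]; ring
  · ring

end TF

/-- Comparison of the leading coefficients in a representation by decaying solutions. -/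
theorem coeff_eq {μ s : ℝ} (hμ : NonInt μ) (hμ0 : 0 < μ) {r : ℕ} (hs : ∀ i < r, 2 * (i : ℝ) - μ ≠ s)
    {u H K : ℝ → ℝ} {c d : ℕ → ℝ} {L L' C : ℝ}
    (hu : ∀ y, 0 < y → u y = ∑ i ∈ Finset.range r, c i * y ^ (2 * (i : ℝ) - μ) + y ^ s * H y)
    (hk : ∀ y, 0 < y → kSol μ 1 y = ∑ i ∈ Finset.range r, d i * y ^ (2 * (i : ℝ) - μ) + y ^ s * K y)
    (hH : ContinuousOn H (Ioi 0)) (hK : ContinuousOn K (Ioi 0)) (hH0 : Tendsto H (𝓝[>] 0) (𝓝 L))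
    (hK0 : Tendsto K (𝓝[>] 0) (𝓝 L')) (hC : ∀ y, 0 < y → |K y| ≤ C) (hn : ∀ᵐ ξ : 𝔼, ξ ≠ 0) {φ : 𝔼 → ℂ}
    (hφ : Integrable fun ξ => ((ℓ[ξ] ^ (μ + s) : ℝ) : ℂ) * φ ξ)
    (h : ∀ χ : TF, ((∫ y in Ioi (0 : ℝ), y⁻¹ * (u y * χ y) : ℝ) : ℂ) =
      ∫ ξ, φ ξ * ((∫ y in Ioi (0 : ℝ), y⁻¹ * (kSol μ ℓ[ξ] y * χ y) : ℝ) : ℂ)) :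
    (L : ℂ) = L' * ∫ ξ, ((ℓ[ξ] ^ (μ + s) : ℝ) : ℂ) * φ ξ := by
  obtain ⟨χ, hχ, hχs⟩ := TF.exists_moments s r hs
  set I : (ℝ → ℝ) → ℝ → ℝ := fun H t => ∫ y in Ioi (0 : ℝ), y⁻¹ * (y ^ s * H (t * y) * χ y) with hI
  have hl : ∀ {ξ : 𝔼}, ξ ≠ 0 → 0 < ℓ[ξ] := fun hξ => by have := norm_pos_iff.2 hξ; positivity
  have key : ∀ t : ℝ, 0 < t → ((I H t : ℝ) : ℂ) =
      ∫ ξ, ((ℓ[ξ] ^ (μ + s) : ℝ) : ℂ) * φ ξ * ((I K (ℓ[ξ] * t) : ℝ) : ℂ) := by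
    intro t ht
    have e := h (TF.dil t⁻¹ (inv_pos.2 ht) χ)
    rw [TF.integral_expansion hu hH hχ ht] at e
    have hts : ((t ^ s : ℝ) : ℂ) ≠ 0 := Complex.ofReal_ne_zero.2 (rpow_pos_of_pos ht s).ne'
    refine mul_left_cancel₀ hts ?_
    rw [← Complex.ofReal_mul]
    refine e.trans ?_
    rw [← integral_const_mul]
    refine integral_congr_ae ?_
    filter_upwards [hn] with ξ hξ
    have hl := hl hξ
    set l := ℓ[ξ]
    have e1 := TF.integral_expansion hk hK hχ (mul_pos hl ht)
    rw [← TF.integral_dil hl] at e1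
    have e2 : ∫ y in Ioi (0 : ℝ), y⁻¹ * (kSol μ l y * TF.dil t⁻¹ (inv_pos.2 ht) χ y) =
        l ^ μ * ((l * t) ^ s * I K (l * t)) := by
      rw [hI, ← e1, ← integral_const_mul]
      refine integral_Ioi_ext fun y hy => ?_
      simp only [TF.dil_app]
      rw [kSol_scale hμ hl hy, abs_of_pos hμ0, show (l * t)⁻¹ * (l * y) = t⁻¹ * y by field_simp]
      ring
    rw [e2, mul_rpow hl.le ht.le, rpow_add hl]
    push_cast
    ring
  have hIK : Tendsto (I K) (𝓝[>] 0) (𝓝 (L' * TF.mellin s χ)) := TF.tendsto_mellin hK hK0 s χ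
  have hIb : ∀ t, 0 < t → |I K t| ≤ C * ∫ y in Ioi (0 : ℝ), |y⁻¹ * (y ^ s * χ y)| := fun t ht => by
    rw [← integral_const_mul, ← Real.norm_eq_abs]
    simp only [hI]
    refine norm_integral_le_of_norm_le (((TF.integrableOn_mul (TF.continuousOn_rpow s) χ).abs).const_mul _) ?_
    filter_upwards [ae_restrict_mem measurableSet_Ioi] with y hy
    rw [show y⁻¹ * (y ^ s * K (t * y) * χ y) = K (t * y) * (y⁻¹ * (y ^ s * χ y)) by ring, norm_mul]
    exact mul_le_mul_of_nonneg_right (hC _ (mul_pos ht hy)) (abs_nonneg _)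
  have hIm : ∀ t, 0 < t → AEStronglyMeasurable fun ξ : 𝔼 => ((I K (ℓ[ξ] * t) : ℝ) : ℂ) := by
    intro t ht
    have hK' : Measurable ((Ioi (0 : ℝ)).indicator K) := by
      have := hK.measurable_piecewise (g := 0) continuousOn_const measurableSet_Ioi
      rwa [Set.piecewise_eq_indicator] at this
    have hm : StronglyMeasurable (Function.uncurry fun (ξ : 𝔼) (y : ℝ) =>
        y⁻¹ * (y ^ s * (Ioi (0 : ℝ)).indicator K (ℓ[ξ] * t * y) * χ y)) :=
      (measurable_snd.inv.mul (((measurable_snd.pow_const s).mul (hK'.comp (by fun_prop))).mul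
        ((TF.continuous χ).measurable.comp measurable_snd))).stronglyMeasurable
    have h1 := (Complex.continuous_ofReal.comp_stronglyMeasurable
      (hm.integral_prod_right (ν := volume.restrict (Ioi (0 : ℝ))))).aestronglyMeasurable (μ := (volume : Measure 𝔼))
    refine h1.congr ?_
    filter_upwards [hn] with ξ hξ
    simp only [hI]
    refine congrArg _ (integral_Ioi_ext fun y hy => ?_)
    rw [Set.indicator_of_mem (mem_Ioi.2 (mul_pos (mul_pos (hl hξ) ht) hy))]
  have lim : Tendsto (fun t : ℝ => ∫ ξ : 𝔼, ((ℓ[ξ] ^ (μ + s) : ℝ) : ℂ) * φ ξ *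
      ((I K (ℓ[ξ] * t) : ℝ) : ℂ)) (𝓝[>] 0)
      (𝓝 (∫ ξ : 𝔼, ((ℓ[ξ] ^ (μ + s) : ℝ) : ℂ) * φ ξ * ((L' * TF.mellin s χ : ℝ) : ℂ))) := by
    refine tendsto_integral_filter_of_dominated_convergence (fun ξ =>
      ‖((ℓ[ξ] ^ (μ + s) : ℝ) : ℂ) * φ ξ‖ * (C * ∫ y in Ioi (0 : ℝ), |y⁻¹ * (y ^ s * χ y)|)) ?_ ?_
      (hφ.norm.mul_const _) ?_
    · filter_upwards [self_mem_nhdsWithin] with t ht using hφ.1.mul (hIm t ht)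
    · filter_upwards [self_mem_nhdsWithin] with t ht
      filter_upwards [hn] with ξ hξ
      rw [norm_mul, Complex.norm_real]
      exact mul_le_mul_of_nonneg_left (hIb _ (mul_pos (hl hξ) ht)) (norm_nonneg _)
    · filter_upwards [hn] with ξ hξ
      refine ((Complex.continuous_ofReal.tendsto _).comp (hIK.comp ?_)).const_mul _
      refine tendsto_nhdsWithin_iff.2 ⟨?_, eventually_mem_nhdsWithin.mono fun t ht => mul_pos (hl hξ) ht⟩
      have : Tendsto (fun t : ℝ => ℓ[ξ] * t) (𝓝 0) (𝓝 (ℓ[ξ] * 0)) :=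
        (continuous_const_mul _).tendsto 0
      rw [mul_zero] at this
      exact this.mono_left nhdsWithin_le_nhds
  have lim2 : Tendsto (fun t => ((I H t : ℝ) : ℂ)) (𝓝[>] 0) (𝓝 ((L * TF.mellin s χ : ℝ) : ℂ)) :=
    (Complex.continuous_ofReal.tendsto _).comp (TF.tendsto_mellin hH hH0 s χ)
  have hkey : (fun t => ((I H t : ℝ) : ℂ)) =ᶠ[𝓝[>] 0] fun t => ∫ ξ : 𝔼,
      ((ℓ[ξ] ^ (μ + s) : ℝ) : ℂ) * φ ξ * ((I K (ℓ[ξ] * t) : ℝ) : ℂ) := by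
    filter_upwards [self_mem_nhdsWithin] with t ht using key t ht
  have := tendsto_nhds_unique (lim2.congr' hkey) lim
  rw [integral_mul_const] at this
  push_cast at this
  refine mul_right_cancel₀ (Complex.ofReal_ne_zero.2 hχs) (this.trans ?_)
  ring

theorem pv_coeffs {μ : ℝ} (hμ : NonInt μ) (hμ0 : 0 < μ) {E F : ES 0} (hn : ∀ᵐ ξ : 𝔼, ξ ≠ 0) {φ : 𝔼 → ℂ}
    (hφ : Integrable φ) (hφ' : Integrable fun ξ => ((ℓ[ξ] ^ (2 * μ) : ℝ) : ℂ) * φ ξ)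
    (h : ∀ χ : TF, ((∫ y in Ioi (0 : ℝ), y⁻¹ * (pv (-μ) μ E F y * χ y) : ℝ) : ℂ) =
      ∫ ξ, φ ξ * ((∫ y in Ioi (0 : ℝ), y⁻¹ * (kSol μ ℓ[ξ] y * χ y) : ℝ) : ℂ)) :
    (E (0, 0) : ℂ) = ∫ ξ, φ ξ ∧
      (F (0, 0) : ℂ) = kap μ 1 * ∫ ξ, ((ℓ[ξ] ^ (2 * μ) : ℝ) : ℂ) * φ ξ := by
  have hrd := rd_kSol hμ one_pos
  set B : ES 0 := cA μ 1 • besE 1 μ with hB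
  set B' : ES 0 := cA (-μ) 1 • besE 1 (-μ) with hB'
  have hk : kSol μ 1 = pv (-μ) μ B B' := rfl
  have hB0 : B (0, 0) = 1 := by rw [hB, smul_app, besE_zero hμ, cA, if_pos hμ0, one_mul]
  have hB0' : B' (0, 0) = kap μ 1 := by
    rw [hB', smul_app, besE_zero hμ.neg, cA, if_neg (by linarith), neg_neg, mul_one]
  constructor
  · have he : ∀ E F : ES 0, ∀ y : ℝ, 0 < y → pv (-μ) μ E F y =
        ∑ i ∈ Finset.range 0, (0 : ℝ) * y ^ (2 * (i : ℝ) - μ) + y ^ (-μ) * pv (2 * μ) 0 F E y := by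
      intro E F y hy
      have : y ^ μ = y ^ (-μ) * y ^ (2 * μ) := by rw [← rpow_add hy]; ring_nf
      simp only [pv, rpow_zero, Finset.range_zero, Finset.sum_empty]
      linear_combination F (0, y) * this
    have hd : (0 : ℝ) < 2 * μ := by linarith
    have hinf : Tendsto (pv (2 * μ) 0 B' B) atTop (𝓝 0) := by
      refine (hrd.tendsto μ).congr' ?_
      filter_upwards [eventually_gt_atTop 0] with y hy
      rw [hk, he B B' y hy, Finset.range_zero, Finset.sum_empty, zero_add, ← mul_assoc, ← rpow_add hy,
        add_neg_cancel, rpow_zero, one_mul]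
    obtain ⟨C, hC⟩ := bounded_of_tendsto (continuousOn_pv _ _ _ _) (tendsto_pv_zero hd B' B) hinf
    have := coeff_eq (c := fun _ => 0) (d := fun _ => 0) hμ hμ0 (r := 0) (fun i hi => absurd hi (by omega)) (he E F)
      (he B B') (continuousOn_pv _ _ _ _) (continuousOn_pv _ _ _ _) (tendsto_pv_zero hd F E)
      (tendsto_pv_zero hd B' B) hC hn (φ := φ) (by simpa using hφ) h
    simpa [hB0] using this
  · set r := ⌊μ⌋₊ + 1 with hr
    have hlt : μ < r := by rw [hr]; push_cast; exact Nat.lt_floor_add_one μ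
    have hd : 0 < 2 * (r : ℝ) - 2 * μ := by linarith
    have hle : ∀ i < r, (i : ℝ) < μ := fun i hi => by
      have h1 : (i : ℝ) ≤ μ := (Nat.cast_le.2 (Nat.lt_succ_iff.1 hi)).trans (Nat.floor_le hμ0.le)
      refine lt_of_le_of_ne h1 fun h2 => hμ i ?_
      rw [← h2]; simp
    have hinf : Tendsto (pv (2 * (r : ℝ) - 2 * μ) 0 ((S ^ r) B) B') atTop (𝓝 0) := by
      have h1 : Tendsto (fun y : ℝ => ∑ i ∈ Finset.range r, (S ^ i) B (0, 0) * y ^ (-(2 * μ - 2 * (i : ℝ)))) atTop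
          (𝓝 0) := by
        refine (tendsto_finsetSum (a := fun _ => (0 : ℝ)) _ fun i hi => ?_).mono_right (by simp)
        have := hle i (Finset.mem_range.1 hi)
        simpa using (tendsto_rpow_neg_atTop (show 0 < 2 * μ - 2 * (i : ℝ) by linarith)).const_mul ((S ^ i) B (0, 0))
      have h2 := (hrd.tendsto (-μ)).sub h1
      rw [sub_zero] at h2
      refine h2.congr' ?_
      filter_upwards [eventually_gt_atTop 0] with y hy
      rw [hk, pv_expansion μ B B' r hy, mul_add, ← mul_assoc, ← rpow_add hy, neg_add_cancel, rpow_zero,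
        one_mul, Finset.mul_sum, sub_eq_iff_eq_add', add_left_inj]
      refine Finset.sum_congr rfl fun i _ => ?_
      rw [mul_left_comm, ← rpow_add hy]
      ring_nf
    obtain ⟨C, hC⟩ := bounded_of_tendsto (continuousOn_pv _ _ _ _) (tendsto_pv_zero hd _ B') hinf
    have := coeff_eq hμ hμ0 (s := μ) (fun i hi h' => by have := hle i hi; linarith)
      (fun y hy => pv_expansion μ E F r hy) (fun y hy => pv_expansion μ B B' r hy) (continuousOn_pv _ _ _ _)
      (continuousOn_pv _ _ _ _) (tendsto_pv_zero hd _ F) (tendsto_pv_zero hd _ B') hC hn (φ := φ)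
      (by rw [← two_mul]; exact hφ') h
    rw [this, hB0']
    simp only [← two_mul μ]

theorem fint_Y_pow (R : ℝ) (w f : ES n) (j : ℕ) : fint R w ((Y ^ j) f) = (Y ^ j) (fint R w f) := by
  induction j generalizing f with
  | zero => rfl
  | succ j ih => rw [pow_succ, mul_apply, ih, fint_Y, pow_succ, mul_apply]

theorem fint_aeval_zero {R : ℝ} {w : ES n} (hw : XSupp R w) (c : ℝ) (q : Polynomial ℝ) (f : ES n) :
    fint R w (aeval (tX c) q f) (0, 0) = ∫ x, q.eval (c ^ 2) * f (x, 0) * w (x, 0) := by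
  rw [fint_eq (Or.inr hw)]
  exact integral_ext fun x => congrArg (· * w (x, 0)) (aeval_wT_zero Lap c q f x)

open Polynomial in
/-- The part of the chain polynomial left after removing the factor with index `j`, written with respect
to both branches. -/
theorem exists_cofactor (γ : ℝ) {j m : ℕ} (hj : j ≤ m) : ∃ B q q' : ℝ[X],
    chainPoly (-γ) (m + 1) = B * (X - C ((γ - 2 * (j : ℝ)) ^ 2)) ∧ B = chainPoly (-γ) j * q ∧
    B = chainPoly (γ - 2 * (m : ℝ)) (m - j) * q' ∧
    bNorm (-γ) j * q.eval ((-γ + 2 * (j : ℝ)) ^ 2) = bAll γ m j ∧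
    bNorm (γ - 2 * (m : ℝ)) (m - j) * q'.eval ((γ - 2 * (m : ℝ) + 2 * ((m - j : ℕ) : ℝ)) ^ 2) = bAll γ m j := by
  obtain ⟨q, h1, h2⟩ := exists_chain_split (-γ) hj
  obtain ⟨q', h1', h2'⟩ := exists_chain_split (γ - 2 * (m : ℝ)) (Nat.sub_le m j)
  have e1 : (-γ + 2 * (j : ℝ)) ^ 2 = (γ - 2 * (j : ℝ)) ^ 2 := by ring
  have e2 : (γ - 2 * (m : ℝ) + 2 * ((m - j : ℕ) : ℝ)) ^ 2 = (γ - 2 * (j : ℝ)) ^ 2 := by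
    rw [Nat.cast_sub hj]; ring
  rw [chainPoly_reflect, h1, e1, e2] at h1'
  refine ⟨chainPoly (-γ) j * q, q, q', by rw [h1, e1]; ring, rfl, ?_, h2.trans (bAll_eq_neg γ m j),
    h2'.trans (bAll_eq_pos γ hj)⟩
  refine mul_right_cancel₀ (X_sub_C_ne_zero ((γ - 2 * (j : ℝ)) ^ 2)) ?_
  linear_combination h1'

/-- The Fourier side of the solution near the boundary, for the pair of boundary operators with index `j`. -/
theorem exists_boundary_pairing (hγ0 : 0 < γ) (hγn : γ < (n : ℝ) / 2) (ha : 0 < fract γ) {U : Pt n → ℝ}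
    (hC : MemC γ U) (hH : MemH γ U) (hL : ∀ p ∈ upper n, opL γ U p = 0) (hn : ∀ᵐ ξ : 𝔼, ξ ≠ 0) {j : ℕ}
    (hj : j ≤ ⌊γ⌋₊) : ∃ (a : 𝔼 → ℂ) (A : 𝔼 → ℝ), Measurable a ∧ MemLp A 2 ∧
      (∃ K, 0 ≤ K ∧ ∀ ξ, ξ ≠ 0 → ‖a ξ‖ ≤ K * ℓ[ξ] ^ (-|γ - 2 * (j : ℝ)|) * A ξ) ∧
      ∀ ρ : 𝔼 → ℝ, ContDiff ℝ ∞ ρ → HasCompactSupport ρ → ∃ E F : ES 0,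
        E (0, 0) = bAll γ ⌊γ⌋₊ j * ∫ x, bEven γ j U x * ρ x ∧
        F (0, 0) = bAll γ ⌊γ⌋₊ j * ∫ x, bFrac γ (⌊γ⌋₊ - j) U x * ρ x ∧
        ∀ χ : TF, ((∫ y in Ioi (0 : ℝ), y⁻¹ * (pv (-(γ - 2 * (j : ℝ))) (γ - 2 * (j : ℝ)) E F y * χ y) : ℝ) : ℂ) =
          ∫ ξ, fi ρ ξ * a ξ *
            ((∫ y in Ioi (0 : ℝ), y⁻¹ * (kSol (γ - 2 * (j : ℝ)) ℓ[ξ] y * χ y) : ℝ) : ℂ) := by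
  obtain ⟨f, g, h⟩ := hC.exists_rep
  obtain ⟨G, A, hG, hU⟩ := exists_kernel hγ0 hγn ha hC hH
  have hflat := flat_eq_zero hγ0 hγn h hG hU hL
  set m := ⌊γ⌋₊ with hm
  obtain ⟨B, q, q', hB, hBq, hBq', hq, hq'⟩ := exists_cofactor γ hj
  rw [hB] at hflat
  obtain ⟨a, ham, hab, hae⟩ := exists_coeff hγ0.le hG (nonInt_sub ha j) hn hflat
  refine ⟨a, A, ham, hG.memLp, hab, fun ρ hρ hρ' => ?_⟩
  obtain ⟨R, hR⟩ := exists_xsupp_lift hρ hρ'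
  refine ⟨fint R (lift ρ hρ) (aeval (tX (-γ + 2 * (j : ℝ))) q (wC Y Q Lap (-γ) j f)),
    fint R (lift ρ hρ) (aeval (tX (γ - 2 * (m : ℝ) + 2 * ((m - j : ℕ) : ℝ))) q'
      (wC Y Q Lap (γ - 2 * (m : ℝ)) (m - j) g)), ?_, ?_, fun χ => ?_⟩
  · rw [fint_aeval_zero hR, ← integral_const_mul, ← hq]
    refine integral_ext fun x => ?_
    rw [bEven_eq hγ0.le ha h hj]
    have := bNorm_neg_ne_zero ha j
    change _ * ρ x = _
    field_simp
  · rw [fint_aeval_zero hR, ← integral_const_mul, ← hq']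
    refine integral_ext fun x => ?_
    rw [bFrac_eq hγ0.le ha h (Nat.sub_le _ _), ← hm]
    have := bNorm_pos_ne_zero ha m (m - j)
    change _ * ρ x = _
    field_simp
  · obtain ⟨-, h2⟩ := pairing_poly hγ0 hγn h hG hU B hR χ
    have h3 : (∫ ξ, fi (fun x => lift ρ hρ (x, 0)) ξ *
        hG.flat ξ (aeval (TF.SL ℓ[ξ]) B χ)) = ∫ ξ, fi ρ ξ * a ξ *
          ((∫ y in Ioi (0 : ℝ), y⁻¹ * (kSol (γ - 2 * (j : ℝ)) ℓ[ξ] y * χ y) : ℝ) : ℂ) := by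
      refine integral_congr_ae ?_
      filter_upwards [hae] with ξ hξ
      rw [hξ χ, ← mul_assoc]
      rfl
    rw [← h3, ← h2]
    refine congrArg _ (integral_Ioi_ext fun y hy => ?_)
    have hy : 0 < y := hy
    have e1 : aeval (tX (-γ)) B f = (Y ^ j) (aeval (tX (-γ + 2 * (j : ℝ))) q
        (wC Y Q Lap (-γ) j f)) := by rw [hBq]; exact aeval_chain_mul Lap commute_Lap_Y _ _ _ _
    have e2 : aeval (tX (γ - 2 * (m : ℝ))) B g = (Y ^ (m - j))
        (aeval (tX (γ - 2 * (m : ℝ) + 2 * ((m - j : ℕ) : ℝ))) q'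
        (wC Y Q Lap (γ - 2 * (m : ℝ)) (m - j) g)) := by rw [hBq']; exact aeval_chain_mul Lap commute_Lap_Y _ _ _ _
    rw [avg, ← hm, e1, e2, fint_Y_pow, fint_Y_pow]
    simp only [pv, Y_pow_app]
    have p1 : y ^ (-γ) * y ^ (2 * j) = y ^ (-(γ - 2 * (j : ℝ))) := by
      rw [← rpow_natCast, ← rpow_add hy]; push_cast; ring_nf
    have p2 : y ^ (γ - 2 * (m : ℝ)) * y ^ (2 * (m - j)) = y ^ (γ - 2 * (j : ℝ)) := by
      rw [← rpow_natCast, ← rpow_add hy, Nat.cast_mul, Nat.cast_sub hj]; push_cast; ring_nf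
    rw [← p1, ← p2]
    ring

theorem norm_ofReal_mul_norm_eq (r : ℝ) (z : ℂ) : ‖((r : ℝ) : ℂ) * z‖ = |r| * ‖z‖ := by
  rw [norm_mul, Complex.norm_real, Real.norm_eq_abs]

theorem memLp_coeff {μ K : ℝ} {a : 𝔼 → ℂ} {A : 𝔼 → ℝ} (ham : Measurable a) (hA : MemLp A 2)
    (hn : ∀ᵐ ξ : 𝔼, ξ ≠ 0) (ha : ∀ ξ, ξ ≠ 0 → ‖a ξ‖ ≤ K * ℓ[ξ] ^ (-μ) * A ξ) :
    MemLp (fun ξ => ((‖ξ‖ ^ μ : ℝ) : ℂ) * a ξ) 2 := by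
  refine (hA.const_mul (K * (2 * Real.pi) ^ (-μ))).of_le ?_ ?_
  · exact ((Complex.measurable_ofReal.comp (measurable_norm.pow_const μ)).mul ham).aestronglyMeasurable
  · filter_upwards [hn] with ξ hξ
    have hp : 0 < ‖ξ‖ := norm_pos_iff.2 hξ
    have h1 : ‖ξ‖ ^ μ * ‖ξ‖ ^ (-μ) = 1 := by rw [← rpow_add hp]; simp
    rw [norm_ofReal_mul_norm_eq, abs_of_pos (rpow_pos_of_pos hp μ)]
    refine (mul_le_mul_of_nonneg_left (ha ξ hξ) (rpow_pos_of_pos hp μ).le).trans ((le_abs_self _).trans_eq ?_)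
    rw [Real.norm_eq_abs]
    congr 1
    rw [mul_rpow (by positivity) hp.le]
    linear_combination K * (2 * Real.pi) ^ (-μ) * A ξ * h1

theorem integrable_coeff (hn0 : 0 < n) {μ s : ℝ} {a : 𝔼 → ℂ} (hn : ∀ᵐ ξ : 𝔼, ξ ≠ 0) (ham : Measurable a)
    (h2 : MemLp (fun ξ => ((‖ξ‖ ^ μ : ℝ) : ℂ) * a ξ) 2) (hs : -((n : ℝ) / 2) < s - μ) {ρ : 𝔼 → ℝ}
    (hρ : ContDiff ℝ ∞ ρ) (hρ' : HasCompactSupport ρ) :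
    Integrable fun ξ => ((ℓ[ξ] ^ s : ℝ) : ℂ) * (fi ρ ξ * a ξ) := by
  have h3 := (((memLp_rpow_fi hn0 hρ hρ' hs).const_mul ((2 * Real.pi) ^ s)).ofReal (K := ℂ)).integrable_mul h2
  refine h3.mono ?_ ?_
  · exact ((Complex.measurable_ofReal.comp ((measurable_norm.const_mul _).pow_const s)).mul
      ((continuous_fi hρ hρ').measurable.mul ham)).aestronglyMeasurable
  · filter_upwards [hn] with ξ hξ
    have hp : 0 < ‖ξ‖ := norm_pos_iff.2 hξ
    have h1 : ‖ξ‖ ^ (s - μ) * ‖ξ‖ ^ μ = ‖ξ‖ ^ s := by rw [← rpow_add hp]; ring_nf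
    refine le_of_eq ?_
    simp only [Pi.mul_apply, norm_mul, Complex.norm_real, Real.norm_eq_abs, RCLike.norm_ofReal]
    rw [mul_rpow (by positivity) hp.le, ← h1]
    simp only [abs_mul, abs_norm]
    ring

theorem fourierInv_eq_fi {η : 𝔼 → ℂ} (h : ContDiff ℝ ∞ η) (h' : HasCompactSupport η) (ξ : 𝔼) :
    𝓕⁻ η ξ = fi (fun x => (η x).re) ξ + Complex.I * fi (fun x => (η x).im) ξ := by
  have hre : Continuous fun x => ((η x).re : ℂ) := Complex.continuous_ofReal.comp
    (Complex.continuous_re.comp h.continuous)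
  have him : Continuous fun x => ((η x).im : ℂ) := Complex.continuous_ofReal.comp
    (Complex.continuous_im.comp h.continuous)
  have cre : HasCompactSupport fun x => ((η x).re : ℂ) := h'.comp_left (g := fun z : ℂ => (z.re : ℂ)) (by simp)
  have cim : HasCompactSupport fun x => ((η x).im : ℂ) := h'.comp_left (g := fun z : ℂ => (z.im : ℂ)) (by simp)
  have he : Continuous fun x : 𝔼 => Complex.exp (↑(2 * Real.pi * inner ℝ x ξ) * Complex.I) := by fun_prop
  rw [fi_eq, fi_eq, Real.fourierInv_eq', ← integral_const_mul]
  refine Eq.trans ?_ (integral_add ((he.mul hre).integrable_of_hasCompactSupport cre.mul_left)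
    (((he.mul him).integrable_of_hasCompactSupport cim.mul_left).const_mul _))
  refine integral_ext fun x => ?_
  simp only [smul_eq_mul]
  conv_lhs => rw [← Complex.re_add_im (η x)]
  ring

theorem fi_re_im_aux {lo : 𝔼 → ℝ} (hlo : Continuous lo) {b : 𝔼 → ℂ}
    (hb : ∀ ρ : 𝔼 → ℝ, ContDiff ℝ ∞ ρ → HasCompactSupport ρ → Integrable (fun ξ => b ξ * fi ρ ξ) ∧
      ((∫ x, lo x * ρ x : ℝ) : ℂ) = ∫ ξ, b ξ * fi ρ ξ) {η : 𝔼 → ℂ} (h : ContDiff ℝ ∞ η) (h' : HasCompactSupport η) :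
    ∫ x, (lo x : ℂ) * η x = ∫ ξ, b ξ * 𝓕⁻ η ξ := by
  have dre : ContDiff ℝ ∞ fun x => (η x).re := Complex.reCLM.contDiff.comp h
  have dim : ContDiff ℝ ∞ fun x => (η x).im := Complex.imCLM.contDiff.comp h
  have cre : HasCompactSupport fun x => (η x).re := h'.comp_left (g := Complex.re) rfl
  have cim : HasCompactSupport fun x => (η x).im := h'.comp_left (g := Complex.im) rfl
  obtain ⟨i1, e1⟩ := hb _ dre cre
  obtain ⟨i2, e2⟩ := hb _ dim cim
  have l1 : Integrable fun x => lo x * (η x).re := (hlo.mul dre.continuous).integrable_of_hasCompactSupport cre.mul_left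
  have l2 : Integrable fun x => lo x * (η x).im := (hlo.mul dim.continuous).integrable_of_hasCompactSupport cim.mul_left
  have eL : (fun x => (lo x : ℂ) * η x) = fun x =>
      ((lo x * (η x).re : ℝ) : ℂ) + Complex.I * ((lo x * (η x).im : ℝ) : ℂ) := funext fun x => by
    conv_lhs => rw [← Complex.re_add_im (η x)]
    push_cast; ring
  have eR : (fun ξ => b ξ * 𝓕⁻ η ξ) = fun ξ => b ξ * fi (fun x => (η x).re) ξ +
      Complex.I * (b ξ * fi (fun x => (η x).im) ξ) := funext fun ξ => by
    rw [fourierInv_eq_fi h h']; ring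
  have l3 := integral_add (l1.ofReal (𝕜 := ℂ)) ((l2.ofReal (𝕜 := ℂ)).const_mul Complex.I)
  simp only [Complex.coe_algebraMap] at l3
  rw [eL, eR]
  refine l3.trans ?_
  rw [integral_add i1 (i2.const_mul _), integral_const_mul, integral_const_mul, ← e1, ← e2, integral_complex_ofReal, integral_complex_ofReal]

theorem kap_one_ne_zero {μ : ℝ} (hμ : NonInt μ) : kap μ 1 ≠ 0 := mul_ne_zero
  (rpow_pos_of_pos (by norm_num) _).ne' (div_ne_zero (gamma_mul_ne_zero hμ.neg) (gamma_mul_ne_zero hμ))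

/-- The two leading coefficients of a boundary expansion are related by the fractional Laplacian. -/
theorem isFracLaplacian_of_pairing (hn0 : 0 < n) (hn : ∀ᵐ ξ : 𝔼, ξ ≠ 0) {μ b : ℝ} (hμ : NonInt μ) (hμ0 : 0 < μ)
    (hμn : μ < (n : ℝ) / 2) (hb : b ≠ 0) {lo hi : 𝔼 → ℝ} (hlo : Continuous lo) (hhi : Continuous hi) {a : 𝔼 → ℂ}
    (ham : Measurable a) (h2 : MemLp (fun ξ => ((‖ξ‖ ^ μ : ℝ) : ℂ) * a ξ) 2)
    (h : ∀ ρ : 𝔼 → ℝ, ContDiff ℝ ∞ ρ → HasCompactSupport ρ → ∃ E F : ES 0,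
      E (0, 0) = b * ∫ x, lo x * ρ x ∧ F (0, 0) = b * ∫ x, hi x * ρ x ∧
      ∀ χ : TF, ((∫ y in Ioi (0 : ℝ), y⁻¹ * (pv (-μ) μ E F y * χ y) : ℝ) : ℂ) =
        ∫ ξ, fi ρ ξ * a ξ * ((∫ y in Ioi (0 : ℝ), y⁻¹ * (kSol μ ℓ[ξ] y * χ y) : ℝ) : ℂ)) :
    IsFracLaplacian μ lo fun x => (kap μ 1)⁻¹ * hi x := by
  have hk := kap_one_ne_zero hμ
  have hkc : (kap μ 1 : ℂ) ≠ 0 := Complex.ofReal_ne_zero.2 hk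
  have hbc : (b : ℂ) ≠ 0 := Complex.ofReal_ne_zero.2 hb
  have key : ∀ ρ : 𝔼 → ℝ, ContDiff ℝ ∞ ρ → HasCompactSupport ρ →
      (Integrable (fun ξ => (b : ℂ)⁻¹ * a ξ * fi ρ ξ) ∧
        ((∫ x, lo x * ρ x : ℝ) : ℂ) = ∫ ξ, (b : ℂ)⁻¹ * a ξ * fi ρ ξ) ∧
      (Integrable (fun ξ => ((ℓ[ξ] ^ (2 * μ) : ℝ) : ℂ) * ((b : ℂ)⁻¹ * a ξ) * fi ρ ξ) ∧
        ((∫ x, (kap μ 1)⁻¹ * hi x * ρ x : ℝ) : ℂ) =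
          ∫ ξ, ((ℓ[ξ] ^ (2 * μ) : ℝ) : ℂ) * ((b : ℂ)⁻¹ * a ξ) * fi ρ ξ) := by
    intro ρ hρ hρ'
    obtain ⟨E, F, hE, hF, hEF⟩ := h ρ hρ hρ'
    have j1 := integrable_coeff hn0 hn ham h2 (s := 0) (by linarith) hρ hρ'
    simp only [rpow_zero, Complex.ofReal_one, one_mul] at j1
    have j2 := integrable_coeff hn0 hn ham h2 (s := 2 * μ) (by linarith) hρ hρ'
    obtain ⟨r1, r2⟩ := pv_coeffs hμ hμ0 hn j1 j2 hEF
    rw [hE] at r1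
    rw [hF] at r2
    have s1 : (fun ξ => (b : ℂ)⁻¹ * a ξ * fi ρ ξ) = fun ξ => (b : ℂ)⁻¹ * (fi ρ ξ * a ξ) := funext fun ξ => by ring
    have s2 : (fun ξ => ((ℓ[ξ] ^ (2 * μ) : ℝ) : ℂ) * ((b : ℂ)⁻¹ * a ξ) * fi ρ ξ) = fun ξ =>
        (b : ℂ)⁻¹ * (((ℓ[ξ] ^ (2 * μ) : ℝ) : ℂ) * (fi ρ ξ * a ξ)) := funext fun ξ => by ring
    rw [s1, s2, integral_const_mul, integral_const_mul, ← r1]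
    refine ⟨⟨j1.const_mul _, ?_⟩, j2.const_mul _, ?_⟩
    · push_cast
      rw [inv_mul_cancel_left₀ hbc]
    · rw [funext fun x => mul_assoc (kap μ 1)⁻¹ (hi x) (ρ x), integral_const_mul]
      push_cast at r2 ⊢
      rw [inv_mul_eq_iff_eq_mul₀ hkc, mul_left_comm, ← r2, inv_mul_cancel_left₀ hbc]
  refine ⟨hlo.locallyIntegrable, (continuous_const.mul hhi).locallyIntegrable, fun ξ => (b : ℂ)⁻¹ * a ξ,
    (ham.const_mul _).aestronglyMeasurable, ?_, fun η hη hη' => ⟨?_, ?_⟩⟩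
  · have := h2.const_mul (b : ℂ)⁻¹
    exact this.congr_norm (by exact ((Complex.measurable_ofReal.comp (measurable_norm.pow_const μ)).mul
      (ham.const_mul _)).aestronglyMeasurable) (Eventually.of_forall fun ξ => by simp only; congr 1; ring)
  · exact fi_re_im_aux hlo (fun ρ hρ hρ' => (key ρ hρ hρ').1) hη hη'
  · exact fi_re_im_aux (continuous_const.mul hhi) (fun ρ hρ hρ' => (key ρ hρ hρ').2) hη hη'

theorem continuous_bEven (hγ : 0 ≤ γ) (ha : 0 < fract γ) {U : Pt n → ℝ} (hC : MemC γ U) {j : ℕ}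
    (hj : j ≤ ⌊γ⌋₊) : Continuous (bEven γ j U) := by
  obtain ⟨f, g, h⟩ := hC.exists_rep
  rw [funext fun x => bEven_eq hγ ha h hj x]
  exact (contDiff_slice _ 0).continuous.div_const _

theorem continuous_bFrac (hγ : 0 ≤ γ) (ha : 0 < fract γ) {U : Pt n → ℝ} (hC : MemC γ U) {j : ℕ}
    (hj : j ≤ ⌊γ⌋₊) : Continuous (bFrac γ j U) := by
  obtain ⟨f, g, h⟩ := hC.exists_rep
  rw [funext fun x => bFrac_eq hγ ha h hj x]
  exact (contDiff_slice _ 0).continuous.div_const _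

theorem bAll_ne_zero (ha : 0 < fract γ) (m j : ℕ) : bAll γ m j ≠ 0 := by
  rw [← bAll_eq_neg]
  refine Finset.prod_ne_zero_iff.2 fun i hi h => ?_
  have hij : (i : ℝ) ≠ j := Nat.cast_injective.ne (Finset.mem_erase.1 hi).1
  have h1 : (4 : ℝ) * (j - i) * ((j + i : ℝ) - γ) = 0 := by linear_combination h
  rcases mul_eq_zero.1 h1 with h2 | h2
  · exact hij (by linarith)
  · exact nonInt_of_fract ha (j + i : ℤ) (by push_cast; linarith)

theorem kap_one (μ : ℝ) : kap μ 1 = (2 : ℝ) ^ (2 * -μ) * Gamma (-μ) / Gamma μ := by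
  rw [kap, mul_div_assoc, rpow_mul (by norm_num), rpow_neg (by norm_num), ← inv_rpow (by norm_num)]
  norm_num

end

end HalfSpace

theorem mainTheorem8 (n : ℕ) (γ : ℝ) (hγ0 : 0 < γ) (hγn : γ < (n : ℝ) / 2)
    (hγ : ∀ m : ℕ, γ ≠ m) (U : HalfSpace.Pt n → ℝ)
    (hC : HalfSpace.MemC γ U) (hH : HalfSpace.MemH γ U)
    (hL : ∀ p ∈ HalfSpace.upper n, HalfSpace.opL γ U p = 0) :
    (∀ j : ℕ, j ≤ ⌊γ / 2⌋₊ →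
      ∃ w : EuclideanSpace ℝ (Fin n) → ℝ,
        IsFracLaplacian (γ - 2 * j) (HalfSpace.bEven γ j U) w ∧
        ∀ x, HalfSpace.bFrac γ (⌊γ⌋₊ - j) U x =
          (2 : ℝ) ^ (2 * (2 * j - γ)) * Real.Gamma (2 * j - γ) / Real.Gamma (γ - 2 * j) * w x) ∧
    (∀ j : ℕ, j + ⌊γ / 2⌋₊ + 1 ≤ ⌊γ⌋₊ →
      ∃ w : EuclideanSpace ℝ (Fin n) → ℝ,
        IsFracLaplacian ((⌊γ⌋₊ : ℝ) - Int.fract γ - 2 * j) (HalfSpace.bFrac γ j U) w ∧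
        ∀ x, HalfSpace.bEven γ (⌊γ⌋₊ - j) U x =
          (2 : ℝ) ^ (2 * (2 * j + Int.fract γ - (⌊γ⌋₊ : ℝ))) *
            Real.Gamma (2 * j + Int.fract γ - (⌊γ⌋₊ : ℝ)) /
            Real.Gamma ((⌊γ⌋₊ : ℝ) - 2 * j - Int.fract γ) * w x) := by
  have ha : 0 < Int.fract γ := (Int.fract_nonneg γ).lt_of_ne fun h => by
    obtain ⟨z, hz⟩ := Int.fract_eq_zero_iff.1 h.symm
    have hz0 : (0 : ℤ) ≤ z := by
      have : (0 : ℝ) < z := hz ▸ hγ0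
      exact_mod_cast this.le
    obtain ⟨m, rfl⟩ := Int.eq_ofNat_of_zero_le hz0
    exact hγ m (by rw [← hz]; simp)
  have hn0 : 0 < n := Nat.pos_of_ne_zero fun h => by
    rw [h] at hγn
    norm_num at hγn
    linarith
  have : Nonempty (Fin n) := ⟨⟨0, hn0⟩⟩
  have hn : ∀ᵐ ξ : EuclideanSpace ℝ (Fin n), ξ ≠ 0 := by simp [ae_iff]
  have hfl : (⌊γ⌋₊ : ℝ) ≤ γ := Nat.floor_le hγ0.le
  have hfr : Int.fract γ = γ - (⌊γ⌋₊ : ℝ) := by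
    have := HalfSpace.two_mul_fract hγ0.le
    linarith
  have main : ∀ j ≤ ⌊γ⌋₊, |γ - 2 * (j : ℝ)| < (n : ℝ) / 2 := fun j hj => by
    have : (j : ℝ) ≤ ⌊γ⌋₊ := Nat.cast_le.2 hj
    have h0 : (0 : ℝ) ≤ j := Nat.cast_nonneg j
    rw [abs_lt]
    constructor <;> linarith
  refine ⟨fun j hj => ?_, fun j hj => ?_⟩
  · have hpos : 0 < γ - 2 * (j : ℝ) := (HalfSpace.le_floor_half_iff hγ0.le ha j).1 hj
    have hjm : j ≤ ⌊γ⌋₊ := hj.trans (Nat.floor_le_floor (by linarith))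
    obtain ⟨a, A, ham, hA, ⟨K, -, hK⟩, h⟩ :=
      HalfSpace.exists_boundary_pairing hγ0 hγn ha hC hH hL hn hjm
    have hlt := main j hjm
    rw [abs_of_pos hpos] at hK hlt
    have hν := HalfSpace.nonInt_sub ha j
    refine ⟨_, HalfSpace.isFracLaplacian_of_pairing hn0 hn hν hpos hlt (HalfSpace.bAll_ne_zero ha ⌊γ⌋₊ j)
      (HalfSpace.continuous_bEven hγ0.le ha hC hjm) (HalfSpace.continuous_bFrac hγ0.le ha hC (Nat.sub_le _ j)) ham
      (HalfSpace.memLp_coeff ham hA hn hK) h, fun x => ?_⟩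
    rw [show (2 : ℝ) * j - γ = -(γ - 2 * j) by ring, ← HalfSpace.kap_one,
      mul_inv_cancel_left₀ (HalfSpace.kap_one_ne_zero hν)]
  · set i := ⌊γ⌋₊ - j with hi
    have hjm : j ≤ ⌊γ⌋₊ := by omega
    have him : i ≤ ⌊γ⌋₊ := Nat.sub_le _ _
    have hji : ⌊γ⌋₊ - i = j := by omega
    have hic : (i : ℝ) = ⌊γ⌋₊ - j := by rw [hi, Nat.cast_sub hjm]
    have hν := HalfSpace.nonInt_sub ha i
    have hneg : γ - 2 * (i : ℝ) < 0 := by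
      refine lt_of_le_of_ne (not_lt.1 fun hp => ?_) hν.ne_zero
      have := (HalfSpace.le_floor_half_iff hγ0.le ha i).2 hp
      omega
    obtain ⟨a, A, ham, hA, ⟨K, -, hK⟩, h⟩ :=
      HalfSpace.exists_boundary_pairing hγ0 hγn ha hC hH hL hn him
    have hlt := main i him
    rw [abs_of_neg hneg] at hK hlt
    rw [hji] at h
    have hμ : (⌊γ⌋₊ : ℝ) - Int.fract γ - 2 * j = -(γ - 2 * i) := by rw [hfr, hic]; ring
    refine ⟨fun x => (HalfSpace.kap (-(γ - 2 * (i : ℝ))) 1)⁻¹ * HalfSpace.bEven γ i U x, ?_, fun x => ?_⟩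
    · rw [hμ]
      refine HalfSpace.isFracLaplacian_of_pairing hn0 hn hν.neg (neg_pos.2 hneg) hlt
        (HalfSpace.bAll_ne_zero ha ⌊γ⌋₊ i) (HalfSpace.continuous_bFrac hγ0.le ha hC hjm)
        (HalfSpace.continuous_bEven hγ0.le ha hC him) ham (HalfSpace.memLp_coeff ham hA hn hK) fun ρ hρ hρ' => ?_
      obtain ⟨E, F, hE, hF, hEF⟩ := h ρ hρ hρ'
      refine ⟨F, E, hF, hE, fun χ => ?_⟩
      simp only [HalfSpace.kSol_neg, neg_neg]
      rw [← hEF]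
      simp only [HalfSpace.pv, add_comm]
    · rw [show (2 : ℝ) * j + Int.fract γ - ⌊γ⌋₊ = -(-(γ - 2 * i)) by rw [← hμ]; ring,
        show (⌊γ⌋₊ : ℝ) - 2 * j - Int.fract γ = -(γ - 2 * i) by rw [← hμ]; ring, ← HalfSpace.kap_one,
        mul_inv_cancel_left₀ (HalfSpace.kap_one_ne_zero hν.neg)]

end
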